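/- Let $n\ge 2$ and $k=n+2$. **Diagrams.** The standard $k$-box is a rectangle with nodes $1,\dots,k$ on its north face and $1',\dots,k'$ on its south face, both numbered from left to right. A pseudo $k$-diagram consists, up to isotopy, of pairwise disjoint curves (edges) in the box joining the $2k$ nodes in pairs, together with finitely many closed curves (loops). An edge joining $i$ to $j'$ is called propagating; all other edges, loops included, are non-propagating. Let $\mathbf a(d)$ be the number of non-propagating edges in the north face of $d$; $d$ is dammed if it has a propagating edge, and undammed otherwise. If $\mathbf a(d)>0$, edges may carry finite sequences of decorations from $\Omega=\{\bullet,\blacktriangle,\circ,\vartriangle\}$, where $\bullet,\blacktriangle$ are called closed and $\circ,\vartriangle$ open; if $\mathbf a(d)=0$ there are no decorations. Propagating edges are read from north to south, other non-loop edges from left to right, and the sequence on a loop matters only up to cyclic permutation and reversal. If $\mathbf a(d)=1$, the relative vertical order of all decorations on propagating edges is part of the data, and decorations that are adjacent on a propagating edge belong to the same block only if no decoration of another propagating edge lies vertically between them; in all other cases all the decorations on an edge form one block. Diagrams are multiplied by concatenation: in $d'd$ the diagram $d'$ is placed on top of $d$. A diagram is LR-decorated if closed decorations occur only on edges that can be deformed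 to touch the left wall without crossing other edges, open decorations only on edges that can be so deformed to touch the right wall, and all closed decorations can be taken to the left wall and all open ones to the right wall simultaneously. Let $\widehat{\mathcal P}=\widehat{\mathcal P}^{LR}_{n+2}(\Omega)$ be the $\mathbb Z[\delta]$-algebra with the LR-decorated diagrams as basis and concatenation as multiplication, modulo the following local relations for adjacent decorations of one block: $\bullet\bullet=\blacktriangle$, $\circ\circ=\vartriangle$, $\bullet\blacktriangle=\blacktriangle\bullet=2\bullet$, $\circ\vartriangle=\vartriangle\circ=2\circ$; and modulo the relations that an undecorated loop, a loop with a single $\blacktriangle$ and a loop with a single $\vartriangle$ may each be replaced by the factor $\delta$. For $1\le i\le n+1$ the simple diagram $d_i$ has an edge joining $i$ to $i+1$, an edge joining $i'$ to $(i+1)'$, and vertical edges otherwise. The two non-propagating edges carry a single $\bullet$ each if $i=1$ and a single $\circ$ each if $i=n+1$, and there are no other decorations. **Admissible diagrams.** An LR-decorated diagram $d$ is admissible if no block on a non-loop edge contains two adjacent decorations of the same type (open or closed) and the following conditions hold, as well as, for (C2)–(C5), their mirror images, in which left and right are exchanged, $1,1'$ are replaced by $n+2,(n+2)'$, and $\bullet,\blacktriangle$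 by $\circ,\vartriangle$. * (C1) Every loop carries exactly one $\blacktriangle$ and one $\vartriangle$. * (C2) If $d$ is undammed: on each of the edges at $1$ and at $1'$ the decoration next to that node is a $\bullet$, and there are no other $\bullet$ on $d$. * (C3) If $d$ has exactly one propagating edge $e$: a non-propagating edge at $1$ or $1'$ carries a single $\bullet$ only. If $e$ ends at $1$ or at $1'$ and carries both open and closed decorations, then the decoration next to each such end is a $\bullet$. If $e$ ends at exactly one of $1,1'$, then the decoration next to that end is a $\bullet$. If $e$ joins $1$ to $1'$ and carries a single decoration, this is a $\blacktriangle$. There are no other $\bullet$ on $d$. * (C4) If $\mathbf a(d)>1$ and $d$ has more than one propagating edge: if $1$ is joined to $1'$, that edge is undecorated or carries a single $\blacktriangle$; otherwise the edges at $1$ and at $1'$ carry a single $\bullet$ each. There are no other $\bullet$ on $d$. * (C5) If $\mathbf a(d)=1$, one of the following holds, where $R$ denotes a possibly empty sequence of blocks each of which is a single $\blacktriangle$: (i) $1$ is joined to $1'$ by an edge carrying $R$; (ii) $1$ is joined to $2$ and $1'$ to $2'$ by edges carrying a single $\bullet$ each, $3$ is joined to $3'$ by an edge that is undecorated or carries a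 single $\blacktriangle$, and $d$ has no open decorations; (iii) $1$ is joined to $2$ and $1'$ to $2'$ by edges carrying a single $\bullet$ each, and $3$ to $3'$ by an edge carrying $\bullet R\bullet$, where these two $\bullet$ are the highest and the lowest of all decorations on propagating edges; (iv) $1$ is joined to $2$ by an edge carrying a single $\bullet$ and $3$ to $1'$ by an edge carrying $\bullet R$, where this $\bullet$ is the highest of all decorations on propagating edges; (v) $1'$ is joined to $2'$ by an edge carrying a single $\bullet$ and $1$ to $3'$ by an edge carrying $R\bullet$, where this $\bullet$ is the lowest of all decorations on propagating edges. **Statement.** For every admissible diagram $d$ and every $i$ with $1\le i\le n+1$ there are integers $r,m\ge 0$ and an admissible diagram $d'$ such that $d_i d=2^r\delta^m d'$ in $\widehat{\mathcal P}$. Moreover, the $\mathbb Z[\delta]$-submodule of $\widehat{\mathcal P}$ spanned by the admissible diagrams is closed under multiplication and is a (unital) $\mathbb Z[\delta]$-subalgebra of $\widehat{\mathcal P}$. -/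

import Mathlib

open Polynomial

/-! Decorated Temperley--Lieb pseudo diagrams with decoration set `{•, ▲, ∘, △}`, the algebra of
LR-decorated diagrams modulo the local relations of the decoration algebra, the simple diagrams, and
the admissible diagrams.

A diagram is recorded, up to isotopy, by its combinatorial data: which node is joined to which, the
sequence of decorations met on every edge, the relative vertical positions of the decorations on
propagating edges (only remembered for diagrams with exactly one edge in the north face), and the
loops with their decorations. -/

namespace DecoratedTL

/-- The decorations: `bullet` is `•`, `blackTri` is `▲` (closed); `circ` is `∘`, `whiteTri` is `△`
(open). -/
inductive Deco
  | bullet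
  | blackTri
  | circ
  | whiteTri

/-- Open decorations are `∘` and `△`; closed decorations are `•` and `▲`. -/
def Deco.isOpen : Deco → Bool
  | .bullet => false
  | .blackTri => false
  | .circ => true
  | .whiteTri => true

/-- Loop equivalence: the sequence of decorations on a loop matters only up to cyclic permutation
and reversal. -/
def LoopEquiv (l l' : List Deco) : Prop := l ~r l' ∨ l.reverse ~r l'

/-- The decoration of a loop edge. -/
def LoopWord : Type := Quot LoopEquiv

/-- The loop carrying the given sequence of decorations. -/
def LoopWord.mk (l : List Deco) : LoopWord := Quot.mk _ l

/-- The nodes of the standard `k`-box: `Sum.inl i` is a node of the north face, `Sum.inr i` the node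
`i'` of the south face (both numbered from `0`, left to right). -/
abbrev Node (k : ℕ) : Type := Fin k ⊕ Fin k

/-- The raw data of a decorated pseudo `k`-diagram; the conditions are in `Diagram.IsDiagram`.
* `mate p` is the other end of the edge at the node `p`.
* `word p` is the sequence of decorations met on that edge when it is traversed from `p` to `mate p`.
* `order` lists the decorations of all propagating edges from top to bottom, each one
  represented by the north end of its edge. It is only used when the diagram has exactly one
  non-propagating edge in its north face.
* `loops` is the collection of the loop edges. -/
@[ext]
structure Diagram (k : ℕ) where
  mate : Node k → Node k
  word : Node k → List Deco
  order : List (Fin k)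
  loops : Multiset LoopWord

namespace Diagram

variable {k : ℕ}

/-- The edge at the node `p` joins the north face to the south face. -/
def IsProp (d : Diagram k) (p : Node k) : Prop := p.isLeft ≠ (d.mate p).isLeft

instance (d : Diagram k) (p : Node k) : Decidable (d.IsProp p) :=
  inferInstanceAs (Decidable (_ ≠ _))

/-- `a(d)`: the number of non-propagating edges in the north face. -/
def aValue (d : Diagram k) : ℕ :=
  (Finset.univ.filter fun i : Fin k => ∃ j : Fin k, i < j ∧ d.mate (.inl i) = .inl j).card

/-- The number of propagating edges. -/
def numProp (d : Diagram k) : ℕ :=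
  (Finset.univ.filter fun i : Fin k => d.IsProp (.inl i)).card

/-- The position of a node on the boundary of the box, read clockwise from the left wall. -/
def leftPos : Node k → ℕ
  | .inl i => i
  | .inr i => 2 * k - 1 - i

/-- The position of a node on the boundary of the box, read clockwise from the right wall. -/
def rightPos : Node k → ℕ
  | .inr i => k - 1 - i
  | .inl i => k + i

/-- Decorated pseudo diagrams: the edges form a planar perfect matching of the nodes, the
sequences of decorations on an edge read from its two ends are mutually reverse, the vertical order
of the decorations on propagating edges is recorded precisely when `a(d) = 1`, and diagrams
with `a(d) = 0` are undecorated. -/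
structure IsDiagram (d : Diagram k) : Prop where
  mate_mate : ∀ p, d.mate (d.mate p) = p
  mate_ne : ∀ p, d.mate p ≠ p
  planar : ∀ p q, ¬ (leftPos p < leftPos q ∧ leftPos q < leftPos (d.mate p) ∧
    leftPos (d.mate p) < leftPos (d.mate q))
  word_mate : ∀ p, d.word (d.mate p) = (d.word p).reverse
  order_eq : d.aValue ≠ 1 → d.order = []
  order_count : d.aValue = 1 → ∀ i : Fin k,
    d.order.count i = if d.IsProp (.inl i) then (d.word (.inl i)).length else 0
  word_eq : d.aValue = 0 → ∀ p, d.word p = []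
  loops_eq : d.aValue = 0 → ∀ w ∈ d.loops, w = LoopWord.mk []

/-- With respect to a numbering of the boundary nodes starting from a wall: the edge at `q` separates
the edge at `p` from that wall. -/
def Separates (d : Diagram k) (pos : Node k → ℕ) (q p : Node k) : Prop :=
  pos q < pos p ∧ pos q < pos (d.mate p) ∧ pos p < pos (d.mate q) ∧ pos (d.mate p) < pos (d.mate q)

/-- The edge at `p` can be deformed to touch the left wall without crossing other edges. -/
def LExposed (d : Diagram k) (p : Node k) : Prop := ∀ q, ¬ d.Separates leftPos q p

/-- The edge at `p` can be deformed to touch the right wall without crossing other edges. -/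
def RExposed (d : Diagram k) (p : Node k) : Prop := ∀ q, ¬ d.Separates rightPos q p

/-- In the face given by `f` (`Sum.inl` for north, `Sum.inr` for south) all closed decorations on
non-propagating edges occur to the left of all open decorations. -/
structure ClosedBeforeOpen (d : Diagram k) (f : Fin k → Node k) : Prop where
  same : ∀ i j, i < j → d.mate (f i) = f j →
    (d.word (f i)).Pairwise fun x y => x.isOpen → y.isOpen
  across : ∀ i j i' j', i < j → j < i' → i' < j' → d.mate (f i) = f j → d.mate (f i') = f j' →
    ∀ x ∈ d.word (f i), ∀ y ∈ d.word (f i'), x.isOpen → y.isOpen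

/-- LR-decorated diagrams: closed decorations only occur on L-exposed edges, open decorations only on
R-exposed edges, and all closed decorations can be taken to the left wall and all open decorations to
the right wall simultaneously. For the latter: in each face the closed decorations must precede the
open ones; a loop of a diagram with propagating edges lies on one side of them and so carries only
one type of decorations; and on a loop of a diagram without propagating edges the closed and the
open decorations must not be interlaced. -/
structure IsLR (d : Diagram k) : Prop where
  isDiagram : d.IsDiagram
  left : ∀ p, ∀ x ∈ d.word p, x.isOpen = false → d.LExposed p
  right : ∀ p, ∀ x ∈ d.word p, x.isOpen = true → d.RExposed p
  north : d.ClosedBeforeOpen Sum.inl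
  south : d.ClosedBeforeOpen Sum.inr
  loops_dammed : 0 < d.numProp → ∀ w ∈ d.loops,
    ∃ (l : List Deco) (b : Bool), w = LoopWord.mk l ∧ ∀ x ∈ l, x.isOpen = b
  loops_undammed : d.numProp = 0 → ∀ w ∈ d.loops,
    ∃ l l' : List Deco, w = LoopWord.mk (l ++ l') ∧
      (∀ x ∈ l, x.isOpen = false) ∧ (∀ x ∈ l', x.isOpen = true)

/-! ### Concatenation

In the product of `top` and `bot` the node `j'` of `top` is identified with the node `j` of `bot`.
Edges of the product are traced through this interface: the state `(true, j)` means that the interface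
is crossed downwards at `j`, into `bot`; the state `(false, j)` that it is crossed upwards
at `j`, into `top`. -/

/-- The node at which the edge entered in the given state ends. -/
def exit (top bot : Diagram k) : Bool × Fin k → Node k
  | (true, j) => bot.mate (.inl j)
  | (false, j) => top.mate (.inr j)

/-- The decorations met on the edge entered in the given state. -/
def piece (top bot : Diagram k) : Bool × Fin k → List Deco
  | (true, j) => bot.word (.inl j)
  | (false, j) => top.word (.inr j)

/-- The next crossing of the interface, if there is one. -/
def next (top bot : Diagram k) : Bool × Fin k → Option (Bool × Fin k)
  | (true, j) => match bot.mate (.inl j) with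
    | .inl m => some (false, m)
    | .inr _ => none
  | (false, j) => match top.mate (.inr j) with
    | .inr m => some (true, m)
    | .inl _ => none

/-- The decorations met from the given state until the outer boundary is reached, and the node reached
there. The number of crossings is at most the first argument. -/
def trace (top bot : Diagram k) : ℕ → Bool × Fin k → List Deco × Node k
  | 0, s => ([], exit top bot s)
  | f + 1, s => match next top bot s with
    | none => (piece top bot s, exit top bot s)
    | some t => (piece top bot s ++ (trace top bot f t).1, (trace top bot f t).2)

/-- The edge of the product which starts at the outer node `p`: its decorations and its end.
An edge crosses the interface at most `k` times. -/
def traceNode (top bot : Diagram k) : Node k → List Deco × Node k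
  | .inl i => match top.mate (.inl i) with
    | .inl j => (top.word (.inl i), .inl j)
    | .inr j => (top.word (.inl i) ++ (trace top bot k (true, j)).1, (trace top bot k (true, j)).2)
  | .inr i => match bot.mate (.inr i) with
    | .inr j => (bot.word (.inr i), .inr j)
    | .inl j => (bot.word (.inr i) ++ (trace top bot k (false, j)).1, (trace top bot k (false, j)).2)

/-- The list of states from `s` up to the first return to `start`, if this happens within the number of
steps given. -/
def cycleFrom (top bot : Diagram k) (start : Bool × Fin k) :
    ℕ → Bool × Fin k → Option (List (Bool × Fin k))
  | 0, _ => none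
  | f + 1, s => match next top bot s with
    | none => none
    | some t => if t = start then some [s] else (cycleFrom top bot start f t).map (s :: ·)

/-- The loop created at the interface whose leftmost crossing of the interface is `j`, if
there is one. -/
def newLoop (top bot : Diagram k) (j : Fin k) : Option LoopWord :=
  match cycleFrom top bot (true, j) k (true, j) with
  | none => none
  | some l => if ∀ s ∈ l, j ≤ s.2 then some (LoopWord.mk (l.flatMap (piece top bot))) else none

/-- The north end of the edge of the product which contains the part of `bot` starting at its node `j`
and continues upwards from there. -/
def northEnd (top bot : Diagram k) (j : Fin k) : Option (Fin k) :=
  match (trace top bot k (false, j)).2 with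
  | .inl i => some i
  | .inr _ => none

/-- The product of two diagrams, with its vertical order left out. -/
def preConcat (top bot : Diagram k) : Diagram k where
  mate p := (traceNode top bot p).2
  word p := (traceNode top bot p).1
  order := []
  loops := top.loops + bot.loops + Multiset.ofList ((List.finRange k).filterMap (newLoop top bot))

/-- The vertical order of the decorations on the propagating edges of a product with `a`-value `1`:
from top to bottom, those of `top`, then those on non-propagating edges at the interface that became part
of a propagating edge, then those of `bot`. -/
def concatOrder (top bot : Diagram k) : List (Fin k) :=
  let low := bot.order.filterMap (northEnd top bot)
  top.order ++
    ((List.finRange k).flatMap fun i =>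
      if (preConcat top bot).IsProp (.inl i) then
        List.replicate
          (((preConcat top bot).word (.inl i)).length - (top.order.count i + low.count i)) i
      else []) ++
    low

/-- Diagram concatenation: `top` is placed on top of `bot`. -/
def concat (top bot : Diagram k) : Diagram k :=
  { preConcat top bot with
    order := if (preConcat top bot).aValue = 1 then concatOrder top bot else [] }

/-! ### Local relations -/

/-- On the edge at `p` the decorations read `u`, then `b`, then `v`, and those of `b` belong to one
block. If `a(d) = 1` and the edge is propagating (it is then read from its north end) this means that
no decoration of another propagating edge has a vertical position between those of `b`; `s` and
`t` describe the decorations above and below. -/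
def BlockAt (d : Diagram k) (p : Node k) (u b v : List Deco) (s t : List (Fin k)) : Prop :=
  d.word p = u ++ b ++ v ∧
    (d.aValue = 1 → d.IsProp p →
      ∃ i, p = .inl i ∧ d.order = s ++ List.replicate b.length i ++ t ∧ s.count i = u.length)

/-- `d'` results from `d` when adjacent decorations `b` of one block on a non-loop edge are
replaced by `b'`. -/
def EdgeStep (b b' : List Deco) (d d' : Diagram k) : Prop :=
  d'.mate = d.mate ∧ d'.loops = d.loops ∧
    ∃ p u v s t, d.BlockAt p u b v s t ∧ d'.BlockAt p u b' v s t ∧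
      (∀ q, q ≠ p → q ≠ d.mate p → d'.word q = d.word q) ∧
      (¬ (d.aValue = 1 ∧ d.IsProp p) → d'.order = d.order)

/-- `d'` results from `d` when adjacent decorations `b` on a loop are replaced by `b'`. -/
def LoopStep (b b' : List Deco) (d d' : Diagram k) : Prop :=
  d'.mate = d.mate ∧ d'.word = d.word ∧ d'.order = d.order ∧
    ∃ v L, d.loops = LoopWord.mk (b ++ v) ::ₘ L ∧ d'.loops = LoopWord.mk (b' ++ v) ::ₘ L

/-- `d'` results from `d` when a loop carrying the sequence `b` is removed. -/
def LoopRemoval (b : List Deco) (d d' : Diagram k) : Prop :=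
  d'.mate = d.mate ∧ d'.word = d.word ∧ d'.order = d.order ∧ d.loops = LoopWord.mk b ::ₘ d'.loops

/-- The identity diagram `d_e`. -/
def one (k : ℕ) : Diagram k where
  mate
    | .inl i => .inr i
    | .inr i => .inl i
  word _ := []
  order := []
  loops := 0

/-- The underlying node map of the simple diagrams. -/
def simpleMate (n : ℕ) (i : Fin (n + 1)) : Node (n + 2) → Node (n + 2)
  | .inl j => if j = i.castSucc then .inl i.succ else if j = i.succ then .inl i.castSucc else .inr j
  | .inr j => if j = i.castSucc then .inr i.succ else if j = i.succ then .inr i.castSucc else .inl j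

/-- The decorations on the two non-propagating edges of a simple diagram. -/
def simpleDeco (n : ℕ) (i : Fin (n + 1)) : List Deco :=
  if i = 0 then [.bullet] else if i = Fin.last n then [.circ] else []

/-- The simple diagram `d_{i+1}`, `0 ≤ i ≤ n`: one edge joins the two adjacent nodes `i`,
`i + 1` (numbered from `0`) in each of the two faces, all other edges are vertical. The two
non-propagating edges carry a single `•` if they meet the first node, a single `∘` if they meet the
last node, and all other edges are undecorated. -/
def simple (n : ℕ) (i : Fin (n + 1)) : Diagram (n + 2) where
  mate := simpleMate n i
  word
    | .inl j => if j = i.castSucc ∨ j = i.succ then simpleDeco n i else []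
    | .inr j => if j = i.castSucc ∨ j = i.succ then simpleDeco n i else []
  order := []
  loops := 0

/-- The identity diagram has `a`-value `0`. -/
theorem aValue_one (k : ℕ) : (one k).aValue = 0 := by
  simp [aValue, one]

theorem one_isLR (k : ℕ) : (one k).IsLR where
  isDiagram :=
    { mate_mate := by rintro (i | i) <;> rfl
      mate_ne := by rintro (i | i) <;> simp [one]
      planar := by
        rintro (i | i) (j | j) <;> simp only [one, leftPos] <;> omega
      word_mate := by intro p; rfl
      order_eq := fun _ => rfl
      order_count := fun h => by simp [aValue_one] at h
      word_eq := fun _ _ => rfl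
      loops_eq := fun _ w hw => by simp [one] at hw }
  left := fun p x hx => by simp [one] at hx
  right := fun p x hx => by simp [one] at hx
  north := ⟨fun i j _ _ => List.Pairwise.nil, fun i j i' j' _ _ _ _ _ x hx => by simp [one] at hx⟩
  south := ⟨fun i j _ _ => List.Pairwise.nil, fun i j i' j' _ _ _ _ _ x hx => by simp [one] at hx⟩
  loops_dammed := fun _ w hw => by simp [one] at hw
  loops_undammed := fun _ w hw => by simp [one] at hw

theorem mem_simpleDeco {n : ℕ} {i : Fin (n + 1)} {x : Deco} (h : x ∈ simpleDeco n i) :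
    (x.isOpen = false ∧ i.val = 0) ∨ (x.isOpen = true ∧ i.val = n) := by
  unfold simpleDeco at h
  split_ifs at h with h1 h2
  · subst h1
    simp only [List.mem_singleton] at h
    subst h
    exact Or.inl ⟨rfl, rfl⟩
  · subst h2
    simp only [List.mem_singleton] at h
    subst h
    exact Or.inr ⟨rfl, rfl⟩
  · simp at h

theorem mem_simple_word {n : ℕ} {i : Fin (n + 1)} {p : Node (n + 2)} {x : Deco}
    (h : x ∈ (simple n i).word p) :
    ((x.isOpen = false ∧ i.val = 0) ∨ (x.isOpen = true ∧ i.val = n)) ∧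
      ∃ a b : Fin (n + 2), (a.val = i.val ∧ b.val = i.val + 1 ∨ a.val = i.val + 1 ∧ b.val = i.val) ∧
        (p = .inl a ∧ (simple n i).mate p = .inl b ∨
          p = .inr a ∧ (simple n i).mate p = .inr b) := by
  have hne : i.succ ≠ i.castSucc := by
    intro h; simpa using congrArg Fin.val h
  rcases p with j | j <;> simp only [simple] at h <;> split_ifs at h with hj <;>
    first
    | (simp at h)
    | refine ⟨mem_simpleDeco h, ?_⟩
  · rcases hj with rfl | rfl
    · exact ⟨i.castSucc, i.succ, Or.inl ⟨rfl, rfl⟩, Or.inl ⟨rfl, by simp [simple, simpleMate]⟩⟩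
    · exact ⟨i.succ, i.castSucc, Or.inr ⟨rfl, rfl⟩, Or.inl ⟨rfl, by simp [simple, simpleMate, hne]⟩⟩
  · rcases hj with rfl | rfl
    · exact ⟨i.castSucc, i.succ, Or.inl ⟨rfl, rfl⟩, Or.inr ⟨rfl, by simp [simple, simpleMate]⟩⟩
    · exact ⟨i.succ, i.castSucc, Or.inr ⟨rfl, rfl⟩, Or.inr ⟨rfl, by simp [simple, simpleMate, hne]⟩⟩

theorem simple_word_pairwise {n : ℕ} {i : Fin (n + 1)} (p : Node (n + 2)) (r : Deco → Deco → Prop) :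
    ((simple n i).word p).Pairwise r := by
  have h : (simpleDeco n i).Pairwise r := by
    unfold simpleDeco
    split_ifs <;> simp
  rcases p with j | j <;> simp only [simple] <;> split_ifs <;> first | exact h | exact List.Pairwise.nil

theorem simpleDeco_reverse (n : ℕ) (i : Fin (n + 1)) :
    (simpleDeco n i).reverse = simpleDeco n i := by
  unfold simpleDeco
  split_ifs <;> rfl

theorem simple_aValue_ne (n : ℕ) (i : Fin (n + 1)) : (simple n i).aValue ≠ 0 := by
  unfold aValue
  rw [Finset.card_ne_zero]
  exact ⟨i.castSucc, by
    simp only [Finset.mem_filter, Finset.mem_univ, true_and]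
    exact ⟨i.succ, Fin.castSucc_lt_succ, by simp [simple, simpleMate]⟩⟩

theorem simple_isLR (n : ℕ) (i : Fin (n + 1)) : (simple n i).IsLR where
  isDiagram :=
    { mate_mate := by
        rintro (j | j) <;> simp only [simple, simpleMate] <;> split_ifs <;>
          simp_all [simpleMate, Fin.ext_iff]
      mate_ne := by
        rintro (j | j) <;> simp only [simple, simpleMate] <;> split_ifs <;>
          simp_all [Fin.ext_iff]
      planar := by
        rintro (j | j) (l | l) <;> simp only [simple, simpleMate] <;> split_ifs <;>
          simp_all only [leftPos, Fin.ext_iff, Fin.val_succ, Fin.val_castSucc] <;> omega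
      word_mate := by
        rintro (j | j) <;> simp only [simple, simpleMate] <;> split_ifs <;>
          simp_all [simpleDeco_reverse]
      order_eq := fun _ => rfl
      order_count := by
        intro _ j
        by_cases hj : j = i.castSucc ∨ j = i.succ
        · have : ¬ (simple n i).IsProp (.inl j) := by
            rcases hj with rfl | rfl
            · simp [IsProp, simple, simpleMate]
            · have hne : i.succ ≠ i.castSucc := by
                intro h; simpa using congrArg Fin.val h
              simp [IsProp, simple, simpleMate, hne]
          rw [if_neg this]
          rfl
        · simp [simple, hj]
      word_eq := fun h => absurd h (simple_aValue_ne n i)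
      loops_eq := fun h => absurd h (simple_aValue_ne n i) }
  left := by
    intro p x hx ho q
    obtain ⟨h1, a, b, hab, h2⟩ := mem_simple_word hx
    have h0 : i.val = 0 := by
      rcases h1 with h | h
      · exact h.2
      · rw [h.1] at ho; cases ho
    have key : ∀ r : Node (n + 2), leftPos r ≤ 2 * (n + 2) - 1 := by
      rintro (r | r) <;> simp only [leftPos] <;> omega
    have := key ((simple n i).mate q)
    unfold Separates
    have hl : ∀ c : Fin (n + 2), leftPos (Sum.inl c : Node (n + 2)) = c := fun _ => rfl
    have hr : ∀ c : Fin (n + 2), leftPos (Sum.inr c : Node (n + 2)) = 2 * (n + 2) - 1 - c := fun _ => rfl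
    rcases h2 with ⟨rfl, h3⟩ | ⟨rfl, h3⟩ <;> rw [h3] <;> simp only [hl, hr] <;> omega
  right := by
    intro p x hx ho q
    obtain ⟨h1, a, b, hab, h2⟩ := mem_simple_word hx
    have h0 : i.val = n := by
      rcases h1 with h | h
      · rw [h.1] at ho; cases ho
      · exact h.2
    have key : ∀ r : Node (n + 2), rightPos r ≤ 2 * (n + 2) - 1 := by
      rintro (r | r) <;> simp only [rightPos] <;> omega
    have := key ((simple n i).mate q)
    unfold Separates
    have hl : ∀ c : Fin (n + 2), rightPos (Sum.inl c : Node (n + 2)) = n + 2 + c := fun _ => rfl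
    have hr : ∀ c : Fin (n + 2), rightPos (Sum.inr c : Node (n + 2)) = n + 2 - 1 - c := fun _ => rfl
    rcases h2 with ⟨rfl, h3⟩ | ⟨rfl, h3⟩ <;> rw [h3] <;> simp only [hl, hr] <;> omega
  north := by
    refine ⟨fun _ _ _ _ => simple_word_pairwise _ _, ?_⟩
    intro a b a' b' h1 h2 h3 h4 h5 x hx y hy
    obtain ⟨-, c, e, hc, h6⟩ := mem_simple_word hx
    obtain ⟨-, c', e', hc', h7⟩ := mem_simple_word hy
    simp only [h4, h5, Sum.inl.injEq, reduceCtorEq, false_and, or_false] at h6 h7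
    omega
  south := by
    refine ⟨fun _ _ _ _ => simple_word_pairwise _ _, ?_⟩
    intro a b a' b' h1 h2 h3 h4 h5 x hx y hy
    obtain ⟨-, c, e, hc, h6⟩ := mem_simple_word hx
    obtain ⟨-, c', e', hc', h7⟩ := mem_simple_word hy
    simp only [h4, h5, Sum.inr.injEq, reduceCtorEq, false_and, false_or] at h6 h7
    omega
  loops_dammed := fun _ w hw => by simp [simple] at hw
  loops_undammed := fun _ w hw => by simp [simple] at hw

/-! ### Admissible diagrams -/

/-- The `j`-th node (`j < n + 2`) of a face, counted from the left (`west = true`) or from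
the right (`west = false`). -/
def sideNode {n : ℕ} (west : Bool) (j : Fin (n + 2)) : Fin (n + 2) := if west then j else j.rev

/-- `•` for the west side, `∘` for the east side. -/
def dot (west : Bool) : Deco := if west then .bullet else .circ

/-- `▲` for the west side, `△` for the east side. -/
def tri (west : Bool) : Deco := if west then .blackTri else .whiteTri

/-- The corners of a side: the nodes `1` and `1'` for the west side, the nodes `n+2` and `(n+2)'` for
the east side. -/
def IsCorner {n : ℕ} (west : Bool) (p : Node (n + 2)) : Prop :=
  p = .inl (sideNode west 0) ∨ p = .inr (sideNode west 0)

/-- The only `•` (for the west side; `∘` for the east side) decorations on non-loop edges of `d` are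
those which come directly next to a corner of that side. -/
def DotsOnlyAtCorners {n : ℕ} (d : Diagram (n + 2)) (west : Bool) : Prop :=
  ∀ p u v, d.word p = u ++ [dot west] ++ v →
    (u = [] ∧ IsCorner west p) ∨ (v = [] ∧ IsCorner west (d.mate p))

/-- Every maximal block is a basis element of the decoration algebra: no block on a non-loop edge
has two adjacent decorations of the same type. -/
def IsReduced (d : Diagram k) : Prop :=
  ∀ p u x y v s t, d.BlockAt p u [x, y] v s t → x.isOpen ≠ y.isOpen

/-- The condition on the given side of an undammed admissible diagram. -/
def UndammedSide {n : ℕ} (d : Diagram (n + 2)) (west : Bool) : Prop :=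
  (∀ p, IsCorner west p → (d.word p).head? = some (dot west)) ∧ d.DotsOnlyAtCorners west

/-- The condition on the given side of an admissible diagram with a single propagating edge. Here
`word p` is read from the corner `p`. -/
structure SinglePropSide {n : ℕ} (d : Diagram (n + 2)) (west : Bool) : Prop where
  nonProp : ∀ p, IsCorner west p → ¬ d.IsProp p → d.word p = [dot west]
  mixed : ∀ p, IsCorner west p → d.IsProp p →
    (∃ x ∈ d.word p, x.isOpen = true) → (∃ x ∈ d.word p, x.isOpen = false) →
    (d.word p).head? = some (dot west)
  vertical : ∀ p, IsCorner west p → d.IsProp p → IsCorner west (d.mate p) →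
    (d.word p).length = 1 → d.word p = [tri west]
  oneCorner : ∀ p, IsCorner west p → d.IsProp p → ¬ IsCorner west (d.mate p) →
    (d.word p).head? = some (dot west)
  dots : d.DotsOnlyAtCorners west

/-- The condition on the given side of a dammed admissible diagram with `a(d) > 1` and
more than one propagating edge. -/
def ManyPropSide {n : ℕ} (d : Diagram (n + 2)) (west : Bool) : Prop :=
  (d.mate (.inl (sideNode west 0)) = .inr (sideNode west 0) →
    d.word (.inl (sideNode west 0)) = [] ∨ d.word (.inl (sideNode west 0)) = [tri west]) ∧
  (d.mate (.inl (sideNode west 0)) ≠ .inr (sideNode west 0) →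
    ∀ p, IsCorner west p → d.word p = [dot west]) ∧
  d.DotsOnlyAtCorners west

/-- There is an edge joining the first two nodes, from the given side, of the face given by `f`, and it
is decorated by a single `•` (west) or `∘` (east). -/
def EndCup {n : ℕ} (d : Diagram (n + 2)) (west : Bool) (f : Fin (n + 2) → Node (n + 2)) : Prop :=
  d.mate (f (sideNode west 0)) = f (sideNode west 1) ∧ d.word (f (sideNode west 0)) = [dot west]

/-- The possible ends of an admissible diagram with `a(d) = 1` on the given side. A list `r` of
decorations `▲` (west) or `△` (east) is a sequence of blocks which are separated by decorations of
other edges, by `IsReduced`. The numbering of nodes starts from the given side. -/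
inductive OnePropEnd {n : ℕ} (d : Diagram (n + 2)) (west : Bool) : Prop
  /-- A vertical edge from `1` to `1'` with blocks `▲`. -/
  | vertical (h : d.mate (.inl (sideNode west 0)) = .inr (sideNode west 0))
      (hw : ∀ x ∈ d.word (.inl (sideNode west 0)), x = tri west)
  /-- `1` joined to `2`, `1'` joined to `2'`, and an edge from `3` to `3'` which is undecorated or
  carries a single `▲`; no decorations of the other type in the diagram. -/
  | plain (h : d.EndCup west .inl) (h' : d.EndCup west .inr)
      (h3 : d.mate (.inl (sideNode west 2)) = .inr (sideNode west 2))
      (hw : d.word (.inl (sideNode west 2)) = [] ∨ d.word (.inl (sideNode west 2)) = [tri west])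
      (ho : ∀ p, ∀ x ∈ d.word p, x.isOpen = !west)
  /-- `1` joined to `2`, `1'` joined to `2'`, and an edge from `3` to `3'` carrying `•`, blocks `▲`,
  `•`; the two `•` are the highest and the lowest decoration on propagating edges. -/
  | both (h : d.EndCup west .inl) (h' : d.EndCup west .inr)
      (h3 : d.mate (.inl (sideNode west 2)) = .inr (sideNode west 2))
      (r : List Deco) (hr : ∀ x ∈ r, x = tri west)
      (hw : d.word (.inl (sideNode west 2)) = [dot west] ++ r ++ [dot west])
      (ht : d.order.head? = some (sideNode west 2))
      (hb : d.order.getLast? = some (sideNode west 2))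
  /-- `1` joined to `2`, and an edge from `3` to `1'` carrying `•` and then blocks `▲`; this `•` is the
  highest decoration on propagating edges. -/
  | north (h : d.EndCup west .inl)
      (h3 : d.mate (.inl (sideNode west 2)) = .inr (sideNode west 0))
      (r : List Deco) (hr : ∀ x ∈ r, x = tri west)
      (hw : d.word (.inl (sideNode west 2)) = [dot west] ++ r)
      (ht : d.order.head? = some (sideNode west 2))
  /-- `1'` joined to `2'`, and an edge from `1` to `3'` carrying blocks `▲` and then `•`; this `•` is
  the lowest decoration on propagating edges. -/
  | south (h' : d.EndCup west .inr)
      (h3 : d.mate (.inl (sideNode west 0)) = .inr (sideNode west 2))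
      (r : List Deco) (hr : ∀ x ∈ r, x = tri west)
      (hw : d.word (.inl (sideNode west 0)) = r ++ [dot west])
      (hb : d.order.getLast? = some (sideNode west 0))

/-- The admissible `(n+2)`-diagrams. -/
structure IsAdmissible {n : ℕ} (d : Diagram (n + 2)) : Prop where
  isLR : d.IsLR
  isReduced : d.IsReduced
  loops : ∀ w ∈ d.loops, w = LoopWord.mk [.blackTri, .whiteTri]
  undammed : d.numProp = 0 → ∀ west, d.UndammedSide west
  singleProp : d.numProp = 1 → ∀ west, d.SinglePropSide west
  manyProp : 1 < d.aValue → 1 < d.numProp → ∀ west, d.ManyPropSide west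
  aValueOne : d.aValue = 1 → ∀ west, d.OnePropEnd west

end Diagram

/-! ### The quotient algebra of LR-decorated diagrams -/

/-- The LR-decorated `(n+2)`-diagrams. -/
abbrev LRDiagram (n : ℕ) : Type := {d : Diagram (n + 2) // d.IsLR}

/-- The reductions `b = c b'` of adjacent decorations of one block: `•• = ▲`, `•▲ = ▲• = 2•`,
`∘∘ = △`, `∘△ = △∘ = 2∘`. -/
inductive Reduction : List Deco → List Deco → ℤ[X] → Prop
  | bullet_bullet : Reduction [.bullet, .bullet] [.blackTri] 1
  | bullet_tri : Reduction [.bullet, .blackTri] [.bullet] 2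
  | tri_bullet : Reduction [.blackTri, .bullet] [.bullet] 2
  | circ_circ : Reduction [.circ, .circ] [.whiteTri] 1
  | circ_tri : Reduction [.circ, .whiteTri] [.circ] 2
  | tri_circ : Reduction [.whiteTri, .circ] [.circ] 2

open Diagram in
/-- The defining relations: the product of diagrams is given by concatenation, with unit `d_e`;
adjacent decorations of a block are reduced; an undecorated loop, a loop with a single `▲` and a
loop with a single `△` are equal to `δ`, which is the polynomial variable `X`. -/
inductive PHatRel (n : ℕ) :
    FreeAlgebra ℤ[X] (LRDiagram n) → FreeAlgebra ℤ[X] (LRDiagram n) → Prop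
  | one (d : LRDiagram n) (h : d.1 = Diagram.one (n + 2)) : PHatRel n (FreeAlgebra.ι ℤ[X] d) 1
  | mul (d' d e : LRDiagram n) (h : e.1 = concat d'.1 d.1) :
      PHatRel n (FreeAlgebra.ι ℤ[X] d' * FreeAlgebra.ι ℤ[X] d) (FreeAlgebra.ι ℤ[X] e)
  | edge (b b' : List Deco) (c : ℤ[X]) (hr : Reduction b b' c) (d d' : LRDiagram n)
      (h : EdgeStep b b' d.1 d'.1) :
      PHatRel n (FreeAlgebra.ι ℤ[X] d) (c • FreeAlgebra.ι ℤ[X] d')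
  | loop (b b' : List Deco) (c : ℤ[X]) (hr : Reduction b b' c) (d d' : LRDiagram n)
      (h : LoopStep b b' d.1 d'.1) :
      PHatRel n (FreeAlgebra.ι ℤ[X] d) (c • FreeAlgebra.ι ℤ[X] d')
  | delta (b : List Deco) (hb : b = [] ∨ b = [.blackTri] ∨ b = [.whiteTri]) (d d' : LRDiagram n)
      (h : LoopRemoval b d.1 d'.1) :
      PHatRel n (FreeAlgebra.ι ℤ[X] d) ((X : ℤ[X]) • FreeAlgebra.ι ℤ[X] d')

/-- The `ℤ[δ]`-algebra of LR-decorated `(n+2)`-diagrams modulo the local relations. The algebra of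
LR-decorated diagrams is the algebra of the monoid of these diagrams under concatenation; it is
presented here by all LR-decorated diagrams and their multiplication table. -/
abbrev PHat (n : ℕ) : Type := RingQuot (PHatRel n)

/-- The class of an LR-decorated diagram. -/
noncomputable def toPHat {n : ℕ} (d : LRDiagram n) : PHat n :=
  RingQuot.mkAlgHom ℤ[X] (PHatRel n) (FreeAlgebra.ι ℤ[X] d)

/-- The simple diagram `d_{i+1}`, `0 ≤ i ≤ n`, as an LR-decorated diagram. -/
def simpleLR (n : ℕ) (i : Fin (n + 1)) : LRDiagram n := ⟨Diagram.simple n i, Diagram.simple_isLR n i⟩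

/-- The `ℤ[δ]`-submodule spanned by the admissible diagrams. -/
noncomputable def admissibleSpan (n : ℕ) : Submodule ℤ[X] (PHat n) :=
  Submodule.span ℤ[X] {x | ∃ d : LRDiagram n, d.1.IsAdmissible ∧ x = toPHat d}

end DecoratedTL

/-!
The product of two admissible diagrams is a multiple of an admissible diagram because admissibility
can be expressed by a condition that is compatible with concatenation and with the local relations.

*States.* Each node of a box has one of three states, according to whether it is at the west side,
at the east side, or at neither of them. The decorations act on states as partial transitions
(`Deco.act`, `run`): `•` interchanges the west state and the neutral one, `▲` fixes both, neither is
possible in the east state, and `∘`, `△` behave in the mirrored way. A diagram is *valid*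
(`IsValid`) if it is LR-decorated, the decorations of each edge lead from the state of one of its
ends to the state of the other (`EdgesValid`), those of each loop lead from some state back to
itself, and, if the `a`-value is `1`, all decorations on propagating edges in their vertical order
lead from the state of the north face to that of the south face (`OrderValid`); the state of a face
names the side whose corner lies on the non-propagating edge of that face. In an alternating
sequence of decorations `•` and `∘` can only stand at the ends, and they stand there if and only if
the states require it. This translates the conditions (C2)–(C5) into validity: admissible diagrams
with nonzero `a`-value are valid (`IsAdmissible.isValid`), and a reduced valid diagram all of whose
loops carry one `▲` and one `△` is admissible (`isAdmissible_of_valid`).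

*Products.* Transitions compose along the edges and the loops of a product (`concat_edgesValid`,
`concat_loopsValid`). For the vertical order, the decorations taken up at the interface lead from
the state of the south face of the upper box to that of the north face of the lower box (`run_mid`,
`concat_orderValid`).

*LR-decorated diagrams.* That products of LR-decorated diagrams are LR-decorated (`concat_isLR`) is
planar topology. It is proved with crossing numbers modulo two. Each edge is cut at its decorations,
where it is made to touch the left or the right wall, and all ends of the resulting arcs are
arranged in one linear order on the boundary of the two boxes. Two arcs of one box do not interleave
(`cross_arc`), crossing numbers are additive along trails of arcs, and so two trails without a
common arc have crossing number zero (`Trail.cross`). As the edges of a product are trails between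
outer nodes and its new loops are closed trails, a product which violates planarity or one of the
conditions on walls would contain two disjoint trails with crossing number one, except for a new
loop with interlaced decorations, where two pairs of disjoint trails would have an odd total
crossing number (`loop_not_interlaced`).

*Reduction.* The local relations keep validity. They reduce every block of one type to a single
decoration, since `▲▲ = ••▲ = 2•• = 2▲` (`reduce_block`), so the class of a valid diagram is a power
of two times the class of a reduced valid diagram (`exists_reduced`). A valid loop with decorations
of one type only reduces to an undecorated loop or to a loop with a single `▲` or `△`, and it is
replaced by `δ`; every other loop reduces to one `▲` and one `△` (`process_loop`). Therefore the
class of a valid diagram is `2 ^ j * δ ^ m` times that of an admissible one (`exists_admissible`).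
The only admissible diagram with `a`-value `0` is the identity (`eq_one_of_aValue_eq_zero`), and the
simple diagrams are admissible, which gives all claims (`exists_mul`).
-/

namespace DecoratedTL

/-! ### Crossing numbers modulo two -/

/-- A pair of integers, compared lexicographically: `c` is the coarse and `f` the fine coordinate.
-/
structure Pos where
  c : ℤ
  f : ℤ

/-- The lexicographic order of positions. -/
def Pos.Before (x y : Pos) : Prop := x.c < y.c ∨ (x.c = y.c ∧ x.f < y.f)

open Classical in
/-- The indicator modulo two of `x` preceding `y`. -/
noncomputable def chi (x y : Pos) : ZMod 2 := if x.Before y then 1 else 0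

/-- The crossing number modulo two of the arcs with ends `x, x'` and `y, y'`: it is `1` precisely
when their four ends interleave. -/
noncomputable def cross (x x' y y' : Pos) : ZMod 2 :=
  chi x y + chi x y' + chi x' y + chi x' y'

theorem zmod_two_add_self (a : ZMod 2) : a + a = 0 := CharTwo.add_self_eq_zero a

theorem chi_one {x y : Pos} (h : x.Before y) : chi x y = 1 := if_pos h

theorem chi_zero {x y : Pos} (h : ¬ x.Before y) : chi x y = 0 := if_neg h

theorem chi_congr {x y x' y' : Pos} (h : x.Before y ↔ x'.Before y') : chi x y = chi x' y' := by
  by_cases h1 : x.Before y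
  · rw [chi_one h1, chi_one (h.1 h1)]
  · rw [chi_zero h1, chi_zero (fun h2 => h1 (h.2 h2))]

theorem chi_swap {x y : Pos} (h : x.c ≠ y.c ∨ x.f ≠ y.f) : chi x y = chi y x + 1 := by
  by_cases h1 : x.Before y
  · rw [chi_one h1, chi_zero]
    · rfl
    · unfold Pos.Before at *
      omega
  · rw [chi_zero h1, chi_one]
    · rfl
    · unfold Pos.Before at *
      omega

theorem cross_eq_zero {x x' y y' : Pos}
    (h : ((x.Before y ↔ x.Before y') ↔ (x'.Before y ↔ x'.Before y'))) : cross x x' y y' = 0 := by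
  unfold cross chi
  by_cases h1 : x.Before y <;> by_cases h2 : x.Before y' <;> by_cases h3 : x'.Before y <;>
    by_cases h4 : x'.Before y' <;> simp only [h1, h2, h3, h4] at h ⊢ <;>
    first
    | (simp at h; done)
    | rfl

theorem cross_eq_one {x x' y y' : Pos}
    (h : ¬ ((x.Before y ↔ x.Before y') ↔ (x'.Before y ↔ x'.Before y'))) :
    cross x x' y y' = 1 := by
  unfold cross chi
  by_cases h1 : x.Before y <;> by_cases h2 : x.Before y' <;> by_cases h3 : x'.Before y <;>
    by_cases h4 : x'.Before y' <;> simp only [h1, h2, h3, h4] at h ⊢ <;>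
    first
    | (simp at h; done)
    | rfl

theorem cross_swap_left (x x' y y' : Pos) : cross x' x y y' = cross x x' y y' := by
  unfold cross; ring

theorem cross_swap_right (x x' y y' : Pos) : cross x x' y' y = cross x x' y y' := by
  unfold cross; ring

theorem cross_symm {x x' y y' : Pos} (h1 : x.c ≠ y.c ∨ x.f ≠ y.f) (h2 : x.c ≠ y'.c ∨ x.f ≠ y'.f)
    (h3 : x'.c ≠ y.c ∨ x'.f ≠ y.f) (h4 : x'.c ≠ y'.c ∨ x'.f ≠ y'.f) :
    cross y y' x x' = cross x x' y y' := by
  unfold cross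
  rw [chi_swap h1, chi_swap h2, chi_swap h3, chi_swap h4]
  have : (4 : ZMod 2) = 0 := rfl
  linear_combination -this

theorem cross_self_left (x y y' : Pos) : cross x x y y' = 0 := by
  unfold cross
  linear_combination zmod_two_add_self (chi x y) + zmod_two_add_self (chi x y')

theorem cross_self_right (x x' y : Pos) : cross x x' y y = 0 := by
  unfold cross
  linear_combination zmod_two_add_self (chi x y) + zmod_two_add_self (chi x' y)

/-- Additivity of the crossing number along two broken arcs. -/
theorem cross_bilinear (p x x' q y y' : Pos) : cross x x' y y' =
    cross p x q y + cross p x q y' + cross p x' q y + cross p x' q y' := by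
  unfold cross
  linear_combination -2 * zmod_two_add_self (chi p q) - zmod_two_add_self (chi p y)
    - zmod_two_add_self (chi p y') - zmod_two_add_self (chi x q) - zmod_two_add_self (chi x' q)

namespace Diagram

variable {k : ℕ}

theorem leftPos_lt (p : Node k) : leftPos p < 2 * k := by
  rcases p with i | i <;> simp only [leftPos] <;> omega

theorem leftPos_inl (i : Fin k) : leftPos (.inl i : Node k) = i := rfl

theorem leftPos_inr (i : Fin k) : leftPos (.inr i : Node k) = 2 * k - 1 - i := rfl

theorem rightPos_inl (i : Fin k) : rightPos (.inl i : Node k) = k + i := rfl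

theorem rightPos_inr (i : Fin k) : rightPos (.inr i : Node k) = k - 1 - i := rfl

theorem leftPos_injective : Function.Injective (leftPos : Node k → ℕ) := by
  rintro (i | i) (j | j) h <;> simp only [leftPos] at h
  · exact congrArg _ (Fin.ext h)
  · omega
  · omega
  · exact congrArg _ (Fin.ext (by omega))

theorem rightPos_eq (p : Node k) :
    (leftPos p < k ∧ rightPos p = leftPos p + k) ∨ (k ≤ leftPos p ∧ rightPos p + k = leftPos p) := by
  rcases p with i | i <;> simp only [leftPos, rightPos] <;> omega

theorem leftPos_ne {p q : Node k} (h : p ≠ q) : leftPos p ≠ leftPos q :=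
  fun h' => h (leftPos_injective h')

/-- The decoration before the gap `g + 1` of the edge at `p` is open. -/
def wallOpen (d : Diagram k) (p : Node k) (g : ℕ) : Bool :=
  match (d.word p)[g]? with
  | some x => x.isOpen
  | none => false

end Diagram

open Diagram

/-- A point on an edge of one of the two boxes of a product: in the upper box (`true`) or lower box
(`false`), on the edge at the given node, at the beginning of the gap with the given index, where
the gaps of an edge are the parts into which it is cut by its decorations. For the index `0` this is
the node itself, otherwise it is the point where a decoration has just been left behind; the edge is
thought to touch the left or right wall there. -/
abbrev EdgePoint (k : ℕ) : Type := Bool × Node k × ℕ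

variable {k : ℕ}

/-- The offset of the positions of the nodes of a box: those of the lower box come after
those of the upper box. -/
def boxBase (k : ℕ) (b : Bool) : ℤ := if b then 0 else 4 * k

/-- Position of a node; the right wall lies between the two faces. -/
def nodePos (b : Bool) (p : Node k) : Pos where
  c := boxBase k b + leftPos p + (if leftPos p < k then 0 else 2 * k)
  f := 0

/-- Position on the left wall of the point `(p, g)` with `0 < g`: before all nodes of the upper
box, behind all nodes of the lower box. An edge nearer to the north-west corner touches the wall
higher up. An edge reaches the wall at a decoration as the point counted from one of its ends and
leaves it as the point counted from the other end; the fine coordinates of these two points are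
consecutive, and they decrease along the edge from the end with the smaller `leftPos`. -/
def leftWallPos (d : Diagram k) (b : Bool) (p : Node k) (g : ℕ) : Pos where
  c := (if b then 0 else 10 * k) - 1 - min (leftPos p : ℤ) (leftPos (d.mate p))
  f := if leftPos p < leftPos (d.mate p) then -2 * g else -2 * ((d.word p).length - g) - 1

/-- Position on the right wall of the point `(p, g)` with `0 < g`; the fine coordinates are chosen
as on the left wall. -/
def rightWallPos (d : Diagram k) (b : Bool) (p : Node k) (g : ℕ) : Pos where
  c := boxBase k b + 3 * k - 1 - min (rightPos p : ℤ) (rightPos (d.mate p))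
  f := if rightPos p < rightPos (d.mate p) then -2 * g else -2 * ((d.word p).length - g) - 1

/-- The position of a point of a box with the diagram `d`: all boundary points of both boxes are
arranged in one linear order, namely the left wall (upwards), north face, right wall and south face
of the upper box, followed by the north face, right wall, south face and left wall of the lower box.
-/
def pointPos (d : Diagram k) (b : Bool) (p : Node k) : ℕ → Pos
  | 0 => nodePos b p
  | g + 1 => if d.wallOpen p g then rightWallPos d b p (g + 1) else leftWallPos d b p (g + 1)

namespace Diagram

/-! ### Arcs within one box do not cross -/

variable {d : Diagram k}

theorem IsDiagram.planar' (hd : d.IsDiagram) (p q : Node k) :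
    (¬ (leftPos p < leftPos q ∧ leftPos q < leftPos (d.mate p) ∧
      leftPos (d.mate p) < leftPos (d.mate q))) ∧
    (¬ (leftPos (d.mate p) < leftPos q ∧ leftPos q < leftPos p ∧ leftPos p < leftPos (d.mate q))) ∧
    (¬ (leftPos p < leftPos (d.mate q) ∧ leftPos (d.mate q) < leftPos (d.mate p) ∧
      leftPos (d.mate p) < leftPos q)) ∧
    (¬ (leftPos (d.mate p) < leftPos (d.mate q) ∧ leftPos (d.mate q) < leftPos p ∧
      leftPos p < leftPos q)) ∧
    (¬ (leftPos q < leftPos p ∧ leftPos p < leftPos (d.mate q) ∧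
      leftPos (d.mate q) < leftPos (d.mate p))) ∧
    (¬ (leftPos (d.mate q) < leftPos p ∧ leftPos p < leftPos q ∧ leftPos q < leftPos (d.mate p))) ∧
    (¬ (leftPos q < leftPos (d.mate p) ∧ leftPos (d.mate p) < leftPos (d.mate q) ∧
      leftPos (d.mate q) < leftPos p)) ∧
    (¬ (leftPos (d.mate q) < leftPos (d.mate p) ∧ leftPos (d.mate p) < leftPos q ∧
      leftPos q < leftPos p)) := by
  have h1 := hd.planar p q
  have h2 := hd.planar (d.mate p) q
  have h3 := hd.planar p (d.mate q)
  have h4 := hd.planar (d.mate p) (d.mate q)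
  have h5 := hd.planar q p
  have h6 := hd.planar (d.mate q) p
  have h7 := hd.planar q (d.mate p)
  have h8 := hd.planar (d.mate q) (d.mate p)
  simp only [hd.mate_mate] at h1 h2 h3 h4 h5 h6 h7 h8
  exact ⟨h1, h2, h3, h4, h5, h6, h7, h8⟩

theorem IsDiagram.mate_eq_iff (hd : d.IsDiagram) {p q : Node k} : d.mate p = q ↔ d.mate q = p :=
  ⟨fun h => by rw [← h, hd.mate_mate], fun h => by rw [← h, hd.mate_mate]⟩

theorem IsDiagram.mate_injective (hd : d.IsDiagram) : Function.Injective d.mate :=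
  fun p q h => by rw [← hd.mate_mate p, h, hd.mate_mate]

/-- Four ends of two different edges have different positions. -/
theorem IsDiagram.ends_ne (hd : d.IsDiagram) {p q : Node k} (h : q ≠ p) (h' : q ≠ d.mate p) :
    leftPos p ≠ leftPos (d.mate p) ∧ leftPos q ≠ leftPos (d.mate q) ∧ leftPos p ≠ leftPos q ∧
    leftPos p ≠ leftPos (d.mate q) ∧ leftPos (d.mate p) ≠ leftPos q ∧
    leftPos (d.mate p) ≠ leftPos (d.mate q) :=
  ⟨leftPos_ne (hd.mate_ne p).symm, leftPos_ne (hd.mate_ne q).symm, leftPos_ne h.symm,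
    leftPos_ne (fun e => h' (hd.mate_eq_iff.1 e.symm).symm), leftPos_ne h'.symm,
    leftPos_ne (fun e => h (hd.mate_injective e).symm)⟩

/-- The edge at `p` carries a closed decoration. -/
def HasClosed (d : Diagram k) (p : Node k) : Prop := ∃ x ∈ d.word p, x.isOpen = false

/-- The edge at `p` carries an open decoration. -/
def HasOpen (d : Diagram k) (p : Node k) : Prop := ∃ x ∈ d.word p, x.isOpen = true

theorem IsDiagram.mem_word_mate (hd : d.IsDiagram) {p : Node k} {x : Deco} :
    x ∈ d.word (d.mate p) ↔ x ∈ d.word p := by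
  rw [hd.word_mate, List.mem_reverse]

theorem IsDiagram.hasClosed_mate (hd : d.IsDiagram) {p : Node k} :
    d.HasClosed (d.mate p) ↔ d.HasClosed p := by
  simp only [HasClosed, hd.mem_word_mate]

theorem IsDiagram.hasOpen_mate (hd : d.IsDiagram) {p : Node k} :
    d.HasOpen (d.mate p) ↔ d.HasOpen p := by
  simp only [HasOpen, hd.mem_word_mate]

theorem IsLR.lExposed (hd : d.IsLR) {p : Node k} (h : d.HasClosed p) (q : Node k) :
    ¬ d.Separates leftPos q p ∧ ¬ d.Separates leftPos (d.mate q) p := by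
  obtain ⟨x, hx, ho⟩ := h
  exact ⟨hd.left p x hx ho q, hd.left p x hx ho _⟩

theorem IsLR.rExposed (hd : d.IsLR) {p : Node k} (h : d.HasOpen p) (q : Node k) :
    ¬ d.Separates rightPos q p ∧ ¬ d.Separates rightPos (d.mate q) p := by
  obtain ⟨x, hx, ho⟩ := h
  exact ⟨hd.right p x hx ho q, hd.right p x hx ho _⟩

theorem not_before_of_across {f : Fin k → Node k} (hd : d.IsDiagram) (h : d.ClosedBeforeOpen f)
    {i i' j j' : Fin k} (hi : d.mate (f i) = f i') (hj : d.mate (f j) = f j')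
    (hc : d.HasClosed (f i)) (ho : d.HasOpen (f j)) :
    ¬ (j < i ∧ j < i' ∧ j' < i ∧ j' < i' ∧ i ≠ i' ∧ j ≠ j') := by
  rintro ⟨h1, h2, h3, h4, h5, h6⟩
  have hi' : d.mate (f i') = f i := by rw [← hi, hd.mate_mate]
  have hj' : d.mate (f j') = f j := by rw [← hj, hd.mate_mate]
  have hc' : d.HasClosed (f i') := by rw [← hi, hd.hasClosed_mate]; exact hc
  have ho' : d.HasOpen (f j') := by rw [← hj, hd.hasOpen_mate]; exact ho
  have key : ∀ a b a' b' : Fin k, a < b → b < a' → a' < b' → d.mate (f a) = f b →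
      d.mate (f a') = f b' → d.HasOpen (f a) → d.HasClosed (f a') → False := by
    rintro a b a' b' l1 l2 l3 m1 m2 ⟨x, hx, hxo⟩ ⟨y, hy, hyo⟩
    have := h.across a b a' b' l1 l2 l3 m1 m2 x hx y hy hxo
    rw [hyo] at this
    cases this
  rcases lt_or_gt_of_ne h5 with l | l <;> rcases lt_or_gt_of_ne h6 with l' | l'
  · exact key j j' i i' l' h3 l hj hi ho hc
  · exact key j' j i i' l' h1 l hj' hi ho' hc
  · exact key j j' i' i l' h4 l hj hi' ho hc'
  · exact key j' j i' i l' h2 l hj' hi' ho' hc'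

/-- In each face, an edge with a closed decoration does not lie to the right of an edge with an open
decoration. -/
theorem IsLR.closed_open (hd : d.IsLR) {p q : Node k} (hc : d.HasClosed p) (ho : d.HasOpen q) :
    ¬ (leftPos q < leftPos p ∧ leftPos q < leftPos (d.mate p) ∧ leftPos (d.mate q) < leftPos p ∧
      leftPos (d.mate q) < leftPos (d.mate p) ∧ leftPos p < k ∧ leftPos (d.mate p) < k) ∧
    ¬ (leftPos p < leftPos q ∧ leftPos p < leftPos (d.mate q) ∧ leftPos (d.mate p) < leftPos q ∧
      leftPos (d.mate p) < leftPos (d.mate q) ∧ k ≤ leftPos p ∧ k ≤ leftPos (d.mate p)) := by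
  have hD := hd.isDiagram
  have hp := leftPos_ne (hD.mate_ne p)
  have hq := leftPos_ne (hD.mate_ne q)
  obtain ⟨p', hi⟩ : ∃ p', d.mate p = p' := ⟨_, rfl⟩
  obtain ⟨q', hj⟩ : ∃ q', d.mate q = q' := ⟨_, rfl⟩
  rw [hi] at hp ⊢
  rw [hj] at hq ⊢
  constructor
  · rintro ⟨h1, h2, h3, h4, h5, h6⟩
    rcases p with i | i <;> rcases q with j | j <;> rcases p' with i' | i' <;>
      rcases q' with j' | j' <;>
      simp only [leftPos] at h1 h2 h3 h4 h5 h6 hp hq <;> try omega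
    exact not_before_of_across hD hd.north hi hj hc ho
      ⟨by omega, by omega, by omega, by omega, by omega, by omega⟩
  · rintro ⟨h1, h2, h3, h4, h5, h6⟩
    rcases p with i | i <;> rcases q with j | j <;> rcases p' with i' | i' <;>
      rcases q' with j' | j' <;>
      simp only [leftPos] at h1 h2 h3 h4 h5 h6 hp hq <;> try omega
    exact not_before_of_across hD hd.south hi hj hc ho
      ⟨by omega, by omega, by omega, by omega, by omega, by omega⟩

end Diagram

end DecoratedTL

namespace DecoratedTL

variable {k : ℕ}

namespace Diagram

variable {d : Diagram k}

theorem min_ne_min {a a' b b' : ℕ} (h1 : a ≠ b) (h2 : a ≠ b') (h3 : a' ≠ b) (h4 : a' ≠ b') :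
    min a a' ≠ min b b' := by
  omega

theorem rightPos_ne {p q : Node k} (h : leftPos p ≠ leftPos q) : rightPos p ≠ rightPos q := by
  have lp := leftPos_lt p
  have lq := leftPos_lt q
  have rp := rightPos_eq p
  have rq := rightPos_eq q
  omega

section Comparison

variable {b : Bool} {p q : Node k} {X Y : Pos}

theorem before_node_node :
    (nodePos b p).Before (nodePos b q) ↔ leftPos p < leftPos q := by
  have lp := leftPos_lt p
  have lq := leftPos_lt q
  simp only [Pos.Before, nodePos]
  split_ifs <;> omega

theorem before_left_node (hX : X.c = (leftWallPos d b p 0).c) :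
    X.Before (nodePos b q) ↔ b = true := by
  have lp := leftPos_lt p
  have lp' := leftPos_lt (d.mate p)
  have lq := leftPos_lt q
  simp only [Pos.Before, nodePos, hX, leftWallPos, boxBase]
  rcases b <;> simp only [Bool.false_eq_true, if_true, if_false, iff_true, iff_false] <;> split_ifs <;> omega

theorem before_node_left (hX : X.c = (leftWallPos d b p 0).c) :
    (nodePos b q).Before X ↔ b = false := by
  have lp := leftPos_lt p
  have lp' := leftPos_lt (d.mate p)
  have lq := leftPos_lt q
  simp only [Pos.Before, nodePos, hX, leftWallPos, boxBase]
  rcases b <;> simp only [Bool.false_eq_true, if_true, if_false, iff_true, iff_false,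
    Bool.true_eq_false] <;> split_ifs <;> omega

theorem before_right_node (hX : X.c = (rightWallPos d b p 0).c) :
    X.Before (nodePos b q) ↔ k ≤ leftPos q := by
  have rp := rightPos_eq p
  have rp' := rightPos_eq (d.mate p)
  have lp := leftPos_lt p
  have lp' := leftPos_lt (d.mate p)
  have lq := leftPos_lt q
  simp only [Pos.Before, nodePos, hX, rightWallPos, boxBase]
  split_ifs <;> omega

theorem before_node_right (hX : X.c = (rightWallPos d b p 0).c) :
    (nodePos b q).Before X ↔ leftPos q < k := by
  have rp := rightPos_eq p
  have rp' := rightPos_eq (d.mate p)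
  have lp := leftPos_lt p
  have lp' := leftPos_lt (d.mate p)
  have lq := leftPos_lt q
  simp only [Pos.Before, nodePos, hX, rightWallPos, boxBase]
  split_ifs <;> omega

theorem before_left_right (hX : X.c = (leftWallPos d b p 0).c)
    (hY : Y.c = (rightWallPos d b q 0).c) : X.Before Y ↔ b = true := by
  have rq := rightPos_eq q
  have rq' := rightPos_eq (d.mate q)
  have lp := leftPos_lt p
  have lp' := leftPos_lt (d.mate p)
  have lq := leftPos_lt q
  have lq' := leftPos_lt (d.mate q)
  simp only [Pos.Before, hX, hY, leftWallPos, rightWallPos, boxBase]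
  rcases b <;> simp only [Bool.false_eq_true, if_true, if_false, iff_true, iff_false] <;> omega

theorem before_right_left (hX : X.c = (leftWallPos d b p 0).c)
    (hY : Y.c = (rightWallPos d b q 0).c) : Y.Before X ↔ b = false := by
  have rq := rightPos_eq q
  have rq' := rightPos_eq (d.mate q)
  have lp := leftPos_lt p
  have lp' := leftPos_lt (d.mate p)
  have lq := leftPos_lt q
  have lq' := leftPos_lt (d.mate q)
  simp only [Pos.Before, hX, hY, leftWallPos, rightWallPos, boxBase]
  rcases b <;> simp only [Bool.false_eq_true, if_true, if_false, iff_true, iff_false,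
    Bool.true_eq_false] <;> omega

theorem nodePos_ne (b : Bool) {p q : Node k} (h : p ≠ q) : (nodePos b p).c ≠ (nodePos b q).c := by
  have := leftPos_ne h
  have := leftPos_lt p
  have := leftPos_lt q
  simp only [nodePos]
  split_ifs <;> omega

theorem left_ne_node (hX : X.c = (leftWallPos d b p 0).c) : X.c ≠ (nodePos b q).c := by
  have lp := leftPos_lt p
  have lp' := leftPos_lt (d.mate p)
  have lq := leftPos_lt q
  simp only [nodePos, hX, leftWallPos, boxBase]
  rcases b <;> simp only [Bool.false_eq_true, if_true, if_false] <;> split_ifs <;> omega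

theorem right_ne_node (hX : X.c = (rightWallPos d b p 0).c) : X.c ≠ (nodePos b q).c := by
  have rp := rightPos_eq p
  have rp' := rightPos_eq (d.mate p)
  have lp := leftPos_lt p
  have lp' := leftPos_lt (d.mate p)
  have lq := leftPos_lt q
  simp only [nodePos, hX, rightWallPos, boxBase]
  split_ifs <;> omega

theorem left_ne_right (hX : X.c = (leftWallPos d b p 0).c)
    (hY : Y.c = (rightWallPos d b q 0).c) : X.c ≠ Y.c := by
  have h1 := before_left_right hX hY
  have h2 := before_right_left hX hY
  intro h
  simp only [Pos.Before, h, lt_irrefl, true_and, false_or] at h1 h2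
  have rq := rightPos_eq q
  have rq' := rightPos_eq (d.mate q)
  have lp := leftPos_lt p
  have lp' := leftPos_lt (d.mate p)
  have lq := leftPos_lt q
  have lq' := leftPos_lt (d.mate q)
  rw [hX, hY] at h
  simp only [leftWallPos, rightWallPos, boxBase] at h
  rcases b <;> simp only [Bool.false_eq_true, if_true, if_false] at h <;> omega

theorem before_left_left (hX : X.c = (leftWallPos d b p 0).c)
    (hY : Y.c = (leftWallPos d b q 0).c)
    (h : min (leftPos p) (leftPos (d.mate p)) ≠ min (leftPos q) (leftPos (d.mate q))) :
    X.Before Y ↔ min (leftPos q) (leftPos (d.mate q)) < min (leftPos p) (leftPos (d.mate p)) := by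
  simp only [Pos.Before, hX, hY, leftWallPos]
  omega

theorem before_right_right (hX : X.c = (rightWallPos d b p 0).c)
    (hY : Y.c = (rightWallPos d b q 0).c)
    (h : min (rightPos p) (rightPos (d.mate p)) ≠ min (rightPos q) (rightPos (d.mate q))) :
    X.Before Y ↔
      min (rightPos q) (rightPos (d.mate q)) < min (rightPos p) (rightPos (d.mate p)) := by
  simp only [Pos.Before, hX, hY, rightWallPos]
  omega

end Comparison

/-- `X` is the position of an end of the edge at `p`, or of a point where this edge touches a wall.
-/
def OnEdge (d : Diagram k) (b : Bool) (p : Node k) (X : Pos) : Prop :=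
  X = nodePos b p ∨ X = nodePos b (d.mate p) ∨
    (d.HasClosed p ∧ X.c = (leftWallPos d b p 0).c) ∨
    (d.HasOpen p ∧ X.c = (rightWallPos d b p 0).c)

theorem IsDiagram.planar_iff (hd : d.IsDiagram) {p q : Node k} (h : q ≠ p) (h' : q ≠ d.mate p) :
    (leftPos p < leftPos q ↔ leftPos p < leftPos (d.mate q)) ↔
      (leftPos (d.mate p) < leftPos q ↔ leftPos (d.mate p) < leftPos (d.mate q)) := by
  obtain ⟨n1, n2, n3, n4, n5, n6⟩ := hd.ends_ne h h'
  obtain ⟨a1, a2, a3, a4, a5, a6, a7, a8⟩ := hd.planar' p q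
  generalize leftPos p = a at *
  generalize leftPos (d.mate p) = a' at *
  generalize leftPos q = c at *
  generalize leftPos (d.mate q) = c' at *
  clear hd h h'
  by_cases h1 : a < c <;> by_cases h2 : a < c' <;> by_cases h3 : a' < c <;>
    by_cases h4 : a' < c' <;> simp only [h1, h2, h3, h4, iff_true, iff_false, not_true] <;> omega

/-- A closed decoration at `p` keeps `p` and the left wall on the same side of any other edge. -/
theorem IsLR.left_iff (hd : d.IsLR) {p q : Node k} (h : q ≠ p) (h' : q ≠ d.mate p)
    (hc : d.HasClosed p) : leftPos q < leftPos p ↔ leftPos (d.mate q) < leftPos p := by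
  have hD := hd.isDiagram
  obtain ⟨n1, n2, n3, n4, n5, n6⟩ := hD.ends_ne h h'
  have pl := hD.planar_iff h h'
  have e := hd.lExposed hc q
  simp only [Separates, hD.mate_mate] at e
  omega

/-- An open decoration at `p` keeps `p` and the right wall on the same side of any other edge. -/
theorem IsLR.right_iff (hd : d.IsLR) {p q : Node k} (h : q ≠ p) (h' : q ≠ d.mate p)
    (hc : d.HasOpen p) : rightPos q < rightPos p ↔ rightPos (d.mate q) < rightPos p := by
  have hD := hd.isDiagram
  obtain ⟨n1, n2, n3, n4, n5, n6⟩ := hD.ends_ne h h'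
  have pl := hD.planar_iff h h'
  have e := hd.rExposed hc q
  simp only [Separates, hD.mate_mate] at e
  have lp := leftPos_lt p
  have lp' := leftPos_lt (d.mate p)
  have lq := leftPos_lt q
  have lq' := leftPos_lt (d.mate q)
  have rp := rightPos_eq p
  have rp' := rightPos_eq (d.mate p)
  have rq := rightPos_eq q
  have rq' := rightPos_eq (d.mate q)
  generalize leftPos p = a at *
  generalize leftPos (d.mate p) = a' at *
  generalize leftPos q = c at *
  generalize leftPos (d.mate q) = c' at *
  generalize rightPos p = ra at *
  generalize rightPos (d.mate p) = ra' at *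
  generalize rightPos q = rc at *
  generalize rightPos (d.mate q) = rc' at *
  clear hd hD h h' hc
  rcases rp with ⟨x1, rfl⟩ | ⟨x1, rfl⟩ <;> rcases rp' with ⟨x2, rfl⟩ | ⟨x2, rfl⟩ <;>
    rcases rq with ⟨x3, rfl⟩ | ⟨x3, rfl⟩ <;> rcases rq' with ⟨x4, rfl⟩ | ⟨x4, rfl⟩ <;> omega

theorem IsDiagram.mate_other (hd : d.IsDiagram) {p q : Node k} (h : q ≠ p) (h' : q ≠ d.mate p) :
    p ≠ q ∧ p ≠ d.mate q ∧ d.mate q ≠ p ∧ d.mate q ≠ d.mate p :=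
  ⟨h.symm, fun e => h' (hd.mate_eq_iff.1 e.symm).symm, fun e => h' (hd.mate_eq_iff.1 e).symm,
    fun e => h (hd.mate_injective e)⟩

theorem cross_onEdge_left_left (hd : d.IsLR) (b : Bool) {p q : Node k} (h : q ≠ p)
    (h' : q ≠ d.mate p) {X Y : Pos} (cX : d.HasClosed p) (cY : d.HasClosed q)
    (hX : X.c = (leftWallPos d b p 0).c) (hY : Y.c = (leftWallPos d b q 0).c) :
    cross (nodePos b p) X (nodePos b q) Y = 0 := by
  have hD := hd.isDiagram
  obtain ⟨n1, n2, n3, n4, n5, n6⟩ := hD.ends_ne h h'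
  obtain ⟨o1, o2, o3, o4⟩ := hD.mate_other h h'
  apply cross_eq_zero
  simp only [before_node_node, before_left_node hX, before_node_left hY,
    before_left_left hX hY (min_ne_min n3 n4 n5 n6)]
  have e1 := hd.left_iff h h' cX
  have e2 := hd.left_iff o1 o2 cY
  have pl := hD.planar_iff h h'
  rcases b <;> simp only [Bool.false_eq_true, Bool.true_eq_false, true_iff, false_iff, iff_true,
      iff_false] <;> omega

theorem cross_onEdge_right_right (hd : d.IsLR) (b : Bool) {p q : Node k} (h : q ≠ p)
    (h' : q ≠ d.mate p) {X Y : Pos} (cX : d.HasOpen p) (cY : d.HasOpen q)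
    (hX : X.c = (rightWallPos d b p 0).c) (hY : Y.c = (rightWallPos d b q 0).c) :
    cross (nodePos b p) X (nodePos b q) Y = 0 := by
  have hD := hd.isDiagram
  obtain ⟨n1, n2, n3, n4, n5, n6⟩ := hD.ends_ne h h'
  obtain ⟨o1, o2, o3, o4⟩ := hD.mate_other h h'
  apply cross_eq_zero
  have mR := min_ne_min (rightPos_ne n3) (rightPos_ne n4) (rightPos_ne n5) (rightPos_ne n6)
  simp only [before_node_node, before_right_node hX, before_node_right hY,
    before_right_right hX hY mR]
  have e1 := hd.right_iff h h' cX
  have e2 := hd.right_iff o1 o2 cY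
  have m1 := rightPos_ne n1
  have m2 := rightPos_ne n2
  have m3 := rightPos_ne n3
  have m4 := rightPos_ne n4
  have m5 := rightPos_ne n5
  have m6 := rightPos_ne n6
  have e3 := hd.right_iff (p := d.mate p) h' (by rwa [hD.mate_mate]) (hD.hasOpen_mate.2 cX)
  have e4 := hd.right_iff (p := d.mate q) o2 (by rwa [hD.mate_mate]) (hD.hasOpen_mate.2 cY)
  have lp := leftPos_lt p
  have lq := leftPos_lt q
  have rp := rightPos_eq p
  have rq := rightPos_eq q
  -- In terms of `rightPos` the claim is that the edges are not nested.
  have key : min (rightPos q) (rightPos (d.mate q)) < min (rightPos p) (rightPos (d.mate p)) ↔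
      rightPos q < rightPos p := by
    clear lp lq rp rq
    omega
  rw [key]
  clear e1 e2 e3 e4 mR m1 m2 m4 m5 m6
  omega

theorem cross_onEdge_left_right (hd : d.IsLR) (b : Bool) {p q : Node k} (h : q ≠ p)
    (h' : q ≠ d.mate p) {X Y : Pos} (cX : d.HasClosed p) (oY : d.HasOpen q)
    (hX : X.c = (leftWallPos d b p 0).c) (hY : Y.c = (rightWallPos d b q 0).c) :
    cross (nodePos b p) X (nodePos b q) Y = 0 := by
  have hD := hd.isDiagram
  obtain ⟨n1, n2, n3, n4, n5, n6⟩ := hD.ends_ne h h'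
  obtain ⟨o1, o2, o3, o4⟩ := hD.mate_other h h'
  apply cross_eq_zero
  simp only [before_node_node, before_left_node hX, before_node_right hY,
    before_left_right hX hY, iff_self, iff_true]
  have e1 := hd.left_iff h h' cX
  have e3 := hd.left_iff (p := d.mate p) h' (by rwa [hD.mate_mate]) (hD.hasClosed_mate.2 cX)
  have e2 := hd.right_iff o1 o2 oY
  have e4 := hd.right_iff (p := d.mate q) o2 (by rwa [hD.mate_mate]) (hD.hasOpen_mate.2 oY)
  have e5 := hd.closed_open cX oY
  have lp := leftPos_lt p
  have lp' := leftPos_lt (d.mate p)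
  have lq := leftPos_lt q
  have lq' := leftPos_lt (d.mate q)
  have rp := rightPos_eq p
  have rp' := rightPos_eq (d.mate p)
  have rq := rightPos_eq q
  have rq' := rightPos_eq (d.mate q)
  clear hX hY cX oY o1 o2 o3 o4
  generalize leftPos p = a at *
  generalize leftPos (d.mate p) = a' at *
  generalize leftPos q = c at *
  generalize leftPos (d.mate q) = c' at *
  generalize rightPos p = ra at *
  generalize rightPos (d.mate p) = ra' at *
  generalize rightPos q = rc at *
  generalize rightPos (d.mate q) = rc' at *
  clear hd hD h h'
  rcases rp with ⟨x1, rfl⟩ | ⟨x1, rfl⟩ <;> rcases rp' with ⟨x2, rfl⟩ | ⟨x2, rfl⟩ <;>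
    rcases rq with ⟨x3, rfl⟩ | ⟨x3, rfl⟩ <;> rcases rq' with ⟨x4, rfl⟩ | ⟨x4, rfl⟩ <;> omega

theorem right_side {p p' q : Node k} (h : rightPos p < rightPos q ↔ rightPos p' < rightPos q)
    (h1 : leftPos p ≠ leftPos q) (h2 : leftPos p' ≠ leftPos q) :
    (leftPos p < leftPos q ↔ leftPos p < k) ↔ (leftPos p' < leftPos q ↔ leftPos p' < k) := by
  have lp := leftPos_lt p
  have lp' := leftPos_lt p'
  have lq := leftPos_lt q
  rcases rightPos_eq p with ⟨x1, e1⟩ | ⟨x1, e1⟩ <;> rcases rightPos_eq p' with ⟨x2, e2⟩ | ⟨x2, e2⟩ <;>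
    rcases rightPos_eq q with ⟨x3, e3⟩ | ⟨x3, e3⟩ <;> omega

/-- Pieces of two different edges of a box, each from an end of its edge to a point of that edge, do
not cross. This is where the conditions on LR-decorated diagrams enter: exposedness for two points
on the same wall, and `IsLR.closed_open` for points on different walls. -/
theorem cross_onEdge (hd : d.IsLR) (b : Bool) {p q : Node k} (h : q ≠ p) (h' : q ≠ d.mate p)
    {X Y : Pos} (hX : d.OnEdge b p X) (hY : d.OnEdge b q Y) :
    cross (nodePos b p) X (nodePos b q) Y = 0 := by
  have hD := hd.isDiagram
  obtain ⟨n1, n2, n3, n4, n5, n6⟩ := hD.ends_ne h h'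
  obtain ⟨o1, o2, o3, o4⟩ := hD.mate_other h h'
  rcases hX with rfl | hX
  · exact cross_self_left _ _ _
  rcases hY with rfl | hY
  · exact cross_self_right _ _ _
  rcases hX with rfl | ⟨cX, hX⟩ | ⟨oX, hX⟩
  · rcases hY with rfl | ⟨cY, hY⟩ | ⟨oY, hY⟩
    · apply cross_eq_zero
      simp only [before_node_node]
      exact hD.planar_iff h h'
    · apply cross_eq_zero
      simp only [before_node_node, before_node_left hY]
      have e2 := hd.left_iff o1 o2 cY
      rcases b <;> simp only [Bool.true_eq_false, iff_true, iff_false] <;> omega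
    · apply cross_eq_zero
      simp only [before_node_node, before_node_right hY]
      have e := right_side (hd.right_iff o1 o2 oY) n3 n5
      omega
  · rcases hY with rfl | ⟨cY, hY⟩ | ⟨oY, hY⟩
    · apply cross_eq_zero
      simp only [before_node_node, before_left_node hX, iff_true]
      have e1 := hd.left_iff h h' cX
      omega
    · exact cross_onEdge_left_left hd b h h' cX cY hX hY
    · exact cross_onEdge_left_right hd b h h' cX oY hX hY
  · rcases hY with rfl | ⟨cY, hY⟩ | ⟨oY, hY⟩
    · apply cross_eq_zero
      simp only [before_node_node, before_right_node hX]
      have e := right_side (hd.right_iff h h' oX) n3.symm n4.symm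
      omega
    · rw [← cross_symm (Or.inl _) (Or.inl _) (Or.inl _) (Or.inl _)]
      · exact cross_onEdge_left_right hd b o1 o2 cY oX hY hX
      · exact nodePos_ne b o1
      · exact (left_ne_node hY).symm
      · exact right_ne_node hX
      · exact (left_ne_right hY hX).symm
    · exact cross_onEdge_right_right hd b h h' oX oY hX hY

end Diagram

end DecoratedTL

namespace DecoratedTL

variable {k : ℕ}

namespace Diagram

variable {d : Diagram k}

theorem wallOpen_eq {p : Node k} {g : ℕ} {x : Deco} (h : (d.word p)[g]? = some x) :
    d.wallOpen p g = x.isOpen := by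
  simp only [wallOpen, h]

theorem IsDiagram.length_word_mate (hd : d.IsDiagram) (p : Node k) :
    (d.word (d.mate p)).length = (d.word p).length := by
  rw [hd.word_mate, List.length_reverse]

/-- Read from its two ends, the decoration `g` is the decoration `len - 1 - g`. -/
theorem IsDiagram.wallOpen_mate (hd : d.IsDiagram) {p : Node k} {g : ℕ}
    (hg : g < (d.word p).length) :
    d.wallOpen (d.mate p) ((d.word p).length - 1 - g) = d.wallOpen p g := by
  unfold wallOpen
  rw [hd.word_mate, List.getElem?_reverse (by omega)]
  congr 2
  omega

/-- The position of the `i`-th point at which the edge at `p` touches a wall, where each decoration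
is counted twice: when it is reached and when it is left. -/
def touchPos (d : Diagram k) (b : Bool) (p : Node k) (i : ℕ) : Pos :=
  if i % 2 = 0 then pointPos d b (d.mate p) ((d.word p).length - i / 2)
  else pointPos d b p (i / 2 + 1)

/-- On a non-propagating edge read from left to right, an open decoration is only followed by open
ones. -/
theorem wallOpen_same {f : Fin k → Node k} (h : d.ClosedBeforeOpen f)
    {i j : Fin k} (hij : i < j) (hi : d.mate (f i) = f j) {s t : ℕ} (hst : s ≤ t)
    (ht : t < (d.word (f i)).length) (ho : d.wallOpen (f i) s = true) :
    d.wallOpen (f i) t = true := by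
  rcases hst.lt_or_eq with hst | rfl
  · have := List.pairwise_iff_getElem.1 (h.same i j hij hi) s t (by omega) ht hst
    rw [wallOpen_eq (List.getElem?_eq_getElem ht)]
    rw [wallOpen_eq (List.getElem?_eq_getElem (by omega))] at ho
    exact this ho
  · exact ho

/-- On an edge in the south face, read from its right end, open decorations come first. -/
theorem IsLR.wallOpen_south (hd : d.IsLR) {p : Node k} (h1 : k ≤ leftPos p)
    (h2 : leftPos p < leftPos (d.mate p)) {s t : ℕ} (hst : s ≤ t)
    (ht : t < (d.word p).length) (hc : d.wallOpen p s = false) : d.wallOpen p t = false := by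
  rcases p with j | j
  · simp only [leftPos] at h1; omega
  rcases hi : d.mate (.inr j) with i | i
  · rw [hi] at h2; simp only [leftPos] at h2; omega
  rw [hi] at h2
  simp only [leftPos] at h2
  have hD := hd.isDiagram
  have hji : d.mate (.inr i) = .inr j := by rw [← hi, hD.mate_mate]
  have hl := hD.length_word_mate (.inr j)
  rw [hi] at hl
  by_contra ho
  rw [Bool.not_eq_false] at ho
  rw [← hD.wallOpen_mate ht, hi] at ho
  have := wallOpen_same hd.south (i := i) (j := j) (by omega) hji
    (s := (d.word (.inr j)).length - 1 - t) (t := (d.word (.inr j)).length - 1 - s)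
    (by omega) (by omega) ho
  rw [← hi, hD.wallOpen_mate (by omega)] at this
  rw [hc] at this
  cases this

/-- On an edge in the north face, read from its left end, closed decorations come first. -/
theorem IsLR.wallOpen_north (hd : d.IsLR) {p : Node k} (h1 : leftPos (d.mate p) < k)
    (h2 : leftPos p < leftPos (d.mate p)) {s t : ℕ} (hst : s ≤ t)
    (ht : t < (d.word p).length) (ho : d.wallOpen p s = true) : d.wallOpen p t = true := by
  rcases p with j | j
  · rcases hi : d.mate (.inl j) with i | i
    · rw [hi] at h2
      exact wallOpen_same hd.north h2 hi hst ht ho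
    · rw [hi] at h1; simp only [leftPos] at h1; omega
  · simp only [leftPos] at h1 h2; omega

section Touch

variable {b : Bool} {p : Node k} {i j : ℕ}

theorem touchPos_of_closed (hd : d.IsDiagram) (h : leftPos p < leftPos (d.mate p))
    (hi : i < 2 * (d.word p).length) (hc : d.wallOpen p (i / 2) = false) :
    touchPos d b p i = ⟨(leftWallPos d b p 0).c, -i - 1⟩ := by
  unfold touchPos
  split_ifs with h2
  · obtain ⟨m, hm⟩ : ∃ m, (d.word p).length - i / 2 = m + 1 := ⟨(d.word p).length - i / 2 - 1, by omega⟩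
    rw [hm, pointPos, show m = (d.word p).length - 1 - i / 2 by omega, hd.wallOpen_mate (by omega), hc,
      if_neg Bool.false_ne_true]
    simp only [leftWallPos, hd.mate_mate, hd.length_word_mate]
    rw [if_neg h.asymm, min_comm]
    congr 1
    omega
  · rw [pointPos, hc, if_neg Bool.false_ne_true]
    simp only [leftWallPos]
    rw [if_pos h]
    congr 1
    omega

theorem touchPos_of_open (hd : d.IsDiagram)
    (hi : i < 2 * (d.word p).length) (hc : d.wallOpen p (i / 2) = true) :
    touchPos d b p i = ⟨(rightWallPos d b p 0).c,
      if rightPos p < rightPos (d.mate p) then -i - 1 else i - 2 * (d.word p).length⟩ := by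
  have hne := rightPos_ne (leftPos_ne (hd.mate_ne p))
  unfold touchPos
  split_ifs with h2 h3 h3
  · obtain ⟨m, hm⟩ : ∃ m, (d.word p).length - i / 2 = m + 1 := ⟨(d.word p).length - i / 2 - 1, by omega⟩
    rw [hm, pointPos, show m = (d.word p).length - 1 - i / 2 by omega, hd.wallOpen_mate (by omega), hc,
      if_pos rfl]
    simp only [rightWallPos, hd.mate_mate, hd.length_word_mate]
    rw [if_neg (by omega), min_comm]
    congr 1
    omega
  · obtain ⟨m, hm⟩ : ∃ m, (d.word p).length - i / 2 = m + 1 := ⟨(d.word p).length - i / 2 - 1, by omega⟩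
    rw [hm, pointPos, show m = (d.word p).length - 1 - i / 2 by omega, hd.wallOpen_mate (by omega), hc,
      if_pos rfl]
    simp only [rightWallPos, hd.mate_mate, hd.length_word_mate]
    rw [if_pos (by omega), min_comm]
    congr 1
    omega
  · rw [pointPos, hc, if_pos rfl]
    simp only [rightWallPos]
    rw [if_pos h3]
    congr 1
    omega
  · rw [pointPos, hc, if_pos rfl]
    simp only [rightWallPos]
    rw [if_neg h3]
    congr 1
    omega

end Touch

/-- Two disjoint parts of one edge, which run from its two ends to points where it touches a
wall, do not cross. -/
theorem cross_touch (hd : d.IsLR) (b : Bool) {p : Node k} (h : leftPos p < leftPos (d.mate p))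
    {i j : ℕ} (hij : i < j) (hj : j < 2 * (d.word p).length) :
    cross (nodePos b p) (touchPos d b p i) (touchPos d b p j) (nodePos b (d.mate p)) = 0 := by
  have hD := hd.isDiagram
  have lp := leftPos_lt p
  have lp' := leftPos_lt (d.mate p)
  have hlt : i / 2 ≤ j / 2 := by omega
  apply cross_eq_zero
  have cl : ∀ {m : ℕ}, m < 2 * (d.word p).length → d.wallOpen p (m / 2) = false →
      (touchPos d b p m).c = (leftWallPos d b p 0).c ∧ (touchPos d b p m).f = -m - 1 :=
    fun h1 h2 => by rw [touchPos_of_closed hD h h1 h2]; exact ⟨rfl, rfl⟩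
  have op : ∀ {m : ℕ}, m < 2 * (d.word p).length → d.wallOpen p (m / 2) = true →
      (touchPos d b p m).c = (rightWallPos d b p 0).c ∧ (touchPos d b p m).f =
        if rightPos p < rightPos (d.mate p) then -(m : ℤ) - 1 else m - 2 * (d.word p).length :=
    fun h1 h2 => by rw [touchPos_of_open hD h1 h2]; exact ⟨rfl, rfl⟩
  cases hi : d.wallOpen p (i / 2) <;> cases hj' : d.wallOpen p (j / 2)
  · obtain ⟨ci, fi⟩ := cl (by omega) hi
    obtain ⟨cj, fj⟩ := cl hj hj'
    rw [before_node_left cj, before_node_node, before_left_node ci]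
    simp only [Pos.Before, ci, cj, fi, fj, true_and, lt_irrefl, false_or]
    rcases b <;> simp only [Bool.false_eq_true, Bool.true_eq_false, true_iff, false_iff, iff_true,
      iff_false, h] <;> omega
  · obtain ⟨ci, fi⟩ := cl (by omega) hi
    obtain ⟨cj, fj⟩ := op hj hj'
    rw [before_node_right cj, before_node_node, before_left_node ci, before_left_right ci cj]
    have : ¬ k ≤ leftPos p := fun hk => by
      have := hd.wallOpen_south hk h hlt (by omega) hi
      rw [hj'] at this
      cases this
    simp only [iff_true]
    omega
  · obtain ⟨ci, fi⟩ := op (by omega) hi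
    obtain ⟨cj, fj⟩ := cl hj hj'
    rw [before_node_left cj, before_node_node, before_right_node ci, before_right_left cj ci]
    have : ¬ leftPos (d.mate p) < k := fun hk => by
      have := hd.wallOpen_north hk h hlt (by omega) hi
      rw [hj'] at this
      cases this
    rcases b <;> simp only [Bool.true_eq_false, true_iff, false_iff] <;> omega
  · obtain ⟨ci, fi⟩ := op (by omega) hi
    obtain ⟨cj, fj⟩ := op hj hj'
    rw [before_node_right cj, before_node_node, before_right_node ci]
    have rp := rightPos_eq p
    have rp' := rightPos_eq (d.mate p)
    by_cases hr : rightPos p < rightPos (d.mate p)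
    · rw [if_pos hr] at fi fj
      simp only [Pos.Before, ci, cj, fi, fj, true_and, lt_irrefl, false_or]
      omega
    · rw [if_neg hr] at fi fj
      simp only [Pos.Before, ci, cj, fi, fj, true_and, lt_irrefl, false_or]
      omega

end Diagram

end DecoratedTL

namespace DecoratedTL

namespace Diagram

variable {k : ℕ}

/-! ### Positions of the points of a product -/

section Points

variable (D : Bool → Diagram k)

/-- The position of a point of the product. -/
def pos (x : EdgePoint k) : Pos := pointPos (D x.1) x.1 x.2.1 x.2.2

/-- The other end of the gap which begins at the point `x`. -/
def arc (x : EdgePoint k) : EdgePoint k :=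
  (x.1, (D x.1).mate x.2.1, ((D x.1).word x.2.1).length - x.2.2)

/-- The point exists: the index of the gap is not larger than the number of decorations. -/
def IsPoint (x : EdgePoint k) : Prop := x.2.2 ≤ ((D x.1).word x.2.1).length

variable {D}

theorem isPoint_arc (hD : ∀ b, (D b).IsDiagram) (x : EdgePoint k) : IsPoint D (arc D x) := by
  simp only [IsPoint, arc, (hD _).length_word_mate]
  omega

theorem arc_arc (hD : ∀ b, (D b).IsDiagram) {x : EdgePoint k} (hx : IsPoint D x) :
    arc D (arc D x) = x := by
  obtain ⟨b, p, g⟩ := x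
  simp only [IsPoint, arc, (hD _).length_word_mate, (hD _).mate_mate] at *
  congr
  omega

theorem arc_ne (hD : ∀ b, (D b).IsDiagram) (x : EdgePoint k) : arc D x ≠ x := by
  intro h
  exact (hD x.1).mate_ne x.2.1 (congrArg (fun y => y.2.1) h)

variable {d : Diagram k} {b : Bool} {p q : Node k} {g h : ℕ}

theorem pointPos_wall (d : Diagram k) (b : Bool) (p : Node k) (g : ℕ) :
    (d.wallOpen p g = false ∧ pointPos d b p (g + 1) = leftWallPos d b p (g + 1)) ∨
      (d.wallOpen p g = true ∧ pointPos d b p (g + 1) = rightWallPos d b p (g + 1)) := by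
  rw [pointPos]
  cases d.wallOpen p g <;> simp

theorem pointPos_lt (d : Diagram k) (p : Node k) (g : ℕ) : (pointPos d true p g).c < 4 * k := by
  have lp := leftPos_lt p
  have lp' := leftPos_lt (d.mate p)
  have rp := rightPos_eq p
  have rp' := rightPos_eq (d.mate p)
  rcases g with - | g
  · simp only [pointPos, nodePos, boxBase, if_true]
    split_ifs <;> omega
  · rcases pointPos_wall d true p g with ⟨-, h⟩ | ⟨-, h⟩ <;> rw [h] <;>
      simp only [leftWallPos, rightWallPos, boxBase, if_true] <;> omega

theorem pointPos_ge (d : Diagram k) (p : Node k) (g : ℕ) : 4 * k ≤ (pointPos d false p g).c := by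
  have lp := leftPos_lt p
  have lp' := leftPos_lt (d.mate p)
  have rp := rightPos_eq p
  have rp' := rightPos_eq (d.mate p)
  rcases g with - | g
  · simp only [pointPos, nodePos, boxBase, Bool.false_eq_true, if_false]
    split_ifs <;> omega
  · rcases pointPos_wall d false p g with ⟨-, h⟩ | ⟨-, h⟩ <;> rw [h] <;>
      simp only [leftWallPos, rightWallPos, boxBase, Bool.false_eq_true, if_false] <;> omega

theorem pointPos_onEdge (hg : g ≤ (d.word p).length) : d.OnEdge b p (pointPos d b p g) := by
  rcases g with - | g
  · exact Or.inl rfl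
  · have hm := List.getElem_mem hg
    rcases pointPos_wall d b p g with ⟨ho, h⟩ | ⟨ho, h⟩ <;> rw [h]
    · exact Or.inr (Or.inr (Or.inl
        ⟨⟨_, hm, by rw [← wallOpen_eq (List.getElem?_eq_getElem hg)]; exact ho⟩, rfl⟩))
    · exact Or.inr (Or.inr (Or.inr
        ⟨⟨_, hm, by rw [← wallOpen_eq (List.getElem?_eq_getElem hg)]; exact ho⟩, rfl⟩))

theorem onEdge_mate (hd : d.IsDiagram) {X : Pos} (h : d.OnEdge b (d.mate p) X) :
    d.OnEdge b p X := by
  unfold OnEdge at *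
  simp only [hd.mate_mate, hd.hasClosed_mate, hd.hasOpen_mate, leftWallPos, rightWallPos] at *
  rw [min_comm, min_comm (rightPos p : ℤ)]
  tauto

theorem pointPos_ne_of_edge_ne (hd : d.IsDiagram) (h1 : q ≠ p) (h2 : q ≠ d.mate p) {X Y : Pos}
    (hX : d.OnEdge b p X) (hY : d.OnEdge b q Y) : X.c ≠ Y.c := by
  obtain ⟨n1, n2, n3, n4, n5, n6⟩ := hd.ends_ne h1 h2
  obtain ⟨o1, o2, o3, o4⟩ := hd.mate_other h1 h2
  have mL := min_ne_min n3 n4 n5 n6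
  have mR := min_ne_min (rightPos_ne n3) (rightPos_ne n4) (rightPos_ne n5) (rightPos_ne n6)
  rcases hX with rfl | rfl | ⟨cX, hX⟩ | ⟨oX, hX⟩ <;>
    rcases hY with rfl | rfl | ⟨cY, hY⟩ | ⟨oY, hY⟩
  · exact nodePos_ne b o1
  · exact nodePos_ne b o2
  · exact (left_ne_node hY).symm
  · exact (right_ne_node hY).symm
  · exact nodePos_ne b h2.symm
  · exact nodePos_ne b o4.symm
  · exact (left_ne_node hY).symm
  · exact (right_ne_node hY).symm
  · exact left_ne_node hX
  · exact left_ne_node hX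
  · rw [hX, hY]
    simp only [leftWallPos]
    omega
  · exact left_ne_right hX hY
  · exact right_ne_node hX
  · exact right_ne_node hX
  · exact (left_ne_right hY hX).symm
  · rw [hX, hY]
    simp only [rightWallPos]
    omega

theorem pointPos_ne_same (hg : g ≤ (d.word p).length)
    (hh : h ≤ (d.word p).length) (hgh : g ≠ h) :
    (pointPos d b p g).c ≠ (pointPos d b p h).c ∨ (pointPos d b p g).f ≠ (pointPos d b p h).f := by
  rcases g with - | g <;> rcases h with - | h
  · exact absurd rfl hgh
  · rcases pointPos_wall d b p h with ⟨ho, h⟩ | ⟨ho, h⟩ <;> rw [h]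
    · exact Or.inl (left_ne_node (p := p) rfl).symm
    · exact Or.inl (right_ne_node (p := p) rfl).symm
  · rcases pointPos_wall d b p g with ⟨ho, h⟩ | ⟨ho, h⟩ <;> rw [h]
    · exact Or.inl (left_ne_node (p := p) rfl)
    · exact Or.inl (right_ne_node (p := p) rfl)
  · rcases pointPos_wall d b p h with ⟨ho, h⟩ | ⟨ho, h⟩ <;>
      rcases pointPos_wall d b p g with ⟨ho', h'⟩ | ⟨ho', h'⟩ <;> rw [h, h']
    · right
      simp only [leftWallPos]
      split_ifs <;> omega
    · exact Or.inl (left_ne_right (p := p) (q := p) rfl rfl).symm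
    · exact Or.inl (left_ne_right (p := p) (q := p) rfl rfl)
    · right
      simp only [rightWallPos]
      split_ifs <;> omega

theorem pointPos_ne_mate (hd : d.IsDiagram) (hg : g ≤ (d.word p).length)
    (hh : h ≤ (d.word p).length) :
    (pointPos d b p g).c ≠ (pointPos d b (d.mate p) h).c ∨
      (pointPos d b p g).f ≠ (pointPos d b (d.mate p) h).f := by
  have hne := leftPos_ne (hd.mate_ne p)
  have hne' := rightPos_ne hne
  rcases g with - | g <;> rcases h with - | h
  · exact Or.inl (nodePos_ne b (hd.mate_ne p).symm)
  · rcases pointPos_wall d b (d.mate p) h with ⟨ho, h⟩ | ⟨ho, h⟩ <;> rw [h]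
    · exact Or.inl (left_ne_node (p := d.mate p) rfl).symm
    · exact Or.inl (right_ne_node (p := d.mate p) rfl).symm
  · rcases pointPos_wall d b p g with ⟨ho, h⟩ | ⟨ho, h⟩ <;> rw [h]
    · exact Or.inl (left_ne_node (p := p) rfl)
    · exact Or.inl (right_ne_node (p := p) rfl)
  · rcases pointPos_wall d b (d.mate p) h with ⟨ho, h⟩ | ⟨ho, h⟩ <;>
      rcases pointPos_wall d b p g with ⟨ho', h'⟩ | ⟨ho', h'⟩ <;> rw [h, h']
    · right
      simp only [leftWallPos, hd.mate_mate, hd.length_word_mate]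
      rcases lt_or_gt_of_ne hne with hl | hl
      · rw [if_neg hl.asymm, if_pos hl]
        omega
      · rw [if_pos hl, if_neg hl.asymm]
        omega
    · exact Or.inl (left_ne_right (p := d.mate p) (q := p) rfl rfl).symm
    · exact Or.inl (left_ne_right (p := p) (q := d.mate p) rfl rfl)
    · right
      simp only [rightWallPos, hd.mate_mate, hd.length_word_mate]
      rcases lt_or_gt_of_ne hne' with hl | hl
      · rw [if_neg hl.asymm, if_pos hl]
        omega
      · rw [if_pos hl, if_neg hl.asymm]
        omega

/-- Different points have different positions. -/
theorem pos_ne (hD : ∀ b, (D b).IsDiagram) {x y : EdgePoint k} (hx : IsPoint D x)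
    (hy : IsPoint D y) (hxy : x ≠ y) :
    (pos D x).c ≠ (pos D y).c ∨ (pos D x).f ≠ (pos D y).f := by
  obtain ⟨b, p, g⟩ := x
  obtain ⟨c, q, h⟩ := y
  simp only [IsPoint, pos] at *
  by_cases hbc : b = c
  · subst hbc
    by_cases hqp : q = p
    · subst hqp
      exact pointPos_ne_same hx hy (fun e => hxy (by rw [e]))
    by_cases hqm : q = (D b).mate p
    · subst hqm
      rw [(hD b).length_word_mate] at hy
      exact pointPos_ne_mate (hD b) hx hy
    · exact Or.inl (pointPos_ne_of_edge_ne (hD b) hqp hqm (pointPos_onEdge hx) (pointPos_onEdge hy))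
  · left
    rcases b <;> rcases c
    · exact absurd rfl hbc
    · have h1 := pointPos_ge (D false) p g
      have h2 := pointPos_lt (D true) q h
      omega
    · have h1 := pointPos_lt (D true) p g
      have h2 := pointPos_ge (D false) q h
      omega
    · exact absurd rfl hbc

/-- Two different gaps of the same edge do not cross. -/
theorem cross_same_edge (hd : d.IsLR) (b : Bool) (hl : leftPos p < leftPos (d.mate p)) (hgh : g < h)
    (hh : h ≤ (d.word p).length) :
    cross (pointPos d b p g) (pointPos d b (d.mate p) ((d.word p).length - g))
      (pointPos d b p h) (pointPos d b (d.mate p) ((d.word p).length - h)) = 0 := by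
  have hE : ∀ {t}, t < (d.word p).length →
      pointPos d b (d.mate p) ((d.word p).length - t) = touchPos d b p (2 * t) := by
    intro t ht
    rw [touchPos, if_pos (by omega)]
    congr
    omega
  have hS : ∀ {t}, pointPos d b p (t + 1) = touchPos d b p (2 * t + 1) := by
    intro t
    rw [touchPos, if_neg (by omega)]
    congr
    omega
  have key : ∀ {i X}, i < 2 * h - 1 ∧ X = touchPos d b p i ∨ X = nodePos b p → ∀ {Y},
      Y = touchPos d b p (2 * h - 1) ∨ h < (d.word p).length ∧ Y = touchPos d b p (2 * h) ∨
        Y = nodePos b (d.mate p) → cross (nodePos b p) X (nodePos b (d.mate p)) Y = 0 := by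
    intro i X hX Y hY
    rw [cross_swap_right]
    rcases hX with ⟨hi, rfl⟩ | rfl
    · rcases hY with rfl | ⟨hhl, rfl⟩ | rfl
      · exact cross_touch hd b hl hi (by omega)
      · exact cross_touch hd b hl (by omega) (by omega)
      · exact cross_self_right _ _ _
    · exact cross_self_left _ _ _
  have hy1 : pointPos d b p h = touchPos d b p (2 * h - 1) := by
    obtain ⟨m, rfl⟩ : ∃ m, h = m + 1 := ⟨h - 1, by omega⟩
    rw [hS]
    congr 1
  have hy2 : h < (d.word p).length ∧ pointPos d b (d.mate p) ((d.word p).length - h) =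
      touchPos d b p (2 * h) ∨ pointPos d b (d.mate p) ((d.word p).length - h) =
        nodePos b (d.mate p) := by
    rcases hh.lt_or_eq with h1 | h1
    · exact Or.inl ⟨h1, hE h1⟩
    · right
      rw [h1, Nat.sub_self]
      rfl
  have hx1 : 2 * g - 1 < 2 * h - 1 ∧ pointPos d b p g = touchPos d b p (2 * g - 1) ∨
      pointPos d b p g = nodePos b p := by
    rcases g with - | g
    · exact Or.inr rfl
    · exact Or.inl ⟨by omega, by rw [hS]; congr 1⟩
  have hx2 : 2 * g < 2 * h - 1 ∧ pointPos d b (d.mate p) ((d.word p).length - g) =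
      touchPos d b p (2 * g) ∨ pointPos d b (d.mate p) ((d.word p).length - g) = nodePos b p :=
    Or.inl ⟨by omega, hE (by omega)⟩
  rw [cross_bilinear (nodePos b p) _ _ (nodePos b (d.mate p)), key hx1 (Or.inl hy1),
    key hx1 (Or.inr hy2), key hx2 (Or.inl hy1), key hx2 (Or.inr hy2)]
  rfl

/-- The gaps of the edges of LR-decorated diagrams, regarded as arcs between nodes and points on
the walls, do not cross each other. -/
theorem cross_arc (hD : ∀ b, (D b).IsLR) {x y : EdgePoint k} (hx : IsPoint D x)
    (hy : IsPoint D y) (h1 : y ≠ x) (h2 : y ≠ arc D x) :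
    cross (pos D x) (pos D (arc D x)) (pos D y) (pos D (arc D y)) = 0 := by
  have hI : ∀ b, (D b).IsDiagram := fun b => (hD b).isDiagram
  have sym : ∀ {x y : EdgePoint k}, IsPoint D x → IsPoint D y → y ≠ x → y ≠ arc D x →
      cross (pos D x) (pos D (arc D x)) (pos D y) (pos D (arc D y)) = 0 →
      cross (pos D y) (pos D (arc D y)) (pos D x) (pos D (arc D x)) = 0 := by
    intro x y hx hy h1 h2 h
    rw [cross_symm, h]
    · exact pos_ne hI hx hy h1.symm
    · refine pos_ne hI hx (isPoint_arc hI y) fun e => h2 ?_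
      rw [e, arc_arc hI hy]
    · exact pos_ne hI (isPoint_arc hI x) hy h2.symm
    · refine pos_ne hI (isPoint_arc hI x) (isPoint_arc hI y) fun e => h1 ?_
      rw [← arc_arc hI hy, ← e, arc_arc hI hx]
  obtain ⟨b, p, g⟩ := x
  obtain ⟨c, q, h⟩ := y
  by_cases hbc : b = c
  · subst hbc
    by_cases hqp : q = p ∨ q = (D b).mate p
    · -- Both points are taken on the edge read from the same, clockwise first, end.
      have key : ∀ {r : Node k} {g h : ℕ}, leftPos r < leftPos ((D b).mate r) →
          g ≤ ((D b).word r).length → h ≤ ((D b).word r).length → g ≠ h →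
          cross (pos D (b, r, g)) (pos D (arc D (b, r, g))) (pos D (b, r, h))
            (pos D (arc D (b, r, h))) = 0 := by
        intro r g h hr hg hh hgh
        rcases lt_or_gt_of_ne hgh with hl | hl
        · exact cross_same_edge (hD b) b hr hl hh
        · refine sym hh hg (fun e => hgh (congrArg (fun y => y.2.2) e)) (fun e => ?_)
            (cross_same_edge (hD b) b hr hl hg)
          exact (hI b).mate_ne r (congrArg (fun y => y.2.1) e).symm
      have key' : ∀ {r : Node k} {g h : ℕ},
          g ≤ ((D b).word r).length → h ≤ ((D b).word r).length → g ≠ h →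
          cross (pos D (b, r, g)) (pos D (arc D (b, r, g))) (pos D (b, r, h))
            (pos D (arc D (b, r, h))) = 0 := by
        intro r g h hg hh hgh
        rcases lt_or_gt_of_ne (leftPos_ne ((hI b).mate_ne r)) with hl | hl
        · have e : ∀ {m}, m ≤ ((D b).word r).length →
              (b, r, m) = arc D (b, (D b).mate r, ((D b).word r).length - m) := by
            intro m hm
            simp only [arc, (hI b).mate_mate, (hI b).length_word_mate]
            congr
            omega
          have := key (r := (D b).mate r) (g := ((D b).word r).length - g)
            (h := ((D b).word r).length - h) (by rwa [(hI b).mate_mate])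
            (by rw [(hI b).length_word_mate]; omega) (by rw [(hI b).length_word_mate]; omega)
            (by omega)
          rw [← e hg, ← e hh, cross_swap_left, cross_swap_right] at this
          exact this
        · exact key hl hg hh hgh
      rcases hqp with rfl | rfl
      · exact key' hx hy (fun e => h1 (by rw [e]))
      · have hy' : h ≤ ((D b).word p).length := by
          simpa only [IsPoint, (hI b).length_word_mate] using hy
        have e : arc D (b, (D b).mate p, h) = (b, p, ((D b).word p).length - h) := by
          simp only [arc, (hI b).mate_mate, (hI b).length_word_mate]
        have e' : (b, (D b).mate p, h) = arc D (b, p, ((D b).word p).length - h) := by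
          simp only [arc]
          congr
          omega
        rw [e, cross_swap_right, e']
        refine key' hx (by omega) fun hne => h2 ?_
        simp only [arc]
        congr
        omega
    · rw [not_or] at hqp
      have hx1 : (D b).OnEdge b p (pos D (b, p, g)) := pointPos_onEdge hx
      have hy1 : (D b).OnEdge b q (pos D (b, q, h)) := pointPos_onEdge hy
      have hx2 : (D b).OnEdge b p (pos D (arc D (b, p, g))) :=
        onEdge_mate (hI b) (pointPos_onEdge (isPoint_arc hI (b, p, g)))
      have hy2 : (D b).OnEdge b q (pos D (arc D (b, q, h))) :=
        onEdge_mate (hI b) (pointPos_onEdge (isPoint_arc hI (b, q, h)))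
      have c := @cross_onEdge _ _ (hD b) b p q hqp.1 hqp.2
      rw [cross_bilinear (nodePos b p) _ _ (nodePos b q), c hx1 hy1,
        c hx1 hy2, c hx2 hy1, c hx2 hy2]
      rfl
  · apply cross_eq_zero
    simp only [pos, arc, Pos.Before]
    rcases b <;> rcases c
    · exact absurd rfl hbc
    · have h1 := pointPos_ge (D false) p g
      have h2 := pointPos_ge (D false) ((D false).mate p) (((D false).word p).length - g)
      have h3 := pointPos_lt (D true) q h
      have h4 := pointPos_lt (D true) ((D true).mate q) (((D true).word q).length - h)
      omega
    · have h1 := pointPos_lt (D true) p g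
      have h2 := pointPos_lt (D true) ((D true).mate p) (((D true).word p).length - g)
      have h3 := pointPos_ge (D false) q h
      have h4 := pointPos_ge (D false) ((D false).mate q) (((D false).word q).length - h)
      omega
    · exact absurd rfl hbc

end Points

end Diagram

end DecoratedTL

namespace DecoratedTL

namespace Diagram

variable {k : ℕ}

/-! ### Trails through a product -/

/-- The two copies of a node of the interface are identified. -/
inductive Glue : EdgePoint k → EdgePoint k → Prop
  | down (j : Fin k) : Glue (true, .inr j, 0) (false, .inl j, 0)
  | up (j : Fin k) : Glue (false, .inl j, 0) (true, .inr j, 0)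

/-- An edge reaches a wall at `y` and leaves it at `z`, and this is due to the decoration `x`. -/
inductive Touch (D : Bool → Diagram k) : EdgePoint k → EdgePoint k → Deco → Prop
  | mk (c : Bool) (q : Node k) (g : ℕ) (x : Deco) (h : ((D c).word q)[g]? = some x) :
      Touch D (c, q, g + 1) (c, (D c).mate q, ((D c).word q).length - g) x

/-- `y` and `z` are two points at which consecutive gaps of an edge of the product meet. -/
def Link (D : Bool → Diagram k) (y z : EdgePoint k) : Prop := Glue y z ∨ ∃ x, Touch D y z x

/-- A path in the product from `a` to `e`: the list of the gaps which it runs through, each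
represented by its beginning, and the list of the decorations which it meets. -/
inductive Trail (D : Bool → Diagram k) :
    EdgePoint k → List (EdgePoint k) → List Deco → EdgePoint k → Prop
  | last {a} (ha : IsPoint D a) : Trail D a [a] [] (arc D a)
  | glue {a b l w e} (ha : IsPoint D a) (h : Glue (arc D a) b) (t : Trail D b l w e) :
      Trail D a (a :: l) w e
  | touch {a b l w e x} (ha : IsPoint D a) (h : Touch D (arc D a) b x) (t : Trail D b l w e) :
      Trail D a (a :: l) (x :: w) e

variable {D : Bool → Diagram k}

theorem Glue.symm {y z : EdgePoint k} (h : Glue y z) : Glue z y := by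
  cases h
  · exact .up _
  · exact .down _

theorem Glue.unique {y z z' : EdgePoint k} (h : Glue y z) (h' : Glue y z') : z = z' := by
  cases h <;> cases h' <;> rfl

theorem Touch.symm (hD : ∀ b, (D b).IsDiagram) {y z : EdgePoint k} {x : Deco}
    (h : Touch D y z x) : Touch D z y x := by
  obtain ⟨c, q, g, x, h⟩ := h
  obtain ⟨hg, hx⟩ := List.getElem?_eq_some_iff.1 h
  have h2 : ((D c).word ((D c).mate q))[((D c).word q).length - 1 - g]? = some x := by
    rw [(hD c).word_mate, List.getElem?_reverse (by omega), ← h]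
    congr 1
    omega
  have := Touch.mk c _ _ x h2
  simp only [(hD c).mate_mate, (hD c).length_word_mate] at this
  convert this using 3 <;> omega

theorem Touch.unique {y z z' : EdgePoint k} {x x' : Deco} (h : Touch D y z x)
    (h' : Touch D y z' x') : z = z' ∧ x = x' := by
  cases h with | mk c q g x hx => ?_
  cases h' with | mk _ _ _ _ hx' => ?_
  exact ⟨rfl, Option.some.inj (hx.symm.trans hx')⟩

theorem Touch.not_glue {y z z' : EdgePoint k} {x : Deco} (h : Touch D y z x) : ¬ Glue y z' := by
  intro h'
  cases h
  cases h'

theorem Link.symm (hD : ∀ b, (D b).IsDiagram) {y z : EdgePoint k} (h : Link D y z) :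
    Link D z y := by
  rcases h with h | ⟨x, h⟩
  · exact Or.inl h.symm
  · exact Or.inr ⟨x, h.symm hD⟩

theorem Link.unique {y z z' : EdgePoint k} (h : Link D y z) (h' : Link D y z') : z = z' := by
  rcases h with h | ⟨x, h⟩ <;> rcases h' with h' | ⟨x', h'⟩
  · exact h.unique h'
  · exact absurd h h'.not_glue
  · exact absurd h' h.not_glue
  · exact (h.unique h').1

theorem Touch.isPoint (hD : ∀ b, (D b).IsDiagram) {y z : EdgePoint k} {x : Deco}
    (h : Touch D y z x) : IsPoint D y ∧ IsPoint D z := by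
  obtain ⟨c, q, g, x, h⟩ := h
  obtain ⟨hg, hx⟩ := List.getElem?_eq_some_iff.1 h
  simp only [IsPoint, (hD c).length_word_mate]
  omega

theorem Touch.pos (hD : ∀ b, (D b).IsDiagram) {y z : EdgePoint k} {x : Deco}
    (h : Touch D y z x) :
    (pos D y).c = (pos D z).c ∧ ((pos D y).f = (pos D z).f + 1 ∨ (pos D z).f = (pos D y).f + 1) := by
  obtain ⟨c, q, g, x, h⟩ := h
  obtain ⟨hg, hx⟩ := List.getElem?_eq_some_iff.1 h
  have ho := (hD c).wallOpen_mate hg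
  obtain ⟨m, hm⟩ : ∃ m, ((D c).word q).length - g = m + 1 :=
    ⟨((D c).word q).length - 1 - g, by omega⟩
  rw [show ((D c).word q).length - 1 - g = m by omega] at ho
  have hne := leftPos_ne ((hD c).mate_ne q)
  have hne' := rightPos_ne hne
  simp only [Diagram.pos, hm]
  rcases pointPos_wall (D c) c q g with ⟨h1, h2⟩ | ⟨h1, h2⟩ <;>
    rcases pointPos_wall (D c) c ((D c).mate q) m with ⟨h3, h4⟩ | ⟨h3, h4⟩
  · rw [h2, h4]
    simp only [leftWallPos, (hD c).mate_mate, (hD c).length_word_mate]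
    refine ⟨by rw [min_comm], ?_⟩
    rcases lt_or_gt_of_ne hne with hl | hl
    · rw [if_neg hl.asymm, if_pos hl]
      omega
    · rw [if_pos hl, if_neg hl.asymm]
      omega
  · rw [h1, h3] at ho
    cases ho
  · rw [h1, h3] at ho
    cases ho
  · rw [h2, h4]
    simp only [rightWallPos, (hD c).mate_mate, (hD c).length_word_mate]
    refine ⟨by rw [min_comm], ?_⟩
    rcases lt_or_gt_of_ne hne' with hl | hl
    · rw [if_neg hl.asymm, if_pos hl]
      omega
    · rw [if_pos hl, if_neg hl.asymm]
      omega

/-- No other point lies between the two points at which an edge reaches and leaves a wall. -/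
theorem Touch.chi (hD : ∀ b, (D b).IsDiagram) {y z u : EdgePoint k} {x : Deco}
    (h : Touch D y z x) (hu : IsPoint D u) (h1 : u ≠ y) (h2 : u ≠ z) :
    chi (Diagram.pos D u) (Diagram.pos D y) = chi (Diagram.pos D u) (Diagram.pos D z) ∧
      chi (Diagram.pos D y) (Diagram.pos D u) = chi (Diagram.pos D z) (Diagram.pos D u) := by
  have hp := h.isPoint hD
  have n1 := pos_ne hD hu hp.1 h1
  have n2 := pos_ne hD hu hp.2 h2
  obtain ⟨e1, e2⟩ := h.pos hD
  constructor <;> apply chi_congr <;> unfold Pos.Before <;> omega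

/-- The point does not lie on the interface of the product. -/
def IsEnd (y : EdgePoint k) : Prop := ∀ z, ¬ Glue y z

theorem nodePos_inl_c (b : Bool) (i : Fin k) : (nodePos b (.inl i)).c = boxBase k b + i := by
  have h := leftPos_inl i
  simp only [nodePos]
  rw [h, if_pos i.2]
  omega

theorem nodePos_inr_c (b : Bool) (i : Fin k) :
    (nodePos b (.inr i)).c = boxBase k b + 4 * k - 1 - i := by
  have h := leftPos_inr i
  simp only [nodePos]
  rw [h, if_neg (by omega)]
  omega

/-- The nodes of the interface occupy the middle of the linear order, and the pairs of identified
nodes are nested there. -/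
theorem nodePos_glue {y z : EdgePoint k} (h : Glue y z) :
    ∃ j : Fin k, ((pos D y).c = 4 * k - 1 - j ∧ (pos D z).c = 4 * k + j ∨
      (pos D z).c = 4 * k - 1 - j ∧ (pos D y).c = 4 * k + j) ∧
      (∀ y' z' : EdgePoint k, ∀ _ : Glue y' z', y' ≠ y → y' ≠ z → ∃ i : Fin k, i.val ≠ j.val ∧
        ((pos D y').c = 4 * k - 1 - i ∧ (pos D z').c = 4 * k + i ∨
          (pos D z').c = 4 * k - 1 - i ∧ (pos D y').c = 4 * k + i)) := by
  have key : ∀ j : Fin k, (pos D (true, .inr j, 0)).c = 4 * k - 1 - j ∧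
      (pos D (false, .inl j, 0)).c = 4 * k + j := by
    intro j
    have := j.2
    have h1 : pos D (true, .inr j, 0) = nodePos true (.inr j) := rfl
    have h2 : pos D (false, .inl j, 0) = nodePos false (.inl j) := rfl
    rw [h1, h2, nodePos_inr_c, nodePos_inl_c]
    simp [boxBase]
  have key' : ∀ j : Fin k, ∀ y' z' : EdgePoint k, Glue y' z' → y' ≠ (true, .inr j, 0) →
      y' ≠ (false, .inl j, 0) → ∃ i : Fin k, i.val ≠ j.val ∧
        ((pos D y').c = 4 * k - 1 - i ∧ (pos D z').c = 4 * k + i ∨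
          (pos D z').c = 4 * k - 1 - i ∧ (pos D y').c = 4 * k + i) := by
    intro j y' z' h' h1 h2
    cases h' with
    | down i =>
      exact ⟨i, fun e => h1 (by rw [Fin.ext e]), Or.inl (key i)⟩
    | up i =>
      exact ⟨i, fun e => h2 (by rw [Fin.ext e]), Or.inr (key i)⟩
  cases h with
  | down j => exact ⟨j, Or.inl (key j), fun y' z' h' h1 h2 => key' j y' z' h' h1 h2⟩
  | up j => exact ⟨j, Or.inr (key j), fun y' z' h' h1 h2 => key' j y' z' h' h2 h1⟩

theorem isEnd_pos {u : EdgePoint k} (he : IsEnd u) :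
    (pos D u).c < 3 * k ∨ 5 * k ≤ (pos D u).c := by
  obtain ⟨b, p, g⟩ := u
  have lp := leftPos_lt p
  have lp' := leftPos_lt ((D b).mate p)
  have rp := rightPos_eq p
  have rp' := rightPos_eq ((D b).mate p)
  rcases g with - | g
  · rcases b <;> rcases p with i | i
    · exact absurd (Glue.up i) (he _)
    · have h : pos D (false, .inr i, 0) = nodePos false (.inr i) := rfl
      rw [h, nodePos_inr_c]
      simp only [boxBase, Bool.false_eq_true, if_false]
      omega
    · have h : pos D (true, .inl i, 0) = nodePos true (.inl i) := rfl
      rw [h, nodePos_inl_c]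
      simp only [boxBase, if_true]
      omega
    · exact absurd (Glue.down i) (he _)
  · simp only [pos]
    rcases pointPos_wall (D b) b p g with ⟨-, h⟩ | ⟨-, h⟩ <;> rw [h] <;>
      simp only [leftWallPos, rightWallPos, boxBase] <;>
      rcases b <;> simp only [Bool.false_eq_true, if_true, if_false] <;> omega

/-- No end of a trail lies between the two points of a link, apart from these points themselves. -/
theorem Link.chi_end (hD : ∀ b, (D b).IsDiagram) {y z u : EdgePoint k} (h : Link D y z)
    (hu : IsPoint D u) (he : IsEnd u) (h1 : u ≠ y) (h2 : u ≠ z) :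
    chi (pos D u) (pos D y) = chi (pos D u) (pos D z) ∧
      chi (pos D y) (pos D u) = chi (pos D z) (pos D u) := by
  rcases h with h | ⟨x, h⟩
  · obtain ⟨j, hj, -⟩ := nodePos_glue (D := D) h
    have hp := isEnd_pos (D := D) he
    have := j.2
    constructor <;> apply chi_congr <;> unfold Pos.Before <;> omega
  · exact h.chi hD hu h1 h2

/-- Two different links do not cross: the two points of a touch are consecutive, and the pairs of
identified nodes of the interface are nested. -/
theorem Link.chi_link (hD : ∀ b, (D b).IsDiagram) {y z y' z' : EdgePoint k} (h : Link D y z)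
    (h' : Link D y' z') (hp : IsPoint D y ∧ IsPoint D z) (hp' : IsPoint D y' ∧ IsPoint D z')
    (h1 : y' ≠ y) (h2 : y' ≠ z) (h3 : z' ≠ y) (h4 : z' ≠ z) :
    chi (pos D y) (pos D y') + chi (pos D z) (pos D y') =
      chi (pos D y) (pos D z') + chi (pos D z) (pos D z') := by
  rcases h with h | ⟨x, h⟩
  · rcases h' with h' | ⟨x, h'⟩
    · obtain ⟨j, hj, hi⟩ := nodePos_glue (D := D) h
      obtain ⟨i, hij, hi⟩ := hi y' z' h' h1 h2
      have := j.2
      have := i.2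
      have c := cross_eq_zero (x := pos D y) (x' := pos D z) (y := pos D y') (y' := pos D z')
        (by unfold Pos.Before; omega)
      unfold cross at c
      linear_combination c - zmod_two_add_self (chi (pos D y) (pos D z'))
        - zmod_two_add_self (chi (pos D z) (pos D z'))
    · rw [(h'.chi hD hp.1 h1.symm h3.symm).1, (h'.chi hD hp.2 h2.symm h4.symm).1]
  · rw [(h.chi hD hp'.1 h1 h2).2, (h.chi hD hp'.2 h3 h4).2, zmod_two_add_self, zmod_two_add_self]

theorem Trail.isPoint_of_mem {a e : EdgePoint k} {l w} (t : Trail D a l w e) :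
    ∀ x ∈ l, IsPoint D x := by
  induction t with
  | last ha => exact fun x hx => List.mem_singleton.1 hx ▸ ha
  | glue ha h t ih => exact List.forall_mem_cons.2 ⟨ha, ih⟩
  | touch ha h t ih => exact List.forall_mem_cons.2 ⟨ha, ih⟩

theorem Trail.start_mem {a e : EdgePoint k} {l w} (t : Trail D a l w e) : a ∈ l := by
  cases t <;> simp

theorem Trail.end_mem {a e : EdgePoint k} {l w} (t : Trail D a l w e) : ∃ x ∈ l, e = arc D x := by
  induction t with
  | last ha => exact ⟨_, by simp, rfl⟩
  | glue ha h t ih => obtain ⟨x, hx, h⟩ := ih; exact ⟨x, by simp [hx], h⟩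
  | touch ha h t ih => obtain ⟨x, hx, h⟩ := ih; exact ⟨x, by simp [hx], h⟩

/-- A function which does not distinguish the two points of a link takes, summed modulo two over all
ends of the gaps of a trail, the same value as on the two ends of the trail. -/
theorem Trail.sum {a e : EdgePoint k} {l w} (t : Trail D a l w e) (φ : EdgePoint k → ZMod 2)
    (hφ : ∀ x ∈ l, ∀ z ∈ l, Link D (arc D x) z → φ (arc D x) = φ z) :
    (l.map fun x => φ x + φ (arc D x)).sum = φ a + φ e := by
  induction t with
  | last ha => simp
  | @glue a b l w e ha h t ih =>
    rw [List.map_cons, List.sum_cons, ih fun x hx z hz => hφ x (by simp [hx]) z (by simp [hz]),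
      hφ a (by simp) b (by simp [t.start_mem]) (Or.inl h)]
    linear_combination zmod_two_add_self (φ b)
  | @touch a b l w e x ha h t ih =>
    rw [List.map_cons, List.sum_cons, ih fun x hx z hz => hφ x (by simp [hx]) z (by simp [hz]),
      hφ a (by simp) b (by simp [t.start_mem]) (Or.inr ⟨_, h⟩)]
    linear_combination zmod_two_add_self (φ b)

/-- The two lists of gaps have no gap in common. -/
def ArcDisjoint (D : Bool → Diagram k) (l l' : List (EdgePoint k)) : Prop :=
  ∀ x ∈ l, ∀ y ∈ l', y ≠ x ∧ y ≠ arc D x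

/-- Trails without a common gap do not cross. -/
theorem Trail.cross (hD : ∀ b, (D b).IsLR) {a e a' e' : EdgePoint k} {l l' w w'}
    (t : Trail D a l w e) (t' : Trail D a' l' w' e') (hl : ArcDisjoint D l l')
    (ha : IsEnd a) (he : IsEnd e) (ha' : IsEnd a') (he' : IsEnd e') :
    cross (pos D a) (pos D e) (pos D a') (pos D e') = 0 := by
  have hI : ∀ b, (D b).IsDiagram := fun b => (hD b).isDiagram
  -- All ends of gaps of the first trail are different from those of the second.
  have ne : ∀ {x y u v}, x ∈ l → y ∈ l' → (u = x ∨ u = arc D x) → (v = y ∨ v = arc D y) →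
      u ≠ v := by
    intro x y u v hx hy hu hv e
    obtain ⟨h1, h2⟩ := hl x hx y hy
    have px := t.isPoint_of_mem x hx
    have py := t'.isPoint_of_mem y hy
    rcases hu with rfl | rfl <;> rcases hv with rfl | rfl
    · exact h1 e.symm
    · exact h2 (by rw [e, arc_arc hI py])
    · exact h2 e.symm
    · exact h1 (by rw [← arc_arc hI py, ← e, arc_arc hI px])
  have pt : ∀ {x u}, x ∈ l → (u = x ∨ u = arc D x) → IsPoint D u := by
    rintro x u hx (rfl | rfl)
    · exact t.isPoint_of_mem _ hx
    · exact isPoint_arc hI _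
  have pt' : ∀ {x u}, x ∈ l' → (u = x ∨ u = arc D x) → IsPoint D u := by
    rintro x u hx (rfl | rfl)
    · exact t'.isPoint_of_mem _ hx
    · exact isPoint_arc hI _
  obtain ⟨xe, hxe, rfl⟩ := t.end_mem
  obtain ⟨ye, hye, rfl⟩ := t'.end_mem
  have hs := t.start_mem
  have hs' := t'.start_mem
  have endsum : ∀ {x u}, x ∈ l → (u = x ∨ u = arc D x) → IsEnd u →
      (l'.map fun y => chi (pos D u) (pos D y) + chi (pos D u) (pos D (arc D y))).sum =
        chi (pos D u) (pos D a') + chi (pos D u) (pos D (arc D ye)) := by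
    intro x u hx hu hue
    apply t'.sum fun y => chi (pos D u) (pos D y)
    intro y hy z hz h
    exact (h.chi_end hI (pt hx hu) hue (ne hx hy hu (Or.inr rfl)) (ne hx hz hu (Or.inl rfl))).1
  have linksum : ∀ x ∈ l, ∀ z ∈ l, Link D (arc D x) z →
      (l'.map fun y => chi (pos D (arc D x)) (pos D y) + chi (pos D (arc D x)) (pos D (arc D y))).sum
      = (l'.map fun y => chi (pos D z) (pos D y) + chi (pos D z) (pos D (arc D y))).sum := by
    intro x hx z hz h
    have s := t'.sum (fun y => chi (pos D (arc D x)) (pos D y) + chi (pos D z) (pos D y)) <| by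
      intro y hy u hu h'
      exact h.chi_link hI h' ⟨pt hx (Or.inr rfl), pt hz (Or.inl rfl)⟩
        ⟨pt' hy (Or.inr rfl), pt' hu (Or.inl rfl)⟩
        (ne hx hy (Or.inr rfl) (Or.inr rfl)).symm (ne hz hy (Or.inl rfl) (Or.inr rfl)).symm
        (ne hx hu (Or.inr rfl) (Or.inl rfl)).symm (ne hz hu (Or.inl rfl) (Or.inl rfl)).symm
    rw [(h.chi_end hI (pt' hs' (Or.inl rfl)) ha' (ne hx hs' (Or.inr rfl) (Or.inl rfl)).symm
      (ne hz hs' (Or.inl rfl) (Or.inl rfl)).symm).2,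
      (h.chi_end hI (pt' hye (Or.inr rfl)) he' (ne hx hye (Or.inr rfl) (Or.inr rfl)).symm
      (ne hz hye (Or.inl rfl) (Or.inr rfl)).symm).2, zmod_two_add_self, zmod_two_add_self,
      add_zero] at s
    have : (l'.map fun y => chi (pos D (arc D x)) (pos D y) +
        chi (pos D (arc D x)) (pos D (arc D y))).sum +
        (l'.map fun y => chi (pos D z) (pos D y) + chi (pos D z) (pos D (arc D y))).sum = 0 := by
      rw [← List.sum_map_add, ← s]
      congr 2
      funext y
      ring
    exact CharTwo.add_eq_zero.1 this
  have total := t.sum (fun x => (l'.map fun y => chi (pos D x) (pos D y) +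
    chi (pos D x) (pos D (arc D y))).sum) linksum
  rw [endsum hs (Or.inl rfl) ha, endsum hxe (Or.inr rfl) he] at total
  have zero : (l.map fun x => (l'.map fun y => chi (pos D x) (pos D y) +
      chi (pos D x) (pos D (arc D y))).sum + (l'.map fun y => chi (pos D (arc D x)) (pos D y) +
      chi (pos D (arc D x)) (pos D (arc D y))).sum).sum = 0 := by
    apply List.sum_eq_zero
    intro s hs
    obtain ⟨x, hx, rfl⟩ := List.mem_map.1 hs
    rw [← List.sum_map_add]
    apply List.sum_eq_zero
    intro s hs
    obtain ⟨y, hy, rfl⟩ := List.mem_map.1 hs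
    rw [← cross_arc hD (t.isPoint_of_mem x hx) (t'.isPoint_of_mem y hy) (hl x hx y hy).1
      (hl x hx y hy).2]
    unfold DecoratedTL.cross
    ring
  rw [zero] at total
  unfold DecoratedTL.cross
  linear_combination -total

end Diagram

end DecoratedTL

namespace DecoratedTL

namespace Diagram

variable {k : ℕ}

/-! ### Cutting, reversing and separating trails -/

/-- In a deterministic reversible system without fixed points, a path which does not return to its
start neither repeats a state nor runs backwards through a state which it has passed before. -/
theorem chain_no_return {α : Type*} (R : α → α → Prop) (flip : α → α) (l : List α)
    (hR : ∀ i (h : i + 1 < l.length), R l[i] l[i + 1])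
    (hinj : ∀ a ∈ l, ∀ b ∈ l, ∀ c ∈ l, R a c → R b c → a = b)
    (hflip : ∀ a ∈ l, ∀ b ∈ l, ∀ c ∈ l, R a b → R c (flip a) → c = flip b)
    (hne : ∀ a, flip a ≠ a) (hno : ∀ a, ¬ R a (flip a))
    (hstart : ∀ i (h : i + 1 < l.length), l[i + 1] ≠ l[0]) :
    ∀ i j (hij : i < j) (hj : j < l.length), l[j] ≠ l[i] ∧ l[j] ≠ flip l[i] := by
  have h1 : ∀ i j (hij : i < j) (hj : j < l.length), l[j] ≠ l[i] := by
    intro i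
    induction i with
    | zero =>
      intro j hij hj
      obtain ⟨m, rfl⟩ : ∃ m, j = m + 1 := ⟨j - 1, by omega⟩
      exact hstart m hj
    | succ i ih =>
      intro j hij hj e
      obtain ⟨m, rfl⟩ : ∃ m, j = m + 1 := ⟨j - 1, by omega⟩
      refine ih m (by omega) (by omega) (hinj _ (List.getElem_mem _) _ (List.getElem_mem _) _
        (List.getElem_mem _) (hR m hj) ?_)
      rw [e]
      exact hR i (by omega)
  have h2 : ∀ m i j (hm : j = i + m + 1) (hj : j < l.length), l[j] ≠ flip l[i] := by
    intro m
    induction m using Nat.strong_induction_on with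
    | _ m ih =>
      intro i j hm hj e
      obtain ⟨t, rfl⟩ : ∃ t, j = t + 1 := ⟨j - 1, by omega⟩
      have r1 := hR i (by omega)
      have r2 := hR t hj
      rw [e] at r2
      have e2 := hflip _ (List.getElem_mem _) _ (List.getElem_mem _) _ (List.getElem_mem _) r1 r2
      rcases m with - | - | m
      · obtain rfl : t = i := by omega
        exact hno _ r2
      · obtain rfl : t = i + 1 := by omega
        exact hne _ e2.symm
      · exact ih m (by omega) (i + 1) t (by omega) (by omega) e2
  exact fun i j hij hj => ⟨h1 i j hij hj, h2 (j - i - 1) i j (by omega) hj⟩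

variable {D : Bool → Diagram k}

/-- A trail can be cut at each of its decorations. -/
theorem Trail.split {a e : EdgePoint k} {l} {u v : List Deco} {x : Deco}
    (t : Trail D a l (u ++ x :: v) e) :
    ∃ l₁ l₂ y b, l = l₁ ++ l₂ ∧ Trail D a l₁ u y ∧ Touch D y b x ∧ Trail D b l₂ v e := by
  generalize hw : u ++ x :: v = w at t
  induction t generalizing u with
  | last ha => simp at hw
  | @glue a b l w e ha h t ih =>
    obtain ⟨l₁, l₂, y, c, rfl, t1, t2, t3⟩ := ih hw
    exact ⟨a :: l₁, l₂, y, c, rfl, .glue ha h t1, t2, t3⟩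
  | @touch a b l w e z ha h t ih =>
    rcases u with - | ⟨z', u⟩
    · simp only [List.nil_append, List.cons.injEq] at hw
      obtain ⟨rfl, rfl⟩ := hw
      exact ⟨[a], l, _, b, rfl, .last ha, h, t⟩
    · simp only [List.cons_append, List.cons.injEq] at hw
      obtain ⟨rfl, hw⟩ := hw
      obtain ⟨l₁, l₂, y, c, rfl, t1, t2, t3⟩ := ih hw
      exact ⟨a :: l₁, l₂, y, c, rfl, .touch ha h t1, t2, t3⟩

theorem Trail.append_glue {a b y e : EdgePoint k} {l l' w w'} (t : Trail D a l w y)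
    (h : Glue y b) (t' : Trail D b l' w' e) : Trail D a (l ++ l') (w ++ w') e := by
  induction t with
  | last ha => exact .glue ha h t'
  | glue ha h' t ih => exact .glue ha h' (ih h)
  | touch ha h' t ih => exact .touch ha h' (ih h)

theorem Trail.append_touch {a b y e : EdgePoint k} {l l' w w' x} (t : Trail D a l w y)
    (h : Touch D y b x) (t' : Trail D b l' w' e) : Trail D a (l ++ l') (w ++ x :: w') e := by
  induction t with
  | last ha => exact .touch ha h t'
  | glue ha h' t ih => exact .glue ha h' (ih h)
  | touch ha h' t ih => exact .touch ha h' (ih h)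

/-- A trail can be run through backwards; its gaps are then represented by their other ends. -/
theorem Trail.reverse (hD : ∀ b, (D b).IsDiagram) {a e : EdgePoint k} {l w}
    (t : Trail D a l w e) : Trail D e (l.reverse.map (arc D)) w.reverse a := by
  induction t with
  | @last a ha =>
    have := Trail.last (D := D) (isPoint_arc hD a)
    rw [arc_arc hD ha] at this
    exact this
  | @glue a b l w e ha h t ih =>
    have := Trail.last (D := D) (isPoint_arc hD a)
    rw [arc_arc hD ha] at this
    simpa using ih.append_glue h.symm this
  | @touch a b l w e x ha h t ih =>
    have := Trail.last (D := D) (isPoint_arc hD a)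
    rw [arc_arc hD ha] at this
    simpa using ih.append_touch (h.symm hD) this

/-- The point is an outer node of the product. -/
def IsOuter (D : Bool → Diagram k) (y : EdgePoint k) : Prop := ∀ z, ¬ Link D y z

/-- As every point belongs to at most one link, a trail to an outer node is determined by its start.
-/
theorem Trail.unique {a e e' : EdgePoint k} {l l' w w'} (t : Trail D a l w e)
    (t' : Trail D a l' w' e') (he : IsOuter D e) (he' : IsOuter D e') :
    l = l' ∧ w = w' ∧ e = e' := by
  induction t generalizing l' w' with
  | last ha =>
    cases t' with
    | last => exact ⟨rfl, rfl, rfl⟩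
    | glue _ h _ => exact absurd (Or.inl h) (he _)
    | touch _ h _ => exact absurd (Or.inr ⟨_, h⟩) (he _)
  | glue ha h t ih =>
    cases t' with
    | last => exact absurd (Or.inl h) (he' _)
    | glue _ h' t' =>
      rw [← h.unique h'] at t'
      obtain ⟨rfl, rfl, rfl⟩ := ih t' he
      exact ⟨rfl, rfl, rfl⟩
    | touch _ h' _ => exact absurd h h'.not_glue
  | touch ha h t ih =>
    cases t' with
    | last => exact absurd (Or.inr ⟨_, h⟩) (he' _)
    | glue _ h' _ => exact absurd h' h.not_glue
    | touch _ h' t' =>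
      obtain ⟨rfl, rfl⟩ := h.unique h'
      obtain ⟨rfl, rfl, rfl⟩ := ih t' he
      exact ⟨rfl, rfl, rfl⟩

theorem Trail.suffix {a e : EdgePoint k} {l w} (t : Trail D a l w e) {x} (hx : x ∈ l) :
    ∃ l' w', Trail D x l' w' e := by
  induction t with
  | last ha =>
    obtain rfl := List.mem_singleton.1 hx
    exact ⟨_, _, .last ha⟩
  | glue ha h t ih =>
    rcases List.mem_cons.1 hx with rfl | hx
    · exact ⟨_, _, .glue ha h t⟩
    · exact ih hx
  | touch ha h t ih =>
    rcases List.mem_cons.1 hx with rfl | hx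
    · exact ⟨_, _, .touch ha h t⟩
    · exact ih hx

theorem Trail.suffix_reverse (hD : ∀ b, (D b).IsDiagram) {a e : EdgePoint k} {l w}
    (t : Trail D a l w e) {x} (hx : x ∈ l) : ∃ l' w', Trail D (arc D x) l' w' a :=
  (t.reverse hD).suffix (List.mem_map.2 ⟨x, List.mem_reverse.2 hx, rfl⟩)

/-- Trails between different outer nodes are disjoint. -/
theorem Trail.disjoint (hD : ∀ b, (D b).IsDiagram) {a e a' e' : EdgePoint k} {l l' w w'}
    (t : Trail D a l w e) (t' : Trail D a' l' w' e') (ha : IsOuter D a) (he : IsOuter D e)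
    (he' : IsOuter D e') (h1 : e' ≠ e) (h2 : e' ≠ a) : ArcDisjoint D l l' := by
  intro x hx y hy
  obtain ⟨m, u, s⟩ := t.suffix hx
  obtain ⟨m', u', s'⟩ := t'.suffix hy
  obtain ⟨m'', u'', s''⟩ := t.suffix_reverse hD hx
  constructor
  · rintro rfl
    exact h1 (s'.unique s he' he).2.2
  · rintro rfl
    exact h2 (s'.unique s'' he' ha).2.2

theorem Trail.chain {a e : EdgePoint k} {l w} (t : Trail D a l w e) :
    ∀ i (h : i + 1 < l.length), Link D (arc D l[i]) l[i + 1] := by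
  have hd : ∀ {a l w e}, Trail D a l w e → ∀ h : 0 < l.length, l[0] = a := by
    intro a l w e t h
    cases t <;> rfl
  induction t with
  | last ha => intro i h; simp at h
  | glue ha h t ih =>
    intro i hi
    rcases i with - | i
    · simp only [List.length_cons] at hi
      simp only [List.getElem_cons_zero, List.getElem_cons_succ]
      rw [hd t (by omega)]
      exact Or.inl h
    · exact ih i (by simpa using hi)
  | touch ha h t ih =>
    intro i hi
    rcases i with - | i
    · simp only [List.length_cons] at hi
      simp only [List.getElem_cons_zero, List.getElem_cons_succ]
      rw [hd t (by omega)]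
      exact Or.inr ⟨_, h⟩
    · exact ih i (by simpa using hi)

theorem Trail.getElem_zero {a e : EdgePoint k} {l w} (t : Trail D a l w e) (h : 0 < l.length) :
    l[0] = a := by
  cases t <;> rfl

theorem Touch.snd_node {y z : EdgePoint k} {x : Deco} (h : Touch D y z x) :
    z.2.1 = (D y.1).mate y.2.1 := by
  cases h
  rfl

theorem Link.irrefl (hD : ∀ b, (D b).IsDiagram) (y : EdgePoint k) : ¬ Link D y y := by
  rintro (h | ⟨x, h⟩)
  · cases h
  · exact (hD y.1).mate_ne y.2.1 h.snd_node.symm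

/-- A trail which does not return to its start runs through each gap at most once. -/
theorem Trail.pairwise (hD : ∀ b, (D b).IsDiagram) {a e : EdgePoint k} {l w}
    (t : Trail D a l w e) (ha : ∀ x ∈ l.tail, x ≠ a) :
    l.Pairwise fun x y => y ≠ x ∧ y ≠ arc D x := by
  rw [List.pairwise_iff_getElem]
  intro i j hi hj hij
  refine chain_no_return (fun x y => Link D (arc D x) y) (arc D) l t.chain ?_ ?_ (arc_ne hD) ?_ ?_
    i j hij hj
  · intro x hx y hy z hz h h'
    rw [← arc_arc hD (t.isPoint_of_mem x hx), ← arc_arc hD (t.isPoint_of_mem y hy),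
      (h.symm hD).unique (h'.symm hD)]
  · intro x hx y hy z hz h h'
    rw [h.unique (h'.symm hD), arc_arc hD (t.isPoint_of_mem z hz)]
  · exact fun x => Link.irrefl hD _
  · intro i h
    rw [t.getElem_zero (by omega)]
    refine ha _ ?_
    rw [← List.getElem_tail (by simp; omega)]
    exact List.getElem_mem _

theorem Trail.pairwise_of_outer (hD : ∀ b, (D b).IsDiagram) {a e : EdgePoint k} {l w}
    (t : Trail D a l w e) (ha : IsOuter D a) : l.Pairwise fun x y => y ≠ x ∧ y ≠ arc D x := by
  refine t.pairwise hD ?_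
  rintro x hx rfl
  obtain ⟨i, hi, rfl⟩ := List.getElem_of_mem hx
  rw [List.getElem_tail] at ha
  rw [List.length_tail] at hi
  exact ha _ ((t.chain i (by omega)).symm hD)

theorem arcDisjoint_of_pairwise {l₁ l₂ : List (EdgePoint k)}
    (h : (l₁ ++ l₂).Pairwise fun x y => y ≠ x ∧ y ≠ arc D x) : ArcDisjoint D l₁ l₂ :=
  fun x hx y hy => (List.pairwise_append.1 h).2.2 x hx y hy

/-- A trail from an outer node to itself does not exist. -/
theorem Trail.end_ne (hD : ∀ b, (D b).IsDiagram) {a e : EdgePoint k} {l w}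
    (t : Trail D a l w e) (ha : IsOuter D a) : e ≠ a := by
  intro he
  have hp := t.pairwise_of_outer hD ha
  have key : ∀ {b l w}, Trail D b l w e → (a :: l).Pairwise (fun x y => y ≠ x ∧ y ≠ arc D x) →
      False := by
    intro b l w t hp
    obtain ⟨x, hx, h⟩ := t.end_mem
    refine ((List.pairwise_cons.1 hp).1 x hx).2 ?_
    rw [← he, h, arc_arc hD (t.isPoint_of_mem x hx)]
  cases t with
  | last ha' => exact arc_ne hD _ he
  | glue _ _ t => exact key t hp
  | touch _ _ t => exact key t hp

end Diagram

end DecoratedTL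

namespace DecoratedTL

namespace Diagram

variable {k : ℕ}

/-! ### The edges and loops of a product as trails -/

/-- The two boxes of a product. -/
def box (top bot : Diagram k) : Bool → Diagram k
  | true => top
  | false => bot

/-- The box entered in a state, and the node through which it is entered. -/
def entry : Bool × Fin k → Bool × Node k
  | (true, j) => (false, .inl j)
  | (false, j) => (true, .inr j)

/-- The point of the interface at which a box is entered. -/
def entryPoint (s : Bool × Fin k) : EdgePoint k := ((entry s).1, (entry s).2, 0)

/-- The gaps of the edge at `p` in the order in which they are met from `p`. -/
def gaps (D : Bool → Diagram k) (c : Bool × Node k) : List (EdgePoint k) :=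
  (List.range (((D c.1).word c.2).length + 1)).map fun g => (c.1, c.2, g)

/-- An outer node as a point of the product. -/
def outerPoint : Node k → EdgePoint k
  | .inl i => (true, .inl i, 0)
  | .inr i => (false, .inr i, 0)

theorem outerPoint_injective : Function.Injective (outerPoint : Node k → EdgePoint k) := by
  rintro (i | i) (j | j) h <;> simp_all [outerPoint]

theorem isEnd_outerPoint (p : Node k) : IsEnd (outerPoint p) := by
  intro z h
  rcases p with i | i <;> cases h

theorem isOuter_outerPoint (D : Bool → Diagram k) (p : Node k) : IsOuter D (outerPoint p) := by
  rintro z (h | ⟨x, h⟩)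
  · exact isEnd_outerPoint p z h
  · rcases p with i | i <;> cases h

variable {D : Bool → Diagram k}

theorem trail_gaps_from (hD : ∀ b, (D b).IsDiagram) (c : Bool) (p : Node k) (m g : ℕ)
    (h : g + m = ((D c).word p).length) :
    Trail D (c, p, g) ((List.range' g (m + 1)).map fun g => (c, p, g)) (((D c).word p).drop g)
      (c, (D c).mate p, 0) := by
  induction m generalizing g with
  | zero =>
    have := Trail.last (D := D) (a := (c, p, g)) (by simp only [IsPoint]; omega)
    have e : arc D (c, p, g) = (c, (D c).mate p, 0) := by
      simp only [arc, Prod.mk.injEq, true_and]; omega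
    rw [e] at this
    rw [List.drop_eq_nil_of_le (by omega)]
    simpa using this
  | succ m ih =>
    have hg : g < ((D c).word p).length := by omega
    rw [List.range'_succ, List.map_cons, List.drop_eq_getElem_cons hg]
    refine .touch (by simp only [IsPoint]; omega) ?_ (ih (g + 1) (by omega))
    exact (Touch.mk c p g _ (List.getElem?_eq_getElem hg)).symm hD

/-- An edge of one of the two boxes, as a trail. -/
theorem trail_gaps (hD : ∀ b, (D b).IsDiagram) (c : Bool × Node k) :
    Trail D (c.1, c.2, 0) (gaps D c) ((D c.1).word c.2) (c.1, (D c.1).mate c.2, 0) := by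
  have := trail_gaps_from hD c.1 c.2 _ 0 (Nat.zero_add _)
  rwa [List.drop_zero, ← List.range_eq_range'] at this

variable {top bot : Diagram k}

theorem box_isDiagram (h : top.IsDiagram) (h' : bot.IsDiagram) (b : Bool) :
    (box top bot b).IsDiagram := by
  cases b
  · exact h'
  · exact h

theorem box_isLR (h : top.IsLR) (h' : bot.IsLR) (b : Bool) : (box top bot b).IsLR := by
  cases b
  · exact h'
  · exact h

theorem piece_eq (s : Bool × Fin k) :
    piece top bot s = (box top bot (entry s).1).word (entry s).2 := by
  rcases s with ⟨b | b, j⟩ <;> rfl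

theorem next_eq_some {s t : Bool × Fin k} : next top bot s = some t ↔
    (entry s).1 = t.1 ∧ (box top bot (entry s).1).mate (entry s).2 =
      (if t.1 then .inr t.2 else .inl t.2) := by
  rcases s with ⟨b | b, j⟩ <;> rcases t with ⟨c | c, m⟩ <;>
    simp only [next, entry, box] <;> split <;> rename_i h <;> simp [h, eq_comm]

theorem next_eq_none {s : Bool × Fin k} (h : next top bot s = none) :
    outerPoint (exit top bot s) =
      ((entry s).1, (box top bot (entry s).1).mate (entry s).2, 0) := by
  rcases s with ⟨b | b, j⟩ <;> simp only [next] at h <;> split at h <;> rename_i h' <;>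
    simp_all [outerPoint, exit, entry, box]

theorem glue_of_next {s t : Bool × Fin k} (h : next top bot s = some t) :
    Glue ((entry s).1, (box top bot (entry s).1).mate (entry s).2, 0) (entryPoint t) := by
  obtain ⟨h1, h2⟩ := next_eq_some.1 h
  rw [h2, h1]
  rcases t with ⟨c | c, m⟩
  · exact .up m
  · exact .down m

theorem next_injective (ht : top.IsDiagram) (hb : bot.IsDiagram) {s s' t : Bool × Fin k}
    (h : next top bot s = some t) (h' : next top bot s' = some t) : s = s' := by
  rw [next_eq_some] at h h'
  obtain ⟨h1, h2⟩ := h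
  obtain ⟨h3, h4⟩ := h'
  rw [h1] at h2
  rw [h3] at h4
  have := (box_isDiagram ht hb _).mate_injective (h2.trans h4.symm)
  rcases s with ⟨b | b, j⟩ <;> rcases s' with ⟨b' | b', j'⟩ <;> simp_all [entry]

/-- Edges can be traced backwards: if `t` follows `s`, then only the reverse of `t` can be followed
by the reverse of `s`. -/
theorem next_flip (ht : top.IsDiagram) (hb : bot.IsDiagram) {s t u : Bool × Fin k}
    (h : next top bot s = some t) (h' : next top bot u = some (!s.1, s.2)) : u = (!t.1, t.2) := by
  rw [next_eq_some] at h h'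
  rcases s with ⟨b | b, j⟩ <;> rcases t with ⟨b' | b', j'⟩ <;> rcases u with ⟨b'' | b'', j''⟩ <;>
    simp [entry, box] at h h' ⊢
  · simpa using ht.mate_injective (h'.trans (ht.mate_eq_iff.1 h).symm)
  · simpa using hb.mate_injective (h'.trans (hb.mate_eq_iff.1 h).symm)

/-- The crossings of the interface by an edge of the product, from a given state until its end. -/
inductive Path (top bot : Diagram k) : Bool × Fin k → List (Bool × Fin k) → Node k → Prop
  | last {s} (h : next top bot s = none) : Path top bot s [s] (exit top bot s)
  | cons {s t l e} (h : next top bot s = some t) (h' : Path top bot t l e) :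
      Path top bot s (s :: l) e

/-- The crossings of the interface by a closed curve, from a given state to the return to `start`.
-/
inductive Cycle (top bot : Diagram k) (start : Bool × Fin k) :
    Bool × Fin k → List (Bool × Fin k) → Prop
  | last {s} (h : next top bot s = some start) : Cycle top bot start s [s]
  | cons {s t l} (h : next top bot s = some t) (ht : t ≠ start) (h' : Cycle top bot start t l) :
      Cycle top bot start s (s :: l)

theorem cycle_of_cycleFrom {start s : Bool × Fin k} {f : ℕ} {l}
    (h : cycleFrom top bot start f s = some l) : Cycle top bot start s l := by
  induction f generalizing s l with
  | zero => simp [cycleFrom] at h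
  | succ f ih =>
    rw [cycleFrom] at h
    split at h
    · simp at h
    · rename_i t ht
      split_ifs at h with hts
      · simp only [Option.some.injEq] at h
        subst h
        exact .last (hts ▸ ht)
      · obtain ⟨l', hl', rfl⟩ := Option.map_eq_some_iff.1 h
        exact .cons ht hts (ih hl')

/-- Either the outer boundary is reached after at most `f` further crossings, or there are `f + 1`
consecutive crossings. -/
theorem path_or_chain (f : ℕ) (s : Bool × Fin k) :
    (∃ l, Path top bot s l (trace top bot f s).2 ∧
      (trace top bot f s).1 = l.flatMap (piece top bot)) ∨
    ∃ l : List (Bool × Fin k), l.length = f + 1 ∧ l[0]? = some s ∧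
      ∀ i (h : i + 1 < l.length), next top bot l[i] = some l[i + 1] := by
  induction f generalizing s with
  | zero => exact Or.inr ⟨[s], rfl, rfl, fun i h => by simp at h⟩
  | succ f ih =>
    rcases hn : next top bot s with - | t
    · left
      refine ⟨[s], ?_, ?_⟩
      · simp only [trace, hn]
        exact .last hn
      · simp [trace, hn]
    · rcases ih t with ⟨l, hl, h⟩ | ⟨l, h1, h2, h3⟩
      · left
        refine ⟨s :: l, ?_, ?_⟩
        · simp only [trace, hn]
          exact .cons hn hl
        · simp [trace, hn, h]
      · right
        refine ⟨s :: l, by simp [h1], rfl, ?_⟩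
        intro i hi
        rcases i with - | i
        · simp only [List.getElem_cons_zero, List.getElem_cons_succ]
          rw [hn, ← h2, List.getElem?_eq_getElem]
        · simp only [List.getElem_cons_succ]
          exact h3 i (by simpa using hi)

/-- A state which is not reached from another state: the interface is entered from outside. -/
def IsInitial (top bot : Diagram k) (s : Bool × Fin k) : Prop := ∀ t, next top bot t ≠ some s

/-- The number of crossings allowed in `traceNode` is sufficient. -/
theorem path_of_initial (ht : top.IsDiagram) (hb : bot.IsDiagram) {s : Bool × Fin k}
    (hs : IsInitial top bot s) : ∃ l, Path top bot s l (trace top bot k s).2 ∧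
      (trace top bot k s).1 = l.flatMap (piece top bot) := by
  rcases path_or_chain (top := top) (bot := bot) k s with h | ⟨l, h1, h2, h3⟩
  · exact h
  · exfalso
    have key := chain_no_return (fun s t => next top bot s = some t) (fun s => (!s.1, s.2)) l h3
      (fun a _ b _ c _ h h' => next_injective ht hb h h')
      (fun a _ b _ c _ h h' => next_flip ht hb h h')
      (fun a h => by simpa using congrArg Prod.fst h)
      (fun a h => by
        rw [next_eq_some] at h
        rcases a with ⟨b | b, j⟩ <;> simp [entry, box] at h
        · exact ht.mate_ne _ h
        · exact hb.mate_ne _ h)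
      (fun i h e => by
        have h2' : l[0] = s := by
          rw [List.getElem?_eq_getElem (by omega)] at h2
          exact Option.some.inj h2
        exact hs _ ((h3 i h).trans (by rw [e, h2'])))
    -- The crossings have different positions on the interface.
    have inj : Function.Injective fun i : Fin (k + 1) => (l[i.val]'(by omega)).2 := by
      have lt : ∀ i j (hij : i < j) (hj : j < l.length), l[j].2 ≠ l[i].2 := by
        intro i j hij hj e
        obtain ⟨e1, e2⟩ := key i j hij hj
        by_cases hh : l[j].1 = l[i].1
        · exact e1 (Prod.ext hh e)
        · exact e2 (Prod.ext (by simpa [Bool.eq_not] using hh) e)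
      intro i j h
      rcases lt_trichotomy i j with hij | hij | hij
      · exact absurd h.symm (lt i j hij (by omega))
      · exact hij
      · exact absurd h (lt j i hij (by omega))
    have := Fintype.card_le_of_injective _ inj
    simp at this

/-- The part of an edge of the product behind a crossing of the interface, as a trail. -/
theorem Path.trail (ht : top.IsDiagram) (hb : bot.IsDiagram) {s l e} (h : Path top bot s l e) :
    Trail (box top bot) (entryPoint s) (l.flatMap fun t => gaps (box top bot) (entry t))
      (l.flatMap (piece top bot)) (outerPoint e) := by
  have hD := box_isDiagram ht hb
  induction h with
  | @last s h =>
    have := trail_gaps hD (entry s)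
    rw [← next_eq_none h, ← piece_eq] at this
    simpa [entryPoint] using this
  | @cons s t l e h h' ih =>
    have := (trail_gaps hD (entry s)).append_glue (glue_of_next h) ih
    rw [← piece_eq] at this
    simpa [entryPoint] using this

/-- A closed curve through the interface, cut open at a crossing, as a trail. -/
theorem Cycle.trail (ht : top.IsDiagram) (hb : bot.IsDiagram) {start s l}
    (h : Cycle top bot start s l) :
    ∃ e, Glue e (entryPoint start) ∧
    Trail (box top bot) (entryPoint s) (l.flatMap fun t => gaps (box top bot) (entry t))
      (l.flatMap (piece top bot)) e := by
  have hD := box_isDiagram ht hb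
  induction h with
  | @last s h =>
    have := trail_gaps hD (entry s)
    rw [← piece_eq] at this
    exact ⟨_, glue_of_next h, by simpa [entryPoint] using this⟩
  | @cons s t l h _ h' ih =>
    obtain ⟨e, he, ih⟩ := ih
    have := (trail_gaps hD (entry s)).append_glue (glue_of_next h) ih
    rw [← piece_eq] at this
    exact ⟨e, he, by simpa [entryPoint] using this⟩

theorem gaps_eq_cons (c : Bool × Node k) :
    ∃ g, gaps D c = (c.1, c.2, 0) :: g ∧ ∀ x ∈ g, x.2.2 ≠ 0 := by
  refine ⟨(List.range ((D c.1).word c.2).length).map fun g => (c.1, c.2, g + 1), ?_, ?_⟩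
  · simp [gaps, List.range_succ_eq_map, Function.comp_def]
  · simp

theorem entryPoint_injective : Function.Injective (entryPoint : Bool × Fin k → EdgePoint k) := by
  rintro ⟨b | b, j⟩ ⟨c | c, m⟩ h <;> simp_all [entryPoint, entry]

theorem mem_gaps_zero {c : Bool × Node k} {x : EdgePoint k} (hx : x ∈ gaps D c)
    (h0 : x.2.2 = 0) : x = (c.1, c.2, 0) := by
  obtain ⟨g, hg, hg'⟩ := gaps_eq_cons (D := D) c
  rw [hg, List.mem_cons] at hx
  rcases hx with h | h
  · exact h
  · exact absurd h0 (hg' x h)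

/-- A closed curve does not run through its first gap again before it closes up. -/
theorem Cycle.start_notMem_tail {start l} (h : Cycle top bot start start l) :
    ∀ x ∈ (l.flatMap fun t => gaps (box top bot) (entry t)).tail, x ≠ entryPoint start := by
  have key : ∀ {s l}, Cycle top bot start s l → ∃ l', l = s :: l' ∧ ∀ t ∈ l', t ≠ start := by
    intro s l h
    induction h with
    | last h => exact ⟨[], rfl, by simp⟩
    | cons h hts h' ih =>
      obtain ⟨l', rfl, hl⟩ := ih
      exact ⟨_, rfl, List.forall_mem_cons.2 ⟨hts, hl⟩⟩
  obtain ⟨l', rfl, hl⟩ := key h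
  obtain ⟨g, hg, hg'⟩ := gaps_eq_cons (D := box top bot) (entry start)
  rw [List.flatMap_cons, hg, List.cons_append, List.tail_cons]
  rintro x hx rfl
  rcases List.mem_append.1 hx with hx | hx
  · exact hg' _ hx rfl
  · obtain ⟨t, htl, hx⟩ := List.mem_flatMap.1 hx
    exact hl t htl (entryPoint_injective (mem_gaps_zero hx rfl)).symm

/-- A closed trail has no gap in common with a trail between outer nodes. -/
theorem Trail.disjoint_closed (hD : ∀ b, (D b).IsDiagram) {a e a' e' : EdgePoint k} {l l' w w'}
    (t : Trail D a l w e) (hc : Link D e a) (t' : Trail D a' l' w' e') (ha' : IsOuter D a')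
    (he' : IsOuter D e') : ArcDisjoint D l l' := by
  have succ : ∀ {b m u}, Trail D b m u e → ∀ c ∈ m, ∃ z, (z = a ∨ z ∈ m) ∧ Link D (arc D c) z := by
    intro b m u t
    generalize he : e = e₁ at t
    induction t with
    | last ha =>
      intro c hc'
      obtain rfl := List.mem_singleton.1 hc'
      exact ⟨a, Or.inl rfl, he ▸ hc⟩
    | glue ha h t ih =>
      intro c hc'
      rcases List.mem_cons.1 hc' with rfl | hc'
      · exact ⟨_, Or.inr (List.mem_cons_of_mem _ t.start_mem), Or.inl h⟩
      · obtain ⟨z, hz, hl⟩ := ih he c hc'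
        exact ⟨z, hz.imp_right (List.mem_cons_of_mem _), hl⟩
    | touch ha h t ih =>
      intro c hc'
      rcases List.mem_cons.1 hc' with rfl | hc'
      · exact ⟨_, Or.inr (List.mem_cons_of_mem _ t.start_mem), Or.inr ⟨_, h⟩⟩
      · obtain ⟨z, hz, hl⟩ := ih he c hc'
        exact ⟨z, hz.imp_right (List.mem_cons_of_mem _), hl⟩
  have succ' : ∀ c ∈ l, ∃ z ∈ l, Link D (arc D c) z := by
    intro c hc
    obtain ⟨z, rfl | hz, h⟩ := succ t c hc
    · exact ⟨z, t.start_mem, h⟩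
    · exact ⟨z, hz, h⟩
  have never : ∀ {b m u f}, Trail D b m u f → b ∈ l → ¬ IsOuter D f := by
    intro b m u f t
    induction t with
    | last ha =>
      intro hb hf
      obtain ⟨z, -, h⟩ := succ' _ hb
      exact hf z h
    | glue ha h t ih =>
      intro hb
      obtain ⟨z, hz, h'⟩ := succ' _ hb
      rw [← Link.unique (Or.inl h) h'] at hz
      exact ih hz
    | touch ha h t ih =>
      intro hb
      obtain ⟨z, hz, h'⟩ := succ' _ hb
      rw [← Link.unique (Or.inr ⟨_, h⟩) h'] at hz
      exact ih hz
  intro x hx y hy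
  constructor
  · rintro rfl
    obtain ⟨m, u, s⟩ := t'.suffix hy
    exact never s hx he'
  · rintro rfl
    obtain ⟨m, u, s⟩ := t'.suffix_reverse hD hy
    rw [arc_arc hD (t.isPoint_of_mem x hx)] at s
    exact never s hx ha'

/-- An edge of the product, as a trail between outer nodes. -/
theorem traceNode_trail (ht : top.IsDiagram) (hb : bot.IsDiagram) (p : Node k) :
    ∃ l, Trail (box top bot) (outerPoint p) l (traceNode top bot p).1
      (outerPoint (traceNode top bot p).2) := by
  have hD := box_isDiagram ht hb
  rcases p with i | i
  · have t := trail_gaps hD (true, .inl i)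
    simp only [traceNode]
    split
    · rename_i j h
      simp only [box, h] at t
      exact ⟨_, t⟩
    · rename_i j h
      obtain ⟨l, hl, hw⟩ := path_of_initial (s := (true, j)) ht hb (by
        rintro ⟨b | b, m⟩ h' <;> rw [next_eq_some] at h' <;> simp [entry, box] at h'
        have h2 := ht.mate_eq_iff.1 h
        rw [ht.mate_eq_iff.1 h'] at h2
        simp at h2)
      simp only [box, h] at t
      have := t.append_glue (.down j) (hl.trail ht hb)
      rw [← hw] at this
      exact ⟨_, this⟩
  · have t := trail_gaps hD (false, .inr i)
    simp only [traceNode]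
    split
    · rename_i j h
      simp only [box, h] at t
      exact ⟨_, t⟩
    · rename_i j h
      obtain ⟨l, hl, hw⟩ := path_of_initial (s := (false, j)) ht hb (by
        rintro ⟨b | b, m⟩ h' <;> rw [next_eq_some] at h' <;> simp [entry, box] at h'
        have h2 := hb.mate_eq_iff.1 h
        rw [hb.mate_eq_iff.1 h'] at h2
        simp at h2)
      simp only [box, h] at t
      have := t.append_glue (.up j) (hl.trail ht hb)
      rw [← hw] at this
      exact ⟨_, this⟩

end Diagram

end DecoratedTL

namespace DecoratedTL

namespace Diagram

variable {k : ℕ}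

/-! ### Products of LR-decorated diagrams are LR-decorated: the geometry -/

variable {D : Bool → Diagram k}

theorem pos_outerPoint (D : Bool → Diagram k) (p : Node k) :
    leftPos p < 2 * k ∧
    (leftPos p < k ∧ (pos D (outerPoint p)).c = leftPos p ∨
      k ≤ leftPos p ∧ (pos D (outerPoint p)).c = leftPos p + 6 * k) := by
  refine ⟨leftPos_lt p, ?_⟩
  rcases p with i | i
  · have h : pos D (outerPoint (.inl i)) = nodePos true (.inl i) := rfl
    rw [h, nodePos_inl_c, leftPos_inl]
    simp only [boxBase, if_true]
    omega
  · have h : pos D (outerPoint (.inr i)) = nodePos false (.inr i) := rfl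
    rw [h, nodePos_inr_c, leftPos_inr]
    simp only [boxBase, Bool.false_eq_true, if_false]
    omega

/-- The wall reached at a decoration: the left wall for closed decorations, the right wall for open
ones. -/
def OnWall (k : ℕ) (o : Bool) (X : Pos) : Prop :=
  (o = false ∧ (X.c < 0 ∨ 8 * k ≤ X.c)) ∨ (o = true ∧ k ≤ X.c ∧ X.c < 7 * k)

theorem Touch.onWall {y z : EdgePoint k} {x : Deco} (h : Touch D y z x) :
    OnWall k x.isOpen (Diagram.pos D y) ∧ IsEnd y := by
  obtain ⟨c, q, g, x, h⟩ := h
  have lp := leftPos_lt q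
  have lp' := leftPos_lt ((D c).mate q)
  have rp := rightPos_eq q
  have rp' := rightPos_eq ((D c).mate q)
  refine ⟨?_, fun z h => by cases h⟩
  simp only [Diagram.pos, OnWall]
  have hw := wallOpen_eq (d := D c) h
  rcases pointPos_wall (D c) c q g with ⟨h1, h2⟩ | ⟨h1, h2⟩
  · left
    rw [h2, ← hw, h1]
    refine ⟨rfl, ?_⟩
    simp only [leftWallPos]
    rcases c <;> simp only [Bool.false_eq_true, if_true, if_false] <;> omega
  · right
    rw [h2, ← hw, h1]
    refine ⟨rfl, ?_⟩
    simp only [rightWallPos, boxBase]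
    rcases c <;> simp only [Bool.false_eq_true, if_true, if_false] <;> omega

theorem Touch.onWall_right (hD : ∀ b, (D b).IsDiagram) {y z : EdgePoint k} {x : Deco}
    (h : Touch D y z x) : OnWall k x.isOpen (Diagram.pos D z) ∧ IsEnd z :=
  (h.symm hD).onWall

theorem ArcDisjoint.mono {l l' m m' : List (EdgePoint k)} (h : ArcDisjoint D l l') (hm : m ⊆ l)
    (hm' : m' ⊆ l') : ArcDisjoint D m m' :=
  fun x hx y hy => h x (hm hx) y (hm' hy)

/-- The part of a trail between two decorations, and the gaps of the parts before and after. -/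
theorem Trail.split₂ {a e : EdgePoint k} {l u m v x y}
    (t : Trail D a l (u ++ x :: (m ++ y :: v)) e) :
    ∃ l₁ l₂ l₃ p q r s, l = l₁ ++ (l₂ ++ l₃) ∧ Trail D a l₁ u p ∧ Touch D p q x ∧
      Trail D q l₂ m r ∧ Touch D r s y ∧ Trail D s l₃ v e := by
  obtain ⟨l₁, l', p, q, rfl, t1, h1, t'⟩ := t.split
  obtain ⟨l₂, l₃, r, s, rfl, t2, h2, t3⟩ := t'.split
  exact ⟨l₁, l₂, l₃, p, q, r, s, rfl, t1, h1, t2, h2, t3⟩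

theorem exists_split_of_not_pairwise {α : Type*} {R : α → α → Prop} {l : List α}
    (h : ¬ l.Pairwise R) : ∃ u x m y v, l = u ++ x :: (m ++ y :: v) ∧ ¬ R x y := by
  induction l with
  | nil => exact absurd .nil h
  | cons a l ih =>
    rw [List.pairwise_cons, not_and_or] at h
    rcases h with h | h
    · push Not at h
      obtain ⟨y, hy, h⟩ := h
      obtain ⟨m, v, rfl⟩ := List.append_of_mem hy
      exact ⟨[], a, m, y, v, rfl, h⟩
    · obtain ⟨u, x, m, y, v, rfl, h'⟩ := ih h
      exact ⟨a :: u, x, m, y, v, rfl, h'⟩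

/-- Four points of a loop on alternating walls, in the order in which the loop runs through them,
do not exist. -/
theorem loop_not_interlaced (hD : ∀ b, (D b).IsLR) {a e : EdgePoint k} {l u₀ u₁ u₂ u₃ u₄}
    {x₁ x₂ x₃ x₄ : Deco}
    (t : Trail D a l (u₀ ++ x₁ :: (u₁ ++ x₂ :: (u₂ ++ x₃ :: (u₃ ++ x₄ :: u₄)))) e)
    (hc : Glue e a) (hp : l.Pairwise fun x y => y ≠ x ∧ y ≠ arc D x)
    (h₁₂ : x₁.isOpen ≠ x₂.isOpen) (h₁₃ : x₁.isOpen = x₃.isOpen) (h₂₄ : x₂.isOpen = x₄.isOpen) :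
    False := by
  have hI : ∀ b, (D b).IsDiagram := fun b => (hD b).isDiagram
  obtain ⟨l₀, l', y₁, z₁, rfl, t₀, T₁, t⟩ := t.split
  obtain ⟨l₁, l', y₂, z₂, rfl, t₁, T₂, t⟩ := t.split
  obtain ⟨l₂, l', y₃, z₃, rfl, t₂, T₃, t⟩ := t.split
  obtain ⟨l₃, l₄, y₄, z₄, rfl, t₃, T₄, t₄⟩ := t.split
  have t₅ := t₄.append_glue hc t₀
  have d₁₃ : ArcDisjoint D l₁ l₃ := by
    refine (arcDisjoint_of_pairwise (List.pairwise_append.1 hp).2.1).mono (by simp) ?_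
    intro x hx; simp [hx]
  have d₀₂ : ArcDisjoint D l₀ l₂ := by
    refine (arcDisjoint_of_pairwise hp).mono (by simp) ?_
    intro x hx; simp [hx]
  have d₂₄ : ArcDisjoint D l₂ l₄ := by
    refine (arcDisjoint_of_pairwise (List.pairwise_append.1 (List.pairwise_append.1 hp).2.1).2.1).mono
      (by simp) ?_
    intro x hx; simp [hx]
  have d₂₅ : ArcDisjoint D l₂ (l₄ ++ l₀) := by
    intro x hx y hy
    rcases List.mem_append.1 hy with hy | hy
    · exact d₂₄ x hx y hy
    · obtain ⟨h1, h2⟩ := d₀₂ y hy x hx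
      exact ⟨h1.symm, fun e => h2 (by rw [e, arc_arc hI (t₂.isPoint_of_mem x hx)])⟩
  -- The loop consists of four disjoint parts between the touches. Opposite parts have crossing number
  -- zero, but the sum of the two crossing numbers turns out to be one.
  have c₁ := t₁.cross hD t₃ d₁₃ (T₁.onWall_right hI).2 T₂.onWall.2 (T₃.onWall_right hI).2 T₄.onWall.2
  have c₂ := t₂.cross hD t₅ d₂₅ (T₂.onWall_right hI).2 T₃.onWall.2 (T₄.onWall_right hI).2 T₁.onWall.2
  -- Points with decorations of different type are different.
  have ne : ∀ {y z y' z' x x'}, Touch D y z x → Touch D y' z' x' → x.isOpen ≠ x'.isOpen →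
      y ≠ y' ∧ y ≠ z' ∧ z ≠ y' ∧ z ≠ z' := by
    intro y z y' z' x x' T T' h
    refine ⟨?_, ?_, ?_, ?_⟩ <;> rintro rfl <;> apply h
    · rw [(T.unique T').2]
    · rw [(T.unique (T'.symm hI)).2]
    · rw [((T.symm hI).unique T').2]
    · rw [((T.symm hI).unique (T'.symm hI)).2]
  have h₁₄ : x₁.isOpen ≠ x₄.isOpen := by rwa [← h₂₄]
  have h₂₃ : x₂.isOpen ≠ x₃.isOpen := by rw [← h₁₃]; exact h₁₂.symm
  have h₃₄ : x₃.isOpen ≠ x₄.isOpen := by rwa [← h₁₃]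
  obtain ⟨ne1, ne2, ne3, ne4⟩ := ne T₁ T₂ h₁₂
  obtain ⟨nf1, nf2, nf3, nf4⟩ := ne T₃ T₄ h₃₄
  -- The second and the fourth, and the first and the third point are different.
  have n₂₄ : y₂ ≠ y₄ ∧ y₂ ≠ z₄ ∧ z₂ ≠ y₄ ∧ z₂ ≠ z₄ := by
    have a1 : z₂ ≠ z₄ := fun e => (d₂₄ _ t₂.start_mem _ t₄.start_mem).1 e.symm
    have a2 : z₂ ≠ y₄ := by
      obtain ⟨g, hg, hg'⟩ := t₃.end_mem
      have d : ArcDisjoint D l₂ l₃ := by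
        refine (arcDisjoint_of_pairwise
          (List.pairwise_append.1 (List.pairwise_append.1 hp).2.1).2.1).mono (by simp) ?_
        intro x hx; simp [hx]
      rw [hg']
      intro e
      exact (d _ t₂.start_mem _ hg).2 (by rw [e, arc_arc hI (t₃.isPoint_of_mem g hg)])
    refine ⟨?_, ?_, a2, a1⟩
    · rintro rfl
      exact a1 (T₂.unique T₄).1
    · rintro rfl
      exact a2 (T₂.unique (T₄.symm hI)).1
  have n₁₃ : z₁ ≠ z₃ := fun e => (d₁₃ _ t₁.start_mem _ t₃.start_mem).1 e.symm
  have i1 := T₁.isPoint hI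
  have i2 := T₂.isPoint hI
  have i3 := T₃.isPoint hI
  have i4 := T₄.isPoint hI
  -- The points at which a wall is reached and left are consecutive, so they compare in the same way
  -- with the points of the other touches.
  have e1 : chi (pos D z₂) (pos D z₄) = chi (pos D y₂) (pos D y₄) := by
    rw [← (T₂.chi hI i4.2 n₂₄.2.1.symm n₂₄.2.2.2.symm).2, (T₄.chi hI i2.1 n₂₄.1 n₂₄.2.1).1]
  have e2 : chi (pos D z₂) (pos D y₁) = chi (pos D y₂) (pos D z₁) := by
    rw [← (T₂.chi hI i1.1 ne1 ne2).2, (T₁.chi hI i2.1 ne1.symm ne3.symm).1]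
  have e3 : chi (pos D y₃) (pos D z₄) = chi (pos D z₃) (pos D y₄) := by
    rw [(T₃.chi hI i4.2 nf2.symm nf4.symm).2, (T₄.chi hI i3.2 nf3 nf4).1]
  have e4 : chi (pos D y₃) (pos D y₁) = chi (pos D z₃) (pos D z₁) := by
    have m1 : y₁ ≠ y₃ := fun e => n₁₃ (T₁.unique (e ▸ T₃)).1
    have m2 : y₁ ≠ z₃ := by
      obtain ⟨g, hg, hg'⟩ := t₀.end_mem
      have d : ArcDisjoint D l₀ l₃ := by
        refine (arcDisjoint_of_pairwise hp).mono (by simp) ?_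
        intro x hx; simp [hx]
      rw [hg']
      intro e
      exact (d _ hg _ t₃.start_mem).2 e.symm
    rw [(T₃.chi hI i1.1 m1 m2).2, (T₁.chi hI i3.2 m2.symm n₁₃.symm).1]
  have w1 := (T₁.onWall_right hI).1
  have w2 := T₂.onWall.1
  have w3 := (T₃.onWall_right hI).1
  have w4 := T₄.onWall.1
  have sw := chi_swap (pos_ne hI i1.2 i3.2 n₁₃)
  unfold DecoratedTL.cross at c₁ c₂
  rw [e1, e2, e3, e4] at c₂
  have s1 : chi (pos D z₁) (pos D y₄) + chi (pos D z₃) (pos D y₄) +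
      (chi (pos D y₂) (pos D z₃) + chi (pos D y₂) (pos D z₁)) = 0 := by
    have f1 := chi_swap (pos_ne hI i2.1 i3.2 (ne T₂ T₃ h₂₃).2.1)
    have f2 := chi_swap (pos_ne hI i2.1 i1.2 ne3.symm)
    have f3 : chi (pos D z₃) (pos D y₂) + chi (pos D z₁) (pos D y₂) =
      chi (pos D z₃) (pos D y₄) + chi (pos D z₁) (pos D y₄) := by
      unfold OnWall at w1 w2 w3 w4
      rw [← h₁₃] at w3
      rw [← h₂₄] at w4
      rcases w1 with ⟨o1, w1⟩ | ⟨o1, w1⟩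
      · have o2 : x₂.isOpen = true := by
          cases h : x₂.isOpen
          · exact absurd (o1.trans h.symm) h₁₂
          · rfl
        simp only [o1, o2, true_and, reduceCtorEq, false_and, or_false, false_or] at w2 w3 w4
        rw [chi_congr (x := pos D z₃) (y := pos D y₂) (x' := pos D z₃) (y' := pos D y₄)
            (by unfold Pos.Before; omega),
          chi_congr (x := pos D z₁) (y := pos D y₂) (x' := pos D z₁) (y' := pos D y₄)
            (by unfold Pos.Before; omega)]
      · have o2 : x₂.isOpen = false := by
          cases h : x₂.isOpen
          · rfl
          · exact absurd (o1.trans h.symm) h₁₂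
        simp only [o1, o2, true_and, reduceCtorEq, false_and, or_false, false_or] at w2 w3 w4
        rw [chi_congr (x := pos D z₃) (y := pos D y₂) (x' := pos D z₁) (y' := pos D y₂)
            (by unfold Pos.Before; omega),
          chi_congr (x := pos D z₃) (y := pos D y₄) (x' := pos D z₁) (y' := pos D y₄)
            (by unfold Pos.Before; omega), zmod_two_add_self, zmod_two_add_self]
    rw [f1, f2]
    linear_combination f3 + zmod_two_add_self (chi (pos D z₃) (pos D y₄)) +
      zmod_two_add_self (chi (pos D z₁) (pos D y₄)) + zmod_two_add_self 1
  have : (1 : ZMod 2) = 0 := by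
    linear_combination c₁ + c₂ - s1 - sw - zmod_two_add_self (chi (pos D y₂) (pos D y₄))
      - zmod_two_add_self (chi (pos D z₃) (pos D z₁))
  exact one_ne_zero this

/-- A sequence without four entries of alternating type is, up to rotation, a sequence of closed
decorations followed by a sequence of open ones. -/
theorem exists_rotation (W : List Deco)
    (h : ∀ u₀ u₁ u₂ u₃ u₄ x₁ x₂ x₃ x₄,
      W = u₀ ++ x₁ :: (u₁ ++ x₂ :: (u₂ ++ x₃ :: (u₃ ++ x₄ :: u₄))) →
      x₁.isOpen ≠ x₂.isOpen → x₁.isOpen = x₃.isOpen → x₂.isOpen = x₄.isOpen → False) :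
    ∃ l l' : List Deco, W ~r l ++ l' ∧ (∀ x ∈ l, x.isOpen = false) ∧ ∀ x ∈ l', x.isOpen = true := by
  -- A sequence is empty or begins with a run of decorations of the same type.
  have run : ∀ W : List Deco, W = [] ∨ ∃ x A B, W = x :: A ++ B ∧ (∀ y ∈ A, y.isOpen = x.isOpen) ∧
      ∀ y ∈ B.head?, y.isOpen ≠ x.isOpen := by
    intro W
    rcases W with - | ⟨x, W⟩
    · exact Or.inl rfl
    · right
      refine ⟨x, W.takeWhile (fun y => y.isOpen == x.isOpen), W.dropWhile (fun y => y.isOpen == x.isOpen),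
        ?_, ?_, ?_⟩
      · rw [List.cons_append, List.takeWhile_append_dropWhile]
      · intro y hy
        simpa using List.mem_takeWhile_imp hy
      · intro y hy
        have := List.head?_dropWhile_not (fun y => y.isOpen == x.isOpen) W
        rw [hy] at this
        simpa using this
  have final : ∀ A B : List Deco, ∀ b : Bool, W ~r A ++ B → (∀ x ∈ A, x.isOpen = b) →
      (∀ x ∈ B, x.isOpen = !b) → ∃ l l' : List Deco, W ~r l ++ l' ∧ (∀ x ∈ l, x.isOpen = false) ∧
        ∀ x ∈ l', x.isOpen = true := by
    intro A B b hW hA hB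
    rcases b with - | -
    · exact ⟨A, B, hW, hA, hB⟩
    · exact ⟨B, A, hW.trans List.isRotated_append, hB, hA⟩
  rcases run W with rfl | ⟨x₁, A₁, W₁, e₁, hA₁, hW₁⟩
  · exact ⟨[], [], List.IsRotated.refl _, by simp, by simp⟩
  rcases run W₁ with rfl | ⟨x₂, A₂, W₂, e₂, hA₂, hW₂⟩
  · refine final (x₁ :: A₁) [] x₁.isOpen (by rw [e₁]) ?_ (by simp)
    simpa using hA₁
  have h₂ : x₂.isOpen ≠ x₁.isOpen := hW₁ x₂ (by rw [e₂]; rfl)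
  rcases run W₂ with rfl | ⟨x₃, A₃, W₃, e₃, hA₃, hW₃⟩
  · refine final (x₁ :: A₁) (x₂ :: A₂) x₁.isOpen
      (by rw [e₁, e₂, List.append_nil]) (by simpa using hA₁) ?_
    have h₂' : x₂.isOpen = !x₁.isOpen := by simpa [Bool.eq_not] using h₂
    rw [← h₂']
    simpa using hA₂
  have h₃ : x₃.isOpen ≠ x₂.isOpen := hW₂ x₃ (by rw [e₃]; rfl)
  have h₂' : x₂.isOpen = !x₁.isOpen := by simpa [Bool.eq_not] using h₂
  have h₃' : x₃.isOpen = x₁.isOpen := by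
    rw [h₂'] at h₃
    simpa using h₃
  rcases W₃ with - | ⟨x₄, W₃⟩
  · refine final (x₃ :: A₃ ++ x₁ :: A₁) (x₂ :: A₂) x₁.isOpen ?_ ?_ ?_
    · rw [e₁, e₂, e₃, List.append_nil, ← List.append_assoc, List.append_assoc (x₃ :: A₃)]
      exact List.isRotated_append
    · intro x hx
      simp only [List.cons_append, List.mem_cons, List.mem_append] at hx
      rcases hx with rfl | hx | rfl | hx
      · exact h₃'
      · rw [hA₃ x hx, h₃']
      · rfl
      · exact hA₁ x hx
    · rw [← h₂']
      simpa using hA₂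
  · have h₄ : x₄.isOpen ≠ x₃.isOpen := hW₃ x₄ rfl
    exfalso
    refine h [] A₁ A₂ A₃ W₃ x₁ x₂ x₃ x₄ (by rw [e₁, e₂, e₃]; simp) h₂.symm h₃'.symm ?_
    rw [h₃'] at h₄
    rw [h₂']
    simpa [eq_comm, Bool.eq_not] using h₄

end Diagram

end DecoratedTL

namespace DecoratedTL

namespace Diagram

variable {k : ℕ}

/-! ### Products of LR-decorated diagrams are LR-decorated -/

section Concat

variable {top bot : Diagram k}

theorem concat_mate (p : Node k) : (concat top bot).mate p = (traceNode top bot p).2 := rfl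

theorem concat_word (p : Node k) : (concat top bot).word p = (traceNode top bot p).1 := rfl

theorem concat_loops : (concat top bot).loops =
    top.loops + bot.loops + Multiset.ofList ((List.finRange k).filterMap (newLoop top bot)) := rfl

theorem concat_order : (concat top bot).order =
    if (concat top bot).aValue = 1 then concatOrder top bot else [] := rfl

/-- An edge of the product, as a trail between outer nodes. -/
theorem concat_trail (ht : top.IsDiagram) (hb : bot.IsDiagram) (p : Node k) :
    ∃ l, Trail (box top bot) (outerPoint p) l ((concat top bot).word p)
      (outerPoint ((concat top bot).mate p)) := traceNode_trail ht hb p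

theorem concat_mate_word (ht : top.IsDiagram) (hb : bot.IsDiagram) (p : Node k) :
    (concat top bot).mate ((concat top bot).mate p) = p ∧
      (concat top bot).word ((concat top bot).mate p) = ((concat top bot).word p).reverse := by
  obtain ⟨l, t⟩ := concat_trail ht hb p
  obtain ⟨l', t'⟩ := concat_trail ht hb ((concat top bot).mate p)
  obtain ⟨-, h1, h2⟩ := t'.unique (t.reverse (box_isDiagram ht hb)) (isOuter_outerPoint _ _)
    (isOuter_outerPoint _ _)
  exact ⟨outerPoint_injective h2, h1⟩

theorem concat_mate_ne (ht : top.IsDiagram) (hb : bot.IsDiagram) (p : Node k) :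
    (concat top bot).mate p ≠ p := by
  obtain ⟨l, t⟩ := concat_trail ht hb p
  exact fun h => t.end_ne (box_isDiagram ht hb) (isOuter_outerPoint _ p) (by rw [h])

theorem concat_mate_inl {i j : Fin k} (h : top.mate (.inl i) = .inl j) :
    (concat top bot).mate (.inl i) = .inl j ∧
      (concat top bot).word (.inl i) = top.word (.inl i) := by
  simp only [concat_mate, concat_word, traceNode]
  split <;> rename_i h' <;> simp_all

theorem concat_mate_inr {i j : Fin k} (h : bot.mate (.inr i) = .inr j) :
    (concat top bot).mate (.inr i) = .inr j ∧
      (concat top bot).word (.inr i) = bot.word (.inr i) := by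
  simp only [concat_mate, concat_word, traceNode]
  split <;> rename_i h' <;> simp_all

theorem trails_disjoint (ht : top.IsDiagram) (hb : bot.IsDiagram) {p q : Node k} {l l'}
    (t : Trail (box top bot) (outerPoint p) l ((concat top bot).word p)
      (outerPoint ((concat top bot).mate p)))
    (t' : Trail (box top bot) (outerPoint q) l' ((concat top bot).word q)
      (outerPoint ((concat top bot).mate q))) (h1 : q ≠ p) (h2 : q ≠ (concat top bot).mate p) :
    ArcDisjoint (box top bot) l l' := by
  have key := concat_mate_word ht hb
  refine t.disjoint (box_isDiagram ht hb) t' (isOuter_outerPoint _ _) (isOuter_outerPoint _ _)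
    (isOuter_outerPoint _ _) (fun e => h1 ?_) (fun e => h2 ?_)
  · rw [← (key q).1, outerPoint_injective e, (key p).1]
  · rw [← outerPoint_injective e, (key q).1]

/-- Edges of the product with interleaved ends would be disjoint trails with crossing number one. -/
theorem concat_planar (ht : top.IsLR) (hb : bot.IsLR) (p q : Node k) :
    ¬ (leftPos p < leftPos q ∧ leftPos q < leftPos ((concat top bot).mate p) ∧
      leftPos ((concat top bot).mate p) < leftPos ((concat top bot).mate q)) := by
  rintro ⟨h1, h2, h3⟩
  obtain ⟨l, t⟩ := concat_trail ht.isDiagram hb.isDiagram p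
  obtain ⟨l', t'⟩ := concat_trail ht.isDiagram hb.isDiagram q
  have c := t.cross (box_isLR ht hb) t'
    (trails_disjoint ht.isDiagram hb.isDiagram t t' (fun e => by rw [e] at h1; omega)
      (fun e => by rw [e] at h2; omega)) (isEnd_outerPoint _) (isEnd_outerPoint _)
    (isEnd_outerPoint _) (isEnd_outerPoint _)
  have p1 := pos_outerPoint (box top bot) p
  have p2 := pos_outerPoint (box top bot) q
  have p3 := pos_outerPoint (box top bot) ((concat top bot).mate p)
  have p4 := pos_outerPoint (box top bot) ((concat top bot).mate q)
  rw [cross_eq_one] at c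
  · exact one_ne_zero c
  · unfold Pos.Before
    omega

/-- The part of an edge of the product between its beginning and a decoration. -/
theorem concat_half {p : Node k} {l}
    (t : Trail (box top bot) (outerPoint p) l ((concat top bot).word p)
      (outerPoint ((concat top bot).mate p))) {x : Deco} (hx : x ∈ (concat top bot).word p) :
    ∃ l₁ u y, l₁ ⊆ l ∧ Trail (box top bot) (outerPoint p) l₁ u y ∧
      OnWall k x.isOpen (pos (box top bot) y) ∧ IsEnd y := by
  obtain ⟨u, v, hw⟩ := List.append_of_mem hx
  rw [hw] at t
  obtain ⟨l₁, l₂, y, b, rfl, t1, T, t2⟩ := t.split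
  exact ⟨l₁, u, y, by simp, t1, T.onWall⟩

/-- The part of an edge from its end to the left wall does not cross any other edge. -/
theorem concat_left (ht : top.IsLR) (hb : bot.IsLR) (p : Node k) (x : Deco)
    (hx : x ∈ (concat top bot).word p) (ho : x.isOpen = false) : (concat top bot).LExposed p := by
  rintro q ⟨h1, h2, h3, h4⟩
  obtain ⟨l, t⟩ := concat_trail ht.isDiagram hb.isDiagram p
  obtain ⟨l', t'⟩ := concat_trail ht.isDiagram hb.isDiagram q
  obtain ⟨l₁, u, y, hl, s, hw, he⟩ := concat_half t hx
  have c := s.cross (box_isLR ht hb) t'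
    ((trails_disjoint ht.isDiagram hb.isDiagram t t' (fun e => by rw [e] at h1; omega)
      (fun e => by rw [e] at h2; omega)).mono hl (List.Subset.refl _)) (isEnd_outerPoint _) he
    (isEnd_outerPoint _) (isEnd_outerPoint _)
  have p1 := pos_outerPoint (box top bot) p
  have p2 := pos_outerPoint (box top bot) q
  have p4 := pos_outerPoint (box top bot) ((concat top bot).mate q)
  simp only [OnWall, ho, true_and, reduceCtorEq, false_and, or_false] at hw
  rw [cross_eq_one] at c
  · exact one_ne_zero c
  · unfold Pos.Before
    omega

/-- The part of an edge from its end to the right wall does not cross any other edge. -/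
theorem concat_right (ht : top.IsLR) (hb : bot.IsLR) (p : Node k) (x : Deco)
    (hx : x ∈ (concat top bot).word p) (ho : x.isOpen = true) : (concat top bot).RExposed p := by
  rintro q ⟨h1, h2, h3, h4⟩
  obtain ⟨l, t⟩ := concat_trail ht.isDiagram hb.isDiagram p
  obtain ⟨l', t'⟩ := concat_trail ht.isDiagram hb.isDiagram q
  obtain ⟨l₁, u, y, hl, s, hw, he⟩ := concat_half t hx
  have c := s.cross (box_isLR ht hb) t'
    ((trails_disjoint ht.isDiagram hb.isDiagram t t' (fun e => by rw [e] at h1; omega)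
      (fun e => by rw [e] at h2; omega)).mono hl (List.Subset.refl _)) (isEnd_outerPoint _) he
    (isEnd_outerPoint _) (isEnd_outerPoint _)
  have p1 := pos_outerPoint (box top bot) p
  have p2 := pos_outerPoint (box top bot) q
  have p4 := pos_outerPoint (box top bot) ((concat top bot).mate q)
  have r1 := rightPos_eq p
  have r2 := rightPos_eq q
  have r4 := rightPos_eq ((concat top bot).mate q)
  simp only [OnWall, ho, true_and, reduceCtorEq, false_and, false_or] at hw
  rw [cross_eq_one] at c
  · exact one_ne_zero c
  · unfold Pos.Before
    omega

/-- If an open decoration preceded a closed one on an edge of a face, the parts of this edge before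
the first and after the second one would cross. -/
theorem concat_same (ht : top.IsLR) (hb : bot.IsLR) {p : Node k}
    (hp : leftPos p < leftPos ((concat top bot).mate p) ∧ leftPos ((concat top bot).mate p) < k ∨
      k ≤ leftPos ((concat top bot).mate p) ∧ leftPos ((concat top bot).mate p) < leftPos p) :
    ((concat top bot).word p).Pairwise fun x y => x.isOpen → y.isOpen := by
  have hI := box_isDiagram ht.isDiagram hb.isDiagram
  by_contra h
  obtain ⟨u, x, m, y, v, hw, hxy⟩ := exists_split_of_not_pairwise h
  rw [Classical.not_imp, Bool.not_eq_true] at hxy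
  obtain ⟨l, t⟩ := concat_trail ht.isDiagram hb.isDiagram p
  rw [hw] at t
  have hpw := t.pairwise_of_outer hI (isOuter_outerPoint _ _)
  obtain ⟨l₁, l₂, l₃, a, b, c, d, rfl, t1, T1, -, T2, t2⟩ := t.split₂
  have c := t1.cross (box_isLR ht hb) t2
    ((arcDisjoint_of_pairwise hpw).mono (List.Subset.refl _) (by simp)) (isEnd_outerPoint _)
    T1.onWall.2 (T2.onWall_right hI).2 (isEnd_outerPoint _)
  have w1 := T1.onWall.1
  have w2 := (T2.onWall_right hI).1
  have p1 := pos_outerPoint (box top bot) p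
  have p2 := pos_outerPoint (box top bot) ((concat top bot).mate p)
  simp only [OnWall, hxy, true_and, reduceCtorEq, false_and, false_or, or_false] at w1 w2
  rw [cross_eq_one] at c
  · exact one_ne_zero c
  · unfold Pos.Before
    omega

/-- If an open decoration occurred to the left of a closed one on another edge of the same face, the
parts of these edges between their ends and the walls would cross. -/
theorem concat_across (ht : top.IsLR) (hb : bot.IsLR) {p q : Node k} (hne : q ≠ p)
    (hne' : q ≠ (concat top bot).mate p)
    (hpq : leftPos p < leftPos q ∧ leftPos q < k ∨ k ≤ leftPos q ∧ leftPos q < leftPos p) :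
    ∀ x ∈ (concat top bot).word p, ∀ y ∈ (concat top bot).word q, x.isOpen → y.isOpen := by
  intro x hx y hy ho
  by_contra ho'
  rw [Bool.not_eq_true] at ho'
  obtain ⟨l, t⟩ := concat_trail ht.isDiagram hb.isDiagram p
  obtain ⟨l', t'⟩ := concat_trail ht.isDiagram hb.isDiagram q
  obtain ⟨l₁, u, a, hl, s, hw, he⟩ := concat_half t hx
  obtain ⟨l₂, u', a', hl', s', hw', he'⟩ := concat_half t' hy
  have c := s.cross (box_isLR ht hb) s'
    ((trails_disjoint ht.isDiagram hb.isDiagram t t' hne hne').mono hl hl') (isEnd_outerPoint _) he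
    (isEnd_outerPoint _) he'
  have p1 := pos_outerPoint (box top bot) p
  have p2 := pos_outerPoint (box top bot) q
  simp only [OnWall, ho, ho', true_and, reduceCtorEq, false_and, false_or, or_false] at hw hw'
  rw [cross_eq_one] at c
  · exact one_ne_zero c
  · unfold Pos.Before
    omega

theorem leftPos_inl_lt (i : Fin k) : leftPos (.inl i : Node k) < k := i.2

theorem le_leftPos_inr (i : Fin k) : k ≤ leftPos (.inr i : Node k) := by
  rw [leftPos_inr]
  omega

theorem concat_closedBeforeOpen_north (ht : top.IsLR) (hb : bot.IsLR) :
    (concat top bot).ClosedBeforeOpen Sum.inl where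
  same i j hij h := concat_same ht hb (by
    left
    rw [h, leftPos_inl, leftPos_inl]
    exact ⟨hij, j.2⟩)
  across i j i' j' hij hji hij' h h' := concat_across ht hb
    (by simp only [ne_eq, Sum.inl.injEq]; omega)
    (by rw [h]; simp only [ne_eq, Sum.inl.injEq]; omega)
    (by rw [leftPos_inl, leftPos_inl]; left; omega)

theorem concat_closedBeforeOpen_south (ht : top.IsLR) (hb : bot.IsLR) :
    (concat top bot).ClosedBeforeOpen Sum.inr where
  same i j hij h := concat_same ht hb (by
    right
    rw [h, leftPos_inr, leftPos_inr]
    omega)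
  across i j i' j' hij hji hij' h h' := concat_across ht hb
    (by simp only [ne_eq, Sum.inr.injEq]; omega)
    (by rw [h]; simp only [ne_eq, Sum.inr.injEq]; omega)
    (by rw [leftPos_inr, leftPos_inr]; right; omega)

theorem newLoop_eq {j : Fin k} {w : LoopWord} (h : newLoop top bot j = some w) :
    ∃ l, Cycle top bot (true, j) (true, j) l ∧ w = LoopWord.mk (l.flatMap (piece top bot)) := by
  unfold newLoop at h
  split at h
  · cases h
  · rename_i l hl
    split_ifs at h
    exact ⟨l, cycle_of_cycleFrom hl, (Option.some.inj h).symm⟩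

theorem mem_concat_loops {w : LoopWord} : w ∈ (concat top bot).loops ↔
    w ∈ top.loops ∨ w ∈ bot.loops ∨ ∃ j, newLoop top bot j = some w := by
  rw [concat_loops]
  simp [or_assoc]

theorem numProp_pos {d : Diagram k} : 0 < d.numProp ↔ ∃ i j, d.mate (.inl i) = .inr j := by
  unfold numProp
  rw [Finset.card_pos]
  constructor
  · rintro ⟨i, hi⟩
    have hi := (Finset.mem_filter.1 hi).2
    rw [IsProp] at hi
    rcases h : d.mate (.inl i) with j | j
    · simp [h] at hi
    · exact ⟨i, j, h⟩
  · rintro ⟨i, j, h⟩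
    exact ⟨i, by simp [IsProp, h]⟩

theorem top_numProp_pos (h : 0 < (concat top bot).numProp) : 0 < top.numProp := by
  obtain ⟨i, j, h⟩ := numProp_pos.1 h
  rcases h' : top.mate (.inl i) with m | m
  · rw [(concat_mate_inl h').1] at h
    cases h
  · exact numProp_pos.2 ⟨i, m, h'⟩

theorem bot_numProp_pos (ht : top.IsDiagram) (hb : bot.IsDiagram)
    (h : 0 < (concat top bot).numProp) : 0 < bot.numProp := by
  obtain ⟨i, j, h⟩ := numProp_pos.1 h
  have h2 : (concat top bot).mate (.inr j) = .inl i := by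
    rw [← h, (concat_mate_word ht hb _).1]
  rcases h' : bot.mate (.inr j) with m | m
  · exact numProp_pos.2 ⟨m, j, hb.mate_eq_iff.1 h'⟩
  · rw [(concat_mate_inr h').1] at h2
    cases h2

/-- A loop of an LR-decorated diagram does not have interlaced closed and open decorations, whether
there are propagating edges or not. -/
theorem IsLR.loop_split {d : Diagram k} (hd : d.IsLR) {w : LoopWord} (hw : w ∈ d.loops) :
    ∃ l l' : List Deco, w = LoopWord.mk (l ++ l') ∧
      (∀ x ∈ l, x.isOpen = false) ∧ (∀ x ∈ l', x.isOpen = true) := by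
  rcases Nat.eq_zero_or_pos d.numProp with h | h
  · exact hd.loops_undammed h w hw
  · obtain ⟨l, b, rfl, hl⟩ := hd.loops_dammed h w hw
    rcases b with - | -
    · exact ⟨l, [], by simp, hl, by simp⟩
    · exact ⟨[], l, by simp, by simp, hl⟩

/-- The part of a new loop between two decorations of different type runs from one wall to the
other, so it would cross every propagating edge. -/
theorem concat_loops_dammed (ht : top.IsLR) (hb : bot.IsLR) (h : 0 < (concat top bot).numProp) :
    ∀ w ∈ (concat top bot).loops,
      ∃ (l : List Deco) (b : Bool), w = LoopWord.mk l ∧ ∀ x ∈ l, x.isOpen = b := by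
  have hI := box_isDiagram ht.isDiagram hb.isDiagram
  intro w hw
  rcases mem_concat_loops.1 hw with hw | hw | ⟨j, hw⟩
  · exact ht.loops_dammed (top_numProp_pos h) w hw
  · exact hb.loops_dammed (bot_numProp_pos ht.isDiagram hb.isDiagram h) w hw
  obtain ⟨l, hl, rfl⟩ := newLoop_eq hw
  obtain ⟨e, hg, t⟩ := hl.trail ht.isDiagram hb.isDiagram
  have hpw := t.pairwise hI hl.start_notMem_tail
  obtain ⟨i, m, him⟩ := numProp_pos.1 h
  obtain ⟨l', t'⟩ := concat_trail ht.isDiagram hb.isDiagram (.inl i)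
  rw [him] at t'
  have dis := t.disjoint_closed hI (Or.inl hg) t' (isOuter_outerPoint _ _) (isOuter_outerPoint _ _)
  have same : (l.flatMap (piece top bot)).Pairwise fun x y => x.isOpen = y.isOpen := by
    by_contra hn
    obtain ⟨u, x, n, y, v, hw, hxy⟩ := exists_split_of_not_pairwise hn
    rw [hw] at t
    obtain ⟨l₁, l₂, l₃, a, b, c, d, hl', t1, T1, t2, T2, t3⟩ := t.split₂
    have c := t2.cross (box_isLR ht hb) t'
      (dis.mono (by rw [hl']; intro x hx; simp [hx]) (List.Subset.refl _)) (T1.onWall_right hI).2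
      T2.onWall.2 (isEnd_outerPoint _) (isEnd_outerPoint _)
    have w1 := (T1.onWall_right hI).1
    have w2 := T2.onWall.1
    have p1 := pos_outerPoint (box top bot) (.inl i)
    have p2 := pos_outerPoint (box top bot) (.inr m)
    have q1 := leftPos_inl_lt i
    have q2 := le_leftPos_inr m
    rw [cross_eq_one] at c
    · exact one_ne_zero c
    · unfold Pos.Before
      unfold OnWall at w1 w2
      rcases hx : x.isOpen with - | - <;> rcases hy : y.isOpen with - | - <;>
        simp only [hx, hy, true_and, reduceCtorEq, false_and, false_or, or_false,
          not_true_eq_false] at w1 w2 hxy <;> omega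
  rcases hW : l.flatMap (piece top bot) with - | ⟨x, W⟩
  · exact ⟨[], true, rfl, by simp⟩
  · rw [hW, List.pairwise_cons] at same
    exact ⟨_, x.isOpen, rfl, List.forall_mem_cons.2 ⟨rfl, fun y hy => (same.1 y hy).symm⟩⟩

/-- On a new loop the decorations of the two types are not interlaced by `loop_not_interlaced`, and
so they can be separated by a rotation. -/
theorem concat_loop_split (ht : top.IsLR) (hb : bot.IsLR) :
    ∀ w ∈ (concat top bot).loops,
      ∃ l l' : List Deco, w = LoopWord.mk (l ++ l') ∧
        (∀ x ∈ l, x.isOpen = false) ∧ (∀ x ∈ l', x.isOpen = true) := by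
  have hI := box_isDiagram ht.isDiagram hb.isDiagram
  intro w hw
  rcases mem_concat_loops.1 hw with hw | hw | ⟨j, hw⟩
  · exact ht.loop_split hw
  · exact hb.loop_split hw
  obtain ⟨l, hl, rfl⟩ := newLoop_eq hw
  obtain ⟨e, hg, t⟩ := hl.trail ht.isDiagram hb.isDiagram
  have hpw := t.pairwise hI hl.start_notMem_tail
  obtain ⟨l₁, l₂, hr, h1, h2⟩ := exists_rotation (l.flatMap (piece top bot)) (by
    intro u₀ u₁ u₂ u₃ u₄ x₁ x₂ x₃ x₄ hw a b c
    rw [hw] at t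
    exact loop_not_interlaced (box_isLR ht hb) t hg hpw a b c)
  exact ⟨l₁, l₂, Quot.sound (Or.inl hr), h1, h2⟩

theorem aValue_le_concat : top.aValue ≤ (concat top bot).aValue := by
  unfold aValue
  refine Finset.card_le_card fun i hi => ?_
  simp only [Finset.mem_filter, Finset.mem_univ, true_and] at hi ⊢
  obtain ⟨j, hij, h⟩ := hi
  exact ⟨j, hij, (concat_mate_inl h).1⟩

end Concat

end Diagram

end DecoratedTL

namespace DecoratedTL

namespace Diagram

variable {k : ℕ}

section Order

variable {d top bot : Diagram k}

/-! ### The vertical order of a product -/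

/-- The north face has only one non-propagating edge. -/
theorem north_unique (h : d.aValue = 1) {i j i' j' : Fin k} (hij : i < j)
    (hm : d.mate (.inl i) = .inl j) (hij' : i' < j') (hm' : d.mate (.inl i') = .inl j') :
    i = i' := by
  obtain ⟨x, hx⟩ := Finset.card_eq_one.1 h
  have h1 : i ∈ ({x} : Finset (Fin k)) := by
    rw [← hx]
    simp only [Finset.mem_filter, Finset.mem_univ, true_and]
    exact ⟨j, hij, hm⟩
  have h2 : i' ∈ ({x} : Finset (Fin k)) := by
    rw [← hx]
    simp only [Finset.mem_filter, Finset.mem_univ, true_and]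
    exact ⟨j', hij', hm'⟩
  rw [Finset.mem_singleton] at h1 h2
  rw [h1, h2]

theorem exists_north (h : d.aValue ≠ 0) : ∃ i j, i < j ∧ d.mate (.inl i) = .inl j := by
  obtain ⟨i, hi⟩ := Finset.card_ne_zero.1 h
  obtain ⟨j, hj⟩ := (Finset.mem_filter.1 hi).2
  exact ⟨i, j, hj⟩

theorem isProp_inl {i : Fin k} : d.IsProp (.inl i) ↔ ∃ j, d.mate (.inl i) = .inr j := by
  unfold IsProp
  rcases h : d.mate (.inl i) with j | j <;> simp

theorem isProp_inr {i : Fin k} : d.IsProp (.inr i) ↔ ∃ j, d.mate (.inr i) = .inl j := by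
  unfold IsProp
  rcases h : d.mate (.inr i) with j | j <;> simp

theorem order_count_le (hd : d.IsDiagram) (i : Fin k) :
    d.order.count i ≤ (d.word (.inl i)).length := by
  by_cases h : d.aValue = 1
  · rw [hd.order_count h]
    split_ifs <;> omega
  · simp [hd.order_eq h]

theorem order_count_eq_zero (hd : d.IsDiagram) {i : Fin k} (h : ¬ d.IsProp (.inl i)) :
    d.order.count i = 0 := by
  by_cases h' : d.aValue = 1
  · rw [hd.order_count h', if_neg h]
  · simp [hd.order_eq h']

theorem Path.end_south {s : Bool × Fin k} {l e} (h : Path top bot s l e) {m : Fin k}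
    (he : e = .inr m) : ∃ L j, l = L ++ [(true, j)] ∧ bot.mate (.inl j) = .inr m := by
  induction h with
  | @last s h =>
    rcases s with ⟨b | b, j⟩
    · simp only [next, exit] at h he
      rw [he] at h
      cases h
    · exact ⟨[], j, rfl, he⟩
  | cons h h' ih =>
    obtain ⟨L, j, rfl, hj⟩ := ih he
    exact ⟨_ :: L, j, rfl, hj⟩

/-- The parts of a propagating edge of a product: from the north face to the first crossing of the
interface, from there to the last crossing, and from the last crossing to the south face. -/
theorem concat_prop (ht : top.IsDiagram) (hb : bot.IsDiagram) {i m : Fin k}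
    (h : (concat top bot).mate (.inl i) = .inr m) :
    ∃ j₀ j L, top.mate (.inl i) = .inr j₀ ∧ bot.mate (.inl j) = .inr m ∧
      northEnd top bot j = some i ∧ Path top bot (true, j₀) (L ++ [(true, j)]) (.inr m) ∧
      (concat top bot).word (.inl i) =
        top.word (.inl i) ++ L.flatMap (piece top bot) ++ bot.word (.inl j) := by
  rcases h' : top.mate (.inl i) with j₀ | j₀
  · rw [(concat_mate_inl h').1] at h
    cases h
  obtain ⟨l, hl, hw⟩ := path_of_initial (s := (true, j₀)) ht hb (by
    rintro ⟨b | b, m⟩ h2 <;> rw [next_eq_some] at h2 <;> simp [entry, box] at h2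
    have h3 := ht.mate_eq_iff.1 h'
    rw [ht.mate_eq_iff.1 h2] at h3
    simp at h3)
  have hm : (trace top bot k (true, j₀)).2 = .inr m := by
    rw [← h, concat_mate, traceNode]
    simp [h']
  obtain ⟨L, j, rfl, hj⟩ := hl.end_south hm
  rw [hm] at hl
  refine ⟨j₀, j, L, rfl, hj, ?_, hl, ?_⟩
  · have h2 := (concat_mate_word ht hb (.inl i)).1
    rw [h, concat_mate, traceNode] at h2
    simp only [hb.mate_eq_iff.1 hj] at h2
    rw [northEnd, h2]
  · rw [concat_word, traceNode]
    simp only [h', hw, List.flatMap_append, List.flatMap_singleton, List.append_assoc]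
    rfl

theorem mate_of_northEnd (ht : top.IsDiagram) (hb : bot.IsDiagram) {i j m : Fin k}
    (hj : bot.mate (.inl j) = .inr m) (h : northEnd top bot j = some i) :
    (concat top bot).mate (.inl i) = .inr m := by
  have h2 : (concat top bot).mate (.inr m) = .inl i := by
    rw [concat_mate, traceNode]
    simp only [hb.mate_eq_iff.1 hj]
    rw [northEnd] at h
    split at h <;> simp_all
  rw [← h2, (concat_mate_word ht hb _).1]

theorem count_filterMap_eq {α β : Type*} [DecidableEq α] [DecidableEq β] {f : α → Option β}
    {l : List α} {x : α} {y : β} (h : ∀ z ∈ l, f z = some y ↔ z = x) :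
    (l.filterMap f).count y = l.count x := by
  induction l with
  | nil => rfl
  | cons z l ih =>
    have ih := ih fun w hw => h w (List.mem_cons_of_mem _ hw)
    have hz := h z List.mem_cons_self
    by_cases e : z = x
    · rw [List.filterMap_cons_some (hz.2 e), List.count_cons, List.count_cons, ih, e]
      simp
    · rcases hf : f z with - | w
      · rw [List.filterMap_cons_none hf, ih, List.count_cons]
        simp [e]
      · have : w ≠ y := fun hw => e (hz.1 (hw ▸ hf))
        rw [List.filterMap_cons_some hf, List.count_cons, ih, List.count_cons]
        simp [e, this]

theorem count_flatMap_eq {α β : Type*} [DecidableEq α] {f : β → List α} {l : List β} {x : β} {y : α}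
    (hl : l.Nodup) (hx : x ∈ l) (h : ∀ z ∈ l, z ≠ x → (f z).count y = 0) :
    (l.flatMap f).count y = (f x).count y := by
  induction l with
  | nil => cases hx
  | cons z l ih =>
    rw [List.flatMap_cons, List.count_append]
    rw [List.nodup_cons] at hl
    rcases List.mem_cons.1 hx with rfl | hx
    · have : (l.flatMap f).count y = 0 := by
        rw [List.count_eq_zero]
        intro hy
        obtain ⟨w, hw, hy⟩ := List.mem_flatMap.1 hy
        exact List.count_eq_zero.1 (h w (List.mem_cons_of_mem _ hw) fun e => hl.1 (e ▸ hw)) hy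
      rw [this, add_zero]
    · rw [ih hl.2 hx fun w hw => h w (List.mem_cons_of_mem _ hw),
        h z List.mem_cons_self (fun e => hl.1 (e ▸ hx)), zero_add]

/-- The propagating edges of `bot` which continue to a given node of the north face are only one. -/
theorem low_count (ht : top.IsDiagram) (hb : bot.IsDiagram) {i j m : Fin k}
    (hj : bot.mate (.inl j) = .inr m) (h : northEnd top bot j = some i) :
    (bot.order.filterMap (northEnd top bot)).count i = bot.order.count j := by
  have h1 := mate_of_northEnd ht hb hj h
  refine count_filterMap_eq fun z hz => ⟨fun hz' => ?_, fun e => e ▸ h⟩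
  have hp : bot.IsProp (.inl z) := by
    by_contra hn
    exact List.count_eq_zero.1 (order_count_eq_zero hb hn) hz
  obtain ⟨m', hm'⟩ := isProp_inl.1 hp
  have h2 := mate_of_northEnd ht hb hm' hz'
  rw [h1] at h2
  obtain rfl := Sum.inr_injective h2
  exact Sum.inl_injective (hb.mate_injective (hm'.trans hj.symm))

theorem low_count_eq_zero (ht : top.IsDiagram) (hb : bot.IsDiagram) {i : Fin k}
    (h : ¬ (concat top bot).IsProp (.inl i)) :
    (bot.order.filterMap (northEnd top bot)).count i = 0 := by
  rw [List.count_eq_zero]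
  intro hi
  obtain ⟨z, hz, hz'⟩ := List.mem_filterMap.1 hi
  have hp : bot.IsProp (.inl z) := by
    by_contra hn
    exact List.count_eq_zero.1 (order_count_eq_zero hb hn) hz
  obtain ⟨m', hm'⟩ := isProp_inl.1 hp
  exact h (isProp_inl.2 ⟨_, mate_of_northEnd ht hb hm' hz'⟩)

/-- If the product of `top` and `bot` has the same `a`-value `1` as `top`, no propagating edge of
`top` becomes part of a non-propagating edge of the north face. -/
theorem isProp_concat (ht : top.IsDiagram) (hb : bot.IsDiagram) (ha : top.aValue ≠ 0)
    (h : (concat top bot).aValue = 1) {i : Fin k} (hi : top.IsProp (.inl i)) :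
    (concat top bot).IsProp (.inl i) := by
  obtain ⟨x, y, hxy, hm⟩ := exists_north ha
  have hm' := (concat_mate_inl (bot := bot) hm).1
  obtain ⟨j₀, hj₀⟩ := isProp_inl.1 hi
  rw [isProp_inl]
  rcases hc : (concat top bot).mate (.inl i) with j | j
  · exfalso
    have hc' : (concat top bot).mate (.inl j) = .inl i := by
      rw [← hc, (concat_mate_word ht hb _).1]
    have hij : i ≠ j := by
      rintro rfl
      exact concat_mate_ne ht hb _ hc
    rcases lt_or_gt_of_ne hij with hl | hl
    · have := north_unique h hxy hm' hl hc
      rw [this] at hm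
      rw [hm] at hj₀
      cases hj₀
    · have := north_unique h hxy hm' hl hc'
      rw [this, hc'] at hm'
      obtain rfl := Sum.inl_injective hm'
      rw [ht.mate_eq_iff.1 hm] at hj₀
      cases hj₀
  · exact ⟨j, rfl⟩

/-- The decorations of a propagating edge which stem neither from `top.order` nor from `bot.order`
are those met at the interface, and `concatOrder` inserts precisely the missing number of them. -/
theorem concat_order_count (ht : top.IsDiagram) (hb : bot.IsDiagram) (ha : top.aValue ≠ 0)
    (h : (concat top bot).aValue = 1) (i : Fin k) : (concat top bot).order.count i =
      if (concat top bot).IsProp (.inl i) then ((concat top bot).word (.inl i)).length else 0 := by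
  have hp : ∀ p, (preConcat top bot).IsProp p ↔ (concat top bot).IsProp p := fun p => Iff.rfl
  rw [concat_order, if_pos h, concatOrder]
  simp only [List.count_append]
  rw [count_flatMap_eq (List.nodup_finRange k) (List.mem_finRange i)]
  · by_cases hi : (concat top bot).IsProp (.inl i)
    · rw [if_pos hi, if_pos ((hp _).2 hi), List.count_replicate_self]
      obtain ⟨m, hm⟩ := isProp_inl.1 hi
      obtain ⟨j₀, j, L, h1, h2, h3, -, h5⟩ := concat_prop ht hb hm
      have e : (preConcat top bot).word (.inl i) = (concat top bot).word (.inl i) := rfl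
      have l1 := order_count_le ht i
      have l2 := order_count_le hb j
      rw [low_count ht hb h2 h3, e, h5]
      simp only [List.length_append]
      omega
    · rw [if_neg hi, if_neg (mt (hp _).1 hi), low_count_eq_zero ht hb hi,
        order_count_eq_zero ht fun h' => hi (isProp_concat ht hb ha h h')]
      rfl
  · intro z _ hz
    split_ifs
    · rw [List.count_replicate]
      simp [hz]
    · rfl

theorem concat_aValue_ne_zero (ha : top.aValue ≠ 0) : (concat top bot).aValue ≠ 0 := by
  have := aValue_le_concat (top := top) (bot := bot)
  omega

/-- The product of two LR-decorated diagrams, the first of which is not the identity up to loops, is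
LR-decorated. -/
theorem concat_isLR (ht : top.IsLR) (hb : bot.IsLR) (ha : top.aValue ≠ 0) :
    (concat top bot).IsLR where
  isDiagram :=
    { mate_mate := fun p => (concat_mate_word ht.isDiagram hb.isDiagram p).1
      mate_ne := concat_mate_ne ht.isDiagram hb.isDiagram
      planar := concat_planar ht hb
      word_mate := fun p => (concat_mate_word ht.isDiagram hb.isDiagram p).2
      order_eq := fun h => by rw [concat_order, if_neg h]
      order_count := concat_order_count ht.isDiagram hb.isDiagram ha
      word_eq := fun h => absurd h (concat_aValue_ne_zero ha)
      loops_eq := fun h => absurd h (concat_aValue_ne_zero ha) }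
  left := concat_left ht hb
  right := concat_right ht hb
  north := concat_closedBeforeOpen_north ht hb
  south := concat_closedBeforeOpen_south ht hb
  loops_dammed := concat_loops_dammed ht hb
  loops_undammed := fun _ => concat_loop_split ht hb

end Order

end Diagram

end DecoratedTL

namespace DecoratedTL

open Diagram

/-! ### Decorations as partial transitions between states -/

theorem isOpen_dot (b : Bool) : (dot b).isOpen = !b := by cases b <;> rfl

theorem isOpen_tri (b : Bool) : (tri b).isOpen = !b := by cases b <;> rfl

theorem dot_injective : Function.Injective dot := by
  intro b c h
  cases b <;> cases c <;> first | rfl | cases h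

theorem dot_ne_tri (b c : Bool) : dot b ≠ tri c := by
  cases b <;> cases c <;> intro h <;> cases h

theorem isOpen_eq_not_iff {x : Deco} {b : Bool} : x.isOpen = !b ↔ x = dot b ∨ x = tri b := by
  cases x <;> cases b <;> simp [Deco.isOpen, dot, tri]

/-- The effect of a decoration on a state. A state is `some true` next to the west corners, `some
false` next to the east corners, and `none` elsewhere. The decoration `•` changes between `some
true` and `none`, `▲` changes neither of them, and none of these two is possible in the state `some
false`; the mirror image holds for `∘` and `△`. -/
def Deco.act : Deco → Option Bool → Option (Option Bool)
  | .bullet, none => some (some true)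
  | .bullet, some true => some none
  | .bullet, some false => none
  | .blackTri, some false => none
  | .blackTri, s => some s
  | .circ, none => some (some false)
  | .circ, some false => some none
  | .circ, some true => none
  | .whiteTri, some true => none
  | .whiteTri, s => some s

/-- The state reached from a given state along a sequence of decorations, if this is possible. -/
def run : List Deco → Option Bool → Option (Option Bool)
  | [], s => some s
  | x :: w, s => (x.act s).bind (run w)

theorem Deco.act_symm {x : Deco} {s t : Option Bool} (h : x.act s = some t) : x.act t = some s := by
  rcases x <;> rcases s with - | (- | -) <;> rcases t with - | (- | -) <;> simp_all [Deco.act]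

theorem act_dot {b : Bool} {s t : Option Bool} : (dot b).act s = some t ↔
    (s = none ∧ t = some b) ∨ (s = some b ∧ t = none) := by
  rcases b <;> rcases s with - | (- | -) <;> rcases t with - | (- | -) <;> simp [Deco.act, dot]

theorem act_tri {b : Bool} {s t : Option Bool} : (tri b).act s = some t ↔
    s = t ∧ s ≠ some !b := by
  rcases b <;> rcases s with - | (- | -) <;> rcases t with - | (- | -) <;> simp [Deco.act, tri]

/-- In the state of one side only the decorations of that side are possible. -/
theorem isOpen_of_act {x : Deco} {b : Bool} {t : Option Bool} (h : x.act (some b) = some t) :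
    x.isOpen = !b := by
  rcases x <;> rcases b <;> simp_all [Deco.act, Deco.isOpen]

theorem run_append (u v : List Deco) (s : Option Bool) :
    run (u ++ v) s = (run u s).bind (run v) := by
  induction u generalizing s with
  | nil => rfl
  | cons x u ih =>
    simp only [List.cons_append, run]
    rcases x.act s with - | t
    · rfl
    · exact ih t

theorem run_append_eq_some {u v : List Deco} {s t : Option Bool} :
    run (u ++ v) s = some t ↔ ∃ r, run u s = some r ∧ run v r = some t := by
  rw [run_append, Option.bind_eq_some_iff]

theorem run_cons_eq_some {x : Deco} {v : List Deco} {s t : Option Bool} :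
    run (x :: v) s = some t ↔ ∃ r, x.act s = some r ∧ run v r = some t := by
  rw [run, Option.bind_eq_some_iff]

theorem run_singleton (x : Deco) (s : Option Bool) : run [x] s = x.act s := by
  simp only [run]
  cases x.act s <;> rfl

/-- Transitions are symmetric, so that the condition on an edge does not depend on the end from
which it is read. -/
theorem run_reverse {w : List Deco} {s t : Option Bool} (h : run w s = some t) :
    run w.reverse t = some s := by
  induction w generalizing s with
  | nil =>
    obtain rfl := Option.some.inj h
    rfl
  | cons x w ih =>
    obtain ⟨r, h1, h2⟩ := run_cons_eq_some.1 h
    rw [List.reverse_cons, run_append_eq_some]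
    exact ⟨r, ih h2, by rw [run_singleton]; exact x.act_symm h1⟩

theorem run_tri {w : List Deco} {b : Bool} (hw : ∀ x ∈ w, x = tri b) {s : Option Bool}
    (hs : s ≠ some !b) : run w s = some s := by
  induction w with
  | nil => rfl
  | cons x w ih =>
    rw [run_cons_eq_some]
    refine ⟨s, ?_, ih fun y hy => hw y (List.mem_cons_of_mem _ hy)⟩
    rw [hw x List.mem_cons_self, act_tri]
    exact ⟨rfl, hs⟩

/-- The types of consecutive decorations alternate. -/
def Alternates (w : List Deco) : Prop := w.IsChain fun x y => x.isOpen ≠ y.isOpen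

theorem Alternates.reverse {w : List Deco} (h : Alternates w) : Alternates w.reverse := by
  unfold Alternates at *
  rw [List.isChain_reverse]
  exact h.imp fun _ _ h => h.symm

theorem Alternates.adjacent {u v : List Deco} {x y : Deco} (h : Alternates (u ++ x :: y :: v)) :
    x.isOpen ≠ y.isOpen := by
  unfold Alternates at h
  rw [List.isChain_append] at h
  exact (List.isChain_cons_cons.1 h.2.1).1

theorem alternates_iff {w : List Deco} :
    Alternates w ↔ ∀ u x y v, w = u ++ x :: y :: v → x.isOpen ≠ y.isOpen := by
  constructor
  · rintro h u x y v rfl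
    exact h.adjacent
  · intro h
    unfold Alternates
    induction w with
    | nil => exact .nil
    | cons a w ih =>
      rcases w with - | ⟨b, w⟩
      · exact .singleton _
      · refine .cons_cons (h [] a b w rfl) (ih ?_)
        intro u x y v e
        exact h (a :: u) x y v (by rw [e]; rfl)

/-- In an alternating sequence which is possible for the given states, `•` and `∘` only occur at the
ends and only where the state is that of their side. -/
theorem dot_at_end {w u v : List Deco} {s t : Option Bool} {b : Bool} (ha : Alternates w)
    (h : run w s = some t) (hw : w = u ++ [dot b] ++ v) :
    (u = [] ∧ s = some b) ∨ (v = [] ∧ t = some b) := by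
  subst hw
  rw [run_append_eq_some] at h
  obtain ⟨r', h, hv⟩ := h
  obtain ⟨r, hu, hd⟩ := run_append_eq_some.1 h
  rw [run_singleton, act_dot] at hd
  rcases hd with ⟨rfl, rfl⟩ | ⟨rfl, rfl⟩
  · right
    rcases v with - | ⟨y, v⟩
    · exact ⟨rfl, (Option.some.inj hv).symm⟩
    · obtain ⟨r, hy, -⟩ := run_cons_eq_some.1 hv
      have ha' : Alternates (u ++ dot b :: y :: v) := by simpa using ha
      have := ha'.adjacent
      rw [isOpen_dot, isOpen_of_act hy] at this
      exact absurd rfl this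
  · left
    rcases List.eq_nil_or_concat u with rfl | ⟨u, y, rfl⟩
    · exact ⟨rfl, Option.some.inj hu⟩
    · rw [List.concat_eq_append] at hu ha
      obtain ⟨r, -, hy⟩ := run_append_eq_some.1 hu
      rw [run_singleton] at hy
      have ha' : Alternates (u ++ y :: dot b :: v) := by simpa using ha
      have := ha'.adjacent
      rw [isOpen_dot, isOpen_of_act (y.act_symm hy)] at this
      exact absurd rfl this

theorem head?_eq_dot {w : List Deco} {t : Option Bool} {b : Bool} (ha : Alternates w)
    (h : run w (some b) = some t) (ht : t ≠ some b ∨ 2 ≤ w.length) : w.head? = some (dot b) := by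
  rcases w with - | ⟨x, w⟩
  · rcases ht with ht | ht
    · exact absurd (Option.some.inj h).symm ht
    · simp at ht
  · obtain ⟨r, hx, hr⟩ := run_cons_eq_some.1 h
    rcases isOpen_eq_not_iff.1 (isOpen_of_act hx) with rfl | rfl
    · rfl
    · rw [act_tri] at hx
      obtain ⟨rfl, -⟩ := hx
      rcases w with - | ⟨y, w⟩
      · rcases ht with ht | ht
        · exact absurd (Option.some.inj hr).symm ht
        · simp at ht
      · obtain ⟨r, hy, -⟩ := run_cons_eq_some.1 hr
        have := Alternates.adjacent (u := []) (x := tri b) (y := y) (v := w) ha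
        rw [isOpen_tri, isOpen_of_act hy] at this
        exact absurd rfl this

theorem getLast?_eq_dot {w : List Deco} {s : Option Bool} {b : Bool} (ha : Alternates w)
    (h : run w s = some (some b)) (hs : s ≠ some b ∨ 2 ≤ w.length) :
    w.getLast? = some (dot b) := by
  rw [← List.head?_reverse]
  exact head?_eq_dot ha.reverse (run_reverse h) (by rwa [List.length_reverse])

theorem Alternates.eq_of_type {w : List Deco} {b : Bool} (ha : Alternates w)
    (hw : ∀ x ∈ w, x.isOpen = !b) : w = [] ∨ w = [tri b] ∨ w = [dot b] := by
  rcases w with - | ⟨x, - | ⟨y, w⟩⟩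
  · exact Or.inl rfl
  · right
    rcases isOpen_eq_not_iff.1 (hw x List.mem_cons_self) with rfl | rfl
    · exact Or.inr rfl
    · exact Or.inl rfl
  · have := Alternates.adjacent (u := []) ha
    rw [hw x (by simp), hw y (by simp)] at this
    exact absurd rfl this

/-- An alternating sequence which consists of decorations of one side and begins in the state of
that side. -/
theorem eq_of_type_of_run {w : List Deco} {t : Option Bool} {b : Bool} (ha : Alternates w)
    (hw : ∀ x ∈ w, x.isOpen = !b) (h : run w (some b) = some t) :
    (t = some b ∧ (w = [] ∨ w = [tri b])) ∨ (t = none ∧ w = [dot b]) := by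
  rcases ha.eq_of_type hw with rfl | rfl | rfl
  · exact Or.inl ⟨(Option.some.inj h).symm, Or.inl rfl⟩
  · rw [run_singleton, act_tri] at h
    exact Or.inl ⟨h.1.symm, Or.inr rfl⟩
  · rw [run_singleton, act_dot] at h
    simp only [reduceCtorEq, false_and, true_and, false_or] at h
    exact Or.inr ⟨h, rfl⟩

/-- A sequence of decorations is possible for the states `s` and `t` if its `•` and `∘` are
precisely the ones which these states require. -/
theorem run_of_dots {w : List Deco} {s t : Option Bool}
    (hs : ∀ b, s = some b → w.head? = some (dot b))
    (ht : ∀ b, t = some b → w.getLast? = some (dot b))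
    (hd : ∀ b u v, w = u ++ [dot b] ++ v → (u = [] ∧ s = some b) ∨ (v = [] ∧ t = some b))
    (h1 : s ≠ none → t ≠ none → w.length ≠ 1) : run w s = some t := by
  have tri_of : ∀ x : Deco, (∀ b, x ≠ dot b) → ∃ b, x = tri b := by
    intro x hx
    rcases isOpen_eq_not_iff.1 (show x.isOpen = !(!x.isOpen) by simp) with h | h
    · exact absurd h (hx _)
    · exact ⟨_, h⟩
  -- Without `•` and `∘`, the state `none` does not change.
  have none_run : ∀ v : List Deco, (∀ x ∈ v, ∀ b, x ≠ dot b) → run v none = some none := by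
    intro v
    induction v with
    | nil => intro _; rfl
    | cons x v ih =>
      intro hv
      obtain ⟨b, rfl⟩ := tri_of x (hv x List.mem_cons_self)
      rw [run_cons_eq_some]
      exact ⟨none, act_tri.2 ⟨rfl, by simp⟩, ih fun y hy => hv y (List.mem_cons_of_mem _ hy)⟩
  -- The part of the sequence after its beginning.
  have tail_run : ∀ (A v : List Deco), w = A ++ v → (A ≠ [] ∨ s = none) →
      (v = [] → t = none) → run v none = some t := by
    intro A v hw hA hv
    have inner : ∀ B x C, v = B ++ x :: C → C ≠ [] → ∀ b, x ≠ dot b := by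
      rintro B x C rfl hC b rfl
      rcases hd b (A ++ B) C (by rw [hw]; simp) with ⟨h, h'⟩ | ⟨h, -⟩
      · rcases hA with hA | hA
        · exact hA (List.append_eq_nil_iff.1 h).1
        · rw [hA] at h'
          cases h'
      · exact hC h
    rcases List.eq_nil_or_concat v with rfl | ⟨B, x, hB⟩
    · rw [hv rfl]
      rfl
    · rw [List.concat_eq_append] at hB
      have hBrun : run B none = some none := by
        refine none_run B fun y hy => ?_
        obtain ⟨B₁, B₂, rfl⟩ := List.append_of_mem hy
        exact inner B₁ y (B₂ ++ [x]) (by rw [hB]; simp) (by simp)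
      rw [hB, run_append_eq_some]
      refine ⟨none, hBrun, ?_⟩
      rw [run_singleton]
      rcases t with - | b
      · obtain ⟨c, rfl⟩ := tri_of x (by
          rintro b rfl
          rcases hd b (A ++ B) [] (by rw [hw, hB]; simp) with ⟨h, h'⟩ | ⟨-, h⟩
          · rcases hA with hA | hA
            · exact hA (List.append_eq_nil_iff.1 h).1
            · rw [hA] at h'
              cases h'
          · cases h)
        exact act_tri.2 ⟨rfl, by simp⟩
      · have := ht b rfl
        rw [hw, hB, ← List.append_assoc, List.getLast?_concat] at this
        rw [Option.some.inj this, act_dot]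
        exact Or.inl ⟨rfl, rfl⟩
  rcases s with - | b
  · exact tail_run [] w rfl (Or.inr rfl) (fun hw => by
      rcases t with - | c
      · rfl
      · have := ht c rfl
        rw [hw] at this
        cases this)
  · obtain ⟨v, rfl⟩ := List.head?_eq_some_iff.1 (hs b rfl)
    rw [run_cons_eq_some]
    refine ⟨none, act_dot.2 (Or.inr ⟨rfl, rfl⟩),
      tail_run [dot b] v rfl (Or.inl (by simp)) ?_⟩
    rintro rfl
    by_contra hne
    exact h1 (by simp) hne rfl

/-- The states agree at the two ends of some linear reading of the loop. -/
def LoopWord.IsValid : LoopWord → Prop :=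
  Quot.lift (fun w => ∃ s, run w s = some s) (by
    have rot : ∀ {l l' : List Deco}, l ~r l' → (∃ s, run l s = some s) → ∃ s, run l' s = some s := by
      rintro l l' ⟨n, rfl⟩ ⟨s, hs⟩
      rw [← List.rotate_mod]
      rcases Nat.eq_zero_or_pos l.length with h | h
      · rw [List.length_eq_zero_iff.1 h] at hs ⊢
        exact ⟨s, by simpa using hs⟩
      · rw [List.rotate_eq_drop_append_take (Nat.mod_lt _ h).le]
        rw [← List.take_append_drop (n % l.length) l, run_append_eq_some] at hs
        obtain ⟨r, h1, h2⟩ := hs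
        exact ⟨r, run_append_eq_some.2 ⟨s, h2, h1⟩⟩
    have rev : ∀ {l : List Deco}, (∃ s, run l s = some s) → ∃ s, run l.reverse s = some s :=
      fun ⟨s, hs⟩ => ⟨s, run_reverse hs⟩
    intro l l' h
    refine propext ?_
    rcases h with h | h
    · exact ⟨rot h, rot h.symm⟩
    · refine ⟨fun h' => rot h (rev h'), fun h' => ?_⟩
      have := rev (rot h.symm h')
      rwa [List.reverse_reverse] at this)

theorem LoopWord.isValid_mk {w : List Deco} :
    (LoopWord.mk w).IsValid ↔ ∃ s, run w s = some s := Iff.rfl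

namespace Diagram

variable {n : ℕ}

/-- The state at the nodes of a column. -/
def colState (i : Fin (n + 2)) : Option Bool :=
  if i = 0 then some true else if i = Fin.last (n + 1) then some false else none

/-- The state at a node. -/
def nodeState : Node (n + 2) → Option Bool
  | .inl i => colState i
  | .inr i => colState i

theorem colState_eq_some {i : Fin (n + 2)} {b : Bool} :
    colState i = some b ↔ i = sideNode b 0 := by
  have h : Fin.last (n + 1) ≠ (0 : Fin (n + 2)) := by
    intro h; simpa using congrArg Fin.val h
  have h' : Fin.rev (0 : Fin (n + 2)) = Fin.last (n + 1) := by
    ext; simp [Fin.rev]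
  unfold colState sideNode
  rcases b <;> split_ifs <;> simp_all [eq_comm]

theorem nodeState_eq_some {p : Node (n + 2)} {b : Bool} :
    nodeState p = some b ↔ IsCorner b p := by
  rcases p with i | i <;> simp [nodeState, colState_eq_some, IsCorner]

/-- The states at the two ends of an edge are related by its decorations. -/
def EdgesValid (d : Diagram (n + 2)) : Prop :=
  ∀ p, run (d.word p) (nodeState p) = some (nodeState (d.mate p))

variable {top bot : Diagram (n + 2)}

theorem run_piece (ht : top.EdgesValid) (hb : bot.EdgesValid) (s : Bool × Fin (n + 2)) :
    run (piece top bot s) (colState s.2) = some (nodeState (exit top bot s)) := by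
  rcases s with ⟨b | b, j⟩
  · exact ht (.inr j)
  · exact hb (.inl j)

theorem nodeState_exit {s t : Bool × Fin (n + 2)} (h : next top bot s = some t) :
    nodeState (exit top bot s) = colState t.2 := by
  rw [next_eq_some] at h
  rcases s with ⟨b | b, j⟩ <;> rcases t with ⟨c | c, m⟩ <;> simp_all [entry, box, exit, nodeState]

theorem Path.run_flatMap (ht : top.EdgesValid) (hb : bot.EdgesValid) {s l e} (h : Path top bot s l e) :
    run (l.flatMap (piece top bot)) (colState s.2) = some (nodeState e) := by
  induction h with
  | @last s h => simpa using run_piece ht hb s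
  | @cons s t l e h _ ih =>
    rw [List.flatMap_cons, run_append_eq_some]
    exact ⟨_, run_piece ht hb s, by rw [nodeState_exit h]; exact ih⟩

theorem Cycle.run_flatMap (ht : top.EdgesValid) (hb : bot.EdgesValid) {start s l}
    (h : Cycle top bot start s l) :
    run (l.flatMap (piece top bot)) (colState s.2) = some (colState start.2) := by
  induction h with
  | @last s h =>
    rw [← nodeState_exit h]
    simpa using run_piece ht hb s
  | @cons s t l h _ _ ih =>
    rw [List.flatMap_cons, run_append_eq_some]
    exact ⟨_, run_piece ht hb s, by rw [nodeState_exit h]; exact ih⟩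

/-- Identified nodes of the interface have the same state, so the transitions along the pieces of an
edge of the product can be composed. -/
theorem concat_edgesValid (hI : top.IsDiagram) (hI' : bot.IsDiagram) (ht : top.EdgesValid)
    (hb : bot.EdgesValid) : (concat top bot).EdgesValid := by
  intro p
  have h2 := (concat_mate_word hI hI' p).1
  rw [concat_word, concat_mate]
  rcases p with i | i
  · have hi := ht (.inl i)
    rcases h : top.mate (.inl i) with j | j
    · rw [h] at hi
      have e := concat_mate_inl (bot := bot) h
      rw [concat_mate, concat_word] at e
      rw [e.1, e.2]
      exact hi
    · obtain ⟨l, hl, hw⟩ := path_of_initial (s := (true, j)) hI hI' (by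
        rintro ⟨b | b, m⟩ h' <;> rw [next_eq_some] at h' <;> simp [entry, box] at h'
        have h2 := hI.mate_eq_iff.1 h
        rw [hI.mate_eq_iff.1 h'] at h2
        simp at h2)
      rw [h] at hi
      simp only [traceNode, h]
      rw [run_append_eq_some, hw]
      exact ⟨_, hi, hl.run_flatMap ht hb⟩
  · have hi := hb (.inr i)
    rcases h : bot.mate (.inr i) with j | j
    · obtain ⟨l, hl, hw⟩ := path_of_initial (s := (false, j)) hI hI' (by
        rintro ⟨b | b, m⟩ h' <;> rw [next_eq_some] at h' <;> simp [entry, box] at h'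
        have h2 := hI'.mate_eq_iff.1 h
        rw [hI'.mate_eq_iff.1 h'] at h2
        simp at h2)
      rw [h] at hi
      simp only [traceNode, h]
      rw [run_append_eq_some, hw]
      exact ⟨_, hi, hl.run_flatMap ht hb⟩
    · rw [h] at hi
      have e := concat_mate_inr (top := top) h
      rw [concat_mate, concat_word] at e
      rw [e.1, e.2]
      exact hi

/-- The transitions along the pieces of a new loop compose to a closed sequence of states. -/
theorem concat_loopsValid (ht : top.EdgesValid) (hb : bot.EdgesValid)
    (hl : ∀ w ∈ top.loops, w.IsValid) (hl' : ∀ w ∈ bot.loops, w.IsValid) :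
    ∀ w ∈ (concat top bot).loops, w.IsValid := by
  intro w hw
  rcases mem_concat_loops.1 hw with hw | hw | ⟨j, hw⟩
  · exact hl w hw
  · exact hl' w hw
  · obtain ⟨l, hc, rfl⟩ := newLoop_eq hw
    exact LoopWord.isValid_mk.2 ⟨_, hc.run_flatMap ht hb⟩

end Diagram

end DecoratedTL

namespace DecoratedTL

namespace Diagram

variable {k : ℕ}

/-! ### Planarity seen from one side -/

/-- The position of a column, counted from the west or from the east. -/
def off (b : Bool) (i : Fin k) : ℕ := if b then i else k - 1 - i

/-- The position of a node on the boundary of the box, read from the given side along the north face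
and back along the south face. -/
def sidePos (b : Bool) (p : Node k) : ℕ := if b then leftPos p else 2 * k - 1 - rightPos p

theorem off_lt (b : Bool) (i : Fin k) : off b i < k := by
  unfold off
  split_ifs <;> omega

theorem sidePos_inl (b : Bool) (i : Fin k) : sidePos b (.inl i) = off b i := by
  have := i.2
  unfold sidePos off
  rw [leftPos_inl, rightPos_inl]
  split_ifs <;> omega

theorem sidePos_inr (b : Bool) (i : Fin k) : sidePos b (.inr i) = 2 * k - 1 - off b i := by
  have := i.2
  unfold sidePos off
  rw [leftPos_inr, rightPos_inr]
  split_ifs <;> omega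

theorem off_injective (b : Bool) : Function.Injective (off b : Fin k → ℕ) := by
  intro i j h
  unfold off at h
  ext
  split_ifs at h <;> omega

theorem sidePos_injective (b : Bool) : Function.Injective (sidePos b : Node k → ℕ) := by
  intro p q h
  have := rightPos_eq p
  have := rightPos_eq q
  have := leftPos_lt p
  have := leftPos_lt q
  apply leftPos_injective
  unfold sidePos at h
  split_ifs at h <;> omega

theorem sidePos_not (b : Bool) (p : Node k) :
    (sidePos b p < k ∧ sidePos (!b) p + sidePos b p + 1 = k) ∨
      (k ≤ sidePos b p ∧ sidePos b p < 2 * k ∧ sidePos (!b) p + sidePos b p + 1 = 3 * k) := by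
  have := rightPos_eq p
  have := leftPos_lt p
  unfold sidePos
  cases b <;> simp <;> omega

variable {d : Diagram k}

theorem IsDiagram.sidePlanar (hd : d.IsDiagram) (b : Bool) (p q : Node k) :
    ¬ (sidePos b p < sidePos b q ∧ sidePos b q < sidePos b (d.mate p) ∧
      sidePos b (d.mate p) < sidePos b (d.mate q)) := by
  obtain ⟨h1, h2, h3, h4, h5, h6, h7, h8⟩ := hd.planar' p q
  have r1 := rightPos_eq p
  have r2 := rightPos_eq q
  have r3 := rightPos_eq (d.mate p)
  have r4 := rightPos_eq (d.mate q)
  have l1 := leftPos_lt p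
  have l2 := leftPos_lt q
  have l3 := leftPos_lt (d.mate p)
  have l4 := leftPos_lt (d.mate q)
  unfold sidePos
  rcases b with - | -
  · simp only [Bool.false_eq_true, if_false]
    omega
  · simpa using h1

/-- An edge with a decoration of the given side is not separated from the wall of that side. -/
theorem IsLR.sideExposed (hd : d.IsLR) {b : Bool} {p : Node k} {x : Deco} (hx : x ∈ d.word p)
    (ho : x.isOpen = !b) (q : Node k) :
    ¬ (sidePos b q < sidePos b p ∧ sidePos b q < sidePos b (d.mate p) ∧
      sidePos b p < sidePos b (d.mate q) ∧ sidePos b (d.mate p) < sidePos b (d.mate q)) := by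
  rcases b with - | -
  · have h := hd.right p x hx ho (d.mate q)
    unfold Separates at h
    rw [hd.isDiagram.mate_mate] at h
    have r1 := rightPos_eq p
    have r2 := rightPos_eq q
    have r3 := rightPos_eq (d.mate p)
    have r4 := rightPos_eq (d.mate q)
    have l1 := leftPos_lt p
    have l2 := leftPos_lt q
    have l3 := leftPos_lt (d.mate p)
    have l4 := leftPos_lt (d.mate q)
    simp only [sidePos, Bool.false_eq_true, if_false]
    omega
  · exact hd.left p x hx ho q

/-- Propagating edges do not cross. -/
theorem IsDiagram.prop_mono (hd : d.IsDiagram) (b : Bool) {i j c e : Fin k}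
    (hi : d.mate (.inl i) = .inr c) (hj : d.mate (.inl j) = .inr e) (h : off b i < off b j) :
    off b c < off b e := by
  have p := hd.sidePlanar b (.inl i) (.inl j)
  rw [hi, hj, sidePos_inl, sidePos_inl, sidePos_inr, sidePos_inr] at p
  have h1 := off_lt b i
  have h2 := off_lt b j
  have h3 := off_lt b c
  have h4 := off_lt b e
  by_contra hn
  have hne : c ≠ e := by
    rintro rfl
    rw [Sum.inl_injective (hd.mate_injective (hi.trans hj.symm))] at h
    omega
  have : off b c ≠ off b e := fun e' => hne (off_injective b e')
  omega

theorem isProp_mate (hd : d.IsDiagram) {p : Node k} : d.IsProp (d.mate p) ↔ d.IsProp p := by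
  unfold IsProp
  rw [hd.mate_mate, ne_comm]

/-- Both faces have the same number of nodes on non-propagating edges. -/
theorem card_nonProp (hd : d.IsDiagram) :
    (Finset.univ.filter fun i : Fin k => ¬ d.IsProp (.inl i)).card =
      (Finset.univ.filter fun i : Fin k => ¬ d.IsProp (.inr i)).card := by
  have h1 := Finset.card_filter_add_card_filter_not (s := Finset.univ)
    (fun i : Fin k => d.IsProp (.inl i))
  have h2 := Finset.card_filter_add_card_filter_not (s := Finset.univ)
    (fun i : Fin k => d.IsProp (.inr i))
  have h3 : (Finset.univ.filter fun i : Fin k => d.IsProp (.inl i)).card =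
      (Finset.univ.filter fun i : Fin k => d.IsProp (.inr i)).card := by
    refine Finset.card_bij' (fun i _ => (d.mate (.inl i)).elim id id)
      (fun i _ => (d.mate (.inr i)).elim id id) ?_ ?_ ?_ ?_ <;> intro i hi <;>
      simp only [Finset.mem_filter, Finset.mem_univ, true_and, isProp_inl, isProp_inr] at hi ⊢ <;>
      obtain ⟨j, hj⟩ := hi <;> simp [hj, hd.mate_eq_iff.1 hj]
  omega

/-- The only non-propagating edge of the face `f` joins the neighbours `x` and `y`, from left to
right. -/
structure IsOnlyCup (d : Diagram k) (f : Fin k → Node k) (x y : Fin k) : Prop where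
  succ : y.val = x.val + 1
  mate : d.mate (f x) = f y
  isProp : ∀ i, i ≠ x → i ≠ y → d.IsProp (f i)

theorem exists_onlyCup_north (hd : d.IsDiagram) (h : d.aValue = 1) :
    ∃ x y, d.IsOnlyCup .inl x y := by
  obtain ⟨x, y, hxy, hm⟩ := exists_north (d := d) (by omega)
  have hp : ∀ i, i ≠ x → i ≠ y → d.IsProp (.inl i) := by
    intro i hx hy
    rw [isProp_inl]
    rcases hi : d.mate (.inl i) with j | j
    · exfalso
      have hij : i ≠ j := by
        rintro rfl
        exact hd.mate_ne _ hi
      rcases lt_or_gt_of_ne hij with hl | hl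
      · exact hx (north_unique h hl hi hxy hm)
      · have := north_unique h hl (hd.mate_eq_iff.1 hi) hxy hm
        subst this
        rw [hd.mate_eq_iff.1 hi] at hm
        exact hy (Sum.inl_injective hm)
    · exact ⟨j, rfl⟩
  refine ⟨x, y, ?_, hm, hp⟩
  by_contra hne
  have hlt : x.val + 1 < y.val := by
    have : x.val < y.val := hxy
    omega
  obtain ⟨c, hc⟩ := isProp_inl.1 (hp ⟨x.val + 1, by omega⟩ (by simp [Fin.ext_iff])
    (by simp only [ne_eq, Fin.ext_iff]; omega))
  have := hd.planar (.inl x) (.inl ⟨x.val + 1, by omega⟩)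
  rw [hm, hc, leftPos_inl, leftPos_inl, leftPos_inl, leftPos_inr] at this
  simp only at this
  omega

/-- The south face has as many nodes on non-propagating edges as the north face, that is two, and so
it has one non-propagating edge as well. -/
theorem exists_onlyCup_south (hd : d.IsDiagram) (h : d.aValue = 1) :
    ∃ x y, d.IsOnlyCup .inr x y := by
  obtain ⟨x, y, h1, h2, h3⟩ := exists_onlyCup_north hd h
  have hN : (Finset.univ.filter fun i : Fin k => ¬ d.IsProp (.inl i)) = {x, y} := by
    ext i
    simp only [Finset.mem_filter, Finset.mem_univ, true_and, Finset.mem_insert,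
      Finset.mem_singleton]
    constructor
    · intro hi
      by_contra hn
      rw [not_or] at hn
      exact hi (h3 i hn.1 hn.2)
    · rintro (rfl | rfl) <;> rw [isProp_inl] <;> rintro ⟨j, hj⟩
      · rw [h2] at hj
        cases hj
      · rw [hd.mate_eq_iff.1 h2] at hj
        cases hj
  have hc := card_nonProp hd
  rw [hN, Finset.card_pair (fun e => by rw [e] at h1; omega)] at hc
  obtain ⟨u, v, huv, hS⟩ := Finset.card_eq_two.1 hc.symm
  have key : ∀ i, ¬ d.IsProp (.inr i) ↔ i = u ∨ i = v := by
    intro i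
    have := Finset.ext_iff.1 hS i
    simpa using this
  have hu : d.mate (.inr u) = .inr v := by
    have hu := (key u).2 (Or.inl rfl)
    rcases hm : d.mate (.inr u) with j | j
    · exact absurd (isProp_inr.2 ⟨j, hm⟩) hu
    · have : ¬ d.IsProp (.inr j) := by
        rw [← hm, isProp_mate hd]
        exact hu
      rcases (key j).1 this with rfl | rfl
      · exact absurd hm (hd.mate_ne _)
      · rfl
  have adj : ∀ u v : Fin k, u < v → d.mate (.inr u) = .inr v →
      (∀ i, ¬ d.IsProp (.inr i) ↔ i = u ∨ i = v) → d.IsOnlyCup .inr u v := by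
    intro u v huv hm key
    have hp : ∀ i, i ≠ u → i ≠ v → d.IsProp (.inr i) := by
      intro i hu hv
      by_contra hn
      rcases (key i).1 hn with h | h
      · exact hu h
      · exact hv h
    refine ⟨?_, hm, hp⟩
    by_contra hne
    have hlt : u.val + 1 < v.val := by
      have : u.val < v.val := huv
      omega
    obtain ⟨c, hc⟩ := isProp_inr.1 (hp ⟨u.val + 1, by omega⟩ (by simp [Fin.ext_iff])
      (by simp only [ne_eq, Fin.ext_iff]; omega))
    have := (hd.planar' (.inr u) (.inr ⟨u.val + 1, by omega⟩))
    rw [hm, hc, leftPos_inr, leftPos_inr, leftPos_inr, leftPos_inl] at this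
    simp only at this
    omega
  rcases lt_or_gt_of_ne huv with hl | hl
  · exact ⟨u, v, adj u v hl hu key⟩
  · exact ⟨v, u, adj v u hl (hd.mate_eq_iff.1 hu) fun i => by rw [key, or_comm]⟩

/-- Each face of a diagram with `a`-value `1` has exactly one non-propagating edge. -/
theorem exists_onlyCup (hd : d.IsDiagram) (h : d.aValue = 1) {f : Fin k → Node k}
    (hf : f = .inl ∨ f = .inr) : ∃ x y, d.IsOnlyCup f x y := by
  rcases hf with rfl | rfl
  · exact exists_onlyCup_north hd h
  · exact exists_onlyCup_south hd h

theorem face_injective {f : Fin k → Node k} (hf : f = .inl ∨ f = .inr) : Function.Injective f := by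
  rcases hf with rfl | rfl
  · exact Sum.inl_injective
  · exact Sum.inr_injective

theorem not_isProp_face {f : Fin k → Node k} (hf : f = .inl ∨ f = .inr) {i : Fin k} :
    ¬ d.IsProp (f i) ↔ ∃ j, d.mate (f i) = f j := by
  rcases hf with rfl | rfl
  · rw [isProp_inl]
    rcases d.mate (.inl i) with j | j <;> simp
  · rw [isProp_inr]
    rcases d.mate (.inr i) with j | j <;> simp

theorem IsOnlyCup.not_isProp (hd : d.IsDiagram) {f : Fin k → Node k} (hf : f = .inl ∨ f = .inr)
    {x y i : Fin k} (h : d.IsOnlyCup f x y) : ¬ d.IsProp (f i) ↔ i = x ∨ i = y := by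
  constructor
  · intro hi
    by_contra hn
    rw [not_or] at hn
    exact hi (h.isProp i hn.1 hn.2)
  · rintro (rfl | rfl)
    · exact (not_isProp_face hf).2 ⟨_, h.mate⟩
    · exact (not_isProp_face hf).2 ⟨_, hd.mate_eq_iff.1 h.mate⟩

end Diagram

end DecoratedTL

namespace DecoratedTL

namespace Diagram

variable {n : ℕ} {d : Diagram (n + 2)}

/-! ### Diagrams with one non-propagating edge in each face -/

theorem off_sideNode (b : Bool) (j : Fin (n + 2)) : off b (sideNode b j) = j.val := by
  unfold off sideNode
  rcases b <;> simp [Fin.rev]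
  omega

theorem eq_sideNode {b : Bool} {i j : Fin (n + 2)} (h : off b i = j.val) : i = sideNode b j :=
  off_injective b (h.trans (off_sideNode b j).symm)

theorem isCorner_mate_iff {b : Bool} {p : Node (n + 2)} (hd : d.IsDiagram) (hp : IsCorner b p) :
    IsCorner b (d.mate p) ↔ d.mate (.inl (sideNode b 0)) = .inr (sideNode b 0) := by
  rcases hp with rfl | rfl
  · constructor
    · rintro (h | h)
      · exact absurd h (hd.mate_ne _)
      · exact h
    · exact fun h => Or.inr h
  · rw [hd.mate_eq_iff]
    constructor
    · rintro (h | h)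
      · exact h
      · exact absurd h (hd.mate_ne _)
    · exact fun h => Or.inl h

/-- An edge at a corner carries only decorations of that side if there is another propagating edge.
-/
theorem corner_type (hd : d.IsLR) {b : Bool} {p : Node (n + 2)} (hp : IsCorner b p)
    {j e : Fin (n + 2)} (hj : d.mate (.inl j) = .inr e) (h1 : Sum.inl j ≠ p)
    (h2 : Sum.inl j ≠ d.mate p) : ∀ x ∈ d.word p, x.isOpen = !b := by
  intro x hx
  by_contra hne
  have ho : x.isOpen = !(!b) := by
    rw [Bool.not_not]
    cases h : x.isOpen <;> cases b <;> simp_all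
  have hI := hd.isDiagram
  have ex := hd.sideExposed hx ho (.inl j)
  have ex' := hd.sideExposed hx ho (.inr e)
  have n1 : sidePos b (.inl j) ≠ sidePos b p := fun h => h1 (sidePos_injective b h)
  have n2 : sidePos b (.inl j) ≠ sidePos b (d.mate p) := fun h => h2 (sidePos_injective b h)
  have n3 : sidePos b (.inr e) ≠ sidePos b p := fun h =>
    h2 (by rw [← hI.mate_eq_iff.1 hj, sidePos_injective b h])
  have n4 : sidePos b (.inr e) ≠ sidePos b (d.mate p) := fun h =>
    h1 (by rw [← hI.mate_eq_iff.1 hj, sidePos_injective b h, hI.mate_mate])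
  have n5 : sidePos b (d.mate p) ≠ sidePos b p := fun h => hI.mate_ne p (sidePos_injective b h)
  have hp0 : sidePos b p = 0 ∨ sidePos b p + 1 = 2 * (n + 2) := by
    have o0 := off_sideNode b (0 : Fin (n + 2))
    simp only [Fin.val_zero] at o0
    rcases hp with rfl | rfl
    · rw [sidePos_inl]
      omega
    · rw [sidePos_inr]
      omega
  have q1 : sidePos b (.inl j : Node (n + 2)) < n + 2 := by
    rw [sidePos_inl]
    exact off_lt b j
  have q2 : n + 2 ≤ sidePos b (.inr e : Node (n + 2)) := by
    have := off_lt b e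
    rw [sidePos_inr]
    omega
  have s1 := sidePos_not b p
  have s2 := sidePos_not b (d.mate p)
  have s3 := sidePos_not b (.inl j : Node (n + 2))
  have s4 := sidePos_not b (.inr e : Node (n + 2))
  have l1 := hI.sidePlanar b p (.inl j)
  have l2 := hI.sidePlanar b (d.mate p) (.inl j)
  have l3 := hI.sidePlanar b (.inl j) p
  have l4 := hI.sidePlanar b (.inl j) (d.mate p)
  rw [hj] at l1 l2 l3 l4 ex
  rw [hI.mate_eq_iff.1 hj] at ex'
  rw [hI.mate_mate] at l2 l4
  rcases hp0 with hp0 | hp0 <;> omega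

/-- Only the propagating edge which is next to a wall can carry decorations of its side. -/
theorem not_type_of_lt (hd : d.IsLR) {b : Bool} {i j : Fin (n + 2)} (hi : d.IsProp (.inl i))
    (hj : d.IsProp (.inl j)) (h : off b j < off b i) : ∀ x ∈ d.word (.inl i), x.isOpen = b := by
  intro x hx
  by_contra hne
  have ho : x.isOpen = !b := by cases h : x.isOpen <;> cases b <;> simp_all
  obtain ⟨c, hc⟩ := isProp_inl.1 hi
  obtain ⟨e, he⟩ := isProp_inl.1 hj
  have ex := hd.sideExposed hx ho (.inl j)
  have pm := hd.isDiagram.prop_mono b he hc h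
  have := off_lt b i
  have := off_lt b c
  have := off_lt b j
  rw [hc, he] at ex
  simp only [sidePos_inl, sidePos_inr] at ex
  omega

/-- A non-propagating edge which is separated from a wall by a propagating edge does not carry
decorations of that side. -/
theorem not_type_of_isProp (hd : d.IsLR) {b : Bool} {f : Fin (n + 2) → Node (n + 2)}
    (hf : f = .inl ∨ f = .inr) {i j : Fin (n + 2)} (hi : d.mate (f i) = f j)
    (h0 : d.IsProp (f (sideNode b 0))) : ∀ x ∈ d.word (f i), x.isOpen = b := by
  intro x hx
  by_contra hne
  have ho : x.isOpen = !b := by cases h : x.isOpen <;> cases b <;> simp_all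
  have hI := hd.isDiagram
  have i0 : off b i ≠ 0 := by
    intro h
    rw [eq_sideNode (j := 0) h] at hi
    exact (not_isProp_face hf).2 ⟨_, hi⟩ h0
  have j0 : off b j ≠ 0 := by
    intro h
    rw [eq_sideNode (j := 0) h] at hi
    exact (not_isProp_face hf).2 ⟨_, hI.mate_eq_iff.1 hi⟩ h0
  have := off_lt b i
  have := off_lt b j
  have o0 := off_sideNode b (0 : Fin (n + 2))
  simp only [Fin.val_zero] at o0
  rcases hf with rfl | rfl
  · obtain ⟨c, hc⟩ := isProp_inl.1 h0
    have ex := hd.sideExposed hx ho (.inl (sideNode b 0))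
    have := off_lt b c
    rw [hi, hc] at ex
    simp only [sidePos_inl, sidePos_inr] at ex
    omega
  · obtain ⟨c, hc⟩ := isProp_inr.1 h0
    have ex := hd.sideExposed hx ho (.inl c)
    have := off_lt b c
    rw [hi, hI.mate_eq_iff.1 hc] at ex
    simp only [sidePos_inl, sidePos_inr] at ex
    omega

theorem fin_val_two (hn : 2 ≤ n) : (2 : Fin (n + 2)).val = 2 := by
  change 2 % (n + 2) = 2
  exact Nat.mod_eq_of_lt (by omega)

theorem fin_val_one : (1 : Fin (n + 2)).val = 1 := rfl

theorem off_succ {b : Bool} {x y : Fin (n + 2)} (h : y.val = x.val + 1) :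
    (b = true ∧ off b y = off b x + 1) ∨ (b = false ∧ off b x = off b y + 1) := by
  have := y.2
  unfold off
  cases b <;> simp <;> omega

/-- The only non-propagating edge of a face, if it meets a corner. -/
theorem IsOnlyCup.corner (hd : d.IsDiagram) {f : Fin (n + 2) → Node (n + 2)}
    (hf : f = .inl ∨ f = .inr) {x y : Fin (n + 2)} (h : d.IsOnlyCup f x y) {b : Bool}
    (h0 : ¬ d.IsProp (f (sideNode b 0))) : d.mate (f (sideNode b 0)) = f (sideNode b 1) ∧
      ∀ i, ¬ d.IsProp (f i) ↔ off b i < 2 := by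
  have hs := off_succ (b := b) h.succ
  have o0 := off_sideNode b (0 : Fin (n + 2))
  have o1 := off_sideNode b (1 : Fin (n + 2))
  simp only [Fin.val_zero, fin_val_one] at o0 o1
  rw [h.not_isProp hd hf] at h0
  have hxy : (off b x = 0 ∧ off b y = 1) ∨ (off b y = 0 ∧ off b x = 1) := by
    rcases h0 with h0 | h0 <;> rw [h0] at o0 <;> omega
  constructor
  · rcases hxy with ⟨hx, hy⟩ | ⟨hy, hx⟩
    · rw [← eq_sideNode (j := 0) hx, ← eq_sideNode (j := 1) hy]
      exact h.mate
    · rw [← eq_sideNode (j := 0) hy, ← eq_sideNode (j := 1) hx]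
      exact hd.mate_eq_iff.1 h.mate
  · intro i
    rw [h.not_isProp hd hf]
    constructor
    · rintro (rfl | rfl) <;> omega
    · intro hi
      have e1 : off b i = off b x → i = x := fun e => off_injective b e
      have e2 : off b i = off b y → i = y := fun e => off_injective b e
      omega

/-- For the face `f` of a diagram with `a`-value `1`: the end of the propagating edge nearest to
the given side. -/
def endNode (d : Diagram (n + 2)) (b : Bool) (f : Fin (n + 2) → Node (n + 2)) : Fin (n + 2) :=
  if d.IsProp (f (sideNode b 0)) then sideNode b 0 else sideNode b 2

/-- The propagating edge next to a side meets the first node of the face not on its only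
non-propagating edge. -/
theorem endNode_isProp (hn : 2 ≤ n) (hd : d.IsDiagram) (h : d.aValue = 1) (b : Bool)
    {f : Fin (n + 2) → Node (n + 2)} (hf : f = .inl ∨ f = .inr) :
    d.IsProp (f (d.endNode b f)) ∧ ∀ i, d.IsProp (f i) → off b (d.endNode b f) ≤ off b i := by
  unfold endNode
  have o0 := off_sideNode b (0 : Fin (n + 2))
  have o2 := off_sideNode b (2 : Fin (n + 2))
  rw [fin_val_two hn] at o2
  simp only [Fin.val_zero] at o0
  split_ifs with h0
  · exact ⟨h0, fun i _ => by omega⟩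
  · obtain ⟨x, y, hc⟩ := exists_onlyCup hd h hf
    obtain ⟨-, h2⟩ := hc.corner hd hf h0
    refine ⟨?_, fun i hi => ?_⟩
    · by_contra hp
      rw [h2] at hp
      omega
    · have := mt (h2 i).2 (not_not.2 hi)
      omega

/-- The nearest propagating edge is the same from both faces, as propagating edges do not cross. -/
theorem mate_endNode (hn : 2 ≤ n) (hd : d.IsDiagram) (h : d.aValue = 1) (b : Bool) :
    d.mate (.inl (d.endNode b .inl)) = .inr (d.endNode b .inr) := by
  obtain ⟨p1, m1⟩ := endNode_isProp hn hd h b (Or.inl rfl)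
  obtain ⟨p2, m2⟩ := endNode_isProp hn hd h b (Or.inr rfl)
  obtain ⟨c, hc⟩ := isProp_inl.1 p1
  obtain ⟨e, he⟩ := isProp_inr.1 p2
  have pc : d.IsProp (.inr c) := by rw [← hc, isProp_mate hd]; exact p1
  have pe : d.IsProp (.inl e) := by rw [← he, isProp_mate hd]; exact p2
  have h1 := m1 e pe
  have h2 := m2 c pc
  rcases h1.lt_or_eq with hl | hl
  · have := hd.prop_mono b hc (hd.mate_eq_iff.1 he) hl
    omega
  · rw [off_injective b hl]
    exact hd.mate_eq_iff.1 he

/-- All decorations of one side on propagating edges are on the propagating edge next to that side.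
-/
theorem eq_endNode_of_type (hn : 2 ≤ n) (hd : d.IsLR) (h : d.aValue = 1) {b : Bool}
    {i : Fin (n + 2)} (hi : d.IsProp (.inl i)) {x : Deco} (hx : x ∈ d.word (.inl i))
    (ho : x.isOpen = !b) : i = d.endNode b .inl := by
  obtain ⟨p1, m1⟩ := endNode_isProp hn hd.isDiagram h b (Or.inl rfl)
  rcases (m1 i hi).lt_or_eq with hl | hl
  · have := not_type_of_lt hd hi p1 hl x hx
    rw [ho] at this
    simp at this
  · exact (off_injective b hl).symm

theorem endNode_ne (hn : 2 ≤ n) (hd : d.IsDiagram) (h : d.aValue = 1) :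
    d.endNode true .inl ≠ d.endNode false .inl := by
  obtain ⟨p1, m1⟩ := endNode_isProp hn hd h true (Or.inl rfl)
  obtain ⟨p2, m2⟩ := endNode_isProp hn hd h false (Or.inl rfl)
  intro e
  obtain ⟨x, y, hc⟩ := exists_onlyCup_north hd h
  have ex : ∃ i, i ≠ x ∧ i ≠ y ∧ i ≠ d.endNode true .inl := by
    have hcard : ({x, y, d.endNode true .inl} : Finset (Fin (n + 2))).card <
        (Finset.univ : Finset (Fin (n + 2))).card := by
      have := Finset.card_le_three (a := x) (b := y) (c := d.endNode true .inl)
      rw [Finset.card_univ, Fintype.card_fin]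
      omega
    obtain ⟨i, -, hi⟩ := Finset.exists_mem_notMem_of_card_lt_card hcard
    simp only [Finset.mem_insert, Finset.mem_singleton, not_or] at hi
    exact ⟨i, hi⟩
  obtain ⟨i, hx, hy, hi⟩ := ex
  have hp := hc.isProp i hx hy
  have a1 := m1 i hp
  have a2 := m2 i hp
  rw [← e] at a2
  apply hi
  ext
  have := i.2
  have := (d.endNode true .inl).2
  simp only [off, if_true, Bool.false_eq_true, if_false] at a1 a2
  omega

/-- The side whose corner in the given face is on a non-propagating edge. -/
def faceState (d : Diagram (n + 2)) (f : Fin (n + 2) → Node (n + 2)) : Option Bool :=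
  if ¬ d.IsProp (f (sideNode true 0)) then some true
  else if ¬ d.IsProp (f (sideNode false 0)) then some false else none

/-- As the only non-propagating edge of a face joins two neighbours of at least four nodes, it does
not meet both corners; so the side in `faceState` is unique. -/
theorem faceState_eq_some (hn : 2 ≤ n) (hd : d.IsDiagram) (h : d.aValue = 1)
    {f : Fin (n + 2) → Node (n + 2)} (hf : f = .inl ∨ f = .inr) {b : Bool} :
    d.faceState f = some b ↔ ¬ d.IsProp (f (sideNode b 0)) := by
  obtain ⟨x, y, hc⟩ := exists_onlyCup hd h hf
  have key : ¬ (¬ d.IsProp (f (sideNode true 0)) ∧ ¬ d.IsProp (f (sideNode false 0))) := by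
    rintro ⟨h1, h2⟩
    have := ((hc.corner hd hf h1).2 _).1 h2
    simp [off, sideNode, Fin.rev] at this
    omega
  unfold faceState
  by_cases h1 : d.IsProp (f (sideNode true 0)) <;> by_cases h2 : d.IsProp (f (sideNode false 0)) <;>
    cases b <;> simp [h1, h2]
  exact key ⟨h1, h2⟩

end Diagram

end DecoratedTL

namespace DecoratedTL

namespace Diagram

/-! ### The decorations of the propagating edges in their vertical order -/

section Vertical

variable {α β : Type*}

theorem flatMap_eq_of_unique {γ δ : Type*} {f : γ → List δ} {l : List γ} {x : γ} (hl : l.Nodup)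
    (hx : x ∈ l) (h : ∀ z ∈ l, z ≠ x → f z = []) : l.flatMap f = f x := by
  induction l with
  | nil => cases hx
  | cons z l ih =>
    rw [List.flatMap_cons]
    rw [List.nodup_cons] at hl
    rcases List.mem_cons.1 hx with rfl | hx
    · have : l.flatMap f = [] := List.flatMap_eq_nil_iff.2 fun w hw =>
        h w (List.mem_cons_of_mem _ hw) fun e => hl.1 (e ▸ hw)
      rw [this, List.append_nil]
    · rw [h z List.mem_cons_self (fun e => hl.1 (e ▸ hx)), List.nil_append,
        ih hl.2 hx fun w hw => h w (List.mem_cons_of_mem _ hw)]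

/-- The entries of `W` with new labels; entries without a new label are omitted. -/
def relabel (g : α → Option α) (W : List (α × β)) : List (α × β) :=
  W.filterMap fun z => (g z.1).map fun i => (i, z.2)

theorem relabel_cons (g : α → Option α) (z : α × β) (W : List (α × β)) :
    relabel g (z :: W) = ((g z.1).map fun i => (i, z.2)).toList ++ relabel g W := by
  unfold relabel
  rcases h : g z.1 with - | i <;> simp [h]

theorem map_fst_relabel (g : α → Option α) (W : List (α × β)) :
    (relabel g W).map Prod.fst = (W.map Prod.fst).filterMap g := by
  induction W with
  | nil => rfl
  | cons z W ih =>
    rw [relabel_cons, List.map_append, ih, List.map_cons, List.filterMap_cons]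
    rcases h : g z.1 with - | i <;> simp

theorem map_snd_relabel {g : α → Option α} {W : List (α × β)} (h : ∀ z ∈ W, g z.1 ≠ none) :
    (relabel g W).map Prod.snd = W.map Prod.snd := by
  induction W with
  | nil => rfl
  | cons z W ih =>
    rw [relabel_cons, List.map_append, ih fun w hw => h w (List.mem_cons_of_mem _ hw), List.map_cons]
    obtain ⟨i, hi⟩ := Option.ne_none_iff_exists'.1 (h z List.mem_cons_self)
    simp [hi]

variable [DecidableEq α]

/-- The entries with the label `i`. -/
def col (i : α) (W : List (α × β)) : List β := (W.filter fun z => z.1 = i).map Prod.snd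

theorem col_append (i : α) (W W' : List (α × β)) : col i (W ++ W') = col i W ++ col i W' := by
  simp [col]

theorem col_cons (i : α) (z : α × β) (W : List (α × β)) :
    col i (z :: W) = if z.1 = i then z.2 :: col i W else col i W := by
  unfold col
  rw [List.filter_cons]
  by_cases h : z.1 = i <;> simp [h]

theorem length_col (i : α) (W : List (α × β)) :
    (col i W).length = (W.map Prod.fst).count i := by
  induction W with
  | nil => rfl
  | cons z W ih =>
    rw [col_cons, List.map_cons, List.count_cons]
    by_cases h : z.1 = i <;> simp [h, ih]

theorem mem_col {i : α} {W : List (α × β)} {x : β} : x ∈ col i W ↔ (i, x) ∈ W := by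
  simp only [col, List.mem_map, List.mem_filter, decide_eq_true_eq]
  constructor
  · rintro ⟨⟨j, y⟩, ⟨h, rfl⟩, rfl⟩
    exact h
  · exact fun h => ⟨(i, x), ⟨h, rfl⟩, rfl⟩

theorem col_map_pair (i j : α) (w : List β) :
    col i (w.map fun x => (j, x)) = if j = i then w else [] := by
  induction w with
  | nil => simp [col]
  | cons x w ih =>
    rw [List.map_cons, col_cons, ih]
    by_cases h : j = i <;> simp [h]

/-- A sequence of labels and a sequence of entries for each label can be merged. -/
theorem exists_merge (o : List α) (ws : α → List β) (h : ∀ i, o.count i = (ws i).length) :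
    ∃ W : List (α × β), W.map Prod.fst = o ∧ ∀ i, col i W = ws i := by
  induction o generalizing ws with
  | nil => exact ⟨[], rfl, fun i => (List.length_eq_zero_iff.1 (h i).symm).symm⟩
  | cons j o ih =>
    rcases hj : ws j with - | ⟨x, w⟩
    · have := h j
      rw [hj] at this
      simp at this
    · obtain ⟨W, h1, h2⟩ := ih (Function.update ws j w) (by
        intro i
        have hi := h i
        by_cases e : i = j
        · subst e
          rw [hj] at hi
          simpa using hi
        · rw [List.count_cons_of_ne (Ne.symm e)] at hi
          rwa [Function.update_of_ne e])
      refine ⟨(j, x) :: W, by rw [List.map_cons, h1], fun i => ?_⟩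
      rw [col_cons, h2]
      by_cases e : j = i
      · subst e
        simp [hj]
      · rw [if_neg e, Function.update_of_ne (Ne.symm e)]

theorem col_relabel {g : α → Option α} {W : List (α × β)} {i j : α}
    (h : ∀ z ∈ W, g z.1 = some i ↔ z.1 = j) : col i (relabel g W) = col j W := by
  induction W with
  | nil => rfl
  | cons z W ih =>
    rw [relabel_cons, col_append, ih fun w hw => h w (List.mem_cons_of_mem _ hw), col_cons]
    have hz := h z List.mem_cons_self
    by_cases e : z.1 = j
    · rw [hz.2 e]
      simp [e, col]
    · rcases hg : g z.1 with - | m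
      · simp [e, col]
      · have : m ≠ i := fun hm => e (hz.1 (hm ▸ hg))
        simp [e, col, this]

theorem col_flatMap (l : List α) (hl : l.Nodup) (ws : α → List β) {i : α} (hi : i ∈ l) :
    col i (l.flatMap fun j => (ws j).map fun x => (j, x)) = ws i := by
  have : ∀ l : List α, col i (l.flatMap fun j => (ws j).map fun x => (j, x)) =
      l.flatMap fun j => if j = i then ws j else [] := by
    intro l
    induction l with
    | nil => rfl
    | cons j l ih => rw [List.flatMap_cons, col_append, ih, col_map_pair, List.flatMap_cons]
  rw [this, flatMap_eq_of_unique hl hi fun z _ hz => if_neg hz, if_pos rfl]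

end Vertical

section OrderValid

variable {k n : ℕ}

/-- `W` lists the decorations of all propagating edges in their vertical order, labelled by the
north ends of the edges. -/
structure IsVertical (d : Diagram k) (W : List (Fin k × Deco)) : Prop where
  fst : W.map Prod.fst = d.order
  col : ∀ i, col i W = if d.IsProp (.inl i) then d.word (.inl i) else []

theorem exists_isVertical {d : Diagram k} (hd : d.IsDiagram) (h : d.aValue = 1) :
    ∃ W, d.IsVertical W := by
  obtain ⟨W, h1, h2⟩ := exists_merge d.order
    (fun i => if d.IsProp (.inl i) then d.word (.inl i) else []) (by
      intro i
      rw [hd.order_count h]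
      split_ifs <;> rfl)
  exact ⟨W, h1, h2⟩

theorem IsVertical.isProp {d : Diagram k} {W : List (Fin k × Deco)} (h : d.IsVertical W)
    {z : Fin k × Deco} (hz : z ∈ W) : d.IsProp (.inl z.1) ∧ z.2 ∈ d.word (.inl z.1) := by
  have h1 := h.col z.1
  have h2 : z.2 ∈ Diagram.col z.1 W := mem_col.2 hz
  rw [h1] at h2
  split_ifs at h2 with hp
  · exact ⟨hp, h2⟩
  · cases h2

theorem IsVertical.mem {d : Diagram k} {W : List (Fin k × Deco)} (h : d.IsVertical W) {i : Fin k}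
    (hi : d.IsProp (.inl i)) {x : Deco} : (i, x) ∈ W ↔ x ∈ d.word (.inl i) := by
  rw [← mem_col, h.col, if_pos hi]

/-- For `a`-value `1`: read from top to bottom, the decorations of the propagating edges relate the
states of the two faces. -/
def OrderValid (d : Diagram (n + 2)) : Prop :=
  ∃ W, d.IsVertical W ∧ run (W.map Prod.snd) (d.faceState .inl) = some (d.faceState .inr)

/-- The decorations required on the non-propagating edge of a face with a given state. -/
def stateWord : Option Bool → List Deco
  | none => []
  | some b => [dot b]

variable {top bot : Diagram k}

/-- In a product, if the `a`-values are all `1`, a propagating edge either crosses the interface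
once, or it runs through the non-propagating edges at the interface of the lower and then of the
upper box. -/
theorem path_of_onlyCup (ht : top.IsDiagram) (hb : bot.IsDiagram) {x y : Fin k}
    (hbc : bot.IsOnlyCup .inl x y) {i j₀ j m : Fin k} {L} (hi : top.mate (.inl i) = .inr j₀)
    (h : Path top bot (true, j₀) (L ++ [(true, j)]) (.inr m)) :
    (L = [] ∧ j = j₀) ∨ ∃ j₁, L = [(true, j₀), (false, j₁)] ∧ bot.mate (.inl j₀) = .inl j₁ ∧
      top.mate (.inr j₁) = .inr j := by
  generalize hl : L ++ [(true, j)] = l at h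
  generalize he : (Sum.inr m : Node k) = e at h
  have first : ∀ {s : Bool × Fin k} {l e}, Path top bot s l e → ∃ l', l = s :: l' := by
    intro s l e h
    cases h <;> exact ⟨_, rfl⟩
  have cup : ∀ {u v : Fin k}, bot.mate (.inl u) = .inl v → u = x ∨ u = y := fun h =>
    (hbc.not_isProp hb (Or.inl rfl)).1 ((not_isProp_face (Or.inl rfl)).2 ⟨_, h⟩)
  cases h with
  | last h =>
    left
    rcases L with - | ⟨z, L⟩
    · simpa using hl
    · simp at hl
  | @cons _ t l' _ h h' =>
    right
    rw [next_eq_some] at h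
    rcases t with ⟨b | b, j₁⟩ <;> simp [entry, box] at h
    cases h' with
    | last h2 =>
      exfalso
      simp only [exit] at he
      simp only [next, ← he] at h2
      cases h2
    | @cons _ t l'' _ h2 h3 =>
      rw [next_eq_some] at h2
      rcases t with ⟨b | b, j₂⟩ <;> simp [entry, box] at h2
      cases h3 with
      | last h4 =>
        refine ⟨j₁, ?_, h, ?_⟩
        · rcases L with - | ⟨z, - | ⟨z', - | ⟨z'', L⟩⟩⟩ <;> simp_all
        · rcases L with - | ⟨z, - | ⟨z', - | ⟨z'', L⟩⟩⟩ <;> simp_all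
      | @cons _ t l3 _ h4 h5 =>
        exfalso
        rw [next_eq_some] at h4
        rcases t with ⟨b | b, j₃⟩ <;> simp [entry, box] at h4
        -- The lower box has only one non-propagating edge at the interface.
        have c0 := cup h
        have c1 := cup (hb.mate_eq_iff.1 h)
        have c2 := cup h4
        have n01 : j₀ ≠ j₁ := by
          rintro rfl
          exact hb.mate_ne _ h
        have n12 : j₁ ≠ j₂ := by
          rintro rfl
          exact ht.mate_ne _ h2
        have n02 : j₀ ≠ j₂ := by
          rintro rfl
          have := ht.mate_eq_iff.1 h2
          rw [ht.mate_eq_iff.1 hi] at this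
          cases this
        rcases c0 with rfl | rfl <;> rcases c1 with rfl | rfl <;> rcases c2 with rfl | rfl <;>
          first
          | exact n01 rfl
          | exact n12 rfl
          | exact n02 rfl

end OrderValid

end Diagram

end DecoratedTL

namespace DecoratedTL

namespace Diagram

section Composite

variable {k n : ℕ}

/-! ### Products of diagrams with `a`-value one -/

theorem aValue_le_one {d : Diagram k} (hd : d.IsDiagram)
    (h : (Finset.univ.filter fun i : Fin k => ¬ d.IsProp (.inl i)).card ≤ 2) : d.aValue ≤ 1 := by
  rw [aValue, Finset.card_le_one]
  have key : ∀ a b : Fin k, a < b → (∃ j, a < j ∧ d.mate (.inl a) = .inl j) →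
      (∃ j, b < j ∧ d.mate (.inl b) = .inl j) → False := by
    rintro a b hab ⟨j, haj, hj⟩ ⟨l, hbl, hl⟩
    have : ({a, b, l} : Finset (Fin k)) ⊆ Finset.univ.filter fun i : Fin k => ¬ d.IsProp (.inl i) := by
      intro i hi
      simp only [Finset.mem_insert, Finset.mem_singleton] at hi
      simp only [Finset.mem_filter, Finset.mem_univ, true_and]
      rcases hi with rfl | rfl | rfl <;> rw [isProp_inl] <;> rintro ⟨c, hc⟩
      · rw [hj] at hc; cases hc
      · rw [hl] at hc; cases hc
      · rw [hd.mate_eq_iff.1 hl] at hc; cases hc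
    have h3 := (Finset.card_le_card this).trans h
    rw [Finset.card_eq_three.2 ⟨a, b, l, hab.ne, (hab.trans hbl).ne, hbl.ne, rfl⟩] at h3
    omega
  intro a ha b hb
  simp only [Finset.mem_filter, Finset.mem_univ, true_and] at ha hb
  rcases lt_trichotomy a b with hl | hl | hl
  · exact (key a b hl ha hb).elim
  · exact hl
  · exact (key b a hl hb ha).elim

/-- What is needed of a diagram with `a`-value `1` to keep track of the vertical order in products.
-/
structure GoodOne (d : Diagram (n + 2)) : Prop where
  isLR : d.IsLR
  aValue : d.aValue = 1
  orderValid : d.OrderValid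
  cup : ∀ f : Fin (n + 2) → Node (n + 2), f = .inl ∨ f = .inr → ∀ i, ¬ d.IsProp (f i) →
    d.word (f i) = stateWord (d.faceState f)

variable {top bot : Diagram (n + 2)}

theorem onlyCup_eq {d : Diagram k} (hd : d.IsDiagram) {f : Fin k → Node k} (hf : f = .inl ∨ f = .inr)
    {x y i j : Fin k} (h : d.IsOnlyCup f x y) (h' : d.mate (f i) = f j) :
    (i = x ∧ j = y) ∨ (i = y ∧ j = x) := by
  have hj := hd.mate_eq_iff.1 h.mate
  rcases (h.not_isProp hd hf).1 ((not_isProp_face hf).2 ⟨_, h'⟩) with rfl | rfl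
  · left
    exact ⟨rfl, face_injective hf (h'.symm.trans h.mate)⟩
  · right
    exact ⟨rfl, face_injective hf (h'.symm.trans hj)⟩

theorem concat_isProp_inr (hb : bot.IsDiagram)
    (hC : (concat top bot).IsDiagram) (ha : (concat top bot).aValue = 1) (hb1 : bot.aValue = 1)
    {m : Fin (n + 2)} : (concat top bot).IsProp (.inr m) ↔ bot.IsProp (.inr m) := by
  obtain ⟨x, y, hc⟩ := exists_onlyCup_south hC ha
  obtain ⟨u, v, hc'⟩ := exists_onlyCup_south hb hb1
  have h1 := onlyCup_eq hC (Or.inr rfl) hc (concat_mate_inr (top := top) hc'.mate).1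
  rw [← not_iff_not, hc.not_isProp hC (Or.inr rfl), hc'.not_isProp hb (Or.inr rfl)]
  rcases h1 with ⟨rfl, rfl⟩ | ⟨rfl, rfl⟩
  · rfl
  · exact or_comm

theorem concat_isProp_inl (ht : top.IsDiagram) (hC : (concat top bot).IsDiagram)
    (ha : (concat top bot).aValue = 1) (ht1 : top.aValue = 1) {m : Fin (n + 2)} :
    (concat top bot).IsProp (.inl m) ↔ top.IsProp (.inl m) := by
  obtain ⟨x, y, hc⟩ := exists_onlyCup_north hC ha
  obtain ⟨u, v, hc'⟩ := exists_onlyCup_north ht ht1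
  have h1 := onlyCup_eq hC (Or.inl rfl) hc (concat_mate_inl (bot := bot) hc'.mate).1
  rw [← not_iff_not, hc.not_isProp hC (Or.inl rfl), hc'.not_isProp ht (Or.inl rfl)]
  rcases h1 with ⟨rfl, rfl⟩ | ⟨rfl, rfl⟩
  · rfl
  · exact or_comm

/-- The south face of the product contains all non-propagating edges of the south face of `bot`. -/
theorem bot_aValue (hb : bot.IsDiagram) (hC : (concat top bot).IsDiagram)
    (ha : (concat top bot).aValue = 1) (hb0 : bot.aValue ≠ 0) : bot.aValue = 1 := by
  have h1 : (Finset.univ.filter fun i : Fin (n + 2) => ¬ (concat top bot).IsProp (.inr i)).card ≤ 2 := by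
    obtain ⟨x, y, hc⟩ := exists_onlyCup_south hC ha
    refine (Finset.card_le_card (t := {x, y}) fun i hi => ?_).trans Finset.card_le_two
    simpa using (hc.not_isProp hC (Or.inr rfl)).1 (Finset.mem_filter.1 hi).2
  have h2 : (Finset.univ.filter fun i : Fin (n + 2) => ¬ bot.IsProp (.inr i)).card ≤ 2 := by
    refine (Finset.card_le_card fun i hi => ?_).trans h1
    simp only [Finset.mem_filter, Finset.mem_univ, true_and] at hi ⊢
    obtain ⟨j, hj⟩ := (not_isProp_face (Or.inr rfl)).1 hi
    exact (not_isProp_face (Or.inr rfl)).2 ⟨j, (concat_mate_inr hj).1⟩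
  rw [← card_nonProp hb] at h2
  have := aValue_le_one hb h2
  omega

/-- At the interface the decorations of the non-propagating edges of the two boxes relate the state
of the south face of the upper box and the state of the north face of the lower box. -/
theorem run_stateWord {s t : Option Bool} (h : s = none ∨ t = none) :
    run (stateWord t ++ stateWord s) s = some t := by
  rcases h with rfl | rfl
  · rcases t with - | b
    · rfl
    · rw [stateWord, stateWord, List.append_nil, run_singleton, act_dot]
      exact Or.inl ⟨rfl, rfl⟩
  · rcases s with - | b
    · rfl
    · rw [stateWord, stateWord, List.nil_append, run_singleton, act_dot]
      exact Or.inr ⟨rfl, rfl⟩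

/-- The decorations which a propagating edge of a product meets at the interface: their description
when all `a`-values are `1`. -/
theorem exists_mid (ht : GoodOne top) (hb : GoodOne bot) (i : Fin (n + 2)) :
    ∃ mid : List Deco, (¬ (concat top bot).IsProp (.inl i) → mid = []) ∧
      ((concat top bot).IsProp (.inl i) → ∃ j₀ j, top.mate (.inl i) = .inr j₀ ∧
        northEnd top bot j = some i ∧ bot.IsProp (.inl j) ∧
        (concat top bot).word (.inl i) = top.word (.inl i) ++ mid ++ bot.word (.inl j) ∧
        ((mid = [] ∧ bot.IsProp (.inl j₀)) ∨
          ∃ j₁, bot.mate (.inl j₀) = .inl j₁ ∧ top.mate (.inr j₁) = .inr j ∧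
            mid = stateWord (bot.faceState .inl) ++ stateWord (top.faceState .inr))) := by
  have hI := ht.isLR.isDiagram
  have hI' := hb.isLR.isDiagram
  by_cases hp : (concat top bot).IsProp (.inl i)
  · obtain ⟨m, hm⟩ := isProp_inl.1 hp
    obtain ⟨j₀, j, L, h1, h2, h3, h4, h5⟩ := concat_prop hI hI' hm
    obtain ⟨x, y, hc⟩ := exists_onlyCup_north hI' hb.aValue
    refine ⟨_, fun h => absurd hp h, fun _ => ⟨j₀, j, h1, h3, isProp_inl.2 ⟨m, h2⟩, h5, ?_⟩⟩
    rcases path_of_onlyCup hI hI' hc h1 h4 with ⟨rfl, rfl⟩ | ⟨j₁, rfl, h6, h7⟩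
    · exact Or.inl ⟨rfl, isProp_inl.2 ⟨m, h2⟩⟩
    · refine Or.inr ⟨j₁, h6, h7, ?_⟩
      simp only [List.flatMap_cons, List.flatMap_nil, List.append_nil, piece]
      rw [hb.cup .inl (Or.inl rfl) _ ((not_isProp_face (Or.inl rfl)).2 ⟨_, h6⟩),
        ht.cup .inr (Or.inr rfl) _ ((not_isProp_face (Or.inr rfl)).2 ⟨_, h7⟩)]
  · exact ⟨[], fun _ => rfl, fun h => absurd h hp⟩

/-- At the interface the decorations taken up by all propagating edges relate the state of the south
face of `top` to the state of the north face of `bot`: only one propagating edge runs through the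
two non-propagating edges at the interface, and it meets the decorations which their states require;
if no edge does so, these two edges form a loop and the states agree. -/
theorem run_mid (hn : 2 ≤ n) (ht : GoodOne top) (hb : GoodOne bot) (ha : (concat top bot).aValue = 1)
    (mid : Fin (n + 2) → List Deco)
    (h0 : ∀ i, ¬ (concat top bot).IsProp (.inl i) → mid i = [])
    (h1 : ∀ i, (concat top bot).IsProp (.inl i) → ∃ j₀ j, top.mate (.inl i) = .inr j₀ ∧
        northEnd top bot j = some i ∧ bot.IsProp (.inl j) ∧
        (concat top bot).word (.inl i) = top.word (.inl i) ++ mid i ++ bot.word (.inl j) ∧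
        ((mid i = [] ∧ bot.IsProp (.inl j₀)) ∨
          ∃ j₁, bot.mate (.inl j₀) = .inl j₁ ∧ top.mate (.inr j₁) = .inr j ∧
            mid i = stateWord (bot.faceState .inl) ++ stateWord (top.faceState .inr))) :
    run ((List.finRange (n + 2)).flatMap mid) (top.faceState .inr) = some (bot.faceState .inl) := by
  have hI := ht.isLR.isDiagram
  have hI' := hb.isLR.isDiagram
  obtain ⟨c, c', hc⟩ := exists_onlyCup_south hI ht.aValue
  obtain ⟨e, e', he⟩ := exists_onlyCup_north hI' hb.aValue
  have np := fun i => hc.not_isProp (i := i) hI (Or.inr rfl)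
  have np' := fun i => he.not_isProp (i := i) hI' (Or.inl rfl)
  by_cases hce : c = e
  · have hce' : c' = e' := by
      have := hc.succ
      have := he.succ
      subst hce
      ext
      omega
    subst hce hce'
    have h2 : (List.finRange (n + 2)).flatMap mid = [] := by
      rw [List.flatMap_eq_nil_iff]
      intro i _
      by_cases hp : (concat top bot).IsProp (.inl i)
      · obtain ⟨j₀, j, h2, -, -, -, h3⟩ := h1 i hp
        rcases h3 with h3 | ⟨j₁, h3, -⟩
        · exact h3.1
        · exfalso
          have := (np' j₀).1 ((not_isProp_face (Or.inl rfl)).2 ⟨_, h3⟩)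
          exact (np j₀).2 this (isProp_inr.2 ⟨_, hI.mate_eq_iff.1 h2⟩)
      · exact h0 i hp
    have h3 : top.faceState .inr = bot.faceState .inl := by
      have : ∀ i, top.IsProp (.inr i) ↔ bot.IsProp (.inl i) := by
        intro i
        rw [← not_iff_not, np, np']
      unfold faceState
      simp only [this]
    rw [h2, h3]
    rfl
  · -- The two non-propagating edges at the interface have one node in common.
    obtain ⟨j₀, hj₀, hj₀'⟩ : ∃ j₀, top.IsProp (.inr j₀) ∧ ¬ bot.IsProp (.inl j₀) := by
      by_contra hcon
      push Not at hcon
      have key : ∀ j, j = e ∨ j = e' → j = c ∨ j = c' := by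
        intro j hj
        by_contra hj'
        rw [← np j, not_not] at hj'
        exact (np' j).2 hj (hcon j hj')
      have k1 := key e (Or.inl rfl)
      have k2 := key e' (Or.inr rfl)
      have s1 := hc.succ
      have s2 := he.succ
      apply hce
      ext
      rcases k1 with rfl | rfl
      · rfl
      · rcases k2 with rfl | rfl <;> omega
    obtain ⟨i₀, hi₀⟩ := isProp_inr.1 hj₀
    have hi₀' := hI.mate_eq_iff.1 hi₀
    have hp₀ := isProp_concat hI hI' (by rw [ht.aValue]; omega) ha (isProp_inl.2 ⟨_, hi₀'⟩)
    obtain ⟨a, j, ha1, -, -, -, ha3⟩ := h1 i₀ hp₀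
    rw [hi₀'] at ha1
    obtain rfl := Sum.inr_injective ha1
    rcases ha3 with ⟨-, ha3⟩ | ⟨j₁, hj₁, hj, hmid⟩
    · exact absurd ha3 hj₀'
    have eq1 := onlyCup_eq hI' (Or.inl rfl) he hj₁
    have eq2 := onlyCup_eq hI (Or.inr rfl) hc hj
    have uniq : ∀ i ∈ List.finRange (n + 2), i ≠ i₀ → mid i = [] := by
      intro i _ hne
      by_cases hp : (concat top bot).IsProp (.inl i)
      · obtain ⟨b, j', hb1, -, -, -, hb3⟩ := h1 i hp
        rcases hb3 with hb3 | ⟨b₁, hb₁, hj', -⟩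
        · exact hb3.1
        · exfalso
          have eq3 := onlyCup_eq hI' (Or.inl rfl) he hb₁
          have hbj : b = j₀ ∨ b₁ = j₀ := by
            rcases eq1 with ⟨rfl, rfl⟩ | ⟨rfl, rfl⟩ <;> rcases eq3 with ⟨rfl, rfl⟩ | ⟨rfl, rfl⟩ <;> simp
          rcases hbj with rfl | rfl
          · exact hne (Sum.inl_injective (hI.mate_injective (hb1.trans hi₀'.symm)))
          · rw [hi₀] at hj'
            cases hj'
      · exact h0 i hp
    rw [flatMap_eq_of_unique (List.nodup_finRange _) (List.mem_finRange i₀) uniq, hmid]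
    apply run_stateWord
    -- Two different edges with a common node cannot both meet a corner.
    by_contra hcon
    rw [not_or] at hcon
    obtain ⟨b, hb'⟩ := Option.ne_none_iff_exists'.1 hcon.1
    obtain ⟨b', hb''⟩ := Option.ne_none_iff_exists'.1 hcon.2
    rw [faceState_eq_some hn hI ht.aValue (Or.inr rfl)] at hb'
    rw [faceState_eq_some hn hI' hb.aValue (Or.inl rfl)] at hb''
    have r1 := (hc.corner hI (Or.inr rfl) hb').2
    have r2 := (he.corner hI' (Or.inl rfl) hb'').2
    have q1 := (r1 j₁).1 ((not_isProp_face (Or.inr rfl)).2 ⟨_, hj⟩)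
    have q2 := (r2 j₁).1 ((not_isProp_face (Or.inl rfl)).2 ⟨_, hI'.mate_eq_iff.1 hj₁⟩)
    have q3 := mt (r1 j₀).2 (not_not.2 hj₀)
    have q4 := (r2 j₀).1 hj₀'
    unfold off at q1 q2 q3 q4
    have := j₀.2
    have := j₁.2
    cases b <;> cases b' <;> simp only [Bool.false_eq_true, if_true, if_false] at q1 q2 q3 q4 <;> omega

/-- The vertical order of a product satisfies the condition on states. -/
theorem concat_orderValid (hn : 2 ≤ n) (ht : GoodOne top) (hb : GoodOne bot)
    (hC : (concat top bot).IsDiagram) (ha : (concat top bot).aValue = 1) :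
    (concat top bot).OrderValid := by
  have hI := ht.isLR.isDiagram
  have hI' := hb.isLR.isDiagram
  choose mid h0 h1 using exists_mid ht hb
  obtain ⟨W₁, v₁, r₁⟩ := ht.orderValid
  obtain ⟨W₂, v₂, r₂⟩ := hb.orderValid
  have hne : ∀ z ∈ W₂, northEnd top bot z.1 ≠ none := by
    intro z hz
    obtain ⟨m, hm⟩ := isProp_inl.1 (v₂.isProp hz).1
    have hp : (concat top bot).IsProp (.inr m) := by
      rw [concat_isProp_inr hI' hC ha hb.aValue, isProp_inr]
      exact ⟨_, hI'.mate_eq_iff.1 hm⟩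
    obtain ⟨i, hi⟩ := isProp_inr.1 hp
    obtain ⟨j₀, j, L, -, h2, h3, -⟩ := concat_prop hI hI' (hC.mate_eq_iff.1 hi)
    rw [← Sum.inl_injective (hI'.mate_injective (h2.trans hm.symm)), h3]
    simp
  refine ⟨W₁ ++ ((List.finRange (n + 2)).flatMap fun i => (mid i).map fun x => (i, x)) ++
    relabel (northEnd top bot) W₂, ⟨?_, ?_⟩, ?_⟩
  · rw [concat_order, if_pos ha, concatOrder, List.map_append, List.map_append, map_fst_relabel,
      v₁.fst, v₂.fst, List.map_flatMap]
    congr 2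
    refine List.flatMap_congr fun i _ => ?_
    have hpp : (preConcat top bot).IsProp (.inl i) ↔ (concat top bot).IsProp (.inl i) := Iff.rfl
    rw [List.map_map]
    by_cases hp : (concat top bot).IsProp (.inl i)
    · rw [if_pos (hpp.2 hp)]
      obtain ⟨j₀, j, h2, h3, h4, h5, -⟩ := h1 i hp
      have e1 : (preConcat top bot).word (.inl i) = (concat top bot).word (.inl i) := rfl
      obtain ⟨m, hm⟩ := isProp_inl.1 h4
      have e2 := hI.order_count ht.aValue i
      have e3 := hI'.order_count hb.aValue j
      rw [if_pos (isProp_inl.2 ⟨_, h2⟩)] at e2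
      rw [if_pos h4] at e3
      rw [e1, h5, low_count hI hI' hm h3, e2, e3]
      have : (top.word (.inl i) ++ mid i ++ bot.word (.inl j)).length -
          ((top.word (.inl i)).length + (bot.word (.inl j)).length) = (mid i).length := by
        simp only [List.length_append]
        omega
      rw [this]
      exact List.map_const' ..
    · rw [if_neg (mt hpp.1 hp), h0 i hp]
      rfl
  · intro i
    rw [col_append, col_append, col_flatMap _ (List.nodup_finRange _) _ (List.mem_finRange i), v₁.col]
    by_cases hp : (concat top bot).IsProp (.inl i)
    · obtain ⟨j₀, j, h2, h3, h4, h5, -⟩ := h1 i hp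
      rw [if_pos hp, if_pos (isProp_inl.2 ⟨_, h2⟩), h5]
      congr 1
      rw [col_relabel (j := j), v₂.col, if_pos h4]
      intro z hz
      refine ⟨fun hz' => ?_, fun e => e ▸ h3⟩
      obtain ⟨m, hm⟩ := isProp_inl.1 h4
      obtain ⟨m', hm'⟩ := isProp_inl.1 (v₂.isProp hz).1
      have q1 := mate_of_northEnd hI hI' hm h3
      rw [mate_of_northEnd hI hI' hm' hz'] at q1
      obtain rfl := Sum.inr_injective q1
      exact Sum.inl_injective (hI'.mate_injective (hm'.trans hm.symm))
    · rw [if_neg hp, if_neg (mt (concat_isProp_inl hI hC ha ht.aValue).2 hp), h0 i hp]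
      have : col i (relabel (northEnd top bot) W₂) = [] := by
        rw [← List.length_eq_zero_iff, length_col, map_fst_relabel, v₂.fst,
          low_count_eq_zero hI hI' hp]
      rw [this]
      rfl
  · rw [List.map_append, List.map_append, map_snd_relabel hne, run_append_eq_some]
    have e1 : (concat top bot).faceState .inl = top.faceState .inl := by
      unfold faceState
      simp only [concat_isProp_inl hI hC ha ht.aValue]
    have e2 : (concat top bot).faceState .inr = bot.faceState .inr := by
      unfold faceState
      simp only [concat_isProp_inr hI' hC ha hb.aValue]
    rw [e1, e2]
    refine ⟨_, run_append_eq_some.2 ⟨_, r₁, ?_⟩, r₂⟩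
    have := run_mid hn ht hb ha mid h0 h1
    rw [List.map_flatMap]
    simpa [Function.comp_def] using this

end Composite

end Diagram

end DecoratedTL

namespace DecoratedTL

namespace Diagram

variable {n : ℕ} {d : Diagram (n + 2)}

/-! ### Reduced diagrams which satisfy the conditions on states are admissible -/

theorem alternates_word (hr : d.IsReduced) {p : Node (n + 2)} (h : ¬ (d.aValue = 1 ∧ d.IsProp p)) :
    Alternates (d.word p) := by
  rw [alternates_iff]
  intro u x y v hw
  exact hr p u x y v [] [] ⟨by rw [hw]; simp, fun h1 h2 => absurd ⟨h1, h2⟩ h⟩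

theorem exists_other_prop (h : 1 < d.numProp) (p : Node (n + 2)) :
    ∃ j e, d.mate (.inl j) = .inr e ∧ Sum.inl j ≠ p ∧ Sum.inl j ≠ d.mate p := by
  obtain ⟨i, j, hi, hj, hij⟩ := Finset.one_lt_card_iff.1 h
  obtain ⟨c, hc⟩ := isProp_inl.1 (Finset.mem_filter.1 hi).2
  obtain ⟨e, he⟩ := isProp_inl.1 (Finset.mem_filter.1 hj).2
  by_contra hcon
  push Not at hcon
  have h1 := hcon i c hc
  have h2 := hcon j e he
  by_cases q1 : Sum.inl i = p
  · by_cases q2 : Sum.inl j = p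
    · exact hij (Sum.inl_injective (q1.trans q2.symm))
    · have := h2 q2
      rw [← q1, hc] at this
      cases this
  · by_cases q2 : Sum.inl j = p
    · have := h1 q1
      rw [← q2, he] at this
      cases this
    · exact hij (Sum.inl_injective ((h1 q1).trans (h2 q2).symm))

theorem one_lt_numProp (hn : 2 ≤ n) (hd : d.IsDiagram) (h : d.aValue = 1) : 1 < d.numProp := by
  rw [numProp, Finset.one_lt_card_iff]
  exact ⟨d.endNode true .inl, d.endNode false .inl,
    by simpa using (endNode_isProp hn hd h true (Or.inl rfl)).1,
    by simpa using (endNode_isProp hn hd h false (Or.inl rfl)).1, endNode_ne hn hd h⟩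

/-- An edge which joins the two corners of one side is propagating. -/
theorem isProp_of_corner_mate (hd : d.IsDiagram) {b : Bool} {p : Node (n + 2)} (hp : IsCorner b p)
    (h : IsCorner b (d.mate p)) : d.IsProp p := by
  have h' := (isCorner_mate_iff hd hp).1 h
  rcases hp with rfl | rfl
  · exact isProp_inl.2 ⟨_, h'⟩
  · exact isProp_inr.2 ⟨_, hd.mate_eq_iff.1 h'⟩

theorem run_corner (he : d.EdgesValid) {b : Bool} {p : Node (n + 2)} (hp : IsCorner b p) :
    run (d.word p) (some b) = some (nodeState (d.mate p)) := by
  have := he p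
  rwa [nodeState_eq_some.2 hp] at this

/-- A non-propagating edge at a corner of a dammed diagram carries a single decoration. -/
theorem word_corner (hd : d.IsLR) (hr : d.IsReduced) (he : d.EdgesValid) {b : Bool}
    {p : Node (n + 2)} (hp : IsCorner b p) (h0 : 0 < d.numProp) (hnp : ¬ d.IsProp p) :
    d.word p = [dot b] := by
  obtain ⟨j, e, hj⟩ := numProp_pos.1 h0
  have hpj : d.IsProp (.inl j) := isProp_inl.2 ⟨_, hj⟩
  have ht := corner_type hd hp hj (fun h => hnp (h ▸ hpj))
    (fun h => hnp ((isProp_mate hd.isDiagram).1 (h ▸ hpj)))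
  rcases eq_of_type_of_run (alternates_word hr fun h => hnp h.2) ht (run_corner he hp) with
    ⟨h1, -⟩ | ⟨-, h1⟩
  · exact absurd (isProp_of_corner_mate hd.isDiagram hp (nodeState_eq_some.1 h1)) hnp
  · exact h1

/-- In an alternating sequence the state changes only at its ends, by `dot_at_end`. -/
theorem dotsOnlyAtCorners_of_valid (ha : ∀ p, Alternates (d.word p)) (he : d.EdgesValid) (b : Bool) :
    d.DotsOnlyAtCorners b := by
  intro p u v hw
  simpa only [nodeState_eq_some] using dot_at_end (ha p) (he p) hw

theorem undammedSide_of_valid (hd : d.IsLR) (hr : d.IsReduced) (he : d.EdgesValid)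
    (h0 : d.numProp = 0) (b : Bool) : d.UndammedSide b := by
  have hnp : ∀ p, ¬ d.IsProp p := by
    have h1 : ∀ i, ¬ d.IsProp (.inl i) := by
      intro i hi
      obtain ⟨j, hj⟩ := isProp_inl.1 hi
      have := numProp_pos.2 ⟨i, j, hj⟩
      omega
    rintro (i | i) hi
    · exact h1 i hi
    · obtain ⟨j, hj⟩ := isProp_inr.1 hi
      exact h1 j (isProp_inl.2 ⟨_, hd.isDiagram.mate_eq_iff.1 hj⟩)
  have ha : ∀ p, Alternates (d.word p) := fun p => alternates_word hr fun h => hnp p h.2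
  refine ⟨fun p hp => head?_eq_dot (ha p) (run_corner he hp) (Or.inl fun h => ?_),
    dotsOnlyAtCorners_of_valid ha he b⟩
  exact hnp p (isProp_of_corner_mate hd.isDiagram hp (nodeState_eq_some.1 h))

theorem singlePropSide_of_valid (hn : 2 ≤ n) (hd : d.IsLR) (hr : d.IsReduced) (he : d.EdgesValid)
    (h1 : d.numProp = 1) (b : Bool) : d.SinglePropSide b := by
  have ha1 : d.aValue ≠ 1 := fun h => by
    have := one_lt_numProp hn hd.isDiagram h
    omega
  have ha : ∀ p, Alternates (d.word p) := fun p => alternates_word hr fun h => ha1 h.1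
  refine ⟨fun p hp hnp => word_corner hd hr he hp (by omega) hnp, ?_, ?_, ?_,
    dotsOnlyAtCorners_of_valid ha he b⟩
  · rintro p hp - ⟨x, hx, hx'⟩ ⟨y, hy, hy'⟩
    refine head?_eq_dot (ha p) (run_corner he hp) (Or.inr ?_)
    rcases hw : d.word p with - | ⟨z, - | ⟨z', w⟩⟩
    · rw [hw] at hx
      cases hx
    · rw [hw, List.mem_singleton] at hx hy
      subst hx hy
      rw [hx'] at hy'
      cases hy'
    · simp
  · intro p hp _ hm hl
    obtain ⟨x, hx⟩ := List.length_eq_one_iff.1 hl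
    have h := run_corner he hp
    rw [nodeState_eq_some.2 hm, hx, run_singleton] at h
    rcases isOpen_eq_not_iff.1 (isOpen_of_act h) with rfl | rfl
    · rw [act_dot] at h
      simp at h
    · exact hx
  · intro p hp _ hm
    exact head?_eq_dot (ha p) (run_corner he hp) (Or.inl fun h => hm (nodeState_eq_some.1 h))

theorem manyPropSide_of_valid (hd : d.IsLR) (hr : d.IsReduced) (he : d.EdgesValid)
    (h2 : 1 < d.aValue) (h1 : 1 < d.numProp) (b : Bool) : d.ManyPropSide b := by
  have ha : ∀ p, Alternates (d.word p) := fun p => alternates_word hr fun h => by omega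
  have key : ∀ p, IsCorner b p →
      (nodeState (d.mate p) = some b ∧ (d.word p = [] ∨ d.word p = [tri b])) ∨
        (nodeState (d.mate p) = none ∧ d.word p = [dot b]) := fun p hp => by
    obtain ⟨j, e, hj, n1, n2⟩ := exists_other_prop h1 p
    exact eq_of_type_of_run (ha p) (corner_type hd hp hj n1 n2) (run_corner he hp)
  refine ⟨fun h => ?_, fun h p hp => ?_, dotsOnlyAtCorners_of_valid ha he b⟩
  · rcases key _ (Or.inl rfl) with ⟨-, h3⟩ | ⟨h3, -⟩
    · exact h3
    · rw [h, nodeState_eq_some.2 (Or.inr rfl)] at h3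
      cases h3
  · rcases key p hp with ⟨h3, -⟩ | ⟨-, h3⟩
    · exact absurd ((isCorner_mate_iff hd.isDiagram hp).1 (nodeState_eq_some.1 h3)) h
    · exact h3

theorem IsVertical.eq_endNode (hn : 2 ≤ n) (hd : d.IsLR) (h : d.aValue = 1)
    {W : List (Fin (n + 2) × Deco)} (hW : d.IsVertical W) {b : Bool} {z : Fin (n + 2) × Deco}
    (hz : z ∈ W) (ho : z.2.isOpen = !b) : z.1 = d.endNode b .inl :=
  eq_endNode_of_type hn hd h (hW.isProp hz).1 (hW.isProp hz).2 ho

theorem IsVertical.alternates (hn : 2 ≤ n) (hd : d.IsLR) (hr : d.IsReduced) (h : d.aValue = 1)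
    {W : List (Fin (n + 2) × Deco)} (hW : d.IsVertical W) : Alternates (W.map Prod.snd) := by
  rw [alternates_iff]
  intro u x y v hw hxy
  obtain ⟨U, V₁, rfl, -, hV₁⟩ := List.map_eq_append_iff.1 hw
  obtain ⟨⟨i, x'⟩, V₂, rfl, rfl, hV₂⟩ := List.map_eq_cons_iff.1 hV₁
  obtain ⟨⟨j, y'⟩, V, rfl, rfl, -⟩ := List.map_eq_cons_iff.1 hV₂
  simp only at hxy
  have hx : x'.isOpen = !(!x'.isOpen) := by simp
  have e1 := hW.eq_endNode hn hd h (z := (i, x')) (by simp) hx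
  have e2 := hW.eq_endNode hn hd h (z := (j, y')) (by simp) (hxy ▸ hx)
  simp only at e1 e2
  rw [← hxy] at e2
  obtain rfl : i = j := e1.trans e2.symm
  have hp := (hW.isProp (z := (i, x')) (by simp)).1
  refine hr (.inl i) (Diagram.col i U) x' y' (Diagram.col i V) (U.map Prod.fst) (V.map Prod.fst) ⟨?_, fun _ _ =>
    ⟨i, rfl, ?_, (length_col i U).symm⟩⟩ hxy
  · have := hW.col i
    rw [if_pos hp] at this
    rw [← this, col_append, col_cons, col_cons, if_pos rfl, if_pos rfl]
    simp
  · rw [← hW.fst]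
    simp [List.replicate]

/-- The decorations of the propagating edge next to a side are of the type of that side. -/
theorem endNode_type (hn : 2 ≤ n) (hd : d.IsLR) (h : d.aValue = 1) {b : Bool} {x : Deco}
    (hx : x ∈ d.word (.inl (d.endNode b .inl))) : x = dot b ∨ x = tri b := by
  rw [← isOpen_eq_not_iff]
  by_contra hne
  have ho : x.isOpen = !(!b) := by cases hx : x.isOpen <;> cases b <;> simp_all
  have := eq_endNode_of_type hn hd h (endNode_isProp hn hd.isDiagram h b (Or.inl rfl)).1 hx ho
  have hends := endNode_ne hn hd.isDiagram h
  cases b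
  · exact hends this.symm
  · exact hends this

theorem endCup_of_valid (hn : 2 ≤ n) (hd : d.IsLR) (hr : d.IsReduced) (he : d.EdgesValid)
    (h : d.aValue = 1) {b : Bool} {f : Fin (n + 2) → Node (n + 2)} (hf : f = .inl ∨ f = .inr)
    (h0 : ¬ d.IsProp (f (sideNode b 0))) : d.EndCup b f := by
  obtain ⟨x, y, hc⟩ := exists_onlyCup hd.isDiagram h hf
  refine ⟨(hc.corner hd.isDiagram hf h0).1, ?_⟩
  have := one_lt_numProp hn hd.isDiagram h
  refine word_corner hd hr he ?_ (by omega) h0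
  rcases hf with rfl | rfl
  · exact Or.inl rfl
  · exact Or.inr rfl

/-- The cases of (C5) are distinguished by the states of the two faces. The sequence of all
decorations in their vertical order alternates, so its `•` and `∘` are at its top and bottom, and
they are there precisely if the states require them. -/
theorem onePropEnd_of_valid (hn : 2 ≤ n) (hd : d.IsLR) (hr : d.IsReduced) (he : d.EdgesValid)
    (h : d.aValue = 1) (ho : d.OrderValid) (b : Bool) : d.OnePropEnd b := by
  have hI := hd.isDiagram
  obtain ⟨W, hW, hrun⟩ := ho
  have hal := hW.alternates hn hd hr h
  have hm := mate_endNode hn hI h b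
  have hpe := (endNode_isProp hn hI h b (Or.inl rfl)).1
  have sN := faceState_eq_some (b := b) hn hI h (Or.inl rfl)
  have sS := faceState_eq_some (b := b) hn hI h (Or.inr rfl)
  have hcol := hW.col (d.endNode b .inl)
  rw [if_pos hpe] at hcol
  have hmem := fun x => hW.mem (x := x) hpe
  have htype := fun x => endNode_type (b := b) (x := x) hn hd h
  -- A decoration `•` on the edge next to the given side is the first or the last one.
  have hdot : ∀ U V : List (Fin (n + 2) × Deco), W = U ++ (d.endNode b .inl, dot b) :: V →
      (U = [] ∧ ¬ d.IsProp (.inl (sideNode b 0))) ∨ (V = [] ∧ ¬ d.IsProp (.inr (sideNode b 0))) := by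
    intro U V hUV
    have := dot_at_end (u := U.map Prod.snd) (b := b) (v := V.map Prod.snd) hal hrun
      (by rw [hUV]; simp)
    rwa [sN, sS, List.map_eq_nil_iff, List.map_eq_nil_iff] at this
  have hfirst : ¬ d.IsProp (.inl (sideNode b 0)) →
      (d.IsProp (.inr (sideNode b 0)) ∨ 2 ≤ W.length) →
      ∃ M, W = (d.endNode b .inl, dot b) :: M := by
    intro h1 h2
    have := head?_eq_dot (b := b) hal (by rw [← sN.2 h1]; exact hrun) (by
      rw [List.length_map]
      refine h2.imp_left fun h2 h3 => sS.1 h3 h2)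
    obtain ⟨l, hl⟩ := List.head?_eq_some_iff.1 this
    obtain ⟨z, M, rfl, hz, -⟩ := List.map_eq_cons_iff.1 hl
    refine ⟨M, ?_⟩
    rw [← hz, ← hW.eq_endNode hn hd h (z := z) (by simp) (by rw [hz, isOpen_dot])]
  have hlast : ¬ d.IsProp (.inr (sideNode b 0)) →
      (d.IsProp (.inl (sideNode b 0)) ∨ 2 ≤ W.length) →
      ∃ M, W = M ++ [(d.endNode b .inl, dot b)] := by
    intro h1 h2
    have := getLast?_eq_dot (b := b) hal (by rw [← sS.2 h1]; exact hrun) (by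
      rw [List.length_map]
      refine h2.imp_left fun h2 h3 => sN.1 h3 h2)
    obtain ⟨l, hl⟩ := List.getLast?_eq_some_iff.1 this
    obtain ⟨M, V', rfl, -, hV'⟩ := List.map_eq_append_iff.1 hl
    obtain ⟨z, V, rfl, hz, hV⟩ := List.map_eq_cons_iff.1 hV'
    rw [List.map_eq_nil_iff] at hV
    subst hV
    refine ⟨M, ?_⟩
    rw [← hz, ← hW.eq_endNode hn hd h (z := z) (by simp) (by rw [hz, isOpen_dot])]
  have tri_of : ∀ M : List (Fin (n + 2) × Deco), (∀ z ∈ M, z ∈ W) →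
      (∀ U V, M = U ++ (d.endNode b .inl, dot b) :: V → False) →
      ∀ x ∈ col (d.endNode b .inl) M, x = tri b := by
    intro M hM hU x hx
    have hx := mem_col.1 hx
    rcases htype x ((hmem x).1 (hM _ hx)) with rfl | rfl
    · obtain ⟨U, V, hUV⟩ := List.append_of_mem hx
      exact (hU U V hUV).elim
    · rfl
  by_cases hN : d.IsProp (.inl (sideNode b 0)) <;> by_cases hS : d.IsProp (.inr (sideNode b 0))
  · have e1 : d.endNode b .inl = sideNode b 0 := if_pos hN
    have e2 : d.endNode b .inr = sideNode b 0 := if_pos hS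
    refine .vertical (by rw [← e1, hm, e2, e1]) ?_
    rw [← e1, ← hcol]
    refine tri_of W (fun _ h => h) fun U V hUV => ?_
    rcases hdot U V hUV with ⟨-, h1⟩ | ⟨-, h1⟩
    · exact h1 hN
    · exact h1 hS
  · have e1 : d.endNode b .inl = sideNode b 0 := if_pos hN
    have e2 : d.endNode b .inr = sideNode b 2 := if_neg hS
    obtain ⟨M, hM⟩ := hlast hS (Or.inl hN)
    refine .south (endCup_of_valid hn hd hr he h (Or.inr rfl) hS) (by rw [← e1, hm, e2])
      (col (d.endNode b .inl) M) (tri_of M (fun z hz => by rw [hM]; simp [hz]) fun U V hUV => ?_) ?_ ?_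
    · rcases hdot U (V ++ [(d.endNode b .inl, dot b)]) (by rw [hM, hUV]; simp) with ⟨-, h1⟩ | ⟨h1, -⟩
      · exact h1 hN
      · simp at h1
    · rw [← e1, ← hcol]
      conv_lhs => rw [hM, col_append, col_cons, if_pos rfl]
      rfl
    · rw [← hW.fst, ← e1, hM]
      simp
  · have e1 : d.endNode b .inl = sideNode b 2 := if_neg hN
    have e2 : d.endNode b .inr = sideNode b 0 := if_pos hS
    obtain ⟨M, hM⟩ := hfirst hN (Or.inl hS)
    refine .north (endCup_of_valid hn hd hr he h (Or.inl rfl) hN) (by rw [← e1, hm, e2])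
      (col (d.endNode b .inl) M) (tri_of M (fun z hz => by rw [hM]; simp [hz]) fun U V hUV => ?_) ?_ ?_
    · rcases hdot ((d.endNode b .inl, dot b) :: U) V (by rw [hM, hUV]; simp) with ⟨h1, -⟩ | ⟨-, h1⟩
      · simp at h1
      · exact h1 hS
    · rw [← e1, ← hcol]
      conv_lhs => rw [hM, col_cons, if_pos rfl]
      rfl
    · rw [← hW.fst, ← e1, hM]
      simp
  · have e1 : d.endNode b .inl = sideNode b 2 := if_neg hN
    have e2 : d.endNode b .inr = sideNode b 2 := if_neg hS
    have c1 := endCup_of_valid hn hd hr he h (Or.inl rfl) hN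
    have c2 := endCup_of_valid hn hd hr he h (Or.inr rfl) hS
    have h3 : d.mate (.inl (sideNode b 2)) = .inr (sideNode b 2) := by rw [← e1, hm, e2, e1]
    by_cases hl : 2 ≤ W.length
    · obtain ⟨M', hM'⟩ := hfirst hN (Or.inr hl)
      obtain ⟨M₀, hM₀⟩ := hlast hS (Or.inr hl)
      obtain ⟨M, rfl⟩ : ∃ M, M' = M ++ [(d.endNode b .inl, dot b)] := by
        rcases M₀ with - | ⟨z, M⟩
        · rw [hM₀] at hl
          simp at hl
        · rw [hM'] at hM₀
          simp only [List.cons_append, List.cons.injEq] at hM₀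
          exact ⟨M, hM₀.2⟩
      refine .both c1 c2 h3 (col (d.endNode b .inl) M)
        (tri_of M (fun z hz => by rw [hM']; simp [hz]) fun U V hUV => ?_) ?_ ?_ ?_
      · rcases hdot ((d.endNode b .inl, dot b) :: U) (V ++ [(d.endNode b .inl, dot b)])
          (by rw [hM', hUV]; simp) with ⟨h1, -⟩ | ⟨h1, -⟩
        · simp at h1
        · simp at h1
      · rw [← e1, ← hcol]
        conv_lhs => rw [hM', col_cons, if_pos rfl, col_append, col_cons, if_pos rfl]
        rfl
      · rw [← hW.fst, ← e1, hM']
        simp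
      · rw [← hW.fst, ← e1, hM₀]
        simp
    · -- At most one decoration on propagating edges, which is then a `▲` or `△` of the given side.
      have hall : ∀ z ∈ W, z = (d.endNode b .inl, tri b) := by
        rcases hW' : W with - | ⟨⟨i, x⟩, - | ⟨z', W'⟩⟩
        · simp
        · have h5 := hrun
          rw [hW', sN.2 hN, sS.2 hS, List.map_singleton, run_singleton] at h5
          have h6 := isOpen_of_act h5
          have h7 := hW.eq_endNode hn hd h (z := (i, x)) (by rw [hW']; simp) h6
          rcases isOpen_eq_not_iff.1 h6 with h8 | h8
          · simp only at h8
            rw [h8, act_dot] at h5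
            simp at h5
          · intro z hz
            rw [List.mem_singleton] at hz
            simp only at h7 h8
            rw [hz, h7, h8]
        · rw [hW'] at hl
          simp at hl
      refine .plain c1 c2 h3 ?_ ?_
      · rw [← e1, ← hcol]
        rcases hW' : W with - | ⟨z, - | ⟨z', W'⟩⟩
        · exact Or.inl rfl
        · right
          have := hall z (by rw [hW']; simp)
          rw [this, col_cons, if_pos rfl]
          rfl
        · rw [hW'] at hl
          simp at hl
      · have cupType : ∀ f : Fin (n + 2) → Node (n + 2), f = .inl ∨ f = .inr → d.EndCup b f →
            ¬ d.IsProp (f (sideNode b 0)) → ∀ i, ¬ d.IsProp (f i) → ∀ x ∈ d.word (f i),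
              x.isOpen = !b := by
          intro f hf hc h0 i hi x hx
          obtain ⟨u, v, huv⟩ := exists_onlyCup hI h hf
          have hi2 := ((huv.corner hI hf h0).2 i).1 hi
          have hx' : x ∈ d.word (f (sideNode b 0)) := by
            rcases Nat.eq_zero_or_pos (off b i) with h4 | h4
            · rwa [eq_sideNode (j := 0) h4] at hx
            · have e1' : i = sideNode b 1 :=
                eq_sideNode (b := b) (j := 1) (by rw [fin_val_one]; omega)
              rw [e1', ← hc.1,
                hI.mem_word_mate] at hx
              exact hx
          rw [hc.2, List.mem_singleton] at hx'
          rw [hx', isOpen_dot]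
        have propType : ∀ i, d.IsProp (.inl i) → ∀ x ∈ d.word (.inl i), x.isOpen = !b := by
          intro i hi x hx
          have := hall _ ((hW.mem hi).2 hx)
          rw [Prod.mk.injEq] at this
          rw [this.2, isOpen_tri]
        rintro (i | i) x hx
        · by_cases hi : d.IsProp (.inl i)
          · exact propType i hi x hx
          · exact cupType .inl (Or.inl rfl) c1 hN i hi x hx
        · by_cases hi : d.IsProp (.inr i)
          · obtain ⟨j, hj⟩ := isProp_inr.1 hi
            refine propType j (isProp_inl.2 ⟨_, hI.mate_eq_iff.1 hj⟩) x ?_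
            rw [← hj, hI.mem_word_mate]
            exact hx
          · exact cupType .inr (Or.inr rfl) c2 hS i hi x hx

/-- A reduced diagram which satisfies the conditions on states is admissible. -/
theorem isAdmissible_of_valid (hn : 2 ≤ n) (hd : d.IsLR) (hr : d.IsReduced)
    (hl : ∀ w ∈ d.loops, w = LoopWord.mk [.blackTri, .whiteTri]) (he : d.EdgesValid)
    (ho : d.aValue = 1 → d.OrderValid) : d.IsAdmissible where
  isLR := hd
  isReduced := hr
  loops := hl
  undammed h b := undammedSide_of_valid hd hr he h b
  singleProp h b := singlePropSide_of_valid hn hd hr he h b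
  manyProp h2 h1 b := manyPropSide_of_valid hd hr he h2 h1 b
  aValueOne h b := onePropEnd_of_valid hn hd hr he h (ho h) b

end Diagram

end DecoratedTL

namespace DecoratedTL

namespace Diagram

variable {n : ℕ} {d : Diagram (n + 2)}

/-! ### Admissible diagrams satisfy the conditions on states -/

/-- If `•` and `∘` occur only at the corners, and occur there next to the node, then the states at
the ends of the edge are related by its decorations. -/
theorem run_word_of_dots (hd : d.IsDiagram) (hdots : ∀ b, d.DotsOnlyAtCorners b) (p : Node (n + 2))
    (hh : ∀ b q, q = p ∨ q = d.mate p → IsCorner b q → (d.word q).head? = some (dot b))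
    (hl : ∀ b, IsCorner b p → IsCorner b (d.mate p) → (d.word p).length ≠ 1) :
    run (d.word p) (nodeState p) = some (nodeState (d.mate p)) := by
  have hlast : ∀ b, IsCorner b (d.mate p) → (d.word p).getLast? = some (dot b) := by
    intro b hb
    have := hh b _ (Or.inr rfl) hb
    rwa [hd.word_mate, List.head?_reverse] at this
  refine run_of_dots (fun b hb => hh b p (Or.inl rfl) (nodeState_eq_some.1 hb))
    (fun b hb => hlast b (nodeState_eq_some.1 hb)) (fun b u v hw => ?_) (fun h1 h2 h3 => ?_)
  · rw [nodeState_eq_some, nodeState_eq_some]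
    exact hdots b p u v hw
  · obtain ⟨b, hb⟩ := Option.ne_none_iff_exists'.1 h1
    obtain ⟨c, hc⟩ := Option.ne_none_iff_exists'.1 h2
    rw [nodeState_eq_some] at hb hc
    have e1 := hh b p (Or.inl rfl) hb
    have e2 := hlast c hc
    obtain ⟨x, hx⟩ := List.length_eq_one_iff.1 h3
    rw [hx] at e1 e2
    simp only [List.head?_cons, List.getLast?_singleton, Option.some.injEq] at e1 e2
    obtain rfl := dot_injective (e1.symm.trans e2)
    exact hl b hb hc h3

theorem edgesValid_of_undammed (hd : d.IsDiagram) (h : ∀ b, d.UndammedSide b) (h0 : d.numProp = 0) :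
    d.EdgesValid := by
  intro p
  refine run_word_of_dots hd (fun b => (h b).2) p (fun b q _ hq => (h b).1 q hq) fun b hp hm _ => ?_
  have := (isCorner_mate_iff hd hp).1 hm
  have := numProp_pos.2 ⟨_, _, this⟩
  omega

theorem mixed_of_alternates {w : List Deco} (ha : Alternates w) (h : 2 ≤ w.length) :
    (∃ x ∈ w, x.isOpen = true) ∧ ∃ x ∈ w, x.isOpen = false := by
  rcases w with - | ⟨x, - | ⟨y, w⟩⟩
  · simp at h
  · simp at h
  · have := Alternates.adjacent (u := []) ha
    cases hx : x.isOpen <;> cases hy : y.isOpen <;> simp_all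

theorem edgesValid_of_singleProp (hd : d.IsDiagram) (hr : d.IsReduced) (ha : d.aValue ≠ 1)
    (h : ∀ b, d.SinglePropSide b) : d.EdgesValid := by
  intro p
  have hal : ∀ p, Alternates (d.word p) := fun p => alternates_word hr fun h => ha h.1
  by_cases hc : ∃ b, IsCorner b p ∧ IsCorner b (d.mate p)
  · obtain ⟨b, hp, hm⟩ := hc
    have hprop := isProp_of_corner_mate hd hp hm
    have hprop' := (isProp_mate hd).2 hprop
    rcases Nat.lt_or_ge (d.word p).length 2 with hl | hl
    · rw [nodeState_eq_some.2 hp, nodeState_eq_some.2 hm]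
      rcases Nat.eq_zero_or_pos (d.word p).length with h0 | h0
      · rw [List.length_eq_zero_iff.1 h0]
        rfl
      · rw [(h b).vertical p hp hprop hm (by omega)]
        exact run_tri (b := b) (by simp) (by simp)
    · have key : ∀ c q, q = p ∨ q = d.mate p → IsCorner c q → (d.word q).head? = some (dot c) := by
        intro c q hq hcq
        have hq' : d.IsProp q ∧ 2 ≤ (d.word q).length := by
          rcases hq with rfl | rfl
          · exact ⟨hprop, hl⟩
          · exact ⟨hprop', by rwa [hd.word_mate, List.length_reverse]⟩
        obtain ⟨h1, h2⟩ := mixed_of_alternates (hal q) hq'.2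
        exact (h c).mixed q hcq hq'.1 h1 h2
      exact run_word_of_dots hd (fun b => (h b).dots) p key (fun _ _ _ => by omega)
  · refine run_word_of_dots hd (fun b => (h b).dots) p (fun b q hq hcq => ?_)
      (fun b h1 h2 => (hc ⟨b, h1, h2⟩).elim)
    by_cases hprop : d.IsProp q
    · refine (h b).oneCorner q hcq hprop fun hm => hc ⟨b, ?_⟩
      rcases hq with rfl | rfl
      · exact ⟨hcq, hm⟩
      · rw [hd.mate_mate] at hm
        exact ⟨hm, hcq⟩
    · rw [(h b).nonProp q hcq hprop]
      rfl

theorem edgesValid_of_manyProp (hd : d.IsDiagram) (h : ∀ b, d.ManyPropSide b) : d.EdgesValid := by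
  intro p
  by_cases hc : ∃ b, IsCorner b p ∧ IsCorner b (d.mate p)
  · obtain ⟨b, hp, hm⟩ := hc
    have h1 := (isCorner_mate_iff hd hp).1 hm
    have hw : ∀ x ∈ d.word p, x = tri b := by
      have h2 := (h b).1 h1
      have h3 : ∀ x ∈ d.word (.inl (sideNode b 0)), x = tri b := by
        rcases h2 with h2 | h2 <;> rw [h2] <;> simp
      rcases hp with rfl | rfl
      · exact h3
      · intro x hx
        rw [← h1, hd.mem_word_mate] at hx
        exact h3 x hx
    rw [nodeState_eq_some.2 hp, nodeState_eq_some.2 hm]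
    exact run_tri hw (by simp)
  · refine run_word_of_dots hd (fun b => (h b).2.2) p (fun b q hq hcq => ?_)
      (fun b h1 h2 => (hc ⟨b, h1, h2⟩).elim)
    rw [(h b).2.1 (fun h1 => hc ⟨b, ?_⟩) q hcq]
    · rfl
    · have hm := (isCorner_mate_iff hd hcq).2 h1
      rcases hq with rfl | rfl
      · exact ⟨hcq, hm⟩
      · rw [hd.mate_mate] at hm
        exact ⟨hm, hcq⟩

theorem OnePropEnd.endCup {b : Bool} (h : d.OnePropEnd b) {f : Fin (n + 2) → Node (n + 2)}
    (hf : f = .inl ∨ f = .inr) (hd : d.IsDiagram) (h0 : ¬ d.IsProp (f (sideNode b 0))) :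
    d.EndCup b f := by
  have hN : d.IsProp (.inl (sideNode b 0)) → f = .inr := by
    rcases hf with rfl | rfl
    · exact fun h => absurd h h0
    · exact fun _ => rfl
  have hS : d.IsProp (.inr (sideNode b 0)) → f = .inl := by
    rcases hf with rfl | rfl
    · exact fun _ => rfl
    · exact fun h => absurd h h0
  cases h with
  | vertical h1 _ =>
    have e1 := hN (isProp_inl.2 ⟨_, h1⟩)
    have e2 := hS (isProp_inr.2 ⟨_, hd.mate_eq_iff.1 h1⟩)
    rw [e2] at e1
    exact absurd (congrFun e1 0) (by simp)
  | plain h1 h2 => rcases hf with rfl | rfl <;> assumption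
  | both h1 h2 => rcases hf with rfl | rfl <;> assumption
  | north h1 h2 =>
    rw [hS (isProp_inr.2 ⟨_, hd.mate_eq_iff.1 h2⟩)]
    exact h1
  | south h1 h2 =>
    rw [hN (isProp_inl.2 ⟨_, h2⟩)]
    exact h1

theorem EndCup.not_isProp {b : Bool} {f : Fin (n + 2) → Node (n + 2)} (hf : f = .inl ∨ f = .inr)
    (h : d.EndCup b f) : ¬ d.IsProp (f (sideNode b 0)) :=
  (not_isProp_face hf).2 ⟨_, h.1⟩

/-- The non-propagating edge of a face carries precisely the decoration which the state of the face
requires. -/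
theorem word_cup (hn : 2 ≤ n) (hd : d.IsLR) (h : d.aValue = 1) (hE : ∀ b, d.OnePropEnd b)
    {f : Fin (n + 2) → Node (n + 2)} (hf : f = .inl ∨ f = .inr) (i : Fin (n + 2))
    (hi : ¬ d.IsProp (f i)) : d.word (f i) = stateWord (d.faceState f) := by
  have hI := hd.isDiagram
  have hs := fun b => faceState_eq_some (b := b) hn hI h hf
  rcases hfs : d.faceState f with - | b
  · have hp : ∀ b, d.IsProp (f (sideNode b 0)) := by
      intro b
      by_contra hc
      rw [(hs b).2 hc] at hfs
      cases hfs
    obtain ⟨j, hj⟩ := (not_isProp_face hf).1 hi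
    rw [stateWord, List.eq_nil_iff_forall_not_mem]
    intro x hx
    have h1 := not_type_of_isProp hd hf hj (hp true) x hx
    have h2 := not_type_of_isProp hd hf hj (hp false) x hx
    rw [h1] at h2
    cases h2
  · have h0 := (hs b).1 hfs
    obtain ⟨x, y, hc⟩ := exists_onlyCup hI h hf
    have hcup := (hE b).endCup hf hI h0
    have hlt := ((hc.corner hI hf h0).2 i).1 hi
    rw [stateWord]
    rcases Nat.eq_zero_or_pos (off b i) with h4 | h4
    · rw [eq_sideNode (j := 0) h4]
      exact hcup.2
    · have e1 : i = sideNode b 1 := eq_sideNode (b := b) (j := 1) (by rw [fin_val_one]; omega)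
      rw [e1, ← hcup.1, hI.word_mate, hcup.2]
      rfl

theorem colState_sideNode_of_lt {b : Bool} {j : Fin (n + 2)} (h0 : 0 < j.val) (h1 : j.val < n + 1) :
    colState (sideNode b j) = none := by
  have ne : ∀ c, sideNode b j ≠ sideNode c 0 := by
    intro c h
    have e1 := off_sideNode b j
    have e2 : off c (sideNode b j) = 0 := by
      rw [h, off_sideNode]
      rfl
    unfold off at e1 e2
    have := (sideNode b j).2
    cases b <;> cases c <;> simp only [if_true, Bool.false_eq_true, if_false] at e1 e2 <;> omega
  rcases h : colState (sideNode b j) with - | c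
  · rfl
  · exact absurd (colState_eq_some.1 h) (ne c)

/-- The edge next to a side relates the states of its ends. -/
theorem run_word_endNode (hn : 2 ≤ n) {b : Bool}
    (hE : d.OnePropEnd b) : run (d.word (.inl (d.endNode b .inl))) (colState (d.endNode b .inl)) =
      some (nodeState (d.mate (.inl (d.endNode b .inl)))) := by
  have c0 : colState (sideNode b (0 : Fin (n + 2))) = some b := colState_eq_some.2 rfl
  have c2 : colState (sideNode b (2 : Fin (n + 2))) = none :=
    colState_sideNode_of_lt (by rw [fin_val_two hn]; omega) (by rw [fin_val_two hn]; omega)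
  have dot_none : (dot b).act none = some (some b) := act_dot.2 (Or.inl ⟨rfl, rfl⟩)
  have dot_some : (dot b).act (some b) = some none := act_dot.2 (Or.inr ⟨rfl, rfl⟩)
  cases hE with
  | vertical h1 hw =>
    have e : d.endNode b .inl = sideNode b 0 := if_pos (isProp_inl.2 ⟨_, h1⟩)
    rw [e, h1, nodeState, c0]
    exact run_tri hw (by simp)
  | plain h1 h2 h3 hw =>
    have e : d.endNode b .inl = sideNode b 2 := if_neg (h1.not_isProp (Or.inl rfl))
    rw [e, h3, nodeState, c2]
    refine run_tri (b := b) ?_ (by simp)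
    rcases hw with hw | hw <;> rw [hw] <;> simp
  | both h1 h2 h3 r hr hw =>
    have e : d.endNode b .inl = sideNode b 2 := if_neg (h1.not_isProp (Or.inl rfl))
    rw [e, h3, nodeState, c2, hw, run_append_eq_some]
    refine ⟨some b, run_append_eq_some.2 ⟨some b, ?_, run_tri hr (by simp)⟩, ?_⟩
    · rw [run_singleton, dot_none]
    · rw [run_singleton, dot_some]
  | north h1 h3 r hr hw =>
    have e : d.endNode b .inl = sideNode b 2 := if_neg (h1.not_isProp (Or.inl rfl))
    rw [e, h3, nodeState, c2, c0, hw, run_append_eq_some]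
    refine ⟨some b, ?_, run_tri hr (by simp)⟩
    rw [run_singleton, dot_none]
  | south h1 h3 r hr hw =>
    have e : d.endNode b .inl = sideNode b 0 := if_pos (isProp_inl.2 ⟨_, h3⟩)
    rw [e, h3, nodeState, c2, c0, hw, run_append_eq_some]
    refine ⟨some b, run_tri hr (by simp), ?_⟩
    rw [run_singleton, dot_some]

theorem edgesValid_of_aValueOne (hn : 2 ≤ n) (hd : d.IsLR) (h : d.aValue = 1)
    (hE : ∀ b, d.OnePropEnd b) : d.EdgesValid := by
  have hI := hd.isDiagram
  have prop : ∀ i, d.IsProp (.inl i) →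
      run (d.word (.inl i)) (colState i) = some (nodeState (d.mate (.inl i))) := by
    intro i hi
    by_cases he : ∃ b, i = d.endNode b .inl
    · obtain ⟨b, rfl⟩ := he
      exact run_word_endNode hn (hE b)
    · push Not at he
      have hw : d.word (.inl i) = [] := by
        rw [List.eq_nil_iff_forall_not_mem]
        intro x hx
        exact he (!x.isOpen) (eq_endNode_of_type hn hd h hi hx (by simp))
      have h1 : colState i = none := by
        rcases hc : colState i with - | b
        · rfl
        · rw [colState_eq_some] at hc
          subst hc
          exact absurd (if_pos hi).symm (he b)
      have h2 : nodeState (d.mate (.inl i)) = none := by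
        obtain ⟨j, hj⟩ := isProp_inl.1 hi
        rw [hj, nodeState]
        rcases hc : colState j with - | b
        · rfl
        · rw [colState_eq_some] at hc
          subst hc
          have hm := mate_endNode hn hI h b
          have e : d.endNode b .inr = sideNode b 0 :=
            if_pos (isProp_inr.2 ⟨_, hI.mate_eq_iff.1 hj⟩)
          rw [e, ← hj] at hm
          exact absurd (Sum.inl_injective (by rw [← hI.mate_mate (.inl i), ← hm, hI.mate_mate]))
            (he b)
      rw [hw, h1, h2]
      rfl
  have cup : ∀ f : Fin (n + 2) → Node (n + 2), f = .inl ∨ f = .inr → ∀ i, ¬ d.IsProp (f i) →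
      run (d.word (f i)) (nodeState (f i)) = some (nodeState (d.mate (f i))) := by
    intro f hf i hi
    have hs := fun b => faceState_eq_some (b := b) hn hI h hf
    have hst : ∀ j, nodeState (f j) = colState j := by
      rcases hf with rfl | rfl <;> exact fun _ => rfl
    rw [word_cup hn hd h hE hf i hi]
    obtain ⟨j, hj⟩ := (not_isProp_face hf).1 hi
    rw [hj, hst, hst]
    have hj' : ¬ d.IsProp (f j) := by rwa [← hj, isProp_mate hI]
    rcases hfs : d.faceState f with - | b
    · have key : ∀ m, ¬ d.IsProp (f m) → colState m = none := by
        intro m hm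
        rcases hc : colState m with - | b
        · rfl
        · rw [colState_eq_some] at hc
          subst hc
          rw [(hs b).2 hm] at hfs
          cases hfs
      rw [key i hi, key j hj']
      rfl
    · have h0 := (hs b).1 hfs
      obtain ⟨x, y, hc⟩ := exists_onlyCup hI h hf
      obtain ⟨h1, h2⟩ := hc.corner hI hf h0
      have hij : off b i ≠ off b j := by
        intro e
        rw [off_injective b e] at hj
        exact hI.mate_ne _ hj
      have li := (h2 i).1 hi
      have lj := (h2 j).1 hj'
      have c0 : colState (sideNode b (0 : Fin (n + 2))) = some b := colState_eq_some.2 rfl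
      have c1 : colState (sideNode b (1 : Fin (n + 2))) = none :=
        colState_sideNode_of_lt (by rw [fin_val_one]; omega) (by rw [fin_val_one]; omega)
      rw [stateWord, run_singleton, act_dot]
      rcases Nat.eq_zero_or_pos (off b i) with h4 | h4
      · have e1 : i = sideNode b 0 := eq_sideNode (b := b) (j := 0) h4
        have e2 : j = sideNode b 1 := eq_sideNode (b := b) (j := 1) (by rw [fin_val_one]; omega)
        rw [e1, e2]
        exact Or.inr ⟨c0, c1⟩
      · have e1 : i = sideNode b 1 := eq_sideNode (b := b) (j := 1) (by rw [fin_val_one]; omega)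
        have e2 : j = sideNode b 0 := eq_sideNode (b := b) (j := 0) (by simp only [Fin.val_zero]; omega)
        rw [e1, e2]
        exact Or.inl ⟨c1, c0⟩
  rintro (i | i)
  · by_cases hi : d.IsProp (.inl i)
    · exact prop i hi
    · exact cup .inl (Or.inl rfl) i hi
  · by_cases hi : d.IsProp (.inr i)
    · obtain ⟨j, hj⟩ := isProp_inr.1 hi
      have hm := hI.mate_eq_iff.1 hj
      have := run_reverse (prop j (isProp_inl.2 ⟨_, hm⟩))
      rw [hm] at this
      rw [hj, ← hm, hI.word_mate, hm]
      exact this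
    · exact cup .inr (Or.inr rfl) i hi

section Lists

variable {α β : Type*} [DecidableEq α]

theorem head?_of_col {W : List (α × β)} {i : α} {x : β} (h : (W.map Prod.fst).head? = some i)
    (h' : (col i W).head? = some x) : W.head? = some (i, x) := by
  rcases W with - | ⟨z, W⟩
  · cases h
  · simp only [List.map_cons, List.head?_cons, Option.some.injEq] at h ⊢
    rw [col_cons, if_pos h, List.head?_cons, Option.some.injEq] at h'
    exact Prod.ext h h'

theorem col_reverse (i : α) (W : List (α × β)) : col i W.reverse = (col i W).reverse := by
  simp [col, List.filter_reverse]

theorem getLast?_of_col {W : List (α × β)} {i : α} {x : β}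
    (h : (W.map Prod.fst).getLast? = some i) (h' : (col i W).getLast? = some x) :
    W.getLast? = some (i, x) := by
  rw [← List.head?_reverse]
  refine head?_of_col ?_ ?_
  · rw [List.map_reverse, List.head?_reverse, h]
  · rw [col_reverse, List.head?_reverse, h']

theorem eq_nil_of_col {U V : List (α × β)} {i : α} (h : ((U ++ V).map Prod.fst).head? = some i)
    (h' : col i U = []) : U = [] := by
  rcases U with - | ⟨z, U⟩
  · rfl
  · simp only [List.cons_append, List.map_cons, List.head?_cons, Option.some.injEq] at h
    rw [col_cons, if_pos h] at h'
    cases h'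

theorem eq_nil_of_col' {U V : List (α × β)} {i : α} (h : ((U ++ V).map Prod.fst).getLast? = some i)
    (h' : col i V = []) : V = [] := by
  rw [← List.reverse_eq_nil_iff]
  refine eq_nil_of_col (U := V.reverse) (V := U.reverse) (i := i) ?_ (by rw [col_reverse, h']; rfl)
  rw [← List.reverse_append, List.map_reverse, List.head?_reverse, h]

end Lists

/-- By (C5), the `•` and `∘` in the vertical order are at its top and bottom, and only those which
the states of the two faces require. -/
theorem orderValid_of_aValueOne (hn : 2 ≤ n) (hd : d.IsLR) (h : d.aValue = 1)
    (hE : ∀ b, d.OnePropEnd b) : d.OrderValid := by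
  have hI := hd.isDiagram
  obtain ⟨W, hW⟩ := exists_isVertical hI h
  refine ⟨W, hW, ?_⟩
  have sN := fun b => faceState_eq_some (b := b) hn hI h (Or.inl rfl)
  have sS := fun b => faceState_eq_some (b := b) hn hI h (Or.inr rfl)
  have hpe := fun b => (endNode_isProp hn hI h b (Or.inl rfl)).1
  have hcol : ∀ b, Diagram.col (d.endNode b .inl) W = d.word (.inl (d.endNode b .inl)) := by
    intro b
    rw [hW.col, if_pos (hpe b)]
  by_cases hplain : ∃ b, d.EndCup b .inl ∧ d.EndCup b .inr ∧
      (d.word (.inl (sideNode b 2)) = [] ∨ d.word (.inl (sideNode b 2)) = [tri b]) ∧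
      ∀ p, ∀ x ∈ d.word p, x.isOpen = !b
  · obtain ⟨b, h1, h2, hw, ho⟩ := hplain
    have n1 := h1.not_isProp (Or.inl rfl)
    have n2 := h2.not_isProp (Or.inr rfl)
    have e : d.endNode b .inl = sideNode b 2 := if_neg n1
    rw [(sN b).2 n1, (sS b).2 n2]
    refine run_tri (b := b) (fun x hx => ?_) (by simp)
    obtain ⟨z, hz, rfl⟩ := List.mem_map.1 hx
    have h3 := hW.eq_endNode hn hd h hz (ho _ _ (hW.isProp hz).2)
    have h4 := (hW.isProp hz).2
    rw [h3, e] at h4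
    rcases hw with hw | hw <;> rw [hw] at h4
    · cases h4
    · exact List.mem_singleton.1 h4
  · have head : ∀ b, ¬ d.IsProp (.inl (sideNode b 0)) →
        W.head? = some (sideNode b 2, dot b) := by
      intro b hb
      have hc := hcol b
      rw [show d.endNode b .inl = sideNode b 2 from if_neg hb] at hc
      have key : ∀ l, d.word (.inl (sideNode b 2)) = dot b :: l →
          d.order.head? = some (sideNode b 2) → W.head? = some (sideNode b 2, dot b) := by
        intro l h1 h2
        rw [← hW.fst] at h2
        exact head?_of_col h2 (by rw [hc, h1]; rfl)
      cases hE b with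
      | vertical h1 => exact absurd (isProp_inl.2 ⟨_, h1⟩) hb
      | plain h1 h2 h3 hw ho => exact (hplain ⟨b, h1, h2, hw, ho⟩).elim
      | both h1 h2 h3 r hr hw ht => exact key _ hw ht
      | north h1 h3 r hr hw ht => exact key _ hw ht
      | south h1 h3 => exact absurd (isProp_inl.2 ⟨_, h3⟩) hb
    have last : ∀ b, ¬ d.IsProp (.inr (sideNode b 0)) →
        W.getLast? = some (d.endNode b .inl, dot b) := by
      intro b hb
      have hc := hcol b
      have key : ∀ l, d.word (.inl (d.endNode b .inl)) = l ++ [dot b] →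
          d.order.getLast? = some (d.endNode b .inl) →
          W.getLast? = some (d.endNode b .inl, dot b) := by
        intro l h1 h2
        rw [← hW.fst] at h2
        exact getLast?_of_col h2 (by rw [hc, h1, List.getLast?_concat])
      cases hE b with
      | vertical h1 => exact absurd (isProp_inr.2 ⟨_, hI.mate_eq_iff.1 h1⟩) hb
      | plain h1 h2 h3 hw ho => exact (hplain ⟨b, h1, h2, hw, ho⟩).elim
      | both h1 h2 h3 r hr hw ht hl =>
        have e : d.endNode b .inl = sideNode b 2 := if_neg (h1.not_isProp (Or.inl rfl))
        rw [e] at key ⊢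
        exact key _ hw hl
      | north h1 h3 => exact absurd (isProp_inr.2 ⟨_, hI.mate_eq_iff.1 h3⟩) hb
      | south h1 h3 r hr hw hl =>
        have e : d.endNode b .inl = sideNode b 0 := if_pos (isProp_inl.2 ⟨_, h3⟩)
        rw [e] at key ⊢
        exact key _ hw hl
    have head' : ∀ b, d.faceState .inl = some b → (W.map Prod.snd).head? = some (dot b) := by
      intro b hb
      rw [List.head?_map, head b ((sN b).1 hb)]
      rfl
    have last' : ∀ b, d.faceState .inr = some b → (W.map Prod.snd).getLast? = some (dot b) := by
      intro b hb
      rw [List.getLast?_map, last b ((sS b).1 hb)]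
      rfl
    refine run_of_dots head' last' (fun b u v hw => ?_) (fun h1 h2 h3 => ?_)
    · obtain ⟨U₀, V, rfl, hu, rfl⟩ := List.map_eq_append_iff.1 hw
      obtain ⟨U, Z, rfl, rfl, hZ⟩ := List.map_eq_append_iff.1 hu
      obtain ⟨⟨i, x⟩, rfl, rfl⟩ := List.map_eq_singleton_iff.1 hZ
      have hi := hW.eq_endNode hn hd h (z := (i, dot b)) (by simp) (isOpen_dot b)
      have hc := hcol b
      simp only at hi
      rw [← hi, col_append, col_append, col_cons, if_pos rfl] at hc
      have hc : Diagram.col i U ++ dot b :: Diagram.col i V = d.word (.inl i) := by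
        rw [← hc]
        simp [Diagram.col]
      rw [List.map_eq_nil_iff, List.map_eq_nil_iff, sN, sS]
      have hord := hW.fst
      have left : d.order.head? = some i → Diagram.col i U = [] → U = [] := by
        intro h1 h2
        rw [← hord, List.append_assoc] at h1
        exact eq_nil_of_col h1 h2
      have right : d.order.getLast? = some i → Diagram.col i V = [] → V = [] := by
        intro h1 h2
        rw [← hord] at h1
        exact eq_nil_of_col' h1 h2
      have not_dot : ∀ r : List Deco, (∀ x ∈ r, x = tri b) → dot b ∉ r :=
        fun r hr hx => dot_ne_tri b b (hr _ hx)
      cases hE b with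
      | vertical h1 hw =>
        have e : d.endNode b .inl = sideNode b 0 := if_pos (isProp_inl.2 ⟨_, h1⟩)
        rw [hi, e] at hc
        exact absurd (hw (dot b) (by rw [← hc]; simp)) (dot_ne_tri b b)
      | plain h1 h2 h3 hw ho => exact (hplain ⟨b, h1, h2, hw, ho⟩).elim
      | both h1 h2 h3 r hr hw ht hl =>
        have n1 := h1.not_isProp (Or.inl rfl)
        have n2 := h2.not_isProp (Or.inr rfl)
        have e : i = sideNode b 2 := hi.trans (if_neg n1)
        rw [← e] at hw ht hl
        rw [hw] at hc
        rcases hU : Diagram.col i U with - | ⟨y, U'⟩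
        · exact Or.inl ⟨left ht hU, n1⟩
        · right
          refine ⟨right hl ?_, n2⟩
          rcases List.eq_nil_or_concat (Diagram.col i V) with hV | ⟨V', y', hV⟩
          · exact hV
          · exfalso
            rw [hU, hV, List.concat_eq_append, List.cons_append, List.append_assoc,
              List.singleton_append, List.cons.injEq, ← List.cons_append, ← List.append_assoc] at hc
            have := List.append_inj_left' hc.2 rfl
            exact not_dot r hr (by rw [← this]; simp)
      | north h1 h3 r hr hw ht =>
        have n1 := h1.not_isProp (Or.inl rfl)
        have e : i = sideNode b 2 := hi.trans (if_neg n1)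
        rw [← e] at hw ht
        rw [hw] at hc
        left
        refine ⟨left ht ?_, n1⟩
        rcases hU : Diagram.col i U with - | ⟨y, U'⟩
        · rfl
        · rw [hU, List.singleton_append, List.cons_append, List.cons.injEq] at hc
          exact absurd (by rw [← hc.2]; simp) (not_dot r hr)
      | south h1 h3 r hr hw hl =>
        have n2 := h1.not_isProp (Or.inr rfl)
        have e : i = sideNode b 0 := hi.trans (if_pos (isProp_inl.2 ⟨_, h3⟩))
        rw [← e] at hw hl
        rw [hw] at hc
        right
        refine ⟨right hl ?_, n2⟩
        rcases List.eq_nil_or_concat (Diagram.col i V) with hV | ⟨V', y', hV⟩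
        · exact hV
        · exfalso
          rw [hV, List.concat_eq_append, ← List.cons_append, ← List.append_assoc] at hc
          have := List.append_inj_left' hc rfl
          exact not_dot r hr (by rw [← this]; simp)
    · obtain ⟨b, hb⟩ := Option.ne_none_iff_exists'.1 h1
      obtain ⟨c, hc⟩ := Option.ne_none_iff_exists'.1 h2
      have e1 := head' b hb
      have e2 := last' c hc
      obtain ⟨x, hx⟩ := List.length_eq_one_iff.1 h3
      rw [hx] at e1 e2
      simp only [List.head?_cons, List.getLast?_singleton, Option.some.injEq] at e1 e2
      obtain rfl := dot_injective (e1.symm.trans e2)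
      rw [sN] at hb
      rw [sS] at hc
      cases hE b with
      | vertical h1 => exact hb (isProp_inl.2 ⟨_, h1⟩)
      | plain h1 h2 h3 hw ho => exact hplain ⟨b, h1, h2, hw, ho⟩
      | both h1 h2 h3' r hr hw =>
        have h4 := hcol b
        rw [show d.endNode b .inl = sideNode b 2 from if_neg hb, hw] at h4
        have h5 := congrArg List.length h4
        have h6 : (Diagram.col (sideNode b 2) W).length ≤ W.length := by
          unfold Diagram.col
          rw [List.length_map]
          exact List.length_filter_le _ _
        rw [List.length_map] at h3
        simp only [List.length_append, List.length_singleton] at h5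
        omega
      | north h1 h3 => exact hc (isProp_inr.2 ⟨_, hI.mate_eq_iff.1 h3⟩)
      | south h1 h3 => exact hb (isProp_inl.2 ⟨_, h3⟩)

/-- The conditions on states which are kept by products and by reductions. -/
structure IsValid (d : Diagram (n + 2)) : Prop where
  isLR : d.IsLR
  aValue : d.aValue ≠ 0
  edges : d.EdgesValid
  loops : ∀ w ∈ d.loops, w.IsValid
  order : d.aValue = 1 → d.OrderValid

theorem IsAdmissible.isValid (hn : 2 ≤ n) (hd : d.IsAdmissible) (h : d.aValue ≠ 0) : d.IsValid where
  isLR := hd.isLR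
  aValue := h
  edges := by
    by_cases h1 : d.aValue = 1
    · exact edgesValid_of_aValueOne hn hd.isLR h1 (hd.aValueOne h1)
    · rcases Nat.lt_trichotomy d.numProp 1 with h2 | h2 | h2
      · have h2 : d.numProp = 0 := by omega
        exact edgesValid_of_undammed hd.isLR.isDiagram (hd.undammed h2) h2
      · exact edgesValid_of_singleProp hd.isLR.isDiagram hd.isReduced h1 (hd.singleProp h2)
      · exact edgesValid_of_manyProp hd.isLR.isDiagram (hd.manyProp (by omega) h2)
  loops w hw := by
    rw [hd.loops w hw, LoopWord.isValid_mk]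
    exact ⟨none, rfl⟩
  order h1 := orderValid_of_aValueOne hn hd.isLR h1 (hd.aValueOne h1)

theorem IsAdmissible.goodOne (hn : 2 ≤ n) (hd : d.IsAdmissible) (h : d.aValue = 1) : d.GoodOne where
  isLR := hd.isLR
  aValue := h
  orderValid := orderValid_of_aValueOne hn hd.isLR h (hd.aValueOne h)
  cup _ hf := word_cup hn hd.isLR h (hd.aValueOne h) hf

/-- The product of two admissible diagrams satisfies the conditions on states. -/
theorem concat_isValid (hn : 2 ≤ n) {top bot : Diagram (n + 2)} (ht : top.IsAdmissible)
    (hb : bot.IsAdmissible) (ht0 : top.aValue ≠ 0) (hb0 : bot.aValue ≠ 0) :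
    (concat top bot).IsValid := by
  have hC := concat_isLR ht.isLR hb.isLR ht0
  have vt := ht.isValid hn ht0
  have vb := hb.isValid hn hb0
  have hI := ht.isLR.isDiagram
  have hI' := hb.isLR.isDiagram
  refine ⟨hC, concat_aValue_ne_zero ht0, concat_edgesValid hI hI' vt.edges vb.edges,
    concat_loopsValid vt.edges vb.edges vt.loops vb.loops, fun h1 => ?_⟩
  have t1 : top.aValue = 1 := by
    have := aValue_le_concat (top := top) (bot := bot)
    omega
  exact concat_orderValid hn (ht.goodOne hn t1)
    (hb.goodOne hn (bot_aValue hI' hC.isDiagram h1 hb0)) hC.isDiagram h1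

end Diagram

end DecoratedTL

namespace DecoratedTL

open Diagram

/-! ### Reduction of blocks -/

open Classical in
/-- The class of a diagram in the quotient algebra, or `0` if the diagram is not LR-decorated. -/
noncomputable def cls {n : ℕ} (d : Diagram (n + 2)) : PHat n :=
  if h : d.IsLR then toPHat ⟨d, h⟩ else 0

section Classes

variable {n : ℕ} {d d' : Diagram (n + 2)}

theorem cls_eq (h : d.IsLR) : cls d = toPHat ⟨d, h⟩ := dif_pos h

theorem toPHat_eq_of_rel {x : LRDiagram n} {d' : LRDiagram n} {c : ℤ[X]}
    (h : PHatRel n (FreeAlgebra.ι ℤ[X] x) (c • FreeAlgebra.ι ℤ[X] d')) :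
    toPHat x = c • toPHat d' := by
  have := RingQuot.mkAlgHom_rel ℤ[X] h
  rwa [map_smul] at this

theorem cls_edge {l l' : List Deco} {c : ℤ[X]} (hr : Reduction l l' c) (hd : d.IsLR) (hd' : d'.IsLR)
    (h : EdgeStep l l' d d') : cls d = c • cls d' := by
  rw [cls_eq hd, cls_eq hd']
  exact toPHat_eq_of_rel (.edge l l' c hr _ _ h)

theorem cls_loop {l l' : List Deco} {c : ℤ[X]} (hr : Reduction l l' c) (hd : d.IsLR) (hd' : d'.IsLR)
    (h : LoopStep l l' d d') : cls d = c • cls d' := by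
  rw [cls_eq hd, cls_eq hd']
  exact toPHat_eq_of_rel (.loop l l' c hr _ _ h)

theorem cls_removal {l : List Deco} (hl : l = [] ∨ l = [.blackTri] ∨ l = [.whiteTri]) (hd : d.IsLR)
    (hd' : d'.IsLR) (h : LoopRemoval l d d') : cls d = (X : ℤ[X]) • cls d' := by
  rw [cls_eq hd, cls_eq hd']
  exact toPHat_eq_of_rel (.delta l hl _ _ h)

end Classes

theorem reduction_dot_dot (b : Bool) : Reduction [dot b, dot b] [tri b] 1 := by
  cases b
  · exact .circ_circ
  · exact .bullet_bullet

theorem reduction_dot_tri (b : Bool) : Reduction [dot b, tri b] [dot b] 2 := by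
  cases b
  · exact .circ_tri
  · exact .bullet_tri

theorem reduction_tri_dot (b : Bool) : Reduction [tri b, dot b] [dot b] 2 := by
  cases b
  · exact .tri_circ
  · exact .tri_bullet

/-- The local relations reduce a nonempty sequence of decorations of one type to a single
decoration; this uses `▲▲ = ••▲ = 2••= 2▲`. Here `F` is the class of a diagram as a function of one
of its blocks. -/
theorem reduce_block {M : Type*} [AddCommGroup M] [Module ℤ[X] M] {b : Bool} (F : List Deco → M)
    (hF : ∀ A l l' B c, Reduction l l' c → (∀ x ∈ A ++ l ++ B, x.isOpen = !b) →
      (∀ x ∈ A ++ l' ++ B, x.isOpen = !b) → F (A ++ l ++ B) = c • F (A ++ l' ++ B))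
    {c : List Deco} (hc : c ≠ []) (ht : ∀ x ∈ c, x.isOpen = !b) :
    ∃ (j : ℕ) (z : Deco), z.isOpen = !b ∧ F c = (2 : ℤ[X]) ^ j • F [z] ∧
      ∀ s, run c s = run [z] s := by
  have hd := isOpen_dot b
  have htr := isOpen_tri b
  induction hm : c.length using Nat.strong_induction_on generalizing c with
  | _ m ih =>
  rcases c with - | ⟨x, - | ⟨y, r⟩⟩
  · exact absurd rfl hc
  · exact ⟨0, x, ht x (by simp), by simp, fun _ => rfl⟩
  · have hx := isOpen_eq_not_iff.1 (ht x (by simp))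
    have hy := isOpen_eq_not_iff.1 (ht y (by simp))
    have hr : ∀ x ∈ r, x.isOpen = !b := fun x hx => ht x (by simp [hx])
    have pair : ∃ (i : ℕ) (z : Deco), z.isOpen = !b ∧ F (x :: y :: r) = (2 : ℤ[X]) ^ i • F (z :: r) ∧
        ∀ s, run (x :: y :: r) s = run (z :: r) s := by
      have h1 : F (dot b :: dot b :: r) = F (tri b :: r) := by
        have := hF [] _ _ r _ (reduction_dot_dot b)
          (by simp only [List.nil_append, List.cons_append, List.forall_mem_cons]; exact ⟨hd, hd, hr⟩)
          (by simp only [List.nil_append, List.cons_append, List.forall_mem_cons]; exact ⟨htr, hr⟩)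
        rwa [one_smul] at this
      rcases hx with rfl | rfl <;> rcases hy with rfl | rfl
      · refine ⟨0, tri b, htr, by rw [pow_zero, one_smul, h1], fun s => ?_⟩
        rcases b <;> rcases s with - | (- | -) <;> rfl
      · refine ⟨1, dot b, hd, ?_, fun s => ?_⟩
        · rw [pow_one]
          exact hF [] _ _ r _ (reduction_dot_tri b)
            (by simp only [List.nil_append, List.cons_append, List.forall_mem_cons]; exact ⟨hd, htr, hr⟩)
            (by simp only [List.nil_append, List.cons_append, List.forall_mem_cons]; exact ⟨hd, hr⟩)
        · rcases b <;> rcases s with - | (- | -) <;> rfl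
      · refine ⟨1, dot b, hd, ?_, fun s => ?_⟩
        · rw [pow_one]
          exact hF [] _ _ r _ (reduction_tri_dot b)
            (by simp only [List.nil_append, List.cons_append, List.forall_mem_cons]; exact ⟨htr, hd, hr⟩)
            (by simp only [List.nil_append, List.cons_append, List.forall_mem_cons]; exact ⟨hd, hr⟩)
        · rcases b <;> rcases s with - | (- | -) <;> rfl
      · refine ⟨1, tri b, htr, ?_, fun s => ?_⟩
        · have h2 := hF [] _ _ (tri b :: r) _ (reduction_dot_dot b)
            (by simp only [List.nil_append, List.cons_append, List.forall_mem_cons]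
                exact ⟨hd, hd, htr, hr⟩)
            (by simp only [List.nil_append, List.cons_append, List.forall_mem_cons]
                exact ⟨htr, htr, hr⟩)
          have h3 := hF [dot b] _ _ r _ (reduction_dot_tri b)
            (by simp only [List.nil_append, List.cons_append, List.forall_mem_cons]
                exact ⟨hd, hd, htr, hr⟩)
            (by simp only [List.nil_append, List.cons_append, List.forall_mem_cons]
                exact ⟨hd, hd, hr⟩)
          rw [one_smul] at h2
          rw [pow_one, ← h1]
          exact h2.symm.trans h3
        · rcases b <;> rcases s with - | (- | -) <;> rfl
    obtain ⟨i, z, hz, e1, e2⟩ := pair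
    obtain ⟨j, z', hz', e3, e4⟩ := ih (r.length + 1) (by rw [← hm]; simp) (c := z :: r) (by simp)
      (by simpa using ⟨hz, hr⟩) (by simp)
    exact ⟨i + j, z', hz', by rw [e1, e3, smul_smul, pow_add], fun s => (e2 s).trans (e4 s)⟩

namespace Diagram

variable {k n : ℕ}

/-- The diagram `d` with the word `w` on the edge at `p`, and with the vertical order `o`. -/
def setWord (d : Diagram k) (p : Node k) (w : List Deco) (o : List (Fin k)) : Diagram k where
  mate := d.mate
  word q := if q = p then w else if q = d.mate p then w.reverse else d.word q
  order := o
  loops := d.loops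

/-- The vertical order of a diagram after the replacement of a block of a propagating edge. -/
def blockOrder (d : Diagram k) (p : Node k) (m : ℕ) (s t : List (Fin k)) : List (Fin k) :=
  match p with
  | .inl i => if d.aValue = 1 ∧ d.IsProp p then s ++ List.replicate m i ++ t else d.order
  | .inr _ => d.order

/-- The diagram `d` after the replacement of a block by `c`. -/
def setBlock (d : Diagram k) (p : Node k) (u v : List Deco) (s t : List (Fin k)) (c : List Deco) :
    Diagram k :=
  d.setWord p (u ++ c ++ v) (d.blockOrder p c.length s t)

section Block

variable {d : Diagram k} {p : Node k} {u v c c₀ : List Deco} {s t : List (Fin k)}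

theorem setBlock_word_self : (d.setBlock p u v s t c).word p = u ++ c ++ v := if_pos rfl

theorem setBlock_word_mate (hd : d.IsDiagram) :
    (d.setBlock p u v s t c).word (d.mate p) = (u ++ c ++ v).reverse := by
  rw [setBlock, setWord]
  exact (if_neg (hd.mate_ne p)).trans (if_pos rfl)

theorem setBlock_word_of_ne {q : Node k} (h : q ≠ p) (h' : q ≠ d.mate p) :
    (d.setBlock p u v s t c).word q = d.word q := by
  rw [setBlock, setWord]
  exact (if_neg h).trans (if_neg h')

theorem blockOrder_of_not {m : ℕ} (h : ¬ (d.aValue = 1 ∧ d.IsProp p)) :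
    d.blockOrder p m s t = d.order := by
  unfold blockOrder
  rcases p with i | i
  · exact if_neg h
  · rfl

theorem blockOrder_inl {m : ℕ} {i : Fin k} (h : d.aValue = 1 ∧ d.IsProp (.inl i)) :
    d.blockOrder (.inl i) m s t = s ++ List.replicate m i ++ t := if_pos h

/-- Replacing a block by itself does not change the diagram. -/
theorem setBlock_self (hd : d.IsDiagram) (h : d.BlockAt p u c₀ v s t) :
    d.setBlock p u v s t c₀ = d := by
  ext1
  · rfl
  · funext q
    by_cases h1 : q = p
    · rw [h1, setBlock_word_self, h.1]
    · by_cases h2 : q = d.mate p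
      · rw [h2, setBlock_word_mate hd, hd.word_mate, h.1]
      · exact setBlock_word_of_ne h1 h2
  · by_cases h1 : d.aValue = 1 ∧ d.IsProp p
    · obtain ⟨i, rfl, h2, -⟩ := h.2 h1.1 h1.2
      exact (blockOrder_inl h1).trans h2.symm
    · exact blockOrder_of_not h1
  · rfl

/-- Replacing a part of the block is a step of the local relations. -/
theorem setBlock_edgeStep {A B l l' : List Deco} (h : d.BlockAt p u c₀ v s t) :
    EdgeStep l l' (d.setBlock p u v s t (A ++ l ++ B)) (d.setBlock p u v s t (A ++ l' ++ B)) := by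
  by_cases h1 : d.aValue = 1 ∧ d.IsProp p
  · obtain ⟨i, rfl, -, h3⟩ := h.2 h1.1 h1.2
    have key : ∀ l, (d.setBlock (.inl i) u v s t (A ++ l ++ B)).BlockAt (.inl i) (u ++ A) l (B ++ v)
        (s ++ List.replicate A.length i) (List.replicate B.length i ++ t) := by
      intro l
      refine ⟨by rw [setBlock_word_self]; simp, fun _ _ => ⟨i, rfl, ?_, ?_⟩⟩
      · refine (blockOrder_inl h1).trans ?_
        rw [List.length_append, List.length_append, List.replicate_add, List.replicate_add]
        simp only [List.append_assoc]
      · rw [List.count_append, h3, List.count_replicate_self, List.length_append]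
    exact ⟨rfl, rfl, .inl i, u ++ A, B ++ v, _, _, key l, key l', fun q h2 h3 =>
      (setBlock_word_of_ne (d := d) h2 h3).trans (setBlock_word_of_ne (d := d) h2 h3).symm, fun h => absurd h1 h⟩
  · have key : ∀ l, (d.setBlock p u v s t (A ++ l ++ B)).BlockAt p (u ++ A) l (B ++ v) s t :=
      fun l => ⟨by rw [setBlock_word_self]; simp, fun h2 h3 => absurd ⟨h2, h3⟩ h1⟩
    exact ⟨rfl, rfl, p, u ++ A, B ++ v, s, t, key l, key l', fun q h2 h3 =>
      (setBlock_word_of_ne (d := d) h2 h3).trans (setBlock_word_of_ne (d := d) h2 h3).symm, fun _ =>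
      (blockOrder_of_not (d := d) h1).trans (blockOrder_of_not (d := d) h1).symm⟩

/-- The replacement of a block by another one of the same type does not change the types of the
decorations which occur on an edge. -/
theorem mem_setBlock (hd : d.IsDiagram) (hw : d.word p = u ++ c₀ ++ v) (hc₀ : c₀ ≠ []) {b : Bool}
    (h₀ : ∀ x ∈ c₀, x.isOpen = b) (h : ∀ x ∈ c, x.isOpen = b) {q : Node k} {x : Deco}
    (hx : x ∈ (d.setBlock p u v s t c).word q) : ∃ y ∈ d.word q, y.isOpen = x.isOpen := by
  have key : x ∈ u ++ c ++ v → ∃ y ∈ d.word p, y.isOpen = x.isOpen := by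
    intro hx
    rw [hw]
    obtain ⟨z, hz⟩ := List.exists_mem_of_ne_nil _ hc₀
    simp only [List.mem_append] at hx ⊢
    rcases hx with (hx | hx) | hx
    · exact ⟨x, Or.inl (Or.inl hx), rfl⟩
    · exact ⟨z, Or.inl (Or.inr hz), (h₀ z hz).trans (h x hx).symm⟩
    · exact ⟨x, Or.inr hx, rfl⟩
  by_cases h1 : q = p
  · rw [h1, setBlock_word_self] at hx
    rw [h1]
    exact key hx
  · by_cases h2 : q = d.mate p
    · rw [h2, setBlock_word_mate hd, List.mem_reverse] at hx
      obtain ⟨y, hy, e⟩ := key hx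
      exact ⟨y, by rw [h2, hd.mem_word_mate]; exact hy, e⟩
    · rw [setBlock_word_of_ne h1 h2] at hx
      exact ⟨x, hx, rfl⟩

theorem pairwise_block {R : Deco → Deco → Prop}
    (hR : ∀ x x' y y', x.isOpen = x'.isOpen → y.isOpen = y'.isOpen → R x y → R x' y')
    (hR' : ∀ x y, x.isOpen = y.isOpen → R x y) (hc₀ : c₀ ≠ []) {b : Bool}
    (h₀ : ∀ x ∈ c₀, x.isOpen = b) (h : ∀ x ∈ c, x.isOpen = b) (hp : (u ++ c₀ ++ v).Pairwise R) :
    (u ++ c ++ v).Pairwise R := by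
  obtain ⟨z, hz⟩ := List.exists_mem_of_ne_nil _ hc₀
  simp only [List.pairwise_append, List.mem_append] at hp ⊢
  obtain ⟨⟨h1, -, h2⟩, h3, h4⟩ := hp
  refine ⟨⟨h1, ?_, fun x hx y hy => ?_⟩, h3, fun x hx y hy => ?_⟩
  · exact List.pairwise_of_forall_mem_list fun x hx y hy => hR' x y ((h x hx).trans (h y hy).symm)
  · exact hR x x z y rfl ((h₀ z hz).trans (h y hy).symm) (h2 x hx z hz)
  · rcases hx with hx | hx
    · exact h4 x (Or.inl hx) y hy
    · exact hR z x y y ((h₀ z hz).trans (h x hx).symm) rfl (h4 z (Or.inr hz) y hy)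

theorem setBlock_isDiagram (hd : d.IsDiagram) (ha : d.aValue ≠ 0) (h : d.BlockAt p u c₀ v s t) :
    (d.setBlock p u v s t c).IsDiagram where
  mate_mate := hd.mate_mate
  mate_ne := hd.mate_ne
  planar := hd.planar
  word_mate := by
    have e := hd.mate_mate p
    intro q
    change (d.setBlock p u v s t c).word (d.mate q) = _
    by_cases h1 : q = p
    · rw [h1, setBlock_word_self, setBlock_word_mate hd]
    · by_cases h2 : q = d.mate p
      · rw [h2, e, setBlock_word_self, setBlock_word_mate hd, List.reverse_reverse]
      · have h3 : d.mate q ≠ p := fun h3 => h2 (by rw [← h3, hd.mate_mate])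
        have h4 : d.mate q ≠ d.mate p := fun h4 => h1 (by rw [← hd.mate_mate q, h4, e])
        rw [setBlock_word_of_ne h1 h2, setBlock_word_of_ne h3 h4, hd.word_mate]
  order_eq h1 := (blockOrder_of_not (d := d) fun h2 => h1 h2.1).trans (hd.order_eq h1)
  order_count := by
    intro h1 j
    replace h1 : d.aValue = 1 := h1
    have h0 := hd.order_count h1 j
    change (d.blockOrder p c.length s t).count j = if d.IsProp (.inl j) then
      ((d.setBlock p u v s t c).word (.inl j)).length else 0
    by_cases hp : d.IsProp p
    · obtain ⟨i, rfl, h2, h3⟩ := h.2 h1 hp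
      rw [blockOrder_inl ⟨h1, hp⟩]
      rw [h2] at h0
      simp only [List.count_append, List.count_replicate] at h0 ⊢
      by_cases e : j = i
      · subst e
        rw [if_pos hp] at h0 ⊢
        rw [setBlock_word_self]
        rw [h.1] at h0
        simp only [List.length_append, beq_self_eq_true, if_true] at h0 ⊢
        omega
      · obtain ⟨m, hm⟩ := isProp_inl.1 hp
        rw [setBlock_word_of_ne (fun h4 => e (Sum.inl_injective h4)) (by rw [hm]; simp)]
        have e' : (i == j) = false := by simpa using Ne.symm e
        rw [e'] at h0 ⊢
        exact h0
    · rw [blockOrder_of_not fun h2 => hp h2.2, h0]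
      split_ifs with hj
      · rw [setBlock_word_of_ne]
        · rintro rfl
          exact hp hj
        · intro h4
          rw [h4, isProp_mate hd] at hj
          exact hp hj
      · rfl
  word_eq h1 := absurd h1 ha
  loops_eq h1 := absurd h1 ha

/-- Whether a diagram is LR-decorated depends only on the types of its decorations and not on their
number within a block. -/
theorem setBlock_isLR (hd : d.IsLR) (ha : d.aValue ≠ 0) (h : d.BlockAt p u c₀ v s t) (hc₀ : c₀ ≠ [])
    {b : Bool} (h₀ : ∀ x ∈ c₀, x.isOpen = b) (hc : ∀ x ∈ c, x.isOpen = b) :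
    (d.setBlock p u v s t c).IsLR := by
  have hI := hd.isDiagram
  have hmem : ∀ {q x}, x ∈ (d.setBlock p u v s t c).word q → ∃ y ∈ d.word q, y.isOpen = x.isOpen :=
    fun hx => mem_setBlock hI h.1 hc₀ h₀ hc hx
  have face : ∀ f : Fin k → Node k, d.ClosedBeforeOpen f →
      (d.setBlock p u v s t c).ClosedBeforeOpen f := by
    intro f hf
    refine ⟨fun i j hij hm => ?_, fun i j i' j' h1 h2 h3 h4 h5 x hx y hy ho => ?_⟩
    · have h0 := hf.same i j hij hm
      by_cases h1 : f i = p
      · rw [h1, setBlock_word_self]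
        rw [h1, h.1] at h0
        refine pairwise_block (fun x x' y y' e1 e2 => ?_) (fun x y e => ?_) hc₀ h₀ hc h0
        · rw [e1, e2]
          exact id
        · rw [e]
          exact id
      · by_cases h2 : f i = d.mate p
        · rw [h2, setBlock_word_mate hI, List.pairwise_reverse]
          rw [h2, hI.word_mate, h.1, List.pairwise_reverse] at h0
          refine pairwise_block (fun x x' y y' e1 e2 => ?_) (fun x y e => ?_) hc₀ h₀ hc h0
          · rw [e1, e2]
            exact id
          · rw [e]
            exact id
        · rw [setBlock_word_of_ne h1 h2]
          exact h0
    · obtain ⟨x', hx', ex⟩ := hmem hx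
      obtain ⟨y', hy', ey⟩ := hmem hy
      rw [← ey]
      exact hf.across i j i' j' h1 h2 h3 h4 h5 x' hx' y' hy' (ex.trans ho)
  refine ⟨setBlock_isDiagram hI ha h, fun q x hx ho => ?_, fun q x hx ho => ?_, face _ hd.north,
    face _ hd.south, hd.loops_dammed, hd.loops_undammed⟩
  · obtain ⟨y, hy, e⟩ := hmem hx
    exact hd.left q y hy (e.trans ho)
  · obtain ⟨y, hy, e⟩ := hmem hx
    exact hd.right q y hy (e.trans ho)

end Block

section Valid

variable {d : Diagram (n + 2)} {p : Node (n + 2)} {u v c c₀ : List Deco} {s t : List (Fin (n + 2))}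

/-- A block can be replaced by another one with the same effect on all states. -/
theorem run_block (hr : ∀ σ, run c σ = run c₀ σ) (u v : List Deco) (σ : Option Bool) :
    run (u ++ c ++ v) σ = run (u ++ c₀ ++ v) σ := by
  rw [run_append, run_append, run_append, run_append]
  congr 2
  exact funext hr

/-- The decorations of a block are consecutive in the vertical order, so replacing them by a block
with the same effect does not change the effect of the whole sequence. -/
theorem setBlock_orderValid (hd : d.IsDiagram) (h1 : d.aValue = 1) (ho : d.OrderValid)
    (h : d.BlockAt p u c₀ v s t) (hr : ∀ σ, run c σ = run c₀ σ) :
    (d.setBlock p u v s t c).OrderValid := by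
  obtain ⟨W, hW, hrun⟩ := ho
  by_cases hp : d.IsProp p
  · obtain ⟨i, rfl, h2, h3⟩ := h.2 h1 hp
    have hf := hW.fst
    rw [h2] at hf
    obtain ⟨W₁, T, rfl, hW₁, hT⟩ := List.map_eq_append_iff.1 hf
    obtain ⟨S, C, rfl, hS, hC⟩ := List.map_eq_append_iff.1 hW₁
    have hCi : ∀ z ∈ C, z.1 = i := by
      intro z hz
      have : z.1 ∈ C.map Prod.fst := List.mem_map_of_mem hz
      rw [hC] at this
      exact List.eq_of_mem_replicate this
    have colC : Diagram.col i C = C.map Prod.snd := by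
      unfold Diagram.col
      rw [List.filter_eq_self.2 (by simpa using fun a b hz => hCi (a, b) hz)]
    have hcol := hW.col i
    rw [if_pos hp, h.1, col_append, col_append, colC] at hcol
    have lenS : (Diagram.col i S).length = u.length := by rw [length_col, hS, h3]
    have lenC : (C.map Prod.snd).length = c₀.length := by
      have := congrArg List.length hC
      simpa using this
    rw [List.append_assoc, List.append_assoc] at hcol
    obtain ⟨e1, hcol⟩ := List.append_inj hcol lenS
    obtain ⟨e2, e3⟩ := List.append_inj hcol lenC
    refine ⟨S ++ c.map (fun x => (i, x)) ++ T, ⟨?_, fun j => ?_⟩, ?_⟩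
    · refine Eq.trans ?_ (blockOrder_inl ⟨h1, hp⟩).symm
      rw [List.map_append, List.map_append, hS, hT, List.map_map]
      congr 2
      rw [List.eq_replicate_iff]
      simp
    · change _ = if d.IsProp (.inl j) then (d.setBlock (.inl i) u v s t c).word (.inl j) else []
      rw [col_append, col_append, col_map_pair]
      by_cases e : i = j
      · subst e
        rw [if_pos rfl, if_pos hp, setBlock_word_self, e1, e3]
      · have h5 := hW.col j
        obtain ⟨m, hm⟩ := isProp_inl.1 hp
        rw [col_append, col_append] at h5
        rw [if_neg e, setBlock_word_of_ne (fun h4 => e (Sum.inl_injective h4).symm) (by rw [hm]; simp),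
          ← h5]
        congr 2
        unfold Diagram.col
        rw [List.filter_eq_nil_iff.2]
        · rfl
        · intro z hz
          rw [hCi z hz]
          simpa using e
    · rw [List.map_append, List.map_append, e2] at hrun
      rw [List.map_append, List.map_append, List.map_map]
      have : List.map (Prod.snd ∘ fun x : Deco => (i, x)) c = c := List.map_id c
      rw [this, run_block hr]
      exact hrun
  · refine ⟨W, ⟨hW.fst.trans (blockOrder_of_not fun h2 => hp h2.2).symm, fun j => ?_⟩, hrun⟩
    rw [hW.col j]
    change _ = if d.IsProp (.inl j) then (d.setBlock p u v s t c).word (.inl j) else []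
    split_ifs with hj
    · rw [setBlock_word_of_ne]
      · rintro rfl
        exact hp hj
      · intro h4
        rw [h4, isProp_mate hd] at hj
        exact hp hj
    · rfl

theorem setBlock_isValid (hd : d.IsValid) (h : d.BlockAt p u c₀ v s t) (hc₀ : c₀ ≠ []) {b : Bool}
    (h₀ : ∀ x ∈ c₀, x.isOpen = b) (hc : ∀ x ∈ c, x.isOpen = b) (hr : ∀ σ, run c σ = run c₀ σ) :
    (d.setBlock p u v s t c).IsValid where
  isLR := setBlock_isLR hd.isLR hd.aValue h hc₀ h₀ hc
  aValue := hd.aValue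
  edges := by
    have hI := hd.isLR.isDiagram
    have hp : run (u ++ c ++ v) (nodeState p) = some (nodeState (d.mate p)) := by
      rw [run_block hr, ← h.1]
      exact hd.edges p
    intro q
    change run ((d.setBlock p u v s t c).word q) _ = some (nodeState (d.mate q))
    by_cases h1 : q = p
    · rw [h1, setBlock_word_self]
      exact hp
    · by_cases h2 : q = d.mate p
      · rw [h2, setBlock_word_mate hI, hI.mate_mate]
        exact run_reverse hp
      · rw [setBlock_word_of_ne h1 h2]
        exact hd.edges q
  loops := hd.loops
  order h1 := setBlock_orderValid hd.isLR.isDiagram h1 (hd.order h1) h hr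

/-- By the relations for edges, the class of a valid diagram is a multiple of the class of a reduced
one. -/
theorem exists_reduced (hd : d.IsValid) :
    ∃ (j : ℕ) (e : Diagram (n + 2)), e.IsValid ∧ e.IsReduced ∧ cls d = (2 : ℤ[X]) ^ j • cls e := by
  induction hm : ∑ q, (d.word q).length using Nat.strong_induction_on generalizing d with
  | _ m ih =>
  by_cases hr : d.IsReduced
  · exact ⟨0, d, hd, hr, by simp⟩
  · unfold IsReduced at hr
    push Not at hr
    obtain ⟨p, u, x, y, v, s, t, hb, hxy⟩ := hr
    have hI := hd.isLR.isDiagram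
    have hx : x.isOpen = !(!x.isOpen) := by simp
    have hc : ∀ z ∈ [x, y], z.isOpen = !(!x.isOpen) := by simp [hxy]
    obtain ⟨j, z, hz, e1, e2⟩ := reduce_block (fun c => cls (d.setBlock p u v s t c))
      (fun A l l' B c h1 h2 h3 => cls_edge h1 (setBlock_isLR hd.isLR hd.aValue hb (by simp) hc h2)
        (setBlock_isLR hd.isLR hd.aValue hb (by simp) hc h3) (setBlock_edgeStep hb))
      (c := [x, y]) (by simp) hc
    have hv : (d.setBlock p u v s t [z]).IsValid := setBlock_isValid hd hb (by simp) hc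
      (by simpa using hz) fun σ => (e2 σ).symm
    obtain ⟨i, e, he, hre, e3⟩ := ih _ (by
      rw [← hm]
      refine Finset.sum_lt_sum (fun q _ => ?_) ⟨p, Finset.mem_univ _, ?_⟩
      · by_cases h1 : q = p
        · rw [h1, setBlock_word_self, hb.1]
          simp
        · by_cases h2 : q = d.mate p
          · rw [h2, setBlock_word_mate hI, hI.word_mate, hb.1]
            simp
          · rw [setBlock_word_of_ne h1 h2]
      · rw [setBlock_word_self, hb.1]
        simp) hv rfl
    refine ⟨j + i, e, he, hre, ?_⟩
    simp only [setBlock_self hI hb] at e1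
    rw [e1, e3, smul_smul, pow_add]

end Valid

end Diagram

end DecoratedTL

namespace DecoratedTL

open Diagram

theorem LoopWord.mk_append_comm (l l' : List Deco) : LoopWord.mk (l ++ l') = LoopWord.mk (l' ++ l) :=
  Quot.sound (Or.inl List.isRotated_append)

namespace Diagram

/-! ### Reduction of loops -/

section Loops

variable {k n : ℕ}

/-- The diagram `d` with other loops. -/
def setLoops (d : Diagram k) (L : Multiset LoopWord) : Diagram k := { d with loops := L }

/-- The decorations of the two types on a loop are separated; only one type occurs if there are
propagating edges. -/
def SplitLoop (d : Diagram k) (b : Bool) (c v : List Deco) : Prop :=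
  (∀ x ∈ c, x.isOpen = !b) ∧ (∀ x ∈ v, x.isOpen = b) ∧ (0 < d.numProp → c = [] ∨ v = [])

/-- The loops which can be added to an LR-decorated diagram. -/
def GoodLoop (d : Diagram k) (w : LoopWord) : Prop :=
  ∃ b c v, w = LoopWord.mk (c ++ v) ∧ d.SplitLoop b c v

theorem SplitLoop.symm {d : Diagram k} {b : Bool} {c v : List Deco} (h : d.SplitLoop b c v) :
    d.SplitLoop (!b) v c :=
  ⟨by simpa using h.2.1, h.1, fun h0 => (h.2.2 h0).symm⟩

theorem IsLR.goodLoop {d : Diagram k} (hd : d.IsLR) {w : LoopWord} (hw : w ∈ d.loops) :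
    d.GoodLoop w := by
  rcases Nat.eq_zero_or_pos d.numProp with h | h
  · obtain ⟨l, l', h1, h2, h3⟩ := hd.loops_undammed h w hw
    exact ⟨true, l, l', h1, h2, h3, fun h0 => by omega⟩
  · obtain ⟨l, b, h1, h2⟩ := hd.loops_dammed h w hw
    exact ⟨!b, l, [], by rw [h1, List.append_nil], by simpa using h2, by simp, fun _ => Or.inr rfl⟩

theorem setLoops_isLR {d : Diagram k} (hd : d.IsLR) (ha : d.aValue ≠ 0) {L : Multiset LoopWord}
    (hL : ∀ w ∈ L, d.GoodLoop w) : (d.setLoops L).IsLR where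
  isDiagram :=
    { mate_mate := hd.isDiagram.mate_mate
      mate_ne := hd.isDiagram.mate_ne
      planar := hd.isDiagram.planar
      word_mate := hd.isDiagram.word_mate
      order_eq := hd.isDiagram.order_eq
      order_count := hd.isDiagram.order_count
      word_eq := hd.isDiagram.word_eq
      loops_eq := fun h => absurd h ha }
  left := hd.left
  right := hd.right
  north := ⟨hd.north.same, hd.north.across⟩
  south := ⟨hd.south.same, hd.south.across⟩
  loops_dammed h w hw := by
    obtain ⟨b, c, v, rfl, h1, h2, h3⟩ := hL w hw
    rcases h3 h with rfl | rfl
    · exact ⟨v, b, rfl, h2⟩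
    · exact ⟨c, !b, by rw [List.append_nil], h1⟩
  loops_undammed _ w hw := by
    obtain ⟨b, c, v, rfl, h1, h2, -⟩ := hL w hw
    rcases b with - | -
    · exact ⟨v, c, LoopWord.mk_append_comm _ _, h2, h1⟩
    · exact ⟨c, v, rfl, h1, h2⟩

variable {d : Diagram (n + 2)} {M : Multiset LoopWord} {b : Bool} {c v : List Deco}

/-- All decorations of one type on a loop can be merged into a single one. -/
theorem reduce_loop (hd : d.IsLR) (ha : d.aValue ≠ 0) (hM : ∀ w ∈ M, d.GoodLoop w)
    (h : d.SplitLoop b c v) (hc : c ≠ []) : ∃ (j : ℕ) (z : Deco), d.SplitLoop b [z] v ∧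
      cls (d.setLoops (LoopWord.mk (c ++ v) ::ₘ M)) =
        (2 : ℤ[X]) ^ j • cls (d.setLoops (LoopWord.mk ([z] ++ v) ::ₘ M)) ∧
      ∀ s, run c s = run [z] s := by
  have split : ∀ c' : List Deco, (∀ x ∈ c', x.isOpen = !b) → d.SplitLoop b c' v := fun c' h' =>
    ⟨h', h.2.1, fun h0 => Or.inr ((h.2.2 h0).resolve_left hc)⟩
  have lr : ∀ c' : List Deco, (∀ x ∈ c', x.isOpen = !b) →
      (d.setLoops (LoopWord.mk (c' ++ v) ::ₘ M)).IsLR := by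
    intro c' h'
    refine setLoops_isLR hd ha fun w hw => ?_
    rcases Multiset.mem_cons.1 hw with rfl | hw
    · exact ⟨b, c', v, rfl, split c' h'⟩
    · exact hM w hw
  have rot : ∀ A l B : List Deco,
      LoopWord.mk (A ++ l ++ B ++ v) = LoopWord.mk (l ++ (B ++ v ++ A)) := by
    intro A l B
    rw [List.append_assoc, List.append_assoc, LoopWord.mk_append_comm]
    simp
  obtain ⟨j, z, hz, e1, e2⟩ := reduce_block (fun c => cls (d.setLoops (LoopWord.mk (c ++ v) ::ₘ M)))
    (fun A l l' B r h1 h2 h3 => cls_loop h1 (lr _ h2) (lr _ h3)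
      ⟨rfl, rfl, rfl, B ++ v ++ A, M, by rw [← rot]; rfl, by rw [← rot]; rfl⟩) hc h.1
  exact ⟨j, z, split _ (by simpa using hz), e1, e2⟩

theorem isValid_append (hr : ∀ s, run c s = run v s) (u : List Deco)
    (h : (LoopWord.mk (c ++ u)).IsValid) : (LoopWord.mk (v ++ u)).IsValid := by
  obtain ⟨s, hs⟩ := LoopWord.isValid_mk.1 h
  exact LoopWord.isValid_mk.2 ⟨s, by rwa [run_append, ← hr, ← run_append]⟩

theorem removal_loop (hd : d.IsLR) (ha : d.aValue ≠ 0) (hM : ∀ w ∈ M, d.GoodLoop w) {l : List Deco}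
    (hl : l = [] ∨ l = [.blackTri] ∨ l = [.whiteTri]) (hg : d.GoodLoop (LoopWord.mk l)) :
    cls (d.setLoops (LoopWord.mk l ::ₘ M)) = (X : ℤ[X]) • cls (d.setLoops M) := by
  refine cls_removal hl (setLoops_isLR hd ha fun w hw => ?_) (setLoops_isLR hd ha hM)
    ⟨rfl, rfl, rfl, rfl⟩
  rcases Multiset.mem_cons.1 hw with rfl | hw
  · exact hg
  · exact hM w hw

/-- A loop with decorations of one type only reduces to a loop with a single decoration. This is not
`•` or `∘`, which always change the state, so the loop can be removed. -/
theorem remove_pure (hd : d.IsLR) (ha : d.aValue ≠ 0) (hM : ∀ w ∈ M, d.GoodLoop w)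
    (h : d.SplitLoop b c []) (hv : (LoopWord.mk c).IsValid) : ∃ j : ℕ,
      cls (d.setLoops (LoopWord.mk c ::ₘ M)) = ((2 : ℤ[X]) ^ j * X) • cls (d.setLoops M) := by
  by_cases hc : c = []
  · subst hc
    exact ⟨0, by rw [pow_zero, one_mul, removal_loop hd ha hM (Or.inl rfl) ⟨b, [], [], rfl, h⟩]⟩
  · obtain ⟨j, z, hz, e1, e2⟩ := reduce_loop hd ha hM h hc
    have hv' := isValid_append e2 [] (by rwa [List.append_nil])
    rw [List.append_nil] at hv'
    rw [List.append_nil, List.append_nil] at e1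
    refine ⟨j, ?_⟩
    obtain ⟨s, hs⟩ := LoopWord.isValid_mk.1 hv'
    have hzt := isOpen_eq_not_iff.1 (hz.1 z (by simp))
    rw [run_singleton] at hs
    have hz' : z = tri b := by
      rcases hzt with rfl | rfl
      · rw [act_dot] at hs
        rcases hs with ⟨rfl, h⟩ | ⟨rfl, h⟩ <;> cases h
      · rfl
    rw [e1, removal_loop (l := [z]) hd ha hM ?_ ⟨b, [z], [], rfl, hz⟩, smul_smul]
    rw [hz']
    cases b
    · exact Or.inr (Or.inr rfl)
    · exact Or.inr (Or.inl rfl)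

/-- A valid loop is either removed or becomes a loop with one `▲` and one `△`. -/
theorem process_loop (hd : d.IsLR) (ha : d.aValue ≠ 0) (hM : ∀ w ∈ M, d.GoodLoop w) {w : LoopWord}
    (hw : d.GoodLoop w) (hv : w.IsValid) :
    (∃ j : ℕ, cls (d.setLoops (w ::ₘ M)) = ((2 : ℤ[X]) ^ j * X) • cls (d.setLoops M)) ∨
    ∃ j : ℕ, d.GoodLoop (LoopWord.mk [.blackTri, .whiteTri]) ∧ cls (d.setLoops (w ::ₘ M)) =
      (2 : ℤ[X]) ^ j • cls (d.setLoops (LoopWord.mk [.blackTri, .whiteTri] ::ₘ M)) := by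
  obtain ⟨b, c, v, rfl, hs⟩ := hw
  by_cases hv0 : v = []
  · subst hv0
    rw [List.append_nil] at hv ⊢
    exact Or.inl (remove_pure hd ha hM hs hv)
  by_cases hc0 : c = []
  · subst hc0
    exact Or.inl (remove_pure hd ha hM hs.symm hv)
  right
  obtain ⟨j, z, hz, e1, e2⟩ := reduce_loop hd ha hM hs hc0
  have hv1 := isValid_append e2 _ hv
  rw [LoopWord.mk_append_comm] at hv1
  obtain ⟨i, y, hy, e3, e4⟩ := reduce_loop hd ha hM hz.symm hv0
  obtain ⟨s, hsv⟩ := LoopWord.isValid_mk.1 (isValid_append e4 _ hv1)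
  have hyz : LoopWord.mk ([y] ++ [z]) = LoopWord.mk [.blackTri, .whiteTri] := by
    have h1 := isOpen_eq_not_iff.1 (hz.1 z (by simp))
    have h2 := isOpen_eq_not_iff.1 (hy.1 y (by simp))
    have h3 : z = tri b ∧ y = tri (!b) := by
      rcases h1 with rfl | rfl <;> rcases h2 with rfl | rfl <;> rcases b <;>
        rcases s with - | (- | -) <;> first | exact ⟨rfl, rfl⟩ | cases hsv
    rw [h3.1, h3.2]
    cases b
    · rfl
    · exact LoopWord.mk_append_comm [Deco.whiteTri] [Deco.blackTri]
  refine ⟨j + i, ⟨!b, [y], [z], hyz.symm, hy⟩, ?_⟩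
  rw [e1, LoopWord.mk_append_comm, e3, hyz, smul_smul, pow_add]

/-- Here `L` are the loops still to be reduced, and `L₀` those which are already in the form
required by (C1). -/
theorem process_loops (hd : d.IsLR) (ha : d.aValue ≠ 0) (L : Multiset LoopWord)
    (hL : ∀ w ∈ L, d.GoodLoop w ∧ w.IsValid) : ∀ L₀ : Multiset LoopWord,
    (∀ w ∈ L₀, d.GoodLoop w ∧ w = LoopWord.mk [.blackTri, .whiteTri]) →
    ∃ (j m : ℕ) (L₁ : Multiset LoopWord),
      (∀ w ∈ L₁, d.GoodLoop w ∧ w = LoopWord.mk [.blackTri, .whiteTri]) ∧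
      cls (d.setLoops (L + L₀)) = ((2 : ℤ[X]) ^ j * X ^ m) • cls (d.setLoops L₁) := by
  induction L using Multiset.induction_on with
  | empty => exact fun L₀ h => ⟨0, 0, L₀, h, by simp⟩
  | cons w L ih =>
    intro L₀ hL₀
    have hL' : ∀ w ∈ L, d.GoodLoop w ∧ w.IsValid := fun w hw => hL w (Multiset.mem_cons_of_mem hw)
    have hM : ∀ w ∈ L + L₀, d.GoodLoop w := by
      intro w hw
      rcases Multiset.mem_add.1 hw with hw | hw
      · exact (hL' w hw).1
      · exact (hL₀ w hw).1
    obtain ⟨hw, hv⟩ := hL w (Multiset.mem_cons_self w L)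
    rw [Multiset.cons_add]
    rcases process_loop hd ha hM hw hv with ⟨i, hi⟩ | ⟨i, hg, hi⟩
    · obtain ⟨j, m, L₁, h1, h2⟩ := ih hL' L₀ hL₀
      refine ⟨i + j, m + 1, L₁, h1, ?_⟩
      rw [hi, h2, smul_smul]
      congr 1
      ring
    · obtain ⟨j, m, L₁, h1, h2⟩ := ih hL' (LoopWord.mk [.blackTri, .whiteTri] ::ₘ L₀) (by
        intro w hw
        rcases Multiset.mem_cons.1 hw with rfl | hw
        · exact ⟨hg, rfl⟩
        · exact hL₀ w hw)
      refine ⟨i + j, m, L₁, h1, ?_⟩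
      rw [Multiset.add_cons] at h2
      rw [hi, h2, smul_smul]
      congr 1
      ring

/-- The class of a valid diagram is a multiple of the class of an admissible one. -/
theorem exists_admissible (hn : 2 ≤ n) (hd : d.IsValid) : ∃ (j m : ℕ) (e : Diagram (n + 2)),
    e.IsAdmissible ∧ cls d = ((2 : ℤ[X]) ^ j * X ^ m) • cls e := by
  obtain ⟨i, e, he, hr, h1⟩ := exists_reduced hd
  obtain ⟨j, m, L, hL, h2⟩ := process_loops he.isLR he.aValue e.loops
    (fun w hw => ⟨he.isLR.goodLoop hw, he.loops w hw⟩) 0 (by simp)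
  rw [add_zero] at h2
  refine ⟨i + j, m, e.setLoops L, ?_, ?_⟩
  · exact isAdmissible_of_valid hn (setLoops_isLR he.isLR he.aValue fun w hw => (hL w hw).1) hr
      (fun w hw => (hL w hw).2) he.edges fun ha => by
        obtain ⟨W, hW, hrun⟩ := he.order ha
        exact ⟨W, ⟨hW.fst, hW.col⟩, hrun⟩
  · rw [h1, show cls e = cls (e.setLoops e.loops) from rfl, h2, smul_smul]
    congr 1
    ring

end Loops

/-! ### The identity diagram and the simple diagrams -/

theorem mk_nil_ne : LoopWord.mk [] ≠ LoopWord.mk [.blackTri, .whiteTri] := by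
  -- The length is an invariant of loops.
  have key : ∀ {l l' : List Deco}, LoopEquiv l l' → l.length = l'.length := by
    rintro l l' (h | h)
    · exact h.perm.length_eq
    · simpa using h.perm.length_eq
  intro h
  have := congrArg (Quot.lift List.length fun _ _ h => key h) h
  cases this

variable {n : ℕ}

/-- If all edges are propagating, planarity forces them to be vertical. Decorations are not allowed
for this `a`-value, while (C1) would require them on every loop, so there are no loops. -/
theorem eq_one_of_aValue_eq_zero {d : Diagram (n + 2)} (hd : d.IsAdmissible) (h : d.aValue = 0) :
    d = one (n + 2) := by
  have hI := hd.isLR.isDiagram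
  have hprop : ∀ i : Fin (n + 2), ∃ j, d.mate (.inl i) = .inr j := by
    intro i
    have h0 : ∀ i j : Fin (n + 2), i < j → d.mate (.inl i) ≠ .inl j := by
      intro i j hij hm
      have : i ∈ Finset.univ.filter fun i : Fin (n + 2) => ∃ j, i < j ∧ d.mate (.inl i) = .inl j := by
        simpa using ⟨j, hij, hm⟩
      rw [aValue, Finset.card_eq_zero] at h
      rw [h] at this
      cases this
    rcases hm : d.mate (.inl i) with j | j
    · rcases lt_trichotomy i j with hl | rfl | hl
      · exact absurd hm (h0 i j hl)
      · exact absurd hm (hI.mate_ne _)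
      · exact absurd (hI.mate_eq_iff.1 hm) (h0 j i hl)
    · exact ⟨j, rfl⟩
  choose f hf using hprop
  have hmono : StrictMono f := by
    intro i j hij
    simpa [off] using hI.prop_mono true (hf i) (hf j) (by simpa [off] using hij)
  have hfid : ∀ i, f i = i := by
    have := Finite.injective_iff_surjective.1 hmono.injective
    have hid : f = id := by
      have e : StrictMono.orderIsoOfSurjective f hmono this = OrderIso.refl _ := Subsingleton.elim _ _
      funext i
      exact congrArg (fun g : Fin (n + 2) ≃o Fin (n + 2) => g i) e
    intro i
    rw [hid]
    rfl
  have hm : ∀ i, d.mate (.inl i) = .inr i := fun i => by rw [hf, hfid]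
  ext1
  · funext p
    rcases p with i | i
    · exact hm i
    · exact hI.mate_eq_iff.1 (hm i)
  · funext p
    exact hI.word_eq h p
  · exact hI.order_eq (by omega)
  · refine Multiset.eq_zero_of_forall_notMem fun w hw => ?_
    exact mk_nil_ne ((hI.loops_eq h w hw).symm.trans (hd.loops w hw))

theorem isReduced_of_length {d : Diagram (n + 2)} (h : ∀ p, (d.word p).length ≤ 1) : d.IsReduced := by
  intro p u x y v s t hb
  have := h p
  rw [hb.1] at this
  simp at this
  omega

theorem one_isAdmissible (n : ℕ) : (one (n + 2)).IsAdmissible where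
  isLR := one_isLR _
  isReduced := isReduced_of_length fun _ => Nat.zero_le _
  loops w hw := by cases hw
  undammed h := by
    have := numProp_pos.2 ⟨0, 0, (rfl : (one (n + 2)).mate (.inl 0) = .inr 0)⟩
    omega
  singleProp h := by
    exfalso
    have : 1 < (one (n + 2)).numProp := by
      rw [numProp, Finset.one_lt_card_iff]
      exact ⟨0, 1, by simp [IsProp, one], by simp [IsProp, one], by simp⟩
    omega
  manyProp h := by
    rw [aValue_one] at h
    omega
  aValueOne h := by
    rw [aValue_one] at h
    omega

theorem simple_aValue (n : ℕ) (i : Fin (n + 1)) : (simple n i).aValue = 1 := by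
  have h1 := simple_aValue_ne n i
  have h2 : (simple n i).aValue ≤ 1 := by
    refine aValue_le_one (simple_isLR n i).isDiagram ?_
    refine (Finset.card_le_card (t := {i.castSucc, i.succ}) fun j hj => ?_).trans Finset.card_le_two
    by_contra hne
    simp only [Finset.mem_insert, Finset.mem_singleton, not_or] at hne
    refine (Finset.mem_filter.1 hj).2 ?_
    simp [IsProp, simple, simpleMate, hne]
  omega

theorem simple_isAdmissible (hn : 2 ≤ n) (i : Fin (n + 1)) : (simple n i).IsAdmissible := by
  have hlr := simple_isLR n i
  have hI := hlr.isDiagram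
  have ha := simple_aValue n i
  have hne : i.succ ≠ i.castSucc := by
    intro h
    simpa using congrArg Fin.val h
  have hlen : (simpleDeco n i).length ≤ 1 := by
    unfold simpleDeco
    split_ifs <;> simp
  have hnum := one_lt_numProp hn hI ha
  have mate_eq : ∀ j, j ≠ i.castSucc → j ≠ i.succ → (simple n i).mate (.inl j) = .inr j := by
    intro j h1 h2
    simp [simple, simpleMate, h1, h2]
  have word_eq : ∀ j, j ≠ i.castSucc → j ≠ i.succ → (simple n i).word (.inl j) = [] := by
    intro j h1 h2
    simp [simple, h1, h2]
  -- A side which is met by the non-propagating edges determines `i`.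
  have side : ∀ b : Bool, sideNode b 0 = i.castSucc ∨ sideNode b 0 = i.succ →
      (b = true ∧ i = 0) ∨ (b = false ∧ i = Fin.last n) := by
    intro b h
    have := i.2
    cases b
    · right
      refine ⟨rfl, Fin.ext ?_⟩
      rcases h with h | h <;> have h := congrArg Fin.val h <;> simp [sideNode, Fin.rev] at h ⊢ <;> omega
    · left
      refine ⟨rfl, Fin.ext ?_⟩
      rcases h with h | h <;> have h := congrArg Fin.val h <;> simp [sideNode] at h ⊢
      exact Fin.ext h.symm
  have cup : ∀ f : Fin (n + 2) → Node (n + 2), f = .inl ∨ f = .inr → ∀ b : Bool,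
      (sideNode b 0 = i.castSucc ∨ sideNode b 0 = i.succ) → (simple n i).EndCup b f := by
    intro f hf b hb
    have last_ne : Fin.last n ≠ 0 := by
      intro h
      have := congrArg Fin.val h
      simp at this
      omega
    rcases side b hb with ⟨rfl, rfl⟩ | ⟨rfl, rfl⟩
    · rcases hf with rfl | rfl <;> simp [EndCup, sideNode, simple, simpleMate, simpleDeco, dot]
    · have e0 : sideNode false (0 : Fin (n + 2)) = (Fin.last n).succ := by
        ext
        simp [sideNode, Fin.rev]
      have e1 : sideNode false (1 : Fin (n + 2)) = (Fin.last n).castSucc := by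
        ext
        simp [sideNode, Fin.rev]
      unfold EndCup
      rw [e0, e1]
      rcases hf with rfl | rfl <;> simp only [simple, simpleMate, hne, simpleDeco, last_ne, dot] <;> simp
  refine ⟨hlr, isReduced_of_length ?_, fun w hw => (Multiset.notMem_zero _ hw).elim, ?_, ?_, ?_,
    fun _ b => ?_⟩
  · rintro (j | j)
    all_goals
      change (if _ then _ else _ : List Deco).length ≤ 1
      split_ifs
      · exact hlen
      · simp
  · intro h
    omega
  · intro h
    omega
  · intro h
    omega
  · by_cases hb : sideNode b 0 = i.castSucc ∨ sideNode b 0 = i.succ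
    · have o0 := off_sideNode b (0 : Fin (n + 2))
      have o2 := off_sideNode b (2 : Fin (n + 2))
      rw [fin_val_two hn] at o2
      simp only [Fin.val_zero] at o0
      have hs := off_succ (b := b) (x := i.castSucc) (y := i.succ) (by simp)
      have n1 : sideNode b 2 ≠ i.castSucc := by
        intro h
        rw [h] at o2
        rcases hb with hb | hb <;> rw [hb] at o0 <;> omega
      have n2 : sideNode b 2 ≠ i.succ := by
        intro h
        rw [h] at o2
        rcases hb with hb | hb <;> rw [hb] at o0 <;> omega
      refine .plain (cup _ (Or.inl rfl) b hb) (cup _ (Or.inr rfl) b hb) (mate_eq _ n1 n2)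
        (Or.inl (word_eq _ n1 n2)) fun p x hx => ?_
      obtain ⟨h1, -⟩ := mem_simple_word hx
      rcases side b hb with ⟨rfl, rfl⟩ | ⟨rfl, rfl⟩
      · rcases h1 with ⟨h1, -⟩ | ⟨-, h1⟩
        · exact h1
        · simp at h1
          omega
      · rcases h1 with ⟨-, h1⟩ | ⟨h1, -⟩
        · simp at h1
          omega
        · exact h1
    · rw [not_or] at hb
      refine .vertical (mate_eq _ hb.1 hb.2) fun x hx => ?_
      rw [word_eq _ hb.1 hb.2] at hx
      cases hx

/-! ### Products of admissible diagrams -/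

/-- Concatenation keeps the conditions on states, and a diagram which satisfies them reduces to a
multiple of an admissible one. A factor with `a`-value `0` is the identity. -/
theorem exists_mul (hn : 2 ≤ n) {d' d : LRDiagram n} (h' : d'.1.IsAdmissible)
    (h : d.1.IsAdmissible) : ∃ (j m : ℕ) (e : LRDiagram n), e.1.IsAdmissible ∧
      toPHat d' * toPHat d = ((2 : ℤ[X]) ^ j * X ^ m) • toPHat e := by
  have unit : ∀ e : LRDiagram n, e.1.IsAdmissible → e.1.aValue = 0 → toPHat e = 1 := by
    intro e he ha
    have := RingQuot.mkAlgHom_rel ℤ[X] (PHatRel.one e (eq_one_of_aValue_eq_zero he ha))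
    rwa [map_one] at this
  by_cases ha' : d'.1.aValue = 0
  · exact ⟨0, 0, d, h, by rw [unit d' h' ha']; simp⟩
  by_cases ha : d.1.aValue = 0
  · exact ⟨0, 0, d', h', by rw [unit d h ha]; simp⟩
  have hv := concat_isValid hn h' h ha' ha
  obtain ⟨j, m, e, he, h1⟩ := exists_admissible hn hv
  refine ⟨j, m, ⟨e, he.isLR⟩, he, ?_⟩
  have hmul := RingQuot.mkAlgHom_rel ℤ[X] (PHatRel.mul d' d ⟨_, hv.isLR⟩ rfl)
  rw [map_mul] at hmul
  rw [cls_eq hv.isLR, cls_eq he.isLR] at h1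
  exact hmul.trans h1

theorem one_mem_admissibleSpan (n : ℕ) : (1 : PHat n) ∈ admissibleSpan n := by
  have := RingQuot.mkAlgHom_rel ℤ[X] (PHatRel.one ⟨one (n + 2), one_isLR _⟩ rfl)
  rw [map_one] at this
  rw [← this]
  exact Submodule.subset_span ⟨_, one_isAdmissible n, rfl⟩

/-- Bilinear extension of `exists_mul`. -/
theorem mul_mem_admissibleSpan (hn : 2 ≤ n) {x y : PHat n} (hx : x ∈ admissibleSpan n)
    (hy : y ∈ admissibleSpan n) : x * y ∈ admissibleSpan n := by
  unfold admissibleSpan at hx hy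
  induction hx using Submodule.span_induction with
  | mem x hx =>
    obtain ⟨d', h', rfl⟩ := hx
    induction hy using Submodule.span_induction with
    | mem y hy =>
      obtain ⟨d, h, rfl⟩ := hy
      obtain ⟨j, m, e, he, h1⟩ := exists_mul hn h' h
      rw [h1]
      exact Submodule.smul_mem _ _ (Submodule.subset_span ⟨e, he, rfl⟩)
    | zero => rw [mul_zero]; exact Submodule.zero_mem _
    | add y z _ _ hy hz => rw [mul_add]; exact Submodule.add_mem _ hy hz
    | smul a y _ hy => rw [mul_smul_comm]; exact Submodule.smul_mem _ _ hy
  | zero => rw [zero_mul]; exact Submodule.zero_mem _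
  | add x z _ _ hx hz => rw [add_mul]; exact Submodule.add_mem _ hx hz
  | smul a x _ hx => rw [smul_mul_assoc]; exact Submodule.smul_mem _ _ hx

end Diagram

end DecoratedTL

theorem mainTheorem3 (n : ℕ) (hn : 2 ≤ n) :
    (∀ (i : Fin (n + 1)) (d : DecoratedTL.LRDiagram n), d.1.IsAdmissible →
      ∃ (k m : ℕ) (d' : DecoratedTL.LRDiagram n), d'.1.IsAdmissible ∧
        DecoratedTL.toPHat (DecoratedTL.simpleLR n i) * DecoratedTL.toPHat d =
          ((2 : ℤ[X]) ^ k * (X : ℤ[X]) ^ m) • DecoratedTL.toPHat d') ∧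
    (∀ x ∈ DecoratedTL.admissibleSpan n, ∀ y ∈ DecoratedTL.admissibleSpan n,
      x * y ∈ DecoratedTL.admissibleSpan n) ∧
    ∃ S : Subalgebra ℤ[X] (DecoratedTL.PHat n),
      Subalgebra.toSubmodule S = DecoratedTL.admissibleSpan n := by
  refine ⟨fun i d hd => DecoratedTL.Diagram.exists_mul hn
      (DecoratedTL.Diagram.simple_isAdmissible hn i) hd,
    fun x hx y hy => DecoratedTL.Diagram.mul_mem_admissibleSpan hn hx hy,
    Submodule.toSubalgebra _ (DecoratedTL.Diagram.one_mem_admissibleSpan n)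
      (fun x y hx hy => DecoratedTL.Diagram.mul_mem_admissibleSpan hn hx hy), ?_⟩
  exact Submodule.toSubalgebra_toSubmodule _ _ _
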